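/- **Conventions.** Let $M\subset\mathbb C^2$ be a real-analytic real hypersurface (locally $M=\{\rho=0\}$ with $\rho$ real-analytic and $d\rho\neq0$) which is Levi nondegenerate at each of its points, and let $T^c_pM=T_pM\cap iT_pM$. A *CR-transversal 1-jet* $j^1_p$ at $p\in M$ is a real line $\mathbb R\xi\subset T_pM$ with $\xi\notin T^c_pM$. *Local holomorphic coordinates* $(z,w)=(x+iy,u+iv)$ *centered at* $p$ are given by a biholomorphism $\Phi$ from a neighbourhood of $p$ onto a neighbourhood of $0$ with $\Phi(p)=0$. They are *normalizing at* $p$ if in them $M$ is given near $0$ by $v=F(z,\bar z,u)=z\bar z+O(6)$ with $F$ real-analytic, where $O(6)$ means that no monomial $z^j\bar z^ku^l$ with $j+k+2l\le5$ occurs in $F-z\bar z$. The 2-jet at a point of a curve with $u'\ne0$ is $(x_1,y_1,x_2,y_2)=\big(\tfrac{dx}{du},\tfrac{dy}{du},\tfrac{d^2x}{du^2},\tfrac{d^2y}{du^2}\big)$. A *Moser chain* of $M$ is an (unparametrized) $\mathcal C^2$ curve $\gamma\subset M$, everywhere transversal to $T^cM$, such that at each of its points $q$, in coordinates normalizing $M$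 at $q$, its 2-jet at $q$ satisfies $$x_2=-2x_1^2y_1-2y_1^3,\qquad y_2=2x_1y_1^2+2x_1^3 .$$ **Proposition 12.6.** Let $M^3\subset\mathbb C^2$ be a Levi nondegenerate real-analytic hypersurface, let $p\in M$ and let $j^1_p$ be a CR-transversal 1-jet at $p$. Then there is a Moser chain $\gamma_p$ through $p$ directed by $j^1_p$ at $p$; it can be taken real-analytic, and any two such chains coincide near $p$ (up to a change of parameter). Moreover, there exist local holomorphic coordinates $(z,w=u+iv)$ centered at $p$ in which $\gamma_p$ is, near $0$, the $u$-axis $\{z=0,\ v=0\}$, and in which $M$ is, near $0$, the graph $$v=F(z,\bar z,u)=z\bar z+z^4\bar z^2F_{4,2}(u)+z^2\bar z^4F_{2,4}(u)+\sum_{\substack{j+k\ge7\\ j\ge2,\ k\ge2}}z^j\bar z^kF_{j,k}(u)$$ of a real-analytic function $F$, where the $F_{j,k}$ are real-analytic complex-valued functions on a common interval around $0$, $F_{k,j}=\overline{F_{j,k}}$, and the series converges for all sufficiently small $z$ and $u$. -/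

import Mathlib

open Set Filter Topology Asymptotics
open scoped ComplexConjugate

namespace MoserChain

/-- `ρ` is a real-analytic local defining function at `p` of the subset `M` of `ℂ²`:
near `p` one has `M = {ρ = 0}`, and `dρ(p) ≠ 0`. -/
def IsDefiningFunction (M : Set (ℂ × ℂ)) (p : ℂ × ℂ) (ρ : ℂ × ℂ → ℝ) : Prop :=
  AnalyticAt ℝ ρ p ∧ fderiv ℝ ρ p ≠ 0 ∧ ∀ᶠ q in 𝓝 p, (q ∈ M ↔ ρ q = 0)

/-- `M` is an embedded (locally closed) real-analytic real hypersurface of `ℂ²`. -/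
def IsAnalyticHypersurface (M : Set (ℂ × ℂ)) : Prop :=
  ∀ p ∈ M, ∃ ρ : ℂ × ℂ → ℝ, IsDefiningFunction M p ρ

/-- The Levi form `∑ ρ_{j k̄} X_j X̄_k` of `ρ` at `p`, written through the real Hessian:
it equals `(D²ρ(X, X) + D²ρ(iX, iX)) / 4`. -/
noncomputable def leviForm (ρ : ℂ × ℂ → ℝ) (p X : ℂ × ℂ) : ℝ :=
  (fderiv ℝ (fderiv ℝ ρ) p X X
    + fderiv ℝ (fderiv ℝ ρ) p (Complex.I • X) (Complex.I • X)) / 4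

/-- `M` is Levi nondegenerate: at each of its points the Levi form of a local defining function
is nondegenerate on the complex tangent space `ker dρ ∩ i ker dρ`. This space is a complex line,
so nondegeneracy means that the form does not vanish on its nonzero vectors; the choice of the
defining function is irrelevant. -/
def IsLeviNondegenerate (M : Set (ℂ × ℂ)) : Prop :=
  ∀ p ∈ M, ∃ ρ : ℂ × ℂ → ℝ, IsDefiningFunction M p ρ ∧
    ∀ X : ℂ × ℂ, X ≠ 0 → fderiv ℝ ρ p X = 0 → fderiv ℝ ρ p (Complex.I • X) = 0 →
      leviForm ρ p X ≠ 0

/-- `X` belongs to the real tangent space `T_p M` of the hypersurface `M`. -/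
def IsTangent (M : Set (ℂ × ℂ)) (p X : ℂ × ℂ) : Prop :=
  ∃ ρ : ℂ × ℂ → ℝ, IsDefiningFunction M p ρ ∧ fderiv ℝ ρ p X = 0

/-- `X ∈ T_p M`, but `X` is not in the complex tangent space `T_p M ∩ i T_p M`.
The CR-transversal 1-jets at `p` are the real lines spanned by such vectors. -/
def IsCRTransversal (M : Set (ℂ × ℂ)) (p X : ℂ × ℂ) : Prop :=
  IsTangent M p X ∧ ¬ IsTangent M p (Complex.I • X)

/-- `Φ` is a system of local holomorphic coordinates `(z, w)` of `ℂ²` centered at `p`: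
a biholomorphism from an open neighbourhood of `p` onto an open neighbourhood of `0`,
with `Φ p = 0`. -/
structure IsHolomorphicChartAt (Φ : OpenPartialHomeomorph (ℂ × ℂ) (ℂ × ℂ)) (p : ℂ × ℂ) :
    Prop where
  mem_source : p ∈ Φ.source
  map_center : Φ p = 0
  holomorphic : DifferentiableOn ℂ Φ Φ.source
  holomorphic_symm : DifferentiableOn ℂ Φ.symm Φ.target

/-- In the coordinates `Φ = (z, w)`, `w = u + i v`, the set `M` is near `p` the graph
`v = F (z, u)`, where `F` is real-analytic at the origin. -/
def IsGraphedBy (M : Set (ℂ × ℂ)) (p : ℂ × ℂ) (Φ : OpenPartialHomeomorph (ℂ × ℂ) (ℂ × ℂ))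
    (F : ℂ × ℝ → ℝ) : Prop :=
  AnalyticAt ℝ F 0 ∧ ∀ᶠ q in 𝓝 p, (q ∈ M ↔ (Φ q).2.im = F ((Φ q).1, (Φ q).2.re))

/-- The coordinates `Φ` centered at `p` normalize `M` up to weighted order 5:
`M` becomes `v = z z̄ + O(6)`, where `z, z̄` have weight 1 and `u` has weight 2. For a
real-analytic remainder, being `O(|z|⁶ + |u|³)` means exactly that no monomial
`z^j z̄^k u^l` with `j + k + 2 l ≤ 5` occurs in it. -/
def IsNormalizingAt (M : Set (ℂ × ℂ)) (p : ℂ × ℂ)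
    (Φ : OpenPartialHomeomorph (ℂ × ℂ) (ℂ × ℂ)) : Prop :=
  IsHolomorphicChartAt Φ p ∧ ∃ F : ℂ × ℝ → ℝ, IsGraphedBy M p Φ F ∧
    (fun x : ℂ × ℝ => F x - Complex.normSq x.1) =O[𝓝 0] (fun x => ‖x.1‖ ^ 6 + |x.2| ^ 3)

/-- First derivative `df/du` at the parameter `t`, for a curve on which the real functions `f` and
`u` of the parameter are given and `u' ≠ 0`. -/
noncomputable def jetOne (f u : ℝ → ℝ) (t : ℝ) : ℝ :=
  deriv f t / deriv u t

/-- Second derivative `d²f/du²` at the parameter `t`, in the same situation. -/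
noncomputable def jetTwo (f u : ℝ → ℝ) (t : ℝ) : ℝ :=
  (deriv (deriv f) t * deriv u t - deriv f t * deriv (deriv u) t) / deriv u t ^ 3

/-- The cubic surface of 2-jets `(x₁, y₁, x₂, y₂)` (the chain locus). -/
def InChainLocus (x₁ y₁ x₂ y₂ : ℝ) : Prop :=
  x₂ = -2 * x₁ ^ 2 * y₁ - 2 * y₁ ^ 3 ∧ y₂ = 2 * x₁ * y₁ ^ 2 + 2 * x₁ ^ 3

/-- The 2-jet at the parameter `t` of a curve `c = (x + i y, u + i v)` in `ℂ²`, in the jet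
coordinates `x₁ = dx/du`, `y₁ = dy/du`, `x₂ = d²x/du²`, `y₂ = d²y/du²`, is in the chain locus. -/
def JetInChainLocus (c : ℝ → ℂ × ℂ) (t : ℝ) : Prop :=
  InChainLocus
    (jetOne (fun s => (c s).1.re) (fun s => (c s).2.re) t)
    (jetOne (fun s => (c s).1.im) (fun s => (c s).2.re) t)
    (jetTwo (fun s => (c s).1.re) (fun s => (c s).2.re) t)
    (jetTwo (fun s => (c s).1.im) (fun s => (c s).2.re) t)

/-- `γ : I → M` is (a parametrization of) a Moser chain of `M`: a CR-transversal curve whose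
2-jet at each of its points `γ t` is the inverse image, under coordinates normalizing `M` at
`γ t` to `v = z z̄ + O(6)`, of a 2-jet in the chain locus. Chains are unparametrized curves: any
regular parameter is allowed. -/
def IsMoserChainOn (M : Set (ℂ × ℂ)) (γ : ℝ → ℂ × ℂ) (I : Set ℝ) : Prop :=
  ContDiffOn ℝ 2 γ I ∧ ∀ t ∈ I, γ t ∈ M ∧ IsCRTransversal M (γ t) (deriv γ t) ∧
    ∃ Φ : OpenPartialHomeomorph (ℂ × ℂ) (ℂ × ℂ),
      IsNormalizingAt M (γ t) Φ ∧ JetInChainLocus (fun s => Φ (γ s)) t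

/-- `γ`, restricted to `(-ε, ε)`, is a piece of Moser chain of `M` which passes through `p` at
the parameter `0` and is directed there by the 1-jet (the real line) spanned by `ξ`. -/
def IsMoserChainThrough (M : Set (ℂ × ℂ)) (p ξ : ℂ × ℂ) (γ : ℝ → ℂ × ℂ) (ε : ℝ) : Prop :=
  0 < ε ∧ IsMoserChainOn M γ (Ioo (-ε) ε) ∧ γ 0 = p ∧ ∃ r : ℝ, r ≠ 0 ∧ deriv γ 0 = r • ξ

/-- Two curves agree near the parameter `0`, up to a `C²` change of parameter fixing `0`. -/
def SameCurveGerm (γ σ : ℝ → ℂ × ℂ) : Prop :=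
  ∃ θ : ℝ → ℝ, ContDiffAt ℝ 2 θ 0 ∧ θ 0 = 0 ∧ deriv θ 0 ≠ 0 ∧ ∀ᶠ s in 𝓝 0, σ s = γ (θ s)

/-- In the coordinates `Φ = (z, u + i v)` the curve `γ` is, near the parameter `0`, the
`u`-axis `{z = 0, v = 0}` near the origin. -/
def IsStraightenedBy (Φ : OpenPartialHomeomorph (ℂ × ℂ) (ℂ × ℂ)) (γ : ℝ → ℂ × ℂ) (ε : ℝ) :
    Prop :=
  ∃ η a b : ℝ, 0 < η ∧ η ≤ ε ∧ a < 0 ∧ 0 < b ∧ (∀ t ∈ Ioo (-η) η, γ t ∈ Φ.source) ∧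
    (fun t => Φ (γ t)) '' Ioo (-η) η = (fun u : ℝ => ((0 : ℂ), (u : ℂ))) '' Ioo a b

/-- `F = z z̄ + z⁴ z̄² F₄₂(u) + z² z̄⁴ F₂₄(u) + ∑_{j,k ≥ 2, j+k ≥ 7} z^j z̄^k F_{jk}(u)`, with an
(absolutely) convergent series near the origin, real-analytic coefficients `F_{jk}(u) = c j k u`,
and the reality condition that `F_{kj}` is the conjugate of `F_{jk}`. -/
def IsMoserNormalForm (F : ℂ × ℝ → ℝ) : Prop :=
  ∃ (δ : ℝ) (c : ℕ → ℕ → ℝ → ℂ), 0 < δ ∧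
    (∀ j k, AnalyticOnNhd ℝ (c j k) (Ioo (-δ) δ)) ∧
    (∀ j k, ∀ u ∈ Ioo (-δ) δ, c k j u = conj (c j k u)) ∧
    ∀ z : ℂ, ‖z‖ < δ → ∀ u ∈ Ioo (-δ) δ,
      HasSum
        (fun i : {i : ℕ × ℕ // 2 ≤ i.1 ∧ 2 ≤ i.2 ∧ 7 ≤ i.1 + i.2} =>
          z ^ i.1.1 * conj z ^ i.1.2 * c i.1.1 i.1.2 u)
        ((F (z, u) : ℂ)
          - (z * conj z + z ^ 4 * conj z ^ 2 * c 4 2 u + z ^ 2 * conj z ^ 4 * c 2 4 u))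

end MoserChain

namespace MoserChain

section implicitFunctions

theorem exists_analyticAt_implicit {𝕜 : Type*} [RCLike 𝕜] {E : Type*} [NormedAddCommGroup E]
    [NormedSpace 𝕜 E] [CompleteSpace E] {f : E × 𝕜 → 𝕜} {x : E} {y : 𝕜}
    (hf : AnalyticAt 𝕜 f (x, y)) (h0 : f (x, y) = 0) {d : 𝕜}
    (hd : HasDerivAt (fun t => f (x, t)) d y) (hd0 : d ≠ 0) :
    ∃ g : E → 𝕜, AnalyticAt 𝕜 g x ∧ g x = y ∧
      ∀ᶠ q in 𝓝 (x, y), (f q = 0 ↔ q.2 = g q.1) := by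
  have hc : ContDiffAt 𝕜 ⊤ f (x, y) := hf.contDiffAt
  have e1 : fderiv 𝕜 f (x, y) ∘L .inr 𝕜 E 𝕜 = ContinuousLinearMap.toSpanSingleton 𝕜 d := by
    have h1 : HasDerivAt (fun t : 𝕜 => (x, t)) ((0 : E), (1 : 𝕜)) y :=
      (hasDerivAt_const y x).prodMk (hasDerivAt_id y)
    have h2 := (hf.differentiableAt.hasFDerivAt.comp_hasDerivAt y h1).unique hd
    ext
    simpa using h2
  have hinv : (fderiv 𝕜 f (x, y) ∘L .inr 𝕜 E 𝕜).IsInvertible := by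
    rw [e1]
    refine ⟨ContinuousLinearEquiv.unitsEquivAut 𝕜 (Units.mk0 d hd0), ?_⟩
    ext
    simp
  refine ⟨hc.implicitFunction (by simp) hinv, ?_, ?_, ?_⟩
  · exact (hc.contDiffAt_implicitFunction (by simp) hinv).analyticAt
  · exact hc.implicitFunction_apply_self (by simp) hinv
  · filter_upwards [hc.eventually_apply_eq_iff_implicitFunction (by simp) hinv] with q hq
    rw [← h0, hq, eq_comm]

/-- The inverse function theorem for analytic maps, with the derivative given as an equivalence. -/
theorem exists_analytic_openPartialHomeomorph {𝕜 : Type*} [RCLike 𝕜] {E F : Type*}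
    [NormedAddCommGroup E] [NormedSpace 𝕜 E] [CompleteSpace E]
    [NormedAddCommGroup F] [NormedSpace 𝕜 F] [CompleteSpace F] {f : E → F} {x : E}
    (hf : AnalyticAt 𝕜 f x) (f' : E ≃L[𝕜] F) (hf' : HasFDerivAt f (f' : E →L[𝕜] F) x) :
    ∃ Φ : OpenPartialHomeomorph E F, x ∈ Φ.source ∧ (∀ y, Φ y = f y) ∧
      AnalyticOnNhd 𝕜 Φ Φ.source ∧ AnalyticOnNhd 𝕜 Φ.symm Φ.target := by
  have hc : ContDiffAt 𝕜 ⊤ f x := hf.contDiffAt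
  set Ψ := hc.toOpenPartialHomeomorph f hf' (by simp) with hΨ
  have hxs : x ∈ Ψ.source := hc.mem_toOpenPartialHomeomorph_source hf' (by simp)
  have hΨf : ∀ y, Ψ y = f y := fun y => rfl
  have h1 : ∀ᶠ y in 𝓝 x, AnalyticAt 𝕜 f y := hf.eventually_analyticAt
  have h2 : AnalyticAt 𝕜 Ψ.symm (Ψ x) := (hc.to_localInverse hf' (by simp)).analyticAt
  have h3 : ∀ᶠ y in 𝓝 x, AnalyticAt 𝕜 Ψ.symm (Ψ y) :=
    (Ψ.continuousAt hxs).eventually h2.eventually_analyticAt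
  obtain ⟨U, hU, hUo, hxU⟩ := eventually_nhds_iff.1 (h1.and h3)
  refine ⟨Ψ.restrOpen U hUo, ⟨hxs, hxU⟩, fun y => rfl, ?_, ?_⟩
  · intro y hy
    exact (hU y hy.2).1
  · intro y hy
    have hy2 : Ψ.symm y ∈ U := hy.2
    have := (hU _ hy2).2
    rwa [Ψ.right_inv hy.1] at this

end implicitFunctions

section factor

variable {E : Type*} [NormedAddCommGroup E] [NormedSpace ℂ E]

/-- The projection onto the kernel of `l` along `e`. -/
noncomputable def kerProj (l : E →L[ℂ] ℂ) (e : E) : E →L[ℂ] E :=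
  ContinuousLinearMap.id ℂ E - l.smulRight e

/-- The power series of the quotient of an analytic function by the linear form `l`, where
`l e = 1`. -/
noncomputable def quotSeries (l : E →L[ℂ] ℂ) (e : E) (p : FormalMultilinearSeries ℂ E ℂ) :
    FormalMultilinearSeries ℂ E ℂ := fun n =>
  ∑ i : Fin (n + 1), ((p (n + 1)).curryMid i e).compContinuousLinearMap
    (fun j => if i.succAbove j < i then ContinuousLinearMap.id ℂ E else kerProj l e)

theorem norm_quotSeries_le (l : E →L[ℂ] ℂ) (e : E) (p : FormalMultilinearSeries ℂ E ℂ) (n : ℕ) :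
    ‖quotSeries l e p n‖ ≤ (n + 1) * (‖p (n + 1)‖ * ‖e‖ * (1 + ‖kerProj l e‖) ^ n) := by
  unfold quotSeries
  refine (norm_sum_le _ _).trans ?_
  have : ∀ i ∈ (Finset.univ : Finset (Fin (n + 1))),
      ‖((p (n + 1)).curryMid i e).compContinuousLinearMap
    (fun j => if i.succAbove j < i then ContinuousLinearMap.id ℂ E else kerProj l e)‖
      ≤ ‖p (n + 1)‖ * ‖e‖ * (1 + ‖kerProj l e‖) ^ n := by
    intro i _
    refine (ContinuousMultilinearMap.norm_compContinuousLinearMap_le _ _).trans ?_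
    have h1 : ‖(p (n + 1)).curryMid i e‖ ≤ ‖p (n + 1)‖ * ‖e‖ := by
      refine ((p (n + 1)).curryMid i).le_opNorm _ |>.trans ?_
      rw [ContinuousMultilinearMap.norm_curryMid]
    have h2 : (∏ j, ‖(if i.succAbove j < i then ContinuousLinearMap.id ℂ E else kerProj l e :
        E →L[ℂ] E)‖) ≤ ∏ _j : Fin n, (1 + ‖kerProj l e‖) := by
      refine Finset.prod_le_prod (fun _ _ => norm_nonneg _) fun j _ => ?_
      split_ifs
      · exact ContinuousLinearMap.norm_id_le.trans (by linarith [norm_nonneg (kerProj l e)])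
      · linarith
    rw [Finset.prod_const, Finset.card_univ, Fintype.card_fin] at h2
    gcongr
  refine (Finset.sum_le_sum this).trans ?_
  simp

theorem mul_quotSeries_apply (l : E →L[ℂ] ℂ) (e : E) (p : FormalMultilinearSeries ℂ E ℂ)
    (n : ℕ) (x : E) :
    l x * quotSeries l e p n (fun _ => x) =
      p (n + 1) (fun _ => x) - p (n + 1) (fun _ => kerProj l e x) := by
  have h := (p (n + 1)).toMultilinearMap.map_sub_map_piecewise (fun _ => x)
    (fun _ => kerProj l e x) Finset.univ
  simp only [Finset.piecewise_univ] at h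
  change (p (n + 1)) (fun _ => x) - (p (n + 1)) (fun _ => kerProj l e x) = _ at h
  rw [h]
  simp only [quotSeries, sum_apply, Finset.mul_sum]
  refine Finset.sum_congr rfl fun i _ => ?_
  simp only [ContinuousMultilinearMap.compContinuousLinearMap_apply,
    ContinuousMultilinearMap.curryMid_apply]
  have h2 := (p (n + 1)).toMultilinearMap.map_insertNth_smul i
    (fun j => (if i.succAbove j < i then ContinuousLinearMap.id ℂ E else kerProj l e) x) (l x) e
  rw [← smul_eq_mul]
  refine h2.symm.trans (congrArg _ ?_)
  funext j
  refine Fin.succAboveCases i ?_ (fun k => ?_) j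
  · simp [kerProj]
  · by_cases hk : i.succAbove k < i
    · simp [hk]
    · have : i ≠ i.succAbove k := (Fin.succAbove_ne i k).symm
      simp [hk, this]

/-- An analytic function vanishing on the hyperplane `l = 0` is divisible by `l`. -/
theorem exists_eq_mul_of_eq_zero {f : E → ℂ} {x : E} (hf : AnalyticAt ℂ f x)
    (l : E →L[ℂ] ℂ) {e : E} (he : l e = 1) (hx : l x = 0)
    (h0 : ∀ᶠ y in 𝓝 x, l y = 0 → f y = 0) :
    ∃ g : E → ℂ, AnalyticAt ℂ g x ∧ ∀ᶠ y in 𝓝 x, f y = l y * g y := by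
  obtain ⟨p, hp⟩ := hf
  obtain ⟨K, a, hK, ha, hpK⟩ : ∃ K a : ℝ, 0 < K ∧ 0 < a ∧ ∀ n, ‖p n‖ ≤ K * a ^ n := by
    obtain ⟨K, a, hK, ha, h⟩ := p.le_mul_pow_of_radius_pos hp.radius_pos
    exact ⟨K, a, hK, ha, h⟩
  set q := quotSeries l e p with hq
  set b := 1 + ‖kerProj l e‖ with hb
  have hb1 : 1 ≤ b := by linarith [norm_nonneg (kerProj l e)]
  have hrad : 0 < q.radius := by
    have hr : 0 < 1 / (2 * a * b) := by positivity
    refine lt_of_lt_of_le ?_ (q.le_radius_of_bound (r := ⟨1 / (2 * a * b), hr.le⟩)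
      (K * a * ‖e‖) fun n => ?_)
    · exact ENNReal.coe_pos.2 (show (0 : NNReal) < ⟨1 / (2 * a * b), hr.le⟩ from hr)
    · have h2 : ((n : ℝ) + 1) ≤ 2 ^ n := by
        exact_mod_cast Nat.lt_two_pow_self (n := n)
      calc ‖q n‖ * (1 / (2 * a * b)) ^ n
          ≤ (2 ^ n * ((K * a ^ (n + 1)) * ‖e‖ * b ^ n)) * (1 / (2 * a * b)) ^ n := by
            have := norm_quotSeries_le l e p n
            gcongr
            refine this.trans ?_
            gcongr
            exact hpK _
        _ = K * a * ‖e‖ * ((2 * a * b) ^ n * (1 / (2 * a * b)) ^ n) := by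
            rw [mul_pow (2 * a) b, mul_pow 2 a, pow_succ]
            ring
        _ = K * a * ‖e‖ := by
            rw [← mul_pow, mul_one_div_cancel (by positivity), one_pow, mul_one]
  have hqs := q.hasFPowerSeriesOnBall hrad
  refine ⟨fun y => q.sum (y - x), ?_, ?_⟩
  · have : AnalyticAt ℂ q.sum (x - x) := by
      rw [sub_self]; exact hqs.analyticAt
    exact this.comp (f := fun y => y - x) (by fun_prop)
  · have t1 : Tendsto (fun y : E => y - x) (𝓝 x) (𝓝 0) := by
      have : ContinuousAt (fun y : E => y - x) x := by fun_prop
      simpa [ContinuousAt] using this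
    have t2 : Tendsto (fun y : E => kerProj l e (y - x)) (𝓝 x) (𝓝 0) := by
      have := (kerProj l e).continuous.tendsto 0
      rw [map_zero] at this
      exact this.comp t1
    have t3 : Tendsto (fun y : E => x + kerProj l e (y - x)) (𝓝 x) (𝓝 x) := by
      simpa using t2.const_add x
    have e1 : ∀ᶠ y in 𝓝 (0 : E), HasSum (fun n => p n fun _ => y) (f (x + y)) :=
      hp.eventually_hasSum
    have e3 : ∀ᶠ y in 𝓝 (0 : E), HasSum (fun n => q n fun _ => y) (q.sum y) := by
      simpa using hqs.hasFPowerSeriesAt.eventually_hasSum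
    filter_upwards [t1.eventually e1, t2.eventually e1, t1.eventually e3, t3.eventually h0]
      with y h1 h2 h3 h4
    have h5 : f (x + kerProj l e (y - x)) = 0 := h4 (by simp [kerProj, hx, he])
    rw [h5] at h2
    have h6 := (h1.sub h2)
    have h7 : HasSum (fun n => l (y - x) * q n fun _ => y - x) (l (y - x) * q.sum (y - x)) :=
      h3.mul_left _
    have h8 := (hasSum_nat_add_iff' 1).2 h6
    simp only [hq, mul_quotSeries_apply] at h7
    have h9 := h8.unique h7
    have h10 : p 0 (fun _ => y - x) = p 0 (fun _ => kerProj l e (y - x)) := by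
      congr 1
      exact Subsingleton.elim _ _
    simp [h10, hx] at h9
    exact h9

end factor

section series

variable {E : Type*} [NormedAddCommGroup E] [NormedSpace ℂ E]

theorem radius_pos_of_le_mul_pow {q : FormalMultilinearSeries ℂ E ℂ} {K a : ℝ} (ha : 0 < a)
    (h : ∀ n, ‖q n‖ ≤ K * a ^ n) : 0 < q.radius := by
  have hr : 0 < a⁻¹ := by positivity
  refine lt_of_lt_of_le ?_ (q.le_radius_of_bound (r := ⟨a⁻¹, hr.le⟩) K fun n => ?_)
  · exact ENNReal.coe_pos.2 (show (0 : NNReal) < ⟨a⁻¹, hr.le⟩ from hr)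
  · calc ‖q n‖ * a⁻¹ ^ n ≤ K * a ^ n * a⁻¹ ^ n := by gcongr; exact h n
      _ = K := by rw [mul_assoc, ← mul_pow, mul_inv_cancel₀ ha.ne', one_pow, mul_one]

theorem exists_norm_le_mul_pow {𝕜 E F : Type*} [NontriviallyNormedField 𝕜]
    [NormedAddCommGroup E] [NormedSpace 𝕜 E] [NormedAddCommGroup F] [NormedSpace 𝕜 F]
    {f : E → F} {p : FormalMultilinearSeries 𝕜 E F} {x : E} (hp : HasFPowerSeriesAt f p x) :
    ∃ K a : ℝ, 0 < K ∧ 0 < a ∧ ∀ n, ‖p n‖ ≤ K * a ^ n := by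
  obtain ⟨K, a, hK, ha, h⟩ := p.le_mul_pow_of_radius_pos hp.radius_pos
  exact ⟨K, a, hK, ha, h⟩

theorem analyticAt_of_eventually_hasSum {f : E → ℂ} {x : E} {q : FormalMultilinearSeries ℂ E ℂ}
    (hq : 0 < q.radius)
    (h : ∀ᶠ y in 𝓝 (0 : E), HasSum (fun n => q n fun _ => y) (f (x + y))) :
    AnalyticAt ℂ f x := by
  have hqs := q.hasFPowerSeriesOnBall hq
  have h1 : AnalyticAt ℂ (fun y => q.sum (y - x)) x := by
    have : AnalyticAt ℂ q.sum (x - x) := by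
      rw [sub_self]; exact hqs.analyticAt
    exact this.comp (f := fun y => y - x) (by fun_prop)
  refine h1.congr ?_
  have t1 : Tendsto (fun y : E => y - x) (𝓝 x) (𝓝 0) := by
    have : ContinuousAt (fun y : E => y - x) x := by fun_prop
    simpa [ContinuousAt] using this
  have e3 : ∀ᶠ y in 𝓝 (0 : E), HasSum (fun n => q n fun _ => y) (q.sum y) := by
    simpa using hqs.hasFPowerSeriesAt.eventually_hasSum
  filter_upwards [t1.eventually h, t1.eventually e3] with y h1 h2
  simpa using h2.unique h1

noncomputable def conjMultilinear {E' : Type*} [NormedAddCommGroup E'] [NormedSpace ℂ E']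
    (σ : E →L⋆[ℂ] E') {n : ℕ} (p : E' [×n]→L[ℂ] ℂ) : E [×n]→L[ℂ] ℂ :=
  MultilinearMap.mkContinuous
    { toFun := fun m => conj (p fun i => σ (m i))
      map_update_add' := by
        intro _ m i x y
        have : ∀ z, (fun j => σ (Function.update m i z j)) =
            Function.update (fun j => σ (m j)) i (σ z) := by
          intro z; funext j
          by_cases h : j = i
          · subst h; simp
          · simp [h]
        rw [this, this, this, map_add, p.map_update_add, map_add]
      map_update_smul' := by
        intro _ m i c x
        have : ∀ z, (fun j => σ (Function.update m i z j)) =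
            Function.update (fun j => σ (m j)) i (σ z) := by
          intro z; funext j
          by_cases h : j = i
          · subst h; simp
          · simp [h]
        rw [this, this, map_smulₛₗ, p.map_update_smul]
        simp }
    (‖p‖ * ‖σ‖ ^ n) (by
      intro m
      simp only [MultilinearMap.coe_mk, RCLike.norm_conj]
      refine (p.le_opNorm _).trans ?_
      rw [mul_assoc]
      gcongr
      calc ∏ i, ‖σ (m i)‖ ≤ ∏ i, (‖σ‖ * ‖m i‖) :=
            Finset.prod_le_prod (fun _ _ => norm_nonneg _) fun i _ => σ.le_opNorm _
        _ = _ := by simp [Finset.prod_mul_distrib])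

theorem AnalyticAt.conj_comp {E' : Type*} [NormedAddCommGroup E'] [NormedSpace ℂ E']
    (σ : E →L⋆[ℂ] E') {f : E' → ℂ} {x : E} (hf : AnalyticAt ℂ f (σ x)) :
    AnalyticAt ℂ (fun y => conj (f (σ y))) x := by
  obtain ⟨p, hp⟩ := hf
  obtain ⟨K, a, hK, ha, hpK⟩ := exists_norm_le_mul_pow hp
  refine analyticAt_of_eventually_hasSum (q := fun n => conjMultilinear σ (p n)) ?_ ?_
  · refine radius_pos_of_le_mul_pow (K := K) (a := a * (1 + ‖σ‖))
      (by positivity) fun n => ?_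
    refine (MultilinearMap.mkContinuous_norm_le _ (by positivity) _).trans ?_
    rw [mul_pow, ← mul_assoc]
    gcongr
    · exact hpK n
    · linarith
  · have t : Tendsto σ (𝓝 0) (𝓝 0) := by simpa using σ.continuous.tendsto 0
    filter_upwards [t.eventually hp.eventually_hasSum] with y hy
    have := Complex.hasSum_conj'.2 hy
    simpa [conjMultilinear] using this

end series

section complexification

variable {ι : Type*} [Fintype ι]

theorem multilinear_apply_eq_sum_words {𝕜 : Type*} [NontriviallyNormedField 𝕜] [DecidableEq ι]
    {F : Type*} [NormedAddCommGroup F] [NormedSpace 𝕜 F] {n : ℕ}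
    (p : (ι → 𝕜) [×n]→L[𝕜] F) (x : ι → 𝕜) :
    p (fun _ => x) = ∑ i : Fin n → ι, (∏ k, x (i k)) • p fun k => Pi.single (i k) 1 := by
  have hx : x = ∑ j, x j • (Pi.single j 1 : ι → 𝕜) := by
    funext k
    simp [Finset.sum_apply, Pi.single_apply]
  conv_lhs => rw [hx]
  have := p.toMultilinearMap.map_sum (fun (_ : Fin n) j => x j • (Pi.single j 1 : ι → 𝕜))
  refine this.trans (Finset.sum_congr rfl fun i _ => ?_)
  exact p.toMultilinearMap.map_smul_univ (fun k => x (i k)) _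

/-- The multilinear map given by a product of coordinates. -/
noncomputable def wordMultilinear {n : ℕ} (i : Fin n → ι) : (ι → ℂ) [×n]→L[ℂ] ℂ :=
  (ContinuousMultilinearMap.mkPiAlgebra ℂ (Fin n) ℂ).compContinuousLinearMap
    fun k => ContinuousLinearMap.proj (i k)

theorem norm_wordMultilinear_le {n : ℕ} (i : Fin n → ι) : ‖wordMultilinear i‖ ≤ 1 := by
  refine ContinuousMultilinearMap.opNorm_le_bound zero_le_one fun m => ?_
  simp only [wordMultilinear, ContinuousMultilinearMap.compContinuousLinearMap_apply,
    ContinuousMultilinearMap.mkPiAlgebra_apply, one_mul, norm_prod]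
  exact Finset.prod_le_prod (fun _ _ => norm_nonneg _) fun k _ => norm_le_pi_norm (m k) (i k)

/-- A real-analytic function extends to a holomorphic function near a real point. -/
theorem exists_complexification {f : (ι → ℝ) → ℝ} (hf : AnalyticAt ℝ f 0) :
    ∃ g : (ι → ℂ) → ℂ, AnalyticAt ℂ g 0 ∧ ∀ᶠ x in 𝓝 (0 : ι → ℝ), g (fun k => (x k : ℂ)) = f x := by
  classical
  obtain ⟨p, hp⟩ := hf
  obtain ⟨K, a, hK, ha, hpK⟩ := exists_norm_le_mul_pow hp
  set q : FormalMultilinearSeries ℂ (ι → ℂ) ℂ := fun n =>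
    ∑ i : Fin n → ι, ((p n fun k => Pi.single (i k) 1 : ℝ) : ℂ) • wordMultilinear i with hq
  have hrad : 0 < q.radius := by
    refine radius_pos_of_le_mul_pow (K := K) (a := (Fintype.card ι + 1) * a)
      (by positivity) fun n => ?_
    refine (norm_sum_le _ _).trans ?_
    have : ∀ i ∈ (Finset.univ : Finset (Fin n → ι)),
        ‖((p n fun k => Pi.single (i k) 1 : ℝ) : ℂ) • wordMultilinear i‖ ≤ K * a ^ n := by
      intro i _
      rw [norm_smul, Complex.norm_real]
      have h1 : ‖(p n fun k => Pi.single (i k) 1 : ℝ)‖ ≤ ‖p n‖ := by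
        refine (ContinuousMultilinearMap.le_opNorm_mul_prod_of_le (b := fun _ => 1) _
          fun k => ?_).trans (by simp)
        rw [Pi.norm_single]; simp
      calc _ ≤ ‖p n‖ * 1 := by gcongr; exact norm_wordMultilinear_le i
        _ ≤ _ := by rw [mul_one]; exact hpK n
    refine (Finset.sum_le_sum this).trans ?_
    simp only [Finset.sum_const, Finset.card_univ, Fintype.card_pi, Finset.prod_const,
      Fintype.card_fin, nsmul_eq_mul, Nat.cast_pow]
    rw [mul_pow]
    have : ((Fintype.card ι : ℝ)) ^ n ≤ (Fintype.card ι + 1) ^ n := by gcongr; linarith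
    nlinarith [mul_le_mul_of_nonneg_right this (show 0 ≤ K * a ^ n by positivity)]
  have hqs := q.hasFPowerSeriesOnBall hrad
  refine ⟨q.sum, hqs.analyticAt, ?_⟩
  have e3 : ∀ᶠ y in 𝓝 (0 : ι → ℂ), HasSum (fun n => q n fun _ => y) (q.sum y) := by
    simpa using hqs.hasFPowerSeriesAt.eventually_hasSum
  have t : Tendsto (fun (x : ι → ℝ) k => (x k : ℂ)) (𝓝 0) (𝓝 0) := by
    have : Continuous (fun (x : ι → ℝ) k => (x k : ℂ)) := by fun_prop
    have := this.tendsto 0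
    simpa [← Pi.zero_def] using this
  filter_upwards [t.eventually e3, hp.eventually_hasSum] with x h1 h2
  have h3 := Complex.hasSum_ofReal.2 h2
  rw [zero_add] at h3
  refine h1.unique ?_
  convert! h3 using 1
  funext n
  rw [multilinear_apply_eq_sum_words (p n) x]
  simp [hq, wordMultilinear, mul_comm]

end complexification

section doubleExpansion

/-- The number of occurrences of a letter in a word. -/
def letterCount (w : Σ n : ℕ, Fin n → Fin 3) (c : Fin 3) : ℕ :=
  (Finset.univ.filter fun k => w.2 k = c).card

theorem prod_word (w : Σ n : ℕ, Fin n → Fin 3) (x : Fin 3 → ℂ) :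
    ∏ k, x (w.2 k) = x 0 ^ letterCount w 0 * x 1 ^ letterCount w 1 * x 2 ^ letterCount w 2 := by
  have h := Finset.prod_fiberwise' (Finset.univ : Finset (Fin w.1)) (fun k => w.2 k) x
  rw [← h, Fin.prod_univ_three]
  simp [letterCount, Finset.prod_const]

theorem letterCount_add (w : Σ n : ℕ, Fin n → Fin 3) :
    letterCount w 0 + letterCount w 1 + letterCount w 2 = w.1 := by
  have h := Finset.card_eq_sum_card_fiberwise (s := (Finset.univ : Finset (Fin w.1)))
    (t := (Finset.univ : Finset (Fin 3))) (f := fun k => w.2 k) (fun _ _ => by simp)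
  rw [Fin.sum_univ_three] at h
  simpa [letterCount] using h.symm

/-- A holomorphic function of three variables expands in a double series in the first two, whose
coefficients are holomorphic in the third. -/
theorem exists_double_expansion {R : ℂ × ℂ × ℂ → ℂ} (hR : AnalyticAt ℂ R 0) :
    ∃ (δ : ℝ) (c : ℕ → ℕ → ℂ → ℂ), 0 < δ ∧
      (∀ j k, AnalyticOnNhd ℂ (c j k) (Metric.ball 0 δ)) ∧
      ∀ z ζ s : ℂ, ‖z‖ < δ → ‖ζ‖ < δ → ‖s‖ < δ →
        HasSum (fun i : ℕ × ℕ => z ^ i.1 * ζ ^ i.2 * c i.1 i.2 s) (R (z, ζ, s)) := by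
  set f : (Fin 3 → ℂ) → ℂ := fun x => R (x 0, x 1, x 2) with hf
  have hfa : AnalyticAt ℂ f 0 := by
    have : AnalyticAt ℂ (fun x : Fin 3 → ℂ => (x 0, x 1, x 2)) 0 :=
      (((ContinuousLinearMap.proj 0 : (Fin 3 → ℂ) →L[ℂ] ℂ).prod
        ((ContinuousLinearMap.proj 1 : (Fin 3 → ℂ) →L[ℂ] ℂ).prod
          (ContinuousLinearMap.proj 2 : (Fin 3 → ℂ) →L[ℂ] ℂ))).analyticAt 0)
    exact AnalyticAt.comp (g := R) (f := fun x : Fin 3 → ℂ => (x 0, x 1, x 2)) hR this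
  obtain ⟨p, hp⟩ := hfa
  obtain ⟨K, a, hK, ha, hpK⟩ := exists_norm_le_mul_pow hp
  have hp' := hp.eventually_hasSum
  simp only [zero_add] at hp'
  obtain ⟨δ₀, hδ₀, hδp⟩ := Metric.eventually_nhds_iff.1 hp'
  set δ : ℝ := min δ₀ (1 / (6 * a)) with hδ
  have hδ0 : 0 < δ := by positivity
  have haδ : 3 * (a * δ) ≤ 1 / 2 := by
    have : δ ≤ 1 / (6 * a) := min_le_right _ _
    calc 3 * (a * δ) ≤ 3 * (a * (1 / (6 * a))) := by gcongr
      _ = 1 / 2 := by field_simp; norm_num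
  set A : (Σ n : ℕ, Fin n → Fin 3) → ℂ := fun w => p w.1 fun k => Pi.single (w.2 k) 1 with hA
  have hAle : ∀ w, ‖A w‖ ≤ K * a ^ w.1 := by
    intro w
    refine le_trans ?_ (hpK w.1)
    refine (ContinuousMultilinearMap.le_opNorm_mul_prod_of_le (b := fun _ => 1) _
          fun k => ?_).trans (by simp)
    rw [Pi.norm_single]; simp
  have hAs : Summable fun w : Σ n : ℕ, Fin n → Fin 3 => K * a ^ w.1 * δ ^ w.1 := by
    refine (summable_sigma_of_nonneg fun w => by positivity).2 ⟨fun n => ?_, ?_⟩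
    · exact Summable.of_finite
    · have : (fun n : ℕ => ∑' _ : Fin n → Fin 3, K * a ^ n * δ ^ n) =
          fun n => K * (3 * (a * δ)) ^ n := by
        funext n
        rw [tsum_fintype]
        simp only [Finset.sum_const, Finset.card_univ, Fintype.card_pi, Finset.prod_const,
          Fintype.card_fin, nsmul_eq_mul, Nat.cast_pow]
        rw [mul_pow, mul_pow]
        push_cast
        ring
      change Summable (fun n : ℕ => ∑' _ : Fin n → Fin 3, K * a ^ n * δ ^ n)
      rw [this]
      exact (summable_geometric_of_lt_one (by positivity) (by linarith)).mul_left K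
  have hAt : ∀ x : Fin 3 → ℂ, (∀ k, ‖x k‖ ≤ δ) → ∀ w : Σ n : ℕ, Fin n → Fin 3,
      ‖(∏ k, x (w.2 k)) * A w‖ ≤ K * a ^ w.1 * δ ^ w.1 := by
    intro x hx w
    rw [norm_mul, norm_prod, mul_comm]
    have : ∏ k, ‖x (w.2 k)‖ ≤ ∏ _k : Fin w.1, δ :=
      Finset.prod_le_prod (fun _ _ => norm_nonneg _) fun k _ => hx _
    rw [Finset.prod_const, Finset.card_univ, Fintype.card_fin] at this
    have h2 := hAle w
    gcongr
  set cnt : (Σ n : ℕ, Fin n → Fin 3) → ℕ × ℕ := fun w => (letterCount w 0, letterCount w 1)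
    with hcnt
  refine ⟨δ, fun j k s => ∑' w : cnt ⁻¹' {(j, k)}, s ^ letterCount w.1 2 * A w, hδ0, ?_, ?_⟩
  · intro j k
    refine DifferentiableOn.analyticOnNhd ?_ Metric.isOpen_ball
    refine Complex.differentiableOn_tsum_of_summable_norm
      (u := fun w : cnt ⁻¹' {(j, k)} => (K * a ^ w.1.1 * δ ^ w.1.1) * (δ⁻¹) ^ (j + k))
      ((hAs.subtype _).mul_right _) (fun w => by fun_prop) Metric.isOpen_ball ?_
    rintro ⟨w, hw⟩ s hs
    have hs' : ‖s‖ ≤ δ := by simpa using (Metric.mem_ball.1 hs).le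
    have hjk : letterCount w 0 = j ∧ letterCount w 1 = k := by
      simpa [hcnt] using hw
    have hn := letterCount_add w
    rw [hjk.1, hjk.2] at hn
    have h2 := hAle w
    rw [norm_mul, norm_pow, mul_comm]
    calc ‖A w‖ * ‖s‖ ^ letterCount w 2 ≤ (K * a ^ w.1) * δ ^ letterCount w 2 := by gcongr
      _ = K * a ^ w.1 * δ ^ w.1 * δ⁻¹ ^ (j + k) := by
        have : δ ^ w.1 * δ⁻¹ ^ (j + k) = δ ^ letterCount w 2 := by
          rw [← hn, pow_add, mul_right_comm, ← mul_pow, mul_inv_cancel₀ hδ0.ne', one_pow,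
            one_mul]
        rw [mul_assoc _ (δ ^ w.1), this]
  · intro z ζ s hz hζ hs
    set x : Fin 3 → ℂ := ![z, ζ, s] with hx
    have hxk : ∀ k, ‖x k‖ < δ := by
      intro k; fin_cases k <;> simpa [hx]
    have hsum : Summable fun w : Σ n : ℕ, Fin n → Fin 3 => (∏ k, x (w.2 k)) * A w :=
      Summable.of_norm_bounded hAs (hAt x fun k => (hxk k).le)
    have h1 : HasSum (fun w : Σ n : ℕ, Fin n → Fin 3 => (∏ k, x (w.2 k)) * A w) (f x) := by
      have h2 := hsum.hasSum.sigma (g := fun n => p n fun _ => x) (fun n => by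
        rw [multilinear_apply_eq_sum_words (p n) x]
        simp only [smul_eq_mul]
        exact hasSum_fintype _)
      have h3 : HasSum (fun n => p n fun _ => x) (f x) := by
        refine hδp ?_
        rw [dist_zero_right, pi_norm_lt_iff hδ₀]
        exact fun k => (hxk k).trans_le (min_le_left _ _)
      rw [← h2.unique h3]
      exact hsum.hasSum
    have h4 := h1.tsum_fiberwise cnt
    have hfx : f x = R (z, ζ, s) := by simp [hf, hx]
    rw [hfx] at h4
    convert! h4 using 1
    funext i
    rw [← tsum_mul_left]
    refine tsum_congr ?_
    rintro ⟨w, hw⟩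
    have hjk : cnt w = i := by simpa using hw
    have hj : letterCount w 0 = i.1 := congrArg Prod.fst hjk
    have hk : letterCount w 1 = i.2 := congrArg Prod.snd hjk
    simp only [prod_word, hj, hk]
    simp [hx]
    ring

end doubleExpansion

section holomorphicODE

variable {E : Type*} [NormedAddCommGroup E] [NormedSpace ℂ E] [CompleteSpace E]

/-- Existence of holomorphic solutions of holomorphic autonomous differential equations. -/
theorem exists_holomorphic_solution {V : E → E} {x₀ : E} (hV : AnalyticAt ℂ V x₀) :
    ∃ y : ℂ → E, y 0 = x₀ ∧ AnalyticAt ℂ y 0 ∧ ∀ᶠ t in 𝓝 (0 : ℂ), HasDerivAt y (V (y t)) t := by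
  obtain ⟨K, s, hs, hKs⟩ := (hV.contDiffAt (n := 1)).exists_lipschitzOnWith
  obtain ⟨R, hR, hRs⟩ : ∃ R > 0, Metric.closedBall x₀ R ⊆
      s ∩ {x | DifferentiableAt ℂ V x} := by
    refine Metric.nhds_basis_closedBall.mem_iff.1 (inter_mem hs ?_)
    exact hV.eventually_analyticAt.mono fun x hx => hx.differentiableAt
  have hK : LipschitzOnWith K V (Metric.closedBall x₀ R) := hKs.mono fun x hx => (hRs hx).1
  have hd : ∀ x ∈ Metric.closedBall x₀ R, DifferentiableAt ℂ V x := fun x hx => (hRs hx).2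
  set B : ℝ := ‖V x₀‖ + K * R with hB
  have hB0 : 0 ≤ B := by positivity
  have hVB : ∀ x ∈ Metric.closedBall x₀ R, ‖V x‖ ≤ B := by
    intro x hx
    have h1 := hK.dist_le_mul x hx x₀ (Metric.mem_closedBall_self hR.le)
    rw [dist_eq_norm] at h1
    have h2 : ‖V x‖ ≤ ‖V x - V x₀‖ + ‖V x₀‖ := by simpa using norm_add_le (V x - V x₀) (V x₀)
    have h3 : (K : ℝ) * dist x x₀ ≤ K * R := by gcongr; exact hx
    linarith
  obtain ⟨r, hr, hrB, hrK⟩ : ∃ r : ℝ, 0 < r ∧ r * B ≤ R ∧ r * K ≤ 1 / 2 := by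
    refine ⟨min (R / (B + 1)) (1 / (2 * (K + 1))), by positivity, ?_, ?_⟩
    · calc _ ≤ R / (B + 1) * B := by gcongr; exact min_le_left _ _
        _ ≤ R := by
          rw [div_mul_eq_mul_div, div_le_iff₀ (by positivity)]; nlinarith
    · calc _ ≤ 1 / (2 * ((K : ℝ) + 1)) * K := by gcongr; exact min_le_right _ _
        _ ≤ 1 / 2 := by
          rw [div_mul_eq_mul_div, div_le_iff₀ (by positivity)]
          nlinarith [K.coe_nonneg]
  set D := Metric.ball (0 : ℂ) r with hD
  have h0D : (0 : ℂ) ∈ D := Metric.mem_ball_self hr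
  have mv : ∀ (g g' : ℂ → E) (C : ℝ), (∀ t ∈ D, HasDerivAt g (g' t) t) → (∀ t ∈ D, ‖g' t‖ ≤ C) →
      g 0 = 0 → ∀ t ∈ D, ‖g t‖ ≤ C * r := by
    intro g g' C h1 h2 h3 t ht
    have := (convex_ball (0 : ℂ) r).norm_image_sub_le_of_norm_hasDerivWithin_le
      (fun x hx => (h1 x hx).hasDerivWithinAt) h2 h0D ht
    rw [h3, sub_zero, sub_zero] at this
    have hC : 0 ≤ C := (norm_nonneg _).trans (h2 0 h0D)
    have htr : ‖t‖ ≤ r := by simpa using (Metric.mem_ball.1 ht).le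
    exact this.trans (by gcongr)
  have step : ∀ y : ℂ → E, DifferentiableOn ℂ y D ∧ (∀ t ∈ D, y t ∈ Metric.closedBall x₀ R) →
      ∃ z : ℂ → E, (DifferentiableOn ℂ z D ∧ ∀ t ∈ D, z t ∈ Metric.closedBall x₀ R) ∧
        z 0 = x₀ ∧ ∀ t ∈ D, HasDerivAt z (V (y t)) t := by
    rintro y ⟨hy1, hy2⟩
    have h1 : DifferentiableOn ℂ (fun t => V (y t)) D := fun t ht =>
      ((hd _ (hy2 t ht)).comp t
        ((hy1 t ht).differentiableAt (Metric.isOpen_ball.mem_nhds ht))).differentiableWithinAt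
    obtain ⟨z, hz0, hz⟩ := h1.isExactOn_ball.with_val_at 0 x₀
    refine ⟨z, ⟨fun t ht => (hz t ht).differentiableAt.differentiableWithinAt, fun t ht => ?_⟩,
      hz0, hz⟩
    have := mv (fun t => z t - x₀) _ B (fun t ht => (hz t ht).sub_const x₀)
      (fun t ht => hVB _ (hy2 t ht)) (by simp [hz0]) t ht
    rw [mem_closedBall_iff_norm]
    linarith
  choose! P hP1 hP0 hP using step
  set Y : ℕ → ℂ → E := fun n => P^[n] (fun _ => x₀) with hY
  have hY1 : ∀ n, DifferentiableOn ℂ (Y n) D ∧ ∀ t ∈ D, Y n t ∈ Metric.closedBall x₀ R := by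
    intro n
    induction n with
    | zero => exact ⟨differentiableOn_const _, fun t _ => Metric.mem_closedBall_self hR.le⟩
    | succ n ih =>
      simp only [hY, Function.iterate_succ_apply']
      exact hP1 _ ih
  have hYs : ∀ n, Y (n + 1) = P (Y n) := fun n => by
    simp only [hY, Function.iterate_succ_apply']
  have hYd : ∀ n, ∀ t ∈ D, HasDerivAt (Y (n + 1)) (V (Y n t)) t := by
    intro n; rw [hYs]; exact hP _ (hY1 n)
  have hY0 : ∀ n, Y n 0 = x₀ := by
    intro n
    cases n with
    | zero => rfl
    | succ n => rw [hYs]; exact hP0 _ (hY1 n)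
  have hdist : ∀ n, ∀ t ∈ D, dist (Y n t) (Y (n + 1) t) ≤ R * (1 / 2) ^ n := by
    intro n
    induction n with
    | zero =>
      intro t ht
      have := (hY1 1).2 t ht
      rw [dist_comm]
      simpa [hY] using this
    | succ n ih =>
      intro t ht
      have h2 := mv (fun t => Y (n + 1) t - Y (n + 2) t) _ (K * (R * (1 / 2) ^ n))
        (fun t ht => (hYd n t ht).sub (hYd (n + 1) t ht)) (fun t ht => by
          have := hK.dist_le_mul _ ((hY1 n).2 t ht) _ ((hY1 (n + 1)).2 t ht)
          rw [dist_eq_norm] at this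
          refine this.trans ?_
          gcongr
          exact ih t ht) (by simp [hY0]) t ht
      rw [dist_eq_norm]
      refine h2.trans ?_
      calc K * (R * (1 / 2) ^ n) * r = (r * K) * (R * (1 / 2) ^ n) := by ring
        _ ≤ 1 / 2 * (R * (1 / 2) ^ n) := by gcongr
        _ = _ := by ring
  have hlim : ∀ t ∈ D, ∃ l, Tendsto (fun n => Y n t) atTop (𝓝 l) := fun t ht =>
    cauchySeq_tendsto_of_complete
      (cauchySeq_of_le_geometric (1 / 2) R (by norm_num) fun n => hdist n t ht)
  choose! y hy using hlim
  have hyR : ∀ t ∈ D, y t ∈ Metric.closedBall x₀ R := fun t ht =>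
    Metric.isClosed_closedBall.mem_of_tendsto (hy t ht)
      (Eventually.of_forall fun n => (hY1 n).2 t ht)
  have hunif : ∀ n, ∀ t ∈ D, dist (Y n t) (y t) ≤ 2 * R * (1 / 2) ^ n := by
    intro n t ht
    have := dist_le_of_le_geometric_of_tendsto (1 / 2) R (by norm_num)
      (fun n => hdist n t ht) (hy t ht) n
    refine this.trans (le_of_eq ?_)
    ring
  have hgeo : Tendsto (fun n : ℕ => 2 * R * (1 / 2 : ℝ) ^ n) atTop (𝓝 0) := by
    simpa using (tendsto_pow_atTop_nhds_zero_of_lt_one (by norm_num : (0 : ℝ) ≤ 1 / 2)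
      (by norm_num)).const_mul (2 * R)
  have hyd : ∀ t ∈ D, HasDerivAt y (V (y t)) t := by
    refine fun t ht => hasDerivAt_of_tendstoUniformlyOn Metric.isOpen_ball
      (f := fun n => Y (n + 1)) (f' := fun n t => V (Y n t)) (l := atTop) (g' := fun t => V (y t)) ?_
      (Eventually.of_forall fun n t ht => hYd n t ht)
      (fun t ht => (tendsto_add_atTop_iff_nat 1).2 (hy t ht)) ht
    rw [Metric.tendstoUniformlyOn_iff]
    intro ε hε
    have h1 : Tendsto (fun n : ℕ => K * (2 * R * (1 / 2 : ℝ) ^ n)) atTop (𝓝 0) := by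
      simpa using hgeo.const_mul (K : ℝ)
    filter_upwards [h1.eventually (gt_mem_nhds hε)] with n hn t ht
    refine lt_of_le_of_lt (hK.dist_le_mul _ (hyR t ht) _ ((hY1 n).2 t ht)) (lt_of_le_of_lt ?_ hn)
    rw [dist_comm]
    gcongr
    exact hunif n t ht
  have hDn : D ∈ 𝓝 (0 : ℂ) := Metric.ball_mem_nhds 0 hr
  refine ⟨y, ?_, ?_, ?_⟩
  · refine tendsto_nhds_unique (hy 0 h0D) ?_
    simp [hY0]
  · exact DifferentiableOn.analyticAt
      (fun t ht => (hyd t ht).differentiableAt.differentiableWithinAt) hDn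
  · filter_upwards [hDn] with t ht using hyd t ht

end holomorphicODE

section osgood

variable {r M : ℝ}

theorem differentiableOn_dslope_ball {g : ℂ → ℂ} (hr : 0 < r)
    (hg : DifferentiableOn ℂ g (Metric.ball 0 r)) :
    DifferentiableOn ℂ (dslope g 0) (Metric.ball 0 r) :=
  (Complex.differentiableOn_dslope (Metric.ball_mem_nhds 0 hr)).2 hg

theorem norm_dslope_le {g : ℂ → ℂ} (hr : 0 < r)
    (hg : DifferentiableOn ℂ g (Metric.ball 0 r)) (hM : ∀ z ∈ Metric.ball (0 : ℂ) r, ‖g z‖ ≤ M) :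
    ∀ z ∈ Metric.ball (0 : ℂ) r, ‖dslope g 0 z‖ ≤ M * (2 / r) := by
  intro z hz
  have h := Complex.norm_dslope_le_div_of_mapsTo_ball (R₂ := 2 * M) hg (fun x hx => by
    rw [mem_closedBall_iff_norm]
    have h1 := hM x hx
    have h2 := hM 0 (Metric.mem_ball_self hr)
    linarith [norm_sub_le (g x) (g 0)]) hz
  refine h.trans (le_of_eq ?_)
  ring

/-- Iterated difference quotient at the origin. -/
noncomputable def iterSlope (j : ℕ) (g : ℂ → ℂ) : ℂ → ℂ := (fun h => dslope h 0)^[j] g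

theorem iterSlope_succ (j : ℕ) (g : ℂ → ℂ) : iterSlope (j + 1) g = iterSlope j (dslope g 0) :=
  Function.iterate_succ_apply _ _ _

theorem iterSlope_bound {g : ℂ → ℂ} (hr : 0 < r)
    (hg : DifferentiableOn ℂ g (Metric.ball 0 r)) (hM : ∀ z ∈ Metric.ball (0 : ℂ) r, ‖g z‖ ≤ M)
    (j : ℕ) : ∀ z ∈ Metric.ball (0 : ℂ) r, ‖iterSlope j g z‖ ≤ M * (2 / r) ^ j := by
  induction j generalizing g M with
  | zero => simpa [iterSlope] using hM
  | succ j ih =>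
    intro z hz
    rw [iterSlope_succ]
    refine (ih (differentiableOn_dslope_ball hr hg) (norm_dslope_le hr hg hM) z hz).trans ?_
    rw [pow_succ]
    exact le_of_eq (by ring)

theorem eq_sum_iterSlope (g : ℂ → ℂ) (n : ℕ) (z : ℂ) :
    g z = ∑ j ∈ Finset.range n, z ^ j * iterSlope j g 0 + z ^ n * iterSlope n g z := by
  induction n generalizing g with
  | zero => simp [iterSlope]
  | succ n ih =>
    have h1 : g z = g 0 + z * dslope g 0 z := by
      have := sub_smul_dslope g 0 z
      simp only [sub_zero, smul_eq_mul] at this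
      rw [this]; ring
    rw [h1, ih (dslope g 0), Finset.sum_range_succ']
    simp only [iterSlope_succ]
    rw [mul_add, Finset.mul_sum]
    have h0 : iterSlope 0 g 0 = g 0 := rfl
    rw [h0]
    have : ∀ x ∈ Finset.range n, z * (z ^ x * iterSlope x (dslope g 0) 0) =
        z ^ (x + 1) * iterSlope x (dslope g 0) 0 := fun x _ => by ring
    rw [Finset.sum_congr rfl this]
    ring

theorem hasSum_iterSlope {g : ℂ → ℂ} (hr : 0 < r)
    (hg : DifferentiableOn ℂ g (Metric.ball 0 r)) (hM : ∀ z ∈ Metric.ball (0 : ℂ) r, ‖g z‖ ≤ M)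
    {z : ℂ} (hz : ‖z‖ ≤ r / 4) : HasSum (fun j => z ^ j * iterSlope j g 0) (g z) := by
  have hM0 : 0 ≤ M := (norm_nonneg _).trans (hM 0 (Metric.mem_ball_self hr))
  have hzb : z ∈ Metric.ball (0 : ℂ) r := by
    rw [mem_ball_zero_iff]; linarith
  have hpow : ∀ j : ℕ, ‖z‖ ^ j * (M * (2 / r) ^ j) ≤ M * (1 / 2) ^ j := by
    intro j
    have : ‖z‖ * (2 / r) ≤ 1 / 2 := by
      calc ‖z‖ * (2 / r) ≤ r / 4 * (2 / r) := by gcongr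
        _ = 1 / 2 := by field_simp; norm_num
    calc ‖z‖ ^ j * (M * (2 / r) ^ j) = M * (‖z‖ * (2 / r)) ^ j := by rw [mul_pow]; ring
      _ ≤ _ := by gcongr
  have hs : Summable fun j => z ^ j * iterSlope j g 0 := by
    refine Summable.of_norm_bounded (g := fun j : ℕ => M * (1 / 2) ^ j)
      ((summable_geometric_of_lt_one (by norm_num) (by norm_num)).mul_left M) fun j => ?_
    rw [norm_mul, norm_pow]
    refine le_trans ?_ (hpow j)
    gcongr
    exact iterSlope_bound hr hg hM j 0 (Metric.mem_ball_self hr)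
  rw [hs.hasSum_iff_tendsto_nat]
  have h1 : Tendsto (fun n => g z - z ^ n * iterSlope n g z) atTop (𝓝 (g z - 0)) := by
    refine tendsto_const_nhds.sub ?_
    refine squeeze_zero_norm (a := fun n : ℕ => M * (1 / 2) ^ n) (fun n => ?_) ?_
    · rw [norm_mul, norm_pow]
      refine le_trans ?_ (hpow n)
      gcongr
      exact iterSlope_bound hr hg hM n z hzb
    · simpa using (tendsto_pow_atTop_nhds_zero_of_lt_one (by norm_num : (0 : ℝ) ≤ 1 / 2)
        (by norm_num)).const_mul M
  rw [sub_zero] at h1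
  refine h1.congr fun n => ?_
  rw [sub_eq_iff_eq_add]
  exact eq_sum_iterSlope g n z

theorem differentiableOn_iterSlope_parameter {f : ℂ → ℂ → ℂ} (hr : 0 < r)
    (h1 : ∀ w ∈ Metric.ball (0 : ℂ) r, DifferentiableOn ℂ (fun z => f z w) (Metric.ball 0 r))
    (h2 : ∀ z ∈ Metric.ball (0 : ℂ) r, DifferentiableOn ℂ (fun w => f z w) (Metric.ball 0 r))
    (hM : ∀ w ∈ Metric.ball (0 : ℂ) r, ∀ z ∈ Metric.ball (0 : ℂ) r, ‖f z w‖ ≤ M) (j : ℕ) :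
    DifferentiableOn ℂ (fun w => iterSlope j (fun z => f z w) 0) (Metric.ball 0 r) := by
  induction j generalizing f M with
  | zero => exact h2 0 (Metric.mem_ball_self hr)
  | succ j ih =>
    simp only [iterSlope_succ]
    have k1 : ∀ w ∈ Metric.ball (0 : ℂ) r,
        DifferentiableOn ℂ (dslope (fun z => f z w) 0) (Metric.ball 0 r) := fun w hw =>
      differentiableOn_dslope_ball hr (h1 w hw)
    have kM : ∀ w ∈ Metric.ball (0 : ℂ) r, ∀ z ∈ Metric.ball (0 : ℂ) r,
        ‖dslope (fun z => f z w) 0 z‖ ≤ M * (2 / r) := fun w hw =>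
      norm_dslope_le hr (h1 w hw) (hM w hw)
    refine ih (f := fun z w => dslope (fun z => f z w) 0 z) (M := M * (2 / r)) k1 ?_ kM
    have hne : ∀ z ∈ Metric.ball (0 : ℂ) r, z ≠ 0 →
        DifferentiableOn ℂ (fun w => dslope (fun z => f z w) 0 z) (Metric.ball 0 r) := by
      intro z hz hz0
      simp only [dslope_of_ne _ hz0, slope_def_field]
      exact ((h2 z hz).sub (h2 0 (Metric.mem_ball_self hr))).div_const _
    intro z hz
    rcases eq_or_ne z 0 with rfl | hz0
    swap
    · exact hne z hz hz0
    set u : ℕ → ℂ := fun n => ((r / (n + 2) : ℝ) : ℂ) with hu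
    have hun : ∀ n, ‖u n‖ = r / (n + 2) := fun n => by
      rw [hu, Complex.norm_real, Real.norm_of_nonneg (by positivity)]
    have hub : ∀ n, u n ∈ Metric.ball (0 : ℂ) r := fun n => by
      rw [mem_ball_zero_iff, hun, div_lt_iff₀ (by positivity)]
      nlinarith [(Nat.cast_nonneg n : (0 : ℝ) ≤ n)]
    have hu0 : ∀ n, u n ≠ 0 := fun n => by
      rw [← norm_pos_iff, hun]; positivity
    have ht : Tendsto (fun n : ℕ => r / ((n : ℝ) + 2)) atTop (𝓝 0) :=
      tendsto_const_nhds.div_atTop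
        (tendsto_atTop_add_const_right _ _ tendsto_natCast_atTop_atTop)
    have hunif : TendstoUniformlyOn (fun n w => dslope (fun z => f z w) 0 (u n))
        (fun w => dslope (fun z => f z w) 0 0) atTop (Metric.ball 0 r) := by
      rw [Metric.tendstoUniformlyOn_iff]
      intro ε hε
      have ht2 : Tendsto (fun n : ℕ => r / ((n : ℝ) + 2) * (M * (2 / r) * (2 / r))) atTop
          (𝓝 0) := by simpa using ht.mul_const (M * (2 / r) * (2 / r))
      filter_upwards [ht2.eventually (gt_mem_nhds hε)] with n hn w hw
      refine lt_of_le_of_lt ?_ hn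
      have := norm_dslope_le hr (k1 w hw) (kM w hw) (u n) (hub n)
      have h3 := sub_smul_dslope (dslope (fun z => f z w) 0) 0 (u n)
      rw [dist_comm, dist_eq_norm, ← h3, sub_zero, norm_smul, hun]
      gcongr
    exact hunif.tendstoLocallyUniformlyOn.differentiableOn
      (Eventually.of_forall fun n => hne _ (hub n) (hu0 n)) Metric.isOpen_ball

theorem analyticAt_of_hasSum_monomials {f : ℂ × ℂ → ℂ} {x : ℂ × ℂ} {b : ℕ → ℕ → ℂ} {M a : ℝ}
    (ha : 0 < a) (hM0 : 0 ≤ M) (hbM : ∀ j k, ‖b j k‖ ≤ M * a ^ j * a ^ k)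
    (hsum : ∀ᶠ y : ℂ × ℂ in 𝓝 0,
      HasSum (fun i : ℕ × ℕ => y.1 ^ i.1 * (y.2 ^ i.2 * b i.1 i.2)) (f (x + y))) :
    AnalyticAt ℂ f x := by
  set q : FormalMultilinearSeries ℂ (ℂ × ℂ) ℂ := fun n =>
    ∑ k ∈ Finset.range (n + 1), b (n - k) k •
      (ContinuousMultilinearMap.mkPiAlgebra ℂ (Fin n) ℂ).compContinuousLinearMap
        fun i => if (i : ℕ) < n - k then ContinuousLinearMap.fst ℂ ℂ ℂ
          else ContinuousLinearMap.snd ℂ ℂ ℂ with hq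
  have hqv : ∀ n (y : ℂ × ℂ), q n (fun _ => y) =
      ∑ k ∈ Finset.range (n + 1), y.1 ^ (n - k) * (y.2 ^ k * b (n - k) k) := by
    intro n y
    simp only [hq, sum_apply, smul_apply, smul_eq_mul,
      ContinuousMultilinearMap.compContinuousLinearMap_apply,
      ContinuousMultilinearMap.mkPiAlgebra_apply]
    refine Finset.sum_congr rfl fun k hk => ?_
    have hk' : k ≤ n := Nat.lt_succ_iff.1 (Finset.mem_range.1 hk)
    have : ∏ i : Fin n, (if (i : ℕ) < n - k then ContinuousLinearMap.fst ℂ ℂ ℂ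
          else ContinuousLinearMap.snd ℂ ℂ ℂ) y = y.1 ^ (n - k) * y.2 ^ k := by
      rw [Fin.prod_univ_eq_prod_range (fun i => (if i < n - k then ContinuousLinearMap.fst ℂ ℂ ℂ
          else ContinuousLinearMap.snd ℂ ℂ ℂ) y) n]
      have hn : n = (n - k) + k := by omega
      conv_lhs => rw [hn]
      rw [Finset.prod_range_add]
      congr 1
      · rw [Finset.prod_congr rfl (g := fun _ => y.1)]
        · simp
        · intro i hi
          simp [Finset.mem_range.1 hi]
      · rw [Finset.prod_congr rfl (g := fun _ => y.2)]
        · simp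
        · intro i hi
          simp
    rw [this]; ring
  have hrad : 0 < q.radius := by
    refine radius_pos_of_le_mul_pow (K := M) (a := 2 * a) (by positivity) fun n => ?_
    refine (norm_sum_le _ _).trans ?_
    have : ∀ k ∈ Finset.range (n + 1), ‖b (n - k) k •
      (ContinuousMultilinearMap.mkPiAlgebra ℂ (Fin n) ℂ).compContinuousLinearMap
        (fun i => if (i : ℕ) < n - k then ContinuousLinearMap.fst ℂ ℂ ℂ
          else ContinuousLinearMap.snd ℂ ℂ ℂ)‖ ≤ M * a ^ n := by
      intro k hk
      have hk' : k ≤ n := Nat.lt_succ_iff.1 (Finset.mem_range.1 hk)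
      rw [norm_smul]
      have h7 : ‖(ContinuousMultilinearMap.mkPiAlgebra ℂ (Fin n) ℂ).compContinuousLinearMap
        (fun i => if (i : ℕ) < n - k then ContinuousLinearMap.fst ℂ ℂ ℂ
          else ContinuousLinearMap.snd ℂ ℂ ℂ)‖ ≤ 1 := by
        refine ContinuousMultilinearMap.opNorm_le_bound zero_le_one fun m => ?_
        simp only [ContinuousMultilinearMap.compContinuousLinearMap_apply,
          ContinuousMultilinearMap.mkPiAlgebra_apply, one_mul, norm_prod]
        refine Finset.prod_le_prod (fun _ _ => norm_nonneg _) fun i _ => ?_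
        split_ifs
        · exact norm_fst_le (m i)
        · exact norm_snd_le (m i)
      calc _ ≤ (M * a ^ (n - k) * a ^ k) * 1 := by
            gcongr
            exact hbM _ _
        _ = M * a ^ n := by
            rw [mul_one, mul_assoc, ← pow_add, Nat.sub_add_cancel hk']
    refine (Finset.sum_le_sum this).trans ?_
    rw [Finset.sum_const, Finset.card_range, nsmul_eq_mul, mul_pow]
    have h2 : (((n + 1 : ℕ)) : ℝ) ≤ 2 ^ n := by
      exact_mod_cast Nat.lt_two_pow_self (n := n)
    calc _ ≤ 2 ^ n * (M * a ^ n) := by gcongr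
      _ = _ := by ring
  refine analyticAt_of_eventually_hasSum hrad ?_
  filter_upwards [hsum] with y h8
  have h9 := (Finset.HasAntidiagonal.sigmaAntidiagonalEquivProd.hasSum_iff).2 h8
  have h10 := h9.sigma (g := fun n => q n fun _ => y) (fun n => by
    have h11 := hasSum_fintype (fun c : Finset.HasAntidiagonal.antidiagonal n =>
      y.1 ^ c.1.1 * (y.2 ^ c.1.2 * b c.1.1 c.1.2))
    convert! h11 using 1
    rw [hqv, Finset.sum_coe_sort (Finset.HasAntidiagonal.antidiagonal n)
      (fun c : ℕ × ℕ => y.1 ^ c.1 * (y.2 ^ c.2 * b c.1 c.2)),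
      Finset.Nat.sum_antidiagonal_eq_sum_range_succ_mk, ← Finset.sum_range_reflect]
    refine Finset.sum_congr rfl fun k hk => ?_
    have hk' : k ≤ n := Nat.lt_succ_iff.1 (Finset.mem_range.1 hk)
    have h1 : n + 1 - 1 - k = n - k := by omega
    have h2 : n - (n - k) = k := by omega
    simp only [h1, h2])
  exact h10

/-- A holomorphic function of two variables is analytic. -/
theorem analyticAt_of_eventually_differentiableAt {f : ℂ × ℂ → ℂ} {x : ℂ × ℂ}
    (hf : ∀ᶠ y in 𝓝 x, DifferentiableAt ℂ f y) : AnalyticAt ℂ f x := by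
  have hb : ∀ᶠ y in 𝓝 x, ‖f y‖ < ‖f x‖ + 1 :=
    hf.self_of_nhds.continuousAt.norm.eventually (gt_mem_nhds (by linarith))
  obtain ⟨r, hr, hball⟩ := Metric.eventually_nhds_iff.1 (hf.and hb)
  set M := ‖f x‖ + 1 with hM
  have hM0 : 0 ≤ M := by positivity
  set g : ℂ → ℂ → ℂ := fun z w => f (x.1 + z, x.2 + w) with hg
  have hmem : ∀ z ∈ Metric.ball (0 : ℂ) r, ∀ w ∈ Metric.ball (0 : ℂ) r,
      dist (x.1 + z, x.2 + w) x < r := by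
    intro z hz w hw
    rw [dist_eq_norm, Prod.norm_def]
    simpa using And.intro (mem_ball_zero_iff.1 hz) (mem_ball_zero_iff.1 hw)
  have h1 : ∀ w ∈ Metric.ball (0 : ℂ) r, DifferentiableOn ℂ (fun z => g z w) (Metric.ball 0 r) := by
    intro w hw z hz
    have := (hball (hmem z hz w hw)).1
    exact (DifferentiableAt.comp z (f := fun z => (x.1 + z, x.2 + w)) this
      (by fun_prop)).differentiableWithinAt
  have h2 : ∀ z ∈ Metric.ball (0 : ℂ) r, DifferentiableOn ℂ (fun w => g z w) (Metric.ball 0 r) := by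
    intro z hz w hw
    have := (hball (hmem z hz w hw)).1
    exact (DifferentiableAt.comp w (f := fun w => (x.1 + z, x.2 + w)) this
      (by fun_prop)).differentiableWithinAt
  have h3 : ∀ w ∈ Metric.ball (0 : ℂ) r, ∀ z ∈ Metric.ball (0 : ℂ) r, ‖g z w‖ ≤ M :=
    fun w hw z hz => (hball (hmem z hz w hw)).2.le
  set a : ℕ → ℂ → ℂ := fun j w => iterSlope j (fun z => g z w) 0 with ha
  have had : ∀ j, DifferentiableOn ℂ (a j) (Metric.ball 0 r) :=
    differentiableOn_iterSlope_parameter hr h1 h2 h3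
  have haM : ∀ j, ∀ w ∈ Metric.ball (0 : ℂ) r, ‖a j w‖ ≤ M * (2 / r) ^ j := fun j w hw =>
    iterSlope_bound hr (h1 w hw) (h3 w hw) j 0 (Metric.mem_ball_self hr)
  set b : ℕ → ℕ → ℂ := fun j k => iterSlope k (a j) 0 with hb
  have hbM : ∀ j k, ‖b j k‖ ≤ M * (2 / r) ^ j * (2 / r) ^ k := fun j k =>
    iterSlope_bound hr (had j) (haM j) k 0 (Metric.mem_ball_self hr)
  have hsum : ∀ z w : ℂ, ‖z‖ ≤ r / 4 → ‖w‖ ≤ r / 4 →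
      HasSum (fun i : ℕ × ℕ => z ^ i.1 * (w ^ i.2 * b i.1 i.2)) (g z w) := by
    intro z w hz hw
    have hwb : w ∈ Metric.ball (0 : ℂ) r := by rw [mem_ball_zero_iff]; linarith
    have hs : Summable fun i : ℕ × ℕ => z ^ i.1 * (w ^ i.2 * b i.1 i.2) := by
      have hgeo : Summable fun j : ℕ => (1 / 2 : ℝ) ^ j :=
        summable_geometric_of_lt_one (by norm_num) (by norm_num)
      have := (hgeo.mul_of_nonneg hgeo (fun _ => by positivity) fun _ => by positivity).mul_left M
      refine Summable.of_norm_bounded this fun i => ?_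
      have h4 : ∀ y : ℂ, ‖y‖ ≤ r / 4 → ‖y‖ * (2 / r) ≤ 1 / 2 := fun y hy => by
        calc ‖y‖ * (2 / r) ≤ r / 4 * (2 / r) := by gcongr
          _ = 1 / 2 := by field_simp; norm_num
      rw [norm_mul, norm_mul, norm_pow, norm_pow]
      calc ‖z‖ ^ i.1 * (‖w‖ ^ i.2 * ‖b i.1 i.2‖)
          ≤ ‖z‖ ^ i.1 * (‖w‖ ^ i.2 * (M * (2 / r) ^ i.1 * (2 / r) ^ i.2)) := by
            gcongr; exact hbM _ _
        _ = M * ((‖z‖ * (2 / r)) ^ i.1 * (‖w‖ * (2 / r)) ^ i.2) := by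
            rw [mul_pow, mul_pow]; ring
        _ ≤ _ := by
            gcongr
            · exact h4 z hz
            · exact h4 w hw
    have h5 : HasSum (fun j => z ^ j * a j w) (g z w) :=
      hasSum_iterSlope hr (h1 w hwb) (h3 w hwb) hz
    have h5' : ∀ j, HasSum (fun k => z ^ j * (w ^ k * b j k)) (z ^ j * a j w) := fun j =>
      (hasSum_iterSlope hr (had j) (haM j) hw).mul_left (z ^ j)
    obtain ⟨S, hS⟩ := hs
    have h6 : HasSum (fun j => z ^ j * a j w) S := hS.prod_fiberwise h5'
    rwa [h6.unique h5] at hS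
  refine analyticAt_of_hasSum_monomials (a := 2 / r) (by positivity) hM0 hbM ?_
  have hev : ∀ᶠ y : ℂ × ℂ in 𝓝 0, ‖y‖ < r / 4 := by
    have := Metric.ball_mem_nhds (0 : ℂ × ℂ) (show 0 < r / 4 by positivity)
    filter_upwards [this] with y hy
    simpa using hy
  filter_upwards [hev] with y hy
  exact hsum y.1 y.2 ((norm_fst_le y).trans hy.le) ((norm_snd_le y).trans hy.le)

end osgood
section projections

variable {𝕜 E F G : Type*} [NontriviallyNormedField 𝕜] [NormedAddCommGroup E] [NormedSpace 𝕜 E]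
  [NormedAddCommGroup F] [NormedSpace 𝕜 F] [NormedAddCommGroup G] [NormedSpace 𝕜 G]

@[fun_prop]
theorem analyticAt_fst_comp {f : E → F × G} {x : E} (hf : AnalyticAt 𝕜 f x) :
    AnalyticAt 𝕜 (fun y => (f y).1) x :=
  analyticAt_fst.comp hf

@[fun_prop]
theorem analyticAt_snd_comp {f : E → F × G} {x : E} (hf : AnalyticAt 𝕜 f x) :
    AnalyticAt 𝕜 (fun y => (f y).2) x :=
  analyticAt_snd.comp hf

end projections

section realAnalytic

variable {E : Type*} [NormedAddCommGroup E] [NormedSpace ℝ E] {f : E → ℂ} {x : E}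

@[fun_prop]
theorem analyticAt_re_comp (hf : AnalyticAt ℝ f x) : AnalyticAt ℝ (fun y => (f y).re) x :=
  (Complex.reCLM.analyticAt _).comp hf

@[fun_prop]
theorem analyticAt_im_comp (hf : AnalyticAt ℝ f x) : AnalyticAt ℝ (fun y => (f y).im) x :=
  (Complex.imCLM.analyticAt _).comp hf

@[fun_prop]
theorem analyticAt_conj_comp (hf : AnalyticAt ℝ f x) : AnalyticAt ℝ (fun y => conj (f y)) x :=
  (Complex.conjCLE.toContinuousLinearMap.analyticAt _).comp hf

@[fun_prop]
theorem analyticAt_ofReal_comp {g : E → ℝ} (hg : AnalyticAt ℝ g x) :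
    AnalyticAt ℝ (fun y => (g y : ℂ)) x :=
  (Complex.ofRealCLM.analyticAt _).comp hg

end realAnalytic

section charts

variable {M : Set (ℂ × ℂ)} {p q : ℂ × ℂ} {Φ : OpenPartialHomeomorph (ℂ × ℂ) (ℂ × ℂ)}

theorem analyticAt_prod_of_eventually_differentiableAt {f : ℂ × ℂ → ℂ × ℂ} {x : ℂ × ℂ}
    (hf : ∀ᶠ y in 𝓝 x, DifferentiableAt ℂ f y) : AnalyticAt ℂ f x :=
  AnalyticAt.prod (analyticAt_of_eventually_differentiableAt (hf.mono fun _ h => h.fst))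
    (analyticAt_of_eventually_differentiableAt (hf.mono fun _ h => h.snd))

theorem IsHolomorphicChartAt.analyticAt (h : IsHolomorphicChartAt Φ p) (hq : q ∈ Φ.source) :
    AnalyticAt ℂ Φ q :=
  analyticAt_prod_of_eventually_differentiableAt <| by
    filter_upwards [Φ.open_source.mem_nhds hq] with y hy
    exact (h.holomorphic y hy).differentiableAt (Φ.open_source.mem_nhds hy)

theorem IsHolomorphicChartAt.analyticAt_symm (h : IsHolomorphicChartAt Φ p) (hq : q ∈ Φ.target) :
    AnalyticAt ℂ Φ.symm q :=
  analyticAt_prod_of_eventually_differentiableAt <| by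
    filter_upwards [Φ.open_target.mem_nhds hq] with y hy
    exact (h.holomorphic_symm y hy).differentiableAt (Φ.open_target.mem_nhds hy)

theorem IsHolomorphicChartAt.zero_mem_target (h : IsHolomorphicChartAt Φ p) :
    (0 : ℂ × ℂ) ∈ Φ.target := h.map_center ▸ Φ.map_source h.mem_source

theorem IsHolomorphicChartAt.symm_zero (h : IsHolomorphicChartAt Φ p) : Φ.symm 0 = p := by
  rw [← h.map_center, Φ.left_inv h.mem_source]

theorem IsHolomorphicChartAt.tendsto_symm (h : IsHolomorphicChartAt Φ p) :
    Tendsto Φ.symm (𝓝 0) (𝓝 p) := by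
  simpa [h.symm_zero] using (Φ.continuousAt_symm h.zero_mem_target).tendsto

theorem IsHolomorphicChartAt.tendsto (h : IsHolomorphicChartAt Φ p) :
    Tendsto Φ (𝓝 p) (𝓝 0) := by
  simpa [h.map_center] using (Φ.continuousAt h.mem_source).tendsto

theorem IsHolomorphicChartAt.eventually_symm_apply (h : IsHolomorphicChartAt Φ p) :
    ∀ᶠ x in 𝓝 0, Φ (Φ.symm x) = x := by
  filter_upwards [Φ.open_target.mem_nhds h.zero_mem_target] with x hx using Φ.right_inv hx

theorem IsHolomorphicChartAt.eventually_apply_symm (h : IsHolomorphicChartAt Φ p) :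
    ∀ᶠ x in 𝓝 p, Φ.symm (Φ x) = x := by
  filter_upwards [Φ.open_source.mem_nhds h.mem_source] with x hx using Φ.left_inv hx

/-- The derivative of the chart is invertible. -/
theorem IsHolomorphicChartAt.fderiv_symm_apply (h : IsHolomorphicChartAt Φ p) (X : ℂ × ℂ) :
    fderiv ℂ Φ.symm 0 (fderiv ℂ Φ p X) = X := by
  have h1 := (h.analyticAt_symm h.zero_mem_target).differentiableAt.hasFDerivAt
  have h2 := (h.analyticAt h.mem_source).differentiableAt.hasFDerivAt
  rw [← h.map_center] at h1
  have h3 := h1.comp p h2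
  have h4 : HasFDerivAt (Φ.symm ∘ Φ) (ContinuousLinearMap.id ℂ (ℂ × ℂ)) p :=
    (hasFDerivAt_id p).congr_of_eventuallyEq h.eventually_apply_symm
  have := congrArg (fun L => L X) (h3.unique h4)
  simpa [h.map_center] using this

theorem IsHolomorphicChartAt.fderiv_apply_symm (h : IsHolomorphicChartAt Φ p) (X : ℂ × ℂ) :
    fderiv ℂ Φ p (fderiv ℂ Φ.symm 0 X) = X := by
  have h1 := (h.analyticAt_symm h.zero_mem_target).differentiableAt.hasFDerivAt
  have h2 := (h.analyticAt h.mem_source).differentiableAt.hasFDerivAt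
  rw [← h.symm_zero] at h2
  have h3 := h2.comp 0 h1
  have h4 : HasFDerivAt (Φ ∘ Φ.symm) (ContinuousLinearMap.id ℂ (ℂ × ℂ)) 0 :=
    (hasFDerivAt_id _).congr_of_eventuallyEq h.eventually_symm_apply
  have := congrArg (fun L => L X) (h3.unique h4)
  simpa [h.symm_zero] using this

theorem IsDefiningFunction.apply_eq_zero {ρ : ℂ × ℂ → ℝ} (h : IsDefiningFunction M q ρ)
    (hq : q ∈ M) : ρ q = 0 := h.2.2.self_of_nhds.1 hq

/-- Two defining functions have the same tangent space. -/
theorem IsDefiningFunction.fderiv_eq_zero {ρ₁ ρ₂ : ℂ × ℂ → ℝ} (hq : q ∈ M)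
    (h₁ : IsDefiningFunction M q ρ₁) (h₂ : IsDefiningFunction M q ρ₂) {X : ℂ × ℂ}
    (hX : fderiv ℝ ρ₁ q X = 0) : fderiv ℝ ρ₂ q X = 0 := by
  have hloc : IsLocalExtrOn ρ₂ {x | ρ₁ x = ρ₁ q} q := by
    left
    have : ∀ᶠ x in 𝓝 q, x ∈ {x | ρ₁ x = ρ₁ q} → ρ₂ q ≤ ρ₂ x := by
      filter_upwards [h₁.2.2, h₂.2.2] with x hx1 hx2 hx
      rw [h₂.apply_eq_zero hq, hx2.1 (hx1.2 (hx.trans (h₁.apply_eq_zero hq)))]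
    exact eventually_nhdsWithin_iff.2 this
  obtain ⟨a, b, hab, h⟩ := hloc.exists_multipliers_of_hasStrictFDerivAt_1d
    h₁.1.hasStrictFDerivAt h₂.1.hasStrictFDerivAt
  have hb : b ≠ 0 := by
    rintro rfl
    have ha : a ≠ 0 := by rintro rfl; exact hab rfl
    simp only [zero_smul, add_zero, smul_eq_zero, ha, false_or] at h
    exact h₁.2.1 h
  have := congrArg (fun L => L X) h
  simpa [hX, hb] using this

theorem isTangent_iff {ρ : ℂ × ℂ → ℝ} (hq : q ∈ M) (h : IsDefiningFunction M q ρ) (X : ℂ × ℂ) :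
    IsTangent M q X ↔ fderiv ℝ ρ q X = 0 :=
  ⟨fun ⟨_, h1, h2⟩ => h1.fderiv_eq_zero hq h h2, fun h1 => ⟨ρ, h, h1⟩⟩

variable {F : ℂ × ℝ → ℝ}

theorem IsHolomorphicChartAt.hasFDerivAt_real (h : IsHolomorphicChartAt Φ q) :
    HasFDerivAt Φ ((fderiv ℂ Φ q).restrictScalars ℝ) q :=
  ((h.analyticAt h.mem_source).differentiableAt.hasFDerivAt).restrictScalars ℝ

theorem IsGraphedBy.mem_of_zero (h : IsHolomorphicChartAt Φ q) (hF : IsGraphedBy M q Φ F)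
    (h0 : F 0 = 0) : q ∈ M := by
  refine hF.2.self_of_nhds.2 ?_
  rw [h.map_center]
  exact h0.symm

theorem IsGraphedBy.isDefiningFunction (h : IsHolomorphicChartAt Φ q) (hF : IsGraphedBy M q Φ F)
    (hdF : HasFDerivAt F (0 : ℂ × ℝ →L[ℝ] ℝ) 0) :
    IsDefiningFunction M q (fun x => (Φ x).2.im - F ((Φ x).1, (Φ x).2.re)) ∧
      ∀ X, fderiv ℝ (fun x => (Φ x).2.im - F ((Φ x).1, (Φ x).2.re)) q X =
        (fderiv ℂ Φ q X).2.im := by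
  have ha : AnalyticAt ℝ Φ q := (h.analyticAt h.mem_source).restrictScalars
  have hz : ((Φ q).1, (Φ q).2.re) = (0 : ℂ × ℝ) := by simp [h.map_center]
  have hL : AnalyticAt ℝ (fun x => ((Φ x).1, (Φ x).2.re)) q := by fun_prop
  have h1 : HasFDerivAt (fun x => (Φ x).2.im - F ((Φ x).1, (Φ x).2.re))
      (Complex.imCLM ∘L (ContinuousLinearMap.snd ℝ ℂ ℂ) ∘L
        ((fderiv ℂ Φ q).restrictScalars ℝ)) q := by
    have e1 : HasFDerivAt (fun x => (Φ x).2.im) (Complex.imCLM ∘L (ContinuousLinearMap.snd ℝ ℂ ℂ) ∘L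
        ((fderiv ℂ Φ q).restrictScalars ℝ)) q :=
      Complex.imCLM.hasFDerivAt.comp q h.hasFDerivAt_real.snd
    have e2 : HasFDerivAt (fun x => F ((Φ x).1, (Φ x).2.re)) (0 : ℂ × ℂ →L[ℝ] ℝ) q := by
      rw [← hz] at hdF
      have := hdF.comp q hL.differentiableAt.hasFDerivAt
      rwa [ContinuousLinearMap.zero_comp] at this
    have := e1.sub e2
    rwa [sub_zero] at this
  have h2 : ∀ X, fderiv ℝ (fun x => (Φ x).2.im - F ((Φ x).1, (Φ x).2.re)) q X =
        (fderiv ℂ Φ q X).2.im := by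
    intro X
    rw [h1.fderiv]
    rfl
  refine ⟨⟨?_, ?_, ?_⟩, h2⟩
  · have e1 : AnalyticAt ℝ (fun x => (Φ x).2.im) q := by fun_prop
    exact e1.sub (AnalyticAt.fun_comp_of_eq hF.1 hL hz)
  · intro h3
    have := h2 (fderiv ℂ Φ.symm 0 (0, Complex.I))
    rw [h3, h.fderiv_apply_symm] at this
    simp at this
  · filter_upwards [hF.2] with x hx
    rw [hx, sub_eq_zero]

theorem IsGraphedBy.isCRTransversal_iff (h : IsHolomorphicChartAt Φ q) (hF : IsGraphedBy M q Φ F)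
    (h0 : F 0 = 0) (hdF : HasFDerivAt F (0 : ℂ × ℝ →L[ℝ] ℝ) 0) (X : ℂ × ℂ) :
    IsCRTransversal M q X ↔ (fderiv ℂ Φ q X).2.im = 0 ∧ (fderiv ℂ Φ q X).2.re ≠ 0 := by
  obtain ⟨h1, h2⟩ := hF.isDefiningFunction h hdF
  have hq := hF.mem_of_zero h h0
  rw [IsCRTransversal, isTangent_iff hq h1, isTangent_iff hq h1, h2, h2]
  simp

end charts

section transitions

theorem isBigO_sq_of_hasFDerivAt {𝕜 E G : Type*} [NontriviallyNormedField 𝕜]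
    [NormedAddCommGroup E] [NormedSpace 𝕜 E] [NormedAddCommGroup G] [NormedSpace 𝕜 G]
    {f : E → G} {L : E →L[𝕜] G} (hf : AnalyticAt 𝕜 f 0) (h0 : f 0 = 0)
    (hL : HasFDerivAt f L 0) : (fun x => f x - L x) =O[𝓝 0] fun x => ‖x‖ ^ 2 := by
  obtain ⟨p, hp⟩ := hf
  have h := hp.isBigO_sub_partialSum_pow 2
  refine h.congr_left fun x => ?_
  have h1 : p.partialSum 2 x = L x := by
    rw [FormalMultilinearSeries.partialSum, Finset.sum_range_succ, Finset.sum_range_one]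
    have e0 : p 0 (fun _ => x) = 0 := by rw [hp.coeff_zero, h0]
    have e1 : p 1 (fun _ => x) = L x := by
      rw [hL.unique hp.hasFDerivAt]
      simp only [continuousMultilinearCurryFin1_apply]
      congr 1
    rw [e0, e1, zero_add]
  rw [h1, zero_add]

variable {M : Set (ℂ × ℂ)} {q : ℂ × ℂ} {Φ Φ' : OpenPartialHomeomorph (ℂ × ℂ) (ℂ × ℂ)}

theorem exists_equiv_of_injective {L : ℂ × ℂ →L[ℂ] ℂ × ℂ} (hL : ∀ X, L X = 0 → X = 0) :
    ∃ e : (ℂ × ℂ) ≃L[ℂ] (ℂ × ℂ), (e : (ℂ × ℂ) →L[ℂ] (ℂ × ℂ)) = L := by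
  have hinj : Function.Injective (L : ℂ × ℂ →ₗ[ℂ] ℂ × ℂ) :=
    (injective_iff_map_eq_zero _).2 hL
  refine ⟨(LinearEquiv.ofInjectiveEndo _ hinj).toContinuousLinearEquiv, ?_⟩
  ext <;> rfl

theorem IsHolomorphicChartAt.postcomp (h : IsHolomorphicChartAt Φ q) {H : ℂ × ℂ → ℂ × ℂ}
    (hH : AnalyticAt ℂ H 0) (h0 : H 0 = 0) {L : ℂ × ℂ →L[ℂ] ℂ × ℂ} (hL : HasFDerivAt H L 0)
    (hinj : ∀ X, L X = 0 → X = 0) :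
    ∃ Φ' : OpenPartialHomeomorph (ℂ × ℂ) (ℂ × ℂ), IsHolomorphicChartAt Φ' q ∧
      (∀ x, Φ' x = H (Φ x)) ∧ ∀ X, fderiv ℂ Φ' q X = L (fderiv ℂ Φ q X) := by
  obtain ⟨e, rfl⟩ := exists_equiv_of_injective hinj
  obtain ⟨Θ, h1, h2, h3, h4⟩ := exists_analytic_openPartialHomeomorph hH e hL
  refine ⟨Φ.trans Θ, ⟨?_, ?_, ?_, ?_⟩, fun x => h2 _, fun X => ?_⟩
  · rw [OpenPartialHomeomorph.trans_source]
    exact ⟨h.mem_source, by rw [mem_preimage, h.map_center]; exact h1⟩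
  · change Θ (Φ q) = 0
    rw [h.map_center, h2, h0]
  · rw [OpenPartialHomeomorph.trans_source, OpenPartialHomeomorph.coe_trans]
    exact h3.differentiableOn.comp (h.holomorphic.mono inter_subset_left) fun x hx => hx.2
  · rw [OpenPartialHomeomorph.trans_target, OpenPartialHomeomorph.coe_trans_symm]
    exact h.holomorphic_symm.comp (h4.differentiableOn.mono inter_subset_left) fun x hx => hx.2
  · have e1 := (h.analyticAt h.mem_source).differentiableAt.hasFDerivAt
    rw [← h.map_center] at hL
    have e2 := hL.comp q e1
    have e3 : (Φ.trans Θ : ℂ × ℂ → ℂ × ℂ) = H ∘ Φ := funext fun x => h2 _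
    rw [e3, e2.fderiv]
    rfl

variable {F F' : ℂ × ℝ → ℝ} {r : ℝ}

/-- The point with graph coordinates `(z, u)` and height `v`. -/
noncomputable def realPoint : (ℂ × ℝ) × ℝ →L[ℝ] ℂ × ℂ :=
  ((ContinuousLinearMap.fst ℝ ℂ ℝ) ∘L (ContinuousLinearMap.fst ℝ (ℂ × ℝ) ℝ)).prod
    (Complex.ofRealCLM ∘L (ContinuousLinearMap.snd ℝ ℂ ℝ) ∘L (ContinuousLinearMap.fst ℝ (ℂ × ℝ) ℝ)
      + (Complex.I • Complex.ofRealCLM) ∘L (ContinuousLinearMap.snd ℝ (ℂ × ℝ) ℝ))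

theorem realPoint_apply (z : ℂ) (u v : ℝ) :
    realPoint ((z, u), v) = (z, (u : ℂ) + Complex.I * v) := by
  simp [realPoint]

theorem realPoint_eq (x : ℂ × ℂ) : realPoint ((x.1, x.2.re), x.2.im) = x := by
  rw [realPoint_apply]
  ext1
  · rfl
  · simp only
    rw [mul_comm, Complex.re_add_im]

/-- In coordinates with the same complex tangent line, `M` is again a graph. -/
theorem IsGraphedBy.exists_graph (h : IsHolomorphicChartAt Φ q) (hF : IsGraphedBy M q Φ F)
    (hdF : HasFDerivAt F (0 : ℂ × ℝ →L[ℝ] ℝ) 0) (h0 : F 0 = 0) (h' : IsHolomorphicChartAt Φ' q)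
    (hr : r ≠ 0) (hD : ∀ X, (fderiv ℂ Φ' q X).2 = r * (fderiv ℂ Φ q X).2) :
    ∃ F' : ℂ × ℝ → ℝ, IsGraphedBy M q Φ' F' ∧ F' 0 = 0 ∧
      HasFDerivAt F' (0 : ℂ × ℝ →L[ℝ] ℝ) 0 := by
  obtain ⟨hρ, hρ'⟩ := hF.isDefiningFunction h hdF
  set ρ : ℂ × ℂ → ℝ := fun x => (Φ x).2.im - F ((Φ x).1, (Φ x).2.re) with hρd
  have hq := hF.mem_of_zero h h0
  set G : (ℂ × ℝ) × ℝ → ℝ := fun y => ρ (Φ'.symm (realPoint y)) with hG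
  have hsa : AnalyticAt ℝ Φ'.symm 0 := (h'.analyticAt_symm h'.zero_mem_target).restrictScalars
  have hGa : AnalyticAt ℝ G 0 := by
    refine AnalyticAt.fun_comp_of_eq hρ.1
      (AnalyticAt.fun_comp_of_eq hsa (realPoint.analyticAt 0) (map_zero _)) ?_
    simp [h'.symm_zero]
  have hsd : HasFDerivAt Φ'.symm ((fderiv ℂ Φ'.symm 0).restrictScalars ℝ) 0 :=
    (h'.analyticAt_symm h'.zero_mem_target).differentiableAt.hasFDerivAt.restrictScalars ℝ
  have hGd : HasFDerivAt G ((fderiv ℝ ρ q) ∘L ((fderiv ℂ Φ'.symm 0).restrictScalars ℝ) ∘L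
      realPoint) 0 := by
    have e1 : HasFDerivAt Φ'.symm ((fderiv ℂ Φ'.symm 0).restrictScalars ℝ) (realPoint 0) := by
      rw [map_zero]; exact hsd
    have e2 := e1.comp 0 realPoint.hasFDerivAt
    have e3 : HasFDerivAt ρ (fderiv ℝ ρ q) ((Φ'.symm ∘ realPoint) 0) := by
      simp only [Function.comp, map_zero, h'.symm_zero]
      exact hρ.1.differentiableAt.hasFDerivAt
    exact e3.comp 0 e2
  have hGv : ∀ Y : (ℂ × ℝ) × ℝ, ((fderiv ℝ ρ q) ∘L ((fderiv ℂ Φ'.symm 0).restrictScalars ℝ) ∘L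
      realPoint) Y = Y.2 / r := by
    intro Y
    have e1 := hD (fderiv ℂ Φ'.symm 0 (realPoint Y))
    rw [h'.fderiv_apply_symm] at e1
    have e2 : (fderiv ℝ ρ q) ((fderiv ℂ Φ'.symm 0) (realPoint Y)) =
        ((fderiv ℂ Φ q) ((fderiv ℂ Φ'.symm 0) (realPoint Y))).2.im := hρ' _
    change (fderiv ℝ ρ q) ((fderiv ℂ Φ'.symm 0) (realPoint Y)) = _
    rw [e2, eq_div_iff hr, mul_comm]
    have e3 := congrArg Complex.im e1
    obtain ⟨⟨z, u⟩, v⟩ := Y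
    rw [realPoint_apply] at e3 ⊢
    simpa using e3.symm
  have hd : HasDerivAt (fun t => G (0, t)) (1 / r) 0 := by
    have e1 : HasDerivAt (fun t : ℝ => ((0 : ℂ × ℝ), t)) ((0 : ℂ × ℝ), (1 : ℝ)) 0 :=
      (hasDerivAt_const _ _).prodMk (hasDerivAt_id _)
    have e2 := HasFDerivAt.comp_hasDerivAt (0 : ℝ) (f := fun t : ℝ => ((0 : ℂ × ℝ), t)) hGd e1
    rwa [hGv] at e2
  have hG0 : G (0, 0) = 0 := by
    change ρ (Φ'.symm (realPoint 0)) = 0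
    rw [map_zero, h'.symm_zero]
    exact hρ.apply_eq_zero hq
  obtain ⟨F', hFa, hF0, hFe⟩ := exists_analyticAt_implicit (x := (0 : ℂ × ℝ)) (y := (0 : ℝ))
    hGa hG0 hd (one_div_ne_zero hr)
  refine ⟨F', ⟨hFa, ?_⟩, hF0, ?_⟩
  · have t1 : Tendsto (fun x => (((Φ' x).1, (Φ' x).2.re), (Φ' x).2.im)) (𝓝 q)
        (𝓝 ((0 : ℂ × ℝ), (0 : ℝ))) := by
      have : ContinuousAt (fun y : ℂ × ℂ => ((y.1, y.2.re), y.2.im)) 0 := by fun_prop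
      exact this.tendsto.comp h'.tendsto
    filter_upwards [t1.eventually hFe, hρ.2.2, h'.eventually_apply_symm] with x e1 e2 e3
    rw [e2, ← e1, hG]
    simp only [realPoint_eq, e3]
  · have hF' := hFa.differentiableAt.hasFDerivAt
    have e1 : HasFDerivAt (fun y : ℂ × ℝ => (y, F' y))
        ((ContinuousLinearMap.id ℝ _).prod (fderiv ℝ F' 0)) 0 := (hasFDerivAt_id _).prodMk hF'
    have hG2 := hGd
    rw [show (0 : (ℂ × ℝ) × ℝ) = (fun y : ℂ × ℝ => (y, F' y)) 0 by simp only [hF0]; rfl] at hG2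
    have e2 := hG2.comp (0 : ℂ × ℝ) e1
    have e3 : ∀ᶠ y in 𝓝 (0 : ℂ × ℝ), (G ∘ fun y : ℂ × ℝ => (y, F' y)) y = 0 := by
      have t : Tendsto (fun y : ℂ × ℝ => (y, F' y)) (𝓝 0) (𝓝 ((0 : ℂ × ℝ), (0 : ℝ))) := by
        have := e1.continuousAt.tendsto
        simpa only [hF0] using this
      filter_upwards [t.eventually hFe] with y hy using hy.2 rfl
    have e4 := ((hasFDerivAt_const (0 : ℝ) (0 : ℂ × ℝ)).congr_of_eventuallyEq e3).unique e2
    have e5 : fderiv ℝ F' 0 = 0 := by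
      refine ContinuousLinearMap.ext fun y => ?_
      have e6 := congrArg (fun L : ℂ × ℝ →L[ℝ] ℝ => L y) e4
      have e7 := hGv (y, fderiv ℝ F' 0 y)
      have e8 : fderiv ℝ F' 0 y / r = 0 := by
        rw [← e7]
        exact e6.symm
      simpa [hr] using e8
    rw [← e5]
    exact hF'

/-- The weighted size of `(z, u)`, where `z` has weight 1 and `u` has weight 2. -/
noncomputable def weightSize (x : ℂ × ℝ) : ℝ := ‖x.1‖ + √|x.2|

theorem weightSize_nonneg (x : ℂ × ℝ) : 0 ≤ weightSize x := by
  unfold weightSize; positivity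

theorem abs_snd_le_weightSize (x : ℂ × ℝ) : |x.2| ≤ weightSize x ^ 2 := by
  unfold weightSize
  nlinarith [Real.sq_sqrt (abs_nonneg x.2), norm_nonneg x.1, Real.sqrt_nonneg |x.2|]

theorem norm_fst_le_weightSize (x : ℂ × ℝ) : ‖x.1‖ ≤ weightSize x := by
  unfold weightSize
  linarith [Real.sqrt_nonneg |x.2|]

theorem weightSize_pow_six_le (x : ℂ × ℝ) : weightSize x ^ 6 ≤ 64 * (‖x.1‖ ^ 6 + |x.2| ^ 3) := by
  have h1 : (√|x.2|) ^ 6 = |x.2| ^ 3 := by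
    rw [show (6 : ℕ) = 2 * 3 from rfl, pow_mul, Real.sq_sqrt (abs_nonneg _)]
  have := add_pow_le (norm_nonneg x.1) (Real.sqrt_nonneg |x.2|) 6
  rw [h1] at this
  unfold weightSize
  refine this.trans ?_
  have : 0 ≤ ‖x.1‖ ^ 6 + |x.2| ^ 3 := by positivity
  norm_num
  linarith

theorem le_two_mul_weightSize_pow_six (x : ℂ × ℝ) :
    ‖x.1‖ ^ 6 + |x.2| ^ 3 ≤ 2 * weightSize x ^ 6 := by
  have h1 : ‖x.1‖ ^ 6 ≤ weightSize x ^ 6 := by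
    gcongr; exact norm_fst_le_weightSize x
  have h2 : |x.2| ^ 3 ≤ (weightSize x ^ 2) ^ 3 := by
    gcongr; exact abs_snd_le_weightSize x
  rw [← pow_mul, show 2 * 3 = 6 from rfl] at h2
  linarith

theorem tendsto_weightSize : Tendsto weightSize (𝓝 0) (𝓝 0) := by
  have : Continuous weightSize := by unfold weightSize; fun_prop
  simpa [weightSize] using this.tendsto 0

theorem isBigO_weightSize_pow_six_iff {f : ℂ × ℝ → ℝ} :
    (f =O[𝓝 0] fun x => ‖x.1‖ ^ 6 + |x.2| ^ 3) ↔ f =O[𝓝 0] fun x => weightSize x ^ 6 := by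
  constructor
  · refine fun h => h.trans (IsBigO.of_bound 2 (Eventually.of_forall fun x => ?_))
    rw [Real.norm_of_nonneg (by positivity),
      Real.norm_of_nonneg (pow_nonneg (weightSize_nonneg x) _)]
    exact le_two_mul_weightSize_pow_six x
  · refine fun h => h.trans (IsBigO.of_bound 64 (Eventually.of_forall fun x => ?_))
    rw [Real.norm_of_nonneg (pow_nonneg (weightSize_nonneg x) _),
      Real.norm_of_nonneg (by positivity : 0 ≤ ‖x.1‖ ^ 6 + |x.2| ^ 3)]
    exact weightSize_pow_six_le x

theorem isBigO_fst_weightSize : (fun x : ℂ × ℝ => x.1) =O[𝓝 0] weightSize :=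
  IsBigO.of_bound 1 (Eventually.of_forall fun x => by
    rw [one_mul, Real.norm_of_nonneg (weightSize_nonneg x)]
    exact norm_fst_le_weightSize x)

theorem isBigO_snd_weightSize : (fun x : ℂ × ℝ => x.2) =O[𝓝 0] fun x => weightSize x ^ 2 :=
  IsBigO.of_bound 1 (Eventually.of_forall fun x => by
    rw [one_mul, Real.norm_of_nonneg (pow_nonneg (weightSize_nonneg x) _)]
    exact abs_snd_le_weightSize x)

theorem isBigO_weightSize_pow {m n : ℕ} (h : m ≤ n) :
    (fun x => weightSize x ^ n) =O[𝓝 0] fun x => weightSize x ^ m := by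
  obtain ⟨k, rfl⟩ := Nat.exists_eq_add_of_le h
  have : (fun x => weightSize x ^ k) =O[𝓝 0] fun _ => (1 : ℝ) :=
    (tendsto_weightSize.pow k).isBigO_one ℝ
  simpa [pow_add] using (isBigO_refl (fun x => weightSize x ^ m) _).mul this

theorem isBigO_norm_weightSize : (fun x : ℂ × ℝ => x) =O[𝓝 0] weightSize := by
  have h2 : (fun x : ℂ × ℝ => x.2) =O[𝓝 0] weightSize := by
    refine isBigO_snd_weightSize.trans ?_
    simpa using isBigO_weightSize_pow (m := 1) (n := 2) (by norm_num)
  exact isBigO_fst_weightSize.prod_left h2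

/-- The graph point over `(z, u)`. -/
noncomputable def graphPoint (F : ℂ × ℝ → ℝ) (x : ℂ × ℝ) : ℂ × ℂ := realPoint (x, F x)

theorem graphPoint_apply (F : ℂ × ℝ → ℝ) (x : ℂ × ℝ) :
    graphPoint F x = (x.1, (x.2 : ℂ) + Complex.I * F x) := realPoint_apply _ _ _

theorem graphPoint_snd_re (F : ℂ × ℝ → ℝ) (x : ℂ × ℝ) : (graphPoint F x).2.re = x.2 := by
  simp [graphPoint_apply]

theorem graphPoint_snd_im (F : ℂ × ℝ → ℝ) (x : ℂ × ℝ) : (graphPoint F x).2.im = F x := by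
  simp [graphPoint_apply]

theorem tendsto_graphPoint (hFa : AnalyticAt ℝ F 0) (h0 : F 0 = 0) :
    Tendsto (graphPoint F) (𝓝 0) (𝓝 0) := by
  have h1 : ContinuousAt (fun x : ℂ × ℝ => (x, F x)) 0 :=
    continuousAt_id.prodMk hFa.continuousAt
  have h2 : ContinuousAt (graphPoint F) 0 := realPoint.continuous.continuousAt.comp h1
  have h3 : graphPoint F 0 = 0 := by simp [graphPoint_apply, h0]
  simpa [ContinuousAt, h3] using h2

theorem analyticAt_graphPoint (hFa : AnalyticAt ℝ F 0) : AnalyticAt ℝ (graphPoint F) 0 := by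
  have h1 : AnalyticAt ℝ (fun x : ℂ × ℝ => (x, F x)) 0 := by fun_prop
  exact AnalyticAt.comp (realPoint.analyticAt _) h1

/-- The graph points lie on `M`. -/
theorem IsGraphedBy.eventually_mem (h : IsHolomorphicChartAt Φ q) (hF : IsGraphedBy M q Φ F)
    (h0 : F 0 = 0) : ∀ᶠ x in 𝓝 (0 : ℂ × ℝ), Φ.symm (graphPoint F x) ∈ M ∧
      Φ (Φ.symm (graphPoint F x)) = graphPoint F x := by
  have t := tendsto_graphPoint hF.1 h0
  filter_upwards [(h.tendsto_symm.comp t).eventually hF.2, t.eventually h.eventually_symm_apply]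
    with x h1 h2
  refine ⟨h1.2 ?_, h2⟩
  simp only [Function.comp]
  rw [h2, graphPoint_snd_im, graphPoint_snd_re, graphPoint_apply]

theorem isBigO_graph (hFa : AnalyticAt ℝ F 0) (h0 : F 0 = 0)
    (hdF : HasFDerivAt F (0 : ℂ × ℝ →L[ℝ] ℝ) 0) : F =O[𝓝 0] fun x => weightSize x ^ 2 := by
  have h1 := isBigO_sq_of_hasFDerivAt hFa h0 hdF
  simp only [zero_apply, sub_zero] at h1
  exact h1.trans (isBigO_norm_weightSize.norm_left.pow 2)

theorem isBigO_graphPoint (hFa : AnalyticAt ℝ F 0) (h0 : F 0 = 0)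
    (hdF : HasFDerivAt F (0 : ℂ × ℝ →L[ℝ] ℝ) 0) :
    (fun x => (graphPoint F x).2) =O[𝓝 0] (fun x => weightSize x ^ 2) ∧
      graphPoint F =O[𝓝 0] weightSize := by
  have h2 : (fun x => (graphPoint F x).2) =O[𝓝 0] (fun x => weightSize x ^ 2) := by
    simp only [graphPoint_apply]
    refine IsBigO.add ?_ ?_
    · exact (isBigO_norm_left.1 (by simpa using isBigO_snd_weightSize.norm_left))
    · have := (isBigO_graph hFa h0 hdF)
      refine IsBigO.of_norm_left ?_
      simpa using this.norm_left
  refine ⟨h2, ?_⟩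
  have h3 : (fun x => (graphPoint F x).1) =O[𝓝 0] weightSize := by
    simp only [graphPoint_apply]
    exact isBigO_fst_weightSize
  have h4 := h2.trans (isBigO_weightSize_pow (m := 1) (n := 2) (by norm_num))
  simp only [pow_one] at h4
  exact h3.prod_left h4

/-- A biholomorphism preserving the complex tangent line preserves weighted sizes. -/
theorem isBigO_comp_graphPoint {K : ℂ × ℂ → ℂ × ℂ} {L : ℂ × ℂ →L[ℂ] ℂ × ℂ} {b : ℂ}
    (hKa : AnalyticAt ℂ K 0) (hK0 : K 0 = 0) (hKd : HasFDerivAt K L 0)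
    (hb : ∀ X, (L X).2 = b * X.2) (hFa : AnalyticAt ℝ F 0) (h0 : F 0 = 0)
    (hdF : HasFDerivAt F (0 : ℂ × ℝ →L[ℝ] ℝ) 0) :
    (fun x => ‖(K (graphPoint F x)).1‖ ^ 6 + |(K (graphPoint F x)).2.re| ^ 3)
      =O[𝓝 0] fun x => weightSize x ^ 6 := by
  have t := tendsto_graphPoint hFa h0
  obtain ⟨g2, g1⟩ := isBigO_graphPoint hFa h0 hdF
  have k1 : (fun x => K (graphPoint F x)) =O[𝓝 0] weightSize := by
    have := hKd.isBigO_sub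
    simp only [hK0, sub_zero] at this
    exact (this.comp_tendsto t).trans g1
  have k2 : (fun x => (K (graphPoint F x)).2) =O[𝓝 0] fun x => weightSize x ^ 2 := by
    have e1 := (isBigO_sq_of_hasFDerivAt hKa hK0 hKd).comp_tendsto t
    have e2 := e1.trans (g1.norm_left.pow 2)
    have e3 : (fun x => (K (graphPoint F x)).2 - b * (graphPoint F x).2) =O[𝓝 0]
        fun x => weightSize x ^ 2 := by
      refine (IsBigO.of_bound 1 (Eventually.of_forall fun x => ?_)).trans e2
      rw [one_mul, ← hb]
      exact norm_snd_le (K (graphPoint F x) - L (graphPoint F x))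
    simpa using e3.add (g2.const_mul_left b)
  have k1' : (fun x => ‖(K (graphPoint F x)).1‖ ^ 6) =O[𝓝 0] fun x => weightSize x ^ 6 := by
    refine IsBigO.pow ?_ 6
    exact (IsBigO.of_bound 1 (Eventually.of_forall fun x => by
      rw [one_mul, norm_norm]; exact norm_fst_le _)).trans k1
  have k2' : (fun x => |(K (graphPoint F x)).2.re| ^ 3) =O[𝓝 0] fun x => weightSize x ^ 6 := by
    have e1 : (fun x => |(K (graphPoint F x)).2.re|) =O[𝓝 0] fun x => weightSize x ^ 2 :=
      (IsBigO.of_bound 1 (Eventually.of_forall fun x => by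
        rw [one_mul, Real.norm_eq_abs, abs_abs]; exact Complex.abs_re_le_norm _)).trans k2
    have e2 := e1.pow 3
    simpa only [← pow_mul] using e2
  exact k1'.add k2'

/-- A weighted estimate of `Im w - |z|²` on `M` in the coordinates `Φ` makes `Φ'` normalizing. -/
theorem isNormalizingAt_of_isBigO (h : IsHolomorphicChartAt Φ q)
    (h' : IsHolomorphicChartAt Φ' q) (hF' : IsGraphedBy M q Φ' F') (h0 : F' 0 = 0)
    (hdF : HasFDerivAt F' (0 : ℂ × ℝ →L[ℝ] ℝ) 0)
    (hr : r ≠ 0) (hD : ∀ X, (fderiv ℂ Φ' q X).2 = r * (fderiv ℂ Φ q X).2) {C : ℝ}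
    (hC : ∀ᶠ x in 𝓝 q, x ∈ M → |(Φ' x).2.im - Complex.normSq (Φ' x).1| ≤
      C * (‖(Φ x).1‖ ^ 6 + |(Φ x).2.re| ^ 3)) : IsNormalizingAt M q Φ' := by
  refine ⟨h', F', hF', ?_⟩
  rw [isBigO_weightSize_pow_six_iff]
  set K : ℂ × ℂ → ℂ × ℂ := fun y => Φ (Φ'.symm y) with hK
  have hKa : AnalyticAt ℂ K 0 := AnalyticAt.fun_comp_of_eq (h.analyticAt h.mem_source)
    (h'.analyticAt_symm h'.zero_mem_target) h'.symm_zero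
  have hK0 : K 0 = 0 := by simp only [hK, h'.symm_zero, h.map_center]
  have hKd : HasFDerivAt K ((fderiv ℂ Φ q) ∘L (fderiv ℂ Φ'.symm 0)) 0 := by
    have e1 := (h.analyticAt h.mem_source).differentiableAt.hasFDerivAt
    rw [← h'.symm_zero] at e1
    have e2 := e1.comp 0 (h'.analyticAt_symm h'.zero_mem_target).differentiableAt.hasFDerivAt
    rwa [h'.symm_zero] at e2
  have hK2 : ∀ Y, (((fderiv ℂ Φ q) ∘L (fderiv ℂ Φ'.symm 0)) Y).2 = (r : ℂ)⁻¹ * Y.2 := by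
    intro Y
    have e1 := hD (fderiv ℂ Φ'.symm 0 Y)
    rw [h'.fderiv_apply_symm] at e1
    rw [← div_eq_inv_mul, eq_div_iff (by exact_mod_cast hr), mul_comm]
    exact e1.symm
  have t := tendsto_graphPoint hF'.1 h0
  refine IsBigO.trans ?_ ((isBigO_comp_graphPoint hKa hK0 hKd hK2 hF'.1 h0 hdF).const_mul_left C)
  refine IsBigO.of_bound 1 ?_
  filter_upwards [(h'.tendsto_symm.comp t).eventually hC, hF'.eventually_mem h' h0] with x e1 e2
  have e3 := e1 e2.1
  simp only [Function.comp] at e3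
  rw [e2.2, graphPoint_snd_im, graphPoint_apply] at e3
  rw [one_mul, Real.norm_eq_abs]
  refine e3.trans ?_
  rw [← graphPoint_apply]
  exact le_abs_self _

end transitions
section jets

/-- Second-order expansion of `φ` at `t`, where `φ t = 0`. -/
def HasTwoJet (φ : ℝ → ℂ) (t : ℝ) (a b : ℂ) : Prop :=
  (fun s => φ s - (a * ((s - t : ℝ) : ℂ) + b * ((s - t : ℝ) : ℂ) ^ 2)) =o[𝓝 t]
    fun s => (s - t) ^ 2

theorem eq_zero_of_isBigO_pow {n : ℕ} {γ : ℕ → ℝ}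
    (h : (fun δ : ℝ => ∑ k ∈ Finset.range n, γ k * δ ^ k) =O[𝓝[>] 0] fun δ => δ ^ n) :
    ∀ k < n, γ k = 0 := by
  induction n generalizing γ with
  | zero => intro k hk; omega
  | succ n ih =>
    have t0 : Tendsto (fun δ : ℝ => δ) (𝓝[>] 0) (𝓝 0) := tendsto_nhdsWithin_of_tendsto_nhds tendsto_id
    have h0 : γ 0 = 0 := by
      have h1 : Tendsto (fun δ : ℝ => ∑ k ∈ Finset.range (n + 1), γ k * δ ^ k) (𝓝[>] 0) (𝓝 (γ 0)) := by
        have : Continuous (fun δ : ℝ => ∑ k ∈ Finset.range (n + 1), γ k * δ ^ k) := by fun_prop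
        have h2 := (this.tendsto 0).comp t0
        have h3 : ∑ k ∈ Finset.range (n + 1), γ k * (0 : ℝ) ^ k = γ 0 := by
          rw [Finset.sum_range_succ']
          simp
        rwa [h3] at h2
      have h4 : Tendsto (fun δ : ℝ => ∑ k ∈ Finset.range (n + 1), γ k * δ ^ k) (𝓝[>] 0) (𝓝 0) := by
        refine h.trans_tendsto ?_
        simpa using t0.pow (n + 1)
      exact tendsto_nhds_unique h1 h4
    have h5 : (fun δ : ℝ => ∑ k ∈ Finset.range n, γ (k + 1) * δ ^ k) =O[𝓝[>] 0] fun δ => δ ^ n := by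
      have h6 := (isBigO_refl (fun δ : ℝ => δ⁻¹) (𝓝[>] 0)).mul h
      refine (h6.congr' ?_ ?_)
      · filter_upwards [self_mem_nhdsWithin] with δ hδ
        have : δ ≠ 0 := ne_of_gt hδ
        rw [Finset.sum_range_succ', h0, zero_mul, add_zero, Finset.mul_sum]
        refine Finset.sum_congr rfl fun k _ => ?_
        field_simp
        try ring
      · filter_upwards [self_mem_nhdsWithin] with δ hδ
        have : δ ≠ 0 := ne_of_gt hδ
        field_simp
        try ring
    intro k hk
    rcases k with _ | k
    · exact h0
    · exact ih h5 k (by omega)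

theorem HasTwoJet.unique {φ : ℝ → ℂ} {t : ℝ} {a b a' b' : ℂ} (h : HasTwoJet φ t a b)
    (h' : HasTwoJet φ t a' b') : a = a' ∧ b = b' := by
  have h1 : (fun s => (a - a') * ((s - t : ℝ) : ℂ) + (b - b') * ((s - t : ℝ) : ℂ) ^ 2) =o[𝓝 t]
      fun s => (s - t) ^ 2 := by
    refine (h'.sub h).congr_left fun s => ?_
    ring
  have t1 : Tendsto (fun δ : ℝ => t + δ) (𝓝[≠] 0) (𝓝 t) := by
    have : ContinuousAt (fun δ : ℝ => t + δ) 0 := by fun_prop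
    have h2 := this.tendsto
    simp only [add_zero] at h2
    exact h2.mono_left nhdsWithin_le_nhds
  have h2 : (fun δ : ℝ => (a - a') * (δ : ℂ) + (b - b') * (δ : ℂ) ^ 2) =o[𝓝[≠] 0]
      fun δ => δ ^ 2 := by
    have := h1.comp_tendsto t1
    simpa [Function.comp_def] using this
  have tδ : Tendsto (fun δ : ℝ => (δ : ℂ)) (𝓝[≠] 0) (𝓝 0) := by
    have := (Complex.continuous_ofReal.tendsto 0).mono_left (nhdsWithin_le_nhds (s := {(0 : ℝ)}ᶜ))
    simpa using this
  have ha : a - a' = 0 := by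
    have h3 : Tendsto (fun δ : ℝ => (a - a') + (b - b') * (δ : ℂ)) (𝓝[≠] 0) (𝓝 (a - a')) := by
      simpa using (tδ.const_mul (b - b')).const_add (a - a')
    have h4 : (fun δ : ℝ => (a - a') * (δ : ℂ) + (b - b') * (δ : ℂ) ^ 2) =o[𝓝[≠] 0]
        fun δ : ℝ => δ := by
      refine h2.trans_isBigO ?_
      have : (fun δ : ℝ => δ) =O[𝓝[≠] 0] fun _ => (1 : ℝ) :=
        (tendsto_nhdsWithin_of_tendsto_nhds tendsto_id : Tendsto (fun δ : ℝ => δ) (𝓝[≠] 0) (𝓝 0)).isBigO_one ℝ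
      simpa [sq] using (isBigO_refl (fun δ : ℝ => δ) (𝓝[≠] 0)).mul this
    have h5 := h4.tendsto_inv_smul_nhds_zero
    refine tendsto_nhds_unique h3 (h5.congr' ?_)
    filter_upwards [self_mem_nhdsWithin] with δ hδ
    have : (δ : ℂ) ≠ 0 := by exact_mod_cast hδ
    rw [Complex.real_smul, Complex.ofReal_inv]
    field_simp
  refine ⟨sub_eq_zero.1 ha, sub_eq_zero.1 ?_⟩
  have h5 := h2.tendsto_inv_smul_nhds_zero
  have h6 : Tendsto (fun _ : ℝ => b - b') (𝓝[≠] 0) (𝓝 (b - b')) := tendsto_const_nhds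
  refine tendsto_nhds_unique h6 (h5.congr' ?_)
  filter_upwards [self_mem_nhdsWithin] with δ hδ
  have : (δ : ℂ) ≠ 0 := by exact_mod_cast hδ
  rw [Complex.real_smul, Complex.ofReal_inv, Complex.ofReal_pow, ha]
  field_simp
  try ring

theorem contDiffAt_deriv {E : Type*} [NormedAddCommGroup E] [NormedSpace ℝ E] {φ : ℝ → E} {t : ℝ}
    (h : ContDiffAt ℝ 2 φ t) : ContDiffAt ℝ 1 (deriv φ) t := by
  have : deriv φ = fun s => fderiv ℝ φ s 1 := funext fun s => fderiv_apply_one_eq_deriv.symm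
  rw [this]
  exact (h.fderiv_right (m := 1) (by norm_num)).clm_apply contDiffAt_const

theorem hasTwoJet_of_contDiffAt {φ : ℝ → ℂ} {t : ℝ} (h : ContDiffAt ℝ 2 φ t) (h0 : φ t = 0) :
    HasTwoJet φ t (deriv φ t) (deriv (deriv φ) t / 2) := by
  set a := deriv φ t with ha
  set b := deriv (deriv φ) t with hb
  have hd : ContDiffAt ℝ 1 (deriv φ) t := contDiffAt_deriv h
  have hd1 : HasDerivAt (deriv φ) b t := (hd.differentiableAt (by norm_num)).hasDerivAt
  have hev : ∀ᶠ s in 𝓝 t, HasDerivAt φ (deriv φ s) s := by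
    filter_upwards [h.eventually (by norm_num)] with s hs
    exact (hs.differentiableAt (by norm_num)).hasDerivAt
  set g : ℝ → ℂ := fun s => φ s - (a * ((s - t : ℝ) : ℂ) + b / 2 * ((s - t : ℝ) : ℂ) ^ 2) with hg
  have hgd : ∀ᶠ s in 𝓝 t, HasDerivAt g (deriv φ s - deriv φ t - (s - t) • b) s := by
    filter_upwards [hev] with s hs
    have e1 : HasDerivAt (fun s : ℝ => ((s - t : ℝ) : ℂ)) 1 s := by
      have := ((hasDerivAt_id s).sub_const t).ofReal_comp
      simpa using this
    have e2 := hs.sub ((e1.const_mul a).add ((e1.pow 2).const_mul (b / 2)))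
    refine e2.congr_deriv ?_
    rw [Complex.real_smul]
    push_cast
    ring
  have hlo := hd1.isLittleO
  rw [HasTwoJet, isLittleO_iff]
  intro ε hε
  obtain ⟨r, hr, hball⟩ := Metric.eventually_nhds_iff_ball.1 (hgd.and (isLittleO_iff.1 hlo hε))
  filter_upwards [Metric.ball_mem_nhds t hr] with s hs
  have hb' : ∀ y ∈ Metric.closedBall t |s - t|, y ∈ Metric.ball t r := fun y hy => by
    rw [Metric.mem_ball, Real.dist_eq] at hs
    rw [Metric.mem_closedBall] at hy
    exact Metric.mem_ball.2 (hy.trans_lt hs)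
  have hm := (convex_closedBall t |s - t|).norm_image_sub_le_of_norm_hasDerivWithin_le
    (f := g) (f' := fun y => deriv φ y - deriv φ t - (y - t) • b) (C := ε * |s - t|) (x := t) (y := s)
    (fun y hy => ((hball y (hb' y hy)).1).hasDerivWithinAt) (fun y hy => ?_) (by simp)
    (by simp [Real.dist_eq])
  · have : g t = 0 := by simp [hg, h0]
    rw [this, sub_zero] at hm
    refine hm.trans (le_of_eq ?_)
    rw [Real.norm_eq_abs, Real.norm_eq_abs, abs_pow]
    ring
  · refine ((hball y (hb' y hy)).2).trans ?_
    rw [Metric.mem_closedBall, Real.dist_eq] at hy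
    rw [Real.norm_eq_abs]
    gcongr

theorem deriv_clm_comp {E E' : Type*} [NormedAddCommGroup E] [NormedSpace ℝ E]
    [NormedAddCommGroup E'] [NormedSpace ℝ E'] (A : E →L[ℝ] E') {φ : ℝ → E} {t : ℝ}
    (h : ContDiffAt ℝ 2 φ t) : deriv (fun s => A (φ s)) t = A (deriv φ t) ∧
      deriv (deriv (fun s => A (φ s))) t = A (deriv (deriv φ) t) := by
  have hev : ∀ᶠ s in 𝓝 t, deriv (fun s => A (φ s)) s = A (deriv φ s) := by
    filter_upwards [h.eventually (by norm_num)] with s hs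
    exact (A.hasFDerivAt.comp_hasDerivAt s
      (hs.differentiableAt (by norm_num)).hasDerivAt).deriv
  refine ⟨hev.self_of_nhds, ?_⟩
  rw [Filter.EventuallyEq.deriv_eq hev]
  exact (A.hasFDerivAt.comp_hasDerivAt t
    ((contDiffAt_deriv h).differentiableAt (by norm_num)).hasDerivAt).deriv

theorem exists_taylor {φ : ℂ → ℂ} (h : AnalyticAt ℂ φ 0) :
    ∃ a : ℕ → ℂ, ∀ n, (fun z => φ z - ∑ i ∈ Finset.range n, a i * z ^ i) =O[𝓝 0] fun z => ‖z‖ ^ n := by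
  obtain ⟨p, hp⟩ := h
  refine ⟨fun i => p.coeff i, fun n => ?_⟩
  refine (hp.isBigO_sub_partialSum_pow n).congr_left fun z => ?_
  rw [zero_add, FormalMultilinearSeries.partialSum]
  congr 1
  refine Finset.sum_congr rfl fun i _ => ?_
  rw [FormalMultilinearSeries.apply_eq_pow_smul_coeff, smul_eq_mul, mul_comm]

theorem exists_eq_add_snd_mul {f : ℂ × ℂ → ℂ} (h : AnalyticAt ℂ f 0) :
    ∃ g : ℂ × ℂ → ℂ, AnalyticAt ℂ g 0 ∧ ∀ᶠ x in 𝓝 (0 : ℂ × ℂ), f x = f (x.1, 0) + x.2 * g x := by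
  have h1 : AnalyticAt ℂ (fun x : ℂ × ℂ => f (x.1, 0)) 0 :=
    AnalyticAt.fun_comp_of_eq h (by fun_prop) rfl
  obtain ⟨g, hg, he⟩ := exists_eq_mul_of_eq_zero (f := fun x => f x - f (x.1, 0)) (h.sub h1)
    (ContinuousLinearMap.snd ℂ ℂ ℂ) (e := (0, 1)) rfl rfl
    (Eventually.of_forall fun x hx => by
      obtain ⟨z, w⟩ := x
      have : w = 0 := hx
      simp [this])
  refine ⟨g, hg, he.mono fun x hx => ?_⟩
  rw [sub_eq_iff_eq_add] at hx
  rw [hx, add_comm]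
  rfl

/-- Taylor expansion up to weight 5, where `z` has weight 1 and `w` has weight 2. -/
theorem exists_weighted_taylor {f : ℂ × ℂ → ℂ} (h : AnalyticAt ℂ f 0) :
    ∃ a b c : ℕ → ℂ, (fun x : ℂ × ℂ => f x - (∑ i ∈ Finset.range 6, a i * x.1 ^ i
      + x.2 * ∑ i ∈ Finset.range 4, b i * x.1 ^ i + x.2 ^ 2 * ∑ i ∈ Finset.range 2, c i * x.1 ^ i))
        =O[𝓝 0] fun x => ‖x.1‖ ^ 6 + ‖x.2‖ ^ 3 := by
  obtain ⟨g, hg, eg⟩ := exists_eq_add_snd_mul h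
  obtain ⟨k, hk, ek⟩ := exists_eq_add_snd_mul hg
  obtain ⟨m, hm, em⟩ := exists_eq_add_snd_mul hk
  have hax : ∀ {f : ℂ × ℂ → ℂ}, AnalyticAt ℂ f 0 → AnalyticAt ℂ (fun z : ℂ => f (z, 0)) 0 :=
    fun hf => AnalyticAt.fun_comp_of_eq hf (by fun_prop) rfl
  obtain ⟨a, ha⟩ := exists_taylor (hax h)
  obtain ⟨b, hb⟩ := exists_taylor (hax hg)
  obtain ⟨c, hc⟩ := exists_taylor (hax hk)
  refine ⟨a, b, c, ?_⟩
  have tf : Tendsto (fun x : ℂ × ℂ => x.1) (𝓝 0) (𝓝 0) := continuous_fst.tendsto 0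
  have bd : ∀ {u : ℂ × ℂ → ℝ}, (∀ x, 0 ≤ u x) → (∀ x, u x ≤ ‖x.1‖ ^ 6 + ‖x.2‖ ^ 3) →
      u =O[𝓝 (0 : ℂ × ℂ)] fun x => ‖x.1‖ ^ 6 + ‖x.2‖ ^ 3 := fun h0 hu =>
    IsBigO.of_bound 1 (Eventually.of_forall fun x => by
      rw [one_mul, Real.norm_of_nonneg (h0 x), Real.norm_of_nonneg (by positivity)]
      exact hu x)
  have r1 := ((ha 6).comp_tendsto tf).trans (bd (u := fun x => ‖x.1‖ ^ 6) (fun x => by positivity)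
    (fun x => by simp))
  have r2 := ((isBigO_refl (fun x : ℂ × ℂ => x.2) (𝓝 0)).norm_right.mul
    ((hb 4).comp_tendsto tf)).trans
    (bd (u := fun x => ‖x.2‖ * ‖x.1‖ ^ 4) (fun x => by positivity) (fun x => by
      have h1 := norm_nonneg x.1
      have h2 := norm_nonneg x.2
      have : ‖x.2‖ * (‖x.1‖ ^ 2) ^ 2 ≤ (‖x.1‖ ^ 2) ^ 3 + ‖x.2‖ ^ 3 := by
        rcases le_total ‖x.2‖ (‖x.1‖ ^ 2) with hle | hle
        · have : ‖x.2‖ * (‖x.1‖ ^ 2) ^ 2 ≤ ‖x.1‖ ^ 2 * (‖x.1‖ ^ 2) ^ 2 := by gcongr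
          have : 0 ≤ ‖x.2‖ ^ 3 := by positivity
          nlinarith
        · have : ‖x.2‖ * (‖x.1‖ ^ 2) ^ 2 ≤ ‖x.2‖ * ‖x.2‖ ^ 2 := by gcongr
          have : 0 ≤ (‖x.1‖ ^ 2) ^ 3 := by positivity
          nlinarith
      calc _ = ‖x.2‖ * (‖x.1‖ ^ 2) ^ 2 := by ring
        _ ≤ _ := this
        _ = _ := by ring))
  have r3 := (((isBigO_refl (fun x : ℂ × ℂ => x.2) (𝓝 0)).norm_right.pow 2).mul
    ((hc 2).comp_tendsto tf)).trans
    (bd (u := fun x => ‖x.2‖ ^ 2 * ‖x.1‖ ^ 2) (fun x => by positivity) (fun x => by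
      have h1 := norm_nonneg x.1
      have h2 := norm_nonneg x.2
      have : ‖x.2‖ ^ 2 * (‖x.1‖ ^ 2) ≤ (‖x.1‖ ^ 2) ^ 3 + ‖x.2‖ ^ 3 := by
        rcases le_total ‖x.2‖ (‖x.1‖ ^ 2) with hle | hle
        · have : ‖x.2‖ ^ 2 * (‖x.1‖ ^ 2) ≤ (‖x.1‖ ^ 2) ^ 2 * (‖x.1‖ ^ 2) := by gcongr
          have : 0 ≤ ‖x.2‖ ^ 3 := by positivity
          nlinarith
        · have : ‖x.2‖ ^ 2 * (‖x.1‖ ^ 2) ≤ ‖x.2‖ ^ 2 * ‖x.2‖ := by gcongr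
          have : 0 ≤ (‖x.1‖ ^ 2) ^ 3 := by positivity
          nlinarith
      calc _ = ‖x.2‖ ^ 2 * (‖x.1‖ ^ 2) := by ring
        _ ≤ _ := this
        _ = _ := by ring))
  have r4 := (((isBigO_refl (fun x : ℂ × ℂ => x.2) (𝓝 0)).norm_right.pow 3).mul
    (hm.continuousAt.tendsto.isBigO_one ℝ)).trans
    (bd (u := fun x => ‖x.2‖ ^ 3 * 1) (fun x => by positivity)
      (fun x => by simp))
  refine (((r1.add r2).add r3).add r4).congr' ?_ EventuallyEq.rfl
  filter_upwards [eg, ek, em] with x e1 e2 e3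
  rw [e1, e2, e3]
  simp only [Function.comp]
  ring

end jets

section invariance

theorem coeff_eq_of_isBigO {f g : ℝ → ℂ} {f₁ f₂ f₃ f₄ f₅ g₁ g₂ g₃ g₄ g₅ : ℂ}
    (hf : (fun δ : ℝ => f δ - (f₁ * δ + f₂ * δ ^ 2 + f₃ * δ ^ 3 + f₄ * δ ^ 4 + f₅ * δ ^ 5))
      =O[𝓝[>] 0] fun δ => δ ^ 6)
    (hg : (fun δ : ℝ => g δ - (g₁ * δ + g₂ * δ ^ 2 + g₃ * δ ^ 3 + g₄ * δ ^ 4 + g₅ * δ ^ 5))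
      =O[𝓝[>] 0] fun δ => δ ^ 6)
    (h : (fun δ : ℝ => (g δ).im - Complex.normSq (f δ)) =O[𝓝[>] 0] fun δ => δ ^ 6) :
    g₃.im = 2 * (conj f₁ * f₂).re ∧ g₅.im = 2 * (conj f₁ * f₄ + conj f₂ * f₃).re := by
  set P : ℝ → ℂ := fun δ => f₁ * δ + f₂ * δ ^ 2 + f₃ * δ ^ 3 + f₄ * δ ^ 4 + f₅ * δ ^ 5 with hP
  set Q : ℝ → ℂ := fun δ => g₁ * δ + g₂ * δ ^ 2 + g₃ * δ ^ 3 + g₄ * δ ^ 4 + g₅ * δ ^ 5 with hQ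
  have t0 : Tendsto (fun δ : ℝ => δ) (𝓝[>] 0) (𝓝 0) := tendsto_nhdsWithin_of_tendsto_nhds tendsto_id
  have hP1 : P =O[𝓝[>] 0] fun _ => (1 : ℝ) := by
    have : Continuous P := by fun_prop
    exact ((this.tendsto 0).comp t0).isBigO_one ℝ
  have h61 : (fun δ : ℝ => δ ^ 6) =O[𝓝[>] 0] fun _ => (1 : ℝ) := (t0.pow 6).isBigO_one ℝ
  have hf1 : f =O[𝓝[>] 0] fun _ => (1 : ℝ) := by
    refine ((hf.trans h61).add hP1).congr_left fun δ => ?_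
    ring
  have e1 : (fun δ : ℝ => Complex.normSq (f δ) - Complex.normSq (P δ)) =O[𝓝[>] 0] fun δ => δ ^ 6 := by
    have e2 := hf.norm_left.mul (hf1.add hP1).norm_left
    simp only [mul_one] at e2
    refine IsBigO.trans (IsBigO.of_bound 1 (Eventually.of_forall fun δ => ?_)) e2
    have e3 : Complex.normSq (f δ) - Complex.normSq (P δ) = ((f δ - P δ) * conj (f δ + P δ)).re := by
      simp [Complex.normSq_apply]
      ring
    rw [e3, one_mul, Real.norm_eq_abs]
    refine (Complex.abs_re_le_norm _).trans (le_of_eq ?_)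
    rw [norm_mul, norm_mul, norm_norm, norm_norm, RCLike.norm_conj]
  have e4 : (fun δ : ℝ => (g δ).im - (Q δ).im) =O[𝓝[>] 0] fun δ => δ ^ 6 := by
    refine IsBigO.trans (IsBigO.of_bound 1 (Eventually.of_forall fun δ => ?_)) hg
    rw [one_mul, ← Complex.sub_im]
    exact Complex.abs_im_le_norm _
  set γ : ℕ → ℝ := fun k => match k with
    | 1 => g₁.im
    | 2 => g₂.im - Complex.normSq f₁
    | 3 => g₃.im - 2 * (conj f₁ * f₂).re
    | 4 => g₄.im - 2 * (conj f₁ * f₃).re - Complex.normSq f₂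
    | 5 => g₅.im - 2 * (conj f₁ * f₄ + conj f₂ * f₃).re
    | _ => 0 with hγ
  set ρ : ℝ → ℝ := fun δ => 2 * (conj f₁ * f₅ + conj f₂ * f₄).re + Complex.normSq f₃
    + 2 * (conj f₂ * f₅ + conj f₃ * f₄).re * δ + (2 * (conj f₃ * f₅).re + Complex.normSq f₄) * δ ^ 2
    + 2 * (conj f₄ * f₅).re * δ ^ 3 + Complex.normSq f₅ * δ ^ 4 with hρ
  have hρ1 : (fun δ => ρ δ * δ ^ 6) =O[𝓝[>] 0] fun δ => δ ^ 6 := by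
    have : Continuous ρ := by fun_prop
    simpa using (((this.tendsto 0).comp t0).isBigO_one ℝ).mul (isBigO_refl (fun δ : ℝ => δ ^ 6) _)
  have e5 : (fun δ : ℝ => ∑ k ∈ Finset.range 6, γ k * δ ^ k) =O[𝓝[>] 0] fun δ => δ ^ 6 := by
    refine (((h.sub e4).add e1).add hρ1).congr_left fun δ => ?_
    simp only [Finset.sum_range_succ, Finset.sum_range_zero, hγ, hρ, hP, hQ, Complex.normSq_apply,
      ← Complex.ofReal_pow, Complex.add_re, Complex.add_im, Complex.mul_re, Complex.conj_re, Complex.conj_im,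
      Complex.mul_im, Complex.ofReal_re, Complex.ofReal_im]
    ring
  have h3 := eq_zero_of_isBigO_pow e5 3 (by norm_num)
  have h5 := eq_zero_of_isBigO_pow e5 5 (by norm_num)
  simp only [hγ] at h3 h5
  exact ⟨by linarith, by linarith⟩

/-- Two harmonics with frequencies 1, 3, 5: the vanishing of the sum isolates the first one. -/
theorem eq_zero_of_harmonics {C₁ C₃ C₅ : ℂ}
    (h : ∀ z : ℂ, ‖z‖ = 1 → (z * C₁ + z ^ 3 * C₃ + z ^ 5 * C₅).re = 0) : C₁ = 0 := by
  have hs : (√2 / 2 : ℝ) ^ 2 = 1 / 2 := by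
    rw [div_pow, Real.sq_sqrt (by norm_num)]; norm_num
  set s : ℝ := √2 / 2 with hsd
  set ω : ℂ := s + s * Complex.I with hω
  have hω2 : ω ^ 2 = Complex.I := by
    have : ((s : ℂ)) ^ 2 = 1 / 2 := by
      rw [← Complex.ofReal_pow, hs]; push_cast; ring
    rw [hω]
    linear_combination (2 * Complex.I) * this + (s : ℂ) ^ 2 * Complex.I_sq
  have hωn : ‖ω‖ = 1 := by
    have h1 : ‖ω‖ ^ 2 = 1 := by rw [← norm_pow, hω2, Complex.norm_I]
    nlinarith [norm_nonneg ω]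
  have h1 := h 1 (by simp)
  have h2 := h Complex.I (by simp)
  have h3 := h ω hωn
  have h4 := h (Complex.I * ω) (by rw [norm_mul, hωn, Complex.norm_I, one_mul])
  have e3 : ω ^ 3 = ω * Complex.I := by rw [pow_succ, hω2]; ring
  have e5 : ω ^ 5 = -ω := by
    rw [show ω ^ 5 = (ω ^ 2) ^ 2 * ω by ring, hω2, Complex.I_sq]; ring
  have i3 : (Complex.I * ω) ^ 3 = ω := by
    rw [mul_pow, e3, show Complex.I ^ 3 * (ω * Complex.I) = ω * (Complex.I ^ 2) ^ 2 by ring,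
      Complex.I_sq]; ring
  have i5 : (Complex.I * ω) ^ 5 = -(Complex.I * ω) := by
    rw [mul_pow, e5, show Complex.I ^ 5 = (Complex.I ^ 2) ^ 2 * Complex.I by ring,
      Complex.I_sq]; ring
  have j3 : Complex.I ^ 3 = -Complex.I := by rw [pow_succ, Complex.I_sq]; ring
  have j5 : Complex.I ^ 5 = Complex.I := by
    rw [show Complex.I ^ 5 = (Complex.I ^ 2) ^ 2 * Complex.I by ring, Complex.I_sq]; ring
  rw [e3, e5] at h3
  rw [i3, i5] at h4
  rw [j3, j5] at h2
  simp [hω] at h1 h2 h3 h4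
  apply Complex.ext
  · rw [Complex.zero_re]
    linear_combination (1 / 2) * h1 + s / 2 * h3 - s / 2 * h4 - (C₁.re - C₃.re - C₅.re) * hs
  · rw [Complex.zero_im]
    linear_combination - (1 / 2) * h2 - s / 2 * h3 - s / 2 * h4 - (C₁.im + C₃.im - C₅.im) * hs

theorem coeff_eq_of_weighted_taylor {f : ℂ × ℂ → ℂ} {L : ℂ × ℂ →L[ℂ] ℂ} (hL : HasFDerivAt f L 0)
    {a b c : ℕ → ℂ} (h : (fun x : ℂ × ℂ => f x - (∑ i ∈ Finset.range 6, a i * x.1 ^ i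
      + x.2 * ∑ i ∈ Finset.range 4, b i * x.1 ^ i + x.2 ^ 2 * ∑ i ∈ Finset.range 2, c i * x.1 ^ i))
        =O[𝓝 0] fun x => ‖x.1‖ ^ 6 + ‖x.2‖ ^ 3) : a 0 = f 0 ∧ a 1 = L (1, 0) ∧ b 0 = L (0, 1) := by
  set P : ℂ × ℂ → ℂ := fun x => ∑ i ∈ Finset.range 6, a i * x.1 ^ i
      + x.2 * ∑ i ∈ Finset.range 4, b i * x.1 ^ i + x.2 ^ 2 * ∑ i ∈ Finset.range 2, c i * x.1 ^ i
    with hP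
  have h2 : (fun x => f x - P x) =O[𝓝 0] fun x => ‖x - 0‖ ^ 2 := by
    refine h.trans ?_
    simp only [sub_zero]
    have t : Tendsto (fun x : ℂ × ℂ => ‖x‖) (𝓝 0) (𝓝 0) := tendsto_norm_zero
    refine IsBigO.of_bound 2 ?_
    filter_upwards [t.eventually (gt_mem_nhds one_pos)] with x hx
    rw [Real.norm_of_nonneg (by positivity), Real.norm_of_nonneg (by positivity)]
    have h1 : ‖x.1‖ ≤ ‖x‖ := norm_fst_le x
    have h2 : ‖x.2‖ ≤ ‖x‖ := norm_snd_le x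
    have h3 : ‖x.1‖ ^ 6 ≤ ‖x‖ ^ 6 := by gcongr
    have h4 : ‖x.2‖ ^ 3 ≤ ‖x‖ ^ 3 := by gcongr
    have h5 : ‖x‖ ^ 6 ≤ ‖x‖ ^ 2 := pow_le_pow_of_le_one (norm_nonneg _) hx.le (by norm_num)
    have h6 : ‖x‖ ^ 3 ≤ ‖x‖ ^ 2 := pow_le_pow_of_le_one (norm_nonneg _) hx.le (by norm_num)
    linarith
  have h3 := h2.hasFDerivAt (𝕜 := ℂ) (by norm_num)
  have hP' : HasFDerivAt P L 0 := by
    have := hL.sub h3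
    rw [sub_zero] at this
    exact this.congr_of_eventuallyEq (Eventually.of_forall fun x => by simp)
  have hf0 : f 0 = P 0 := by
    have h4 := h2.eq_zero_of_norm_pow (by norm_num)
    exact sub_eq_zero.1 h4
  refine ⟨?_, ?_, ?_⟩
  · rw [hf0]; simp [hP, Finset.sum_range_succ]
  · have e1 : HasDerivAt (fun t : ℂ => (t, (0 : ℂ))) (1, 0) 0 :=
      (hasDerivAt_id _).prodMk (hasDerivAt_const _ _)
    have e2 := HasFDerivAt.comp_hasDerivAt (0 : ℂ) (f := fun t : ℂ => (t, (0 : ℂ))) hP' e1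
    refine HasDerivAt.unique ?_ e2
    have e3 : (P ∘ fun t : ℂ => (t, (0 : ℂ))) = fun t => a 0 + a 1 * t + t ^ 2 * (a 2 + a 3 * t +
        a 4 * t ^ 2 + a 5 * t ^ 3) := by
      funext t
      simp [hP, Finset.sum_range_succ]
      ring
    rw [e3]
    have e4 : DifferentiableAt ℂ (fun t => a 2 + a 3 * t + a 4 * t ^ 2 + a 5 * t ^ 3) 0 := by fun_prop
    have e5 := (((hasDerivAt_id (0 : ℂ)).const_mul (a 1)).const_add (a 0)).add
      (((hasDerivAt_id (0 : ℂ)).pow 2).mul e4.hasDerivAt)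
    refine HasDerivAt.congr_deriv (f := fun t => a 0 + a 1 * t + t ^ 2 * (a 2 + a 3 * t +
        a 4 * t ^ 2 + a 5 * t ^ 3)) e5 ?_
    simp
  · have e1 : HasDerivAt (fun t : ℂ => ((0 : ℂ), t)) (0, 1) 0 :=
      (hasDerivAt_const _ _).prodMk (hasDerivAt_id _)
    have e2 := HasFDerivAt.comp_hasDerivAt (0 : ℂ) (f := fun t : ℂ => ((0 : ℂ), t)) hP' e1
    refine HasDerivAt.unique ?_ e2
    have e3 : (P ∘ fun t : ℂ => ((0 : ℂ), t)) = fun t => a 0 + b 0 * t + t ^ 2 * c 0 := by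
      funext t
      simp [hP, Finset.sum_range_succ]
      ring
    rw [e3]
    have e5 := (((hasDerivAt_id (0 : ℂ)).const_mul (b 0)).const_add (a 0)).add
      (((hasDerivAt_id (0 : ℂ)).pow 2).mul_const (c 0))
    refine HasDerivAt.congr_deriv (f := fun t => a 0 + b 0 * t + t ^ 2 * c 0) e5 ?_
    simp

/-- A local biholomorphism between two normalized graphs which fixes the direction of the `u`-axis
has no pure `w²` term in its first component. -/
theorem second_order_rigidity {f g : ℂ × ℂ → ℂ} {F : ℂ × ℝ → ℝ} (hf : AnalyticAt ℂ f 0)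
    (hg : AnalyticAt ℂ g 0) (hf0 : f 0 = 0) (hg0 : g 0 = 0) {L : ℂ × ℂ →L[ℂ] ℂ}
    (hL : HasFDerivAt f L 0) (h1 : L (1, 0) ≠ 0) (h2 : L (0, 1) = 0)
    (hF : (fun x : ℂ × ℝ => F x - Complex.normSq x.1) =O[𝓝 0] fun x => ‖x.1‖ ^ 6 + |x.2| ^ 3)
    (h : (fun x => (g (graphPoint F x)).im - Complex.normSq (f (graphPoint F x)))
      =O[𝓝 0] fun x => ‖x.1‖ ^ 6 + |x.2| ^ 3) :
    ∃ a b c : ℕ → ℂ, (fun x : ℂ × ℂ => f x - (∑ i ∈ Finset.range 6, a i * x.1 ^ i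
      + x.2 * ∑ i ∈ Finset.range 4, b i * x.1 ^ i + x.2 ^ 2 * ∑ i ∈ Finset.range 2, c i * x.1 ^ i))
        =O[𝓝 0] (fun x => ‖x.1‖ ^ 6 + ‖x.2‖ ^ 3) ∧ a 0 = 0 ∧ a 1 ≠ 0 ∧ b 0 = 0 ∧ c 0 = 0 := by
  obtain ⟨a, b, c, hT⟩ := exists_weighted_taylor hf
  obtain ⟨a', b', c', hT'⟩ := exists_weighted_taylor hg
  obtain ⟨ha0, ha1, hb0⟩ := coeff_eq_of_weighted_taylor hL hT
  obtain ⟨ha0', -, -⟩ := coeff_eq_of_weighted_taylor hg.differentiableAt.hasFDerivAt hT'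
  rw [hf0] at ha0
  rw [hg0] at ha0'
  rw [← ha1] at h1
  rw [h2] at hb0
  refine ⟨a, b, c, hT, ha0, h1, hb0, ?_⟩
  have key : ∀ (z : ℂ) (u : ℝ), ‖z‖ = 1 → ∀ ω : ℂ, ω = u + Complex.I →
      (a' 3 * z ^ 3 + b' 1 * z * ω).im = 2 * (conj (a 1 * z) * (a 2 * z ^ 2)).re ∧
      (a' 5 * z ^ 5 + b' 3 * z ^ 3 * ω + c' 1 * z * ω ^ 2).im =
        2 * (conj (a 1 * z) * (a 4 * z ^ 4 + b 2 * z ^ 2 * ω + c 0 * ω ^ 2) +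
          conj (a 2 * z ^ 2) * (a 3 * z ^ 3 + b 1 * z * ω)).re := by
    intro z u hz ω hω
    have tx : Tendsto (fun δ : ℝ => ((δ : ℂ) * z, δ ^ 2 * u)) (𝓝[>] 0) (𝓝 (0 : ℂ × ℝ)) := by
      have : ContinuousAt (fun δ : ℝ => ((δ : ℂ) * z, δ ^ 2 * u)) 0 := by fun_prop
      have := this.tendsto
      simp only [Complex.ofReal_zero, zero_mul, ne_eq, OfNat.ofNat_ne_zero, not_false_eq_true,
        zero_pow] at this
      exact this.mono_left nhdsWithin_le_nhds
    have t0 : Tendsto (fun δ : ℝ => δ) (𝓝[>] 0) (𝓝 0) := tendsto_nhdsWithin_of_tendsto_nhds tendsto_id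
    have hN : (fun δ : ℝ => ‖(δ : ℂ) * z‖ ^ 6 + |δ ^ 2 * u| ^ 3) =O[𝓝[>] 0] fun δ => δ ^ 6 := by
      refine IsBigO.of_bound (1 + |u| ^ 3) (Eventually.of_forall fun δ => le_of_eq ?_)
      have e1 : ‖(δ : ℂ) * z‖ ^ 6 + |δ ^ 2 * u| ^ 3 = (1 + |u| ^ 3) * |δ| ^ 6 := by
        rw [norm_mul, hz, mul_one, Complex.norm_real, abs_mul, abs_pow, Real.norm_eq_abs]
        ring
      rw [e1, Real.norm_of_nonneg (by positivity), norm_pow, Real.norm_eq_abs]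
    have eF := (hF.comp_tendsto tx).trans hN
    have eE := (h.comp_tendsto tx).trans hN
    set e : ℝ → ℂ := fun δ => Complex.I * ((F ((δ : ℂ) * z, δ ^ 2 * u) - Complex.normSq ((δ : ℂ) * z) : ℝ) : ℂ)
      with he
    have he6 : e =O[𝓝[>] 0] fun δ => δ ^ 6 := by
      refine IsBigO.trans (IsBigO.of_bound 1 (Eventually.of_forall fun δ => ?_)) eF
      rw [he, norm_mul, Complex.norm_I, Complex.norm_real]
      rfl
    have hgp : ∀ δ : ℝ, graphPoint F ((δ : ℂ) * z, δ ^ 2 * u) = ((δ : ℂ) * z, (δ : ℂ) ^ 2 * ω + e δ) := by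
      intro δ
      rw [graphPoint_apply, hω]
      have : Complex.normSq ((δ : ℂ) * z) = δ ^ 2 := by
        rw [Complex.normSq_eq_norm_sq, norm_mul, hz, mul_one, Complex.norm_real, Real.norm_eq_abs, sq_abs]
      simp only [he, this]
      push_cast
      ext1
      · rfl
      · simp only
        ring
    have tw : Tendsto (fun δ : ℝ => (δ : ℂ) ^ 2 * ω + e δ) (𝓝[>] 0) (𝓝 0) := by
      have h1 : Tendsto (fun δ : ℝ => (δ : ℂ) ^ 2 * ω) (𝓝[>] 0) (𝓝 0) := by
        have : ContinuousAt (fun δ : ℝ => (δ : ℂ) ^ 2 * ω) 0 := by fun_prop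
        have := this.tendsto
        simp only [Complex.ofReal_zero, zero_mul, ne_eq, OfNat.ofNat_ne_zero, not_false_eq_true,
          zero_pow] at this
        exact this.mono_left nhdsWithin_le_nhds
      have h2 := he6.trans_tendsto (by simpa using t0.pow 6)
      simpa using h1.add h2
    have tz : Tendsto (fun δ : ℝ => (δ : ℂ) * z) (𝓝[>] 0) (𝓝 0) := by
      have := (continuous_fst.tendsto (0 : ℂ × ℝ)).comp tx
      simpa [Function.comp_def] using this
    have tg : Tendsto (fun δ : ℝ => (((δ : ℂ) * z, (δ : ℂ) ^ 2 * ω + e δ) : ℂ × ℂ)) (𝓝[>] 0) (𝓝 0) :=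
      tz.prodMk_nhds tw
    have hw2 : (fun δ : ℝ => (δ : ℂ) ^ 2 * ω + e δ) =O[𝓝[>] 0] fun δ => δ ^ 2 := by
      refine IsBigO.add ?_ (he6.trans ?_)
      · refine IsBigO.of_bound ‖ω‖ (Eventually.of_forall fun δ => le_of_eq ?_)
        simp [mul_comm]
      · have : (fun δ : ℝ => δ ^ 4) =O[𝓝[>] 0] fun _ => (1 : ℝ) := (t0.pow 4).isBigO_one ℝ
        have := this.mul (isBigO_refl (fun δ : ℝ => δ ^ 2) (𝓝[>] 0))
        simpa [← pow_add] using this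
    have hN' : (fun δ : ℝ => ‖(δ : ℂ) * z‖ ^ 6 + ‖(δ : ℂ) ^ 2 * ω + e δ‖ ^ 3) =O[𝓝[>] 0]
        fun δ => δ ^ 6 := by
      refine IsBigO.add ?_ ?_
      · refine IsBigO.of_bound 1 (Eventually.of_forall fun δ => le_of_eq ?_)
        simp [hz]
      · have := hw2.norm_left.pow 3
        simpa only [← pow_mul] using this
    have tay : ∀ {φ : ℂ × ℂ → ℂ} {a b c : ℕ → ℂ}, a 0 = 0 →
        (fun x : ℂ × ℂ => φ x - (∑ i ∈ Finset.range 6, a i * x.1 ^ i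
        + x.2 * ∑ i ∈ Finset.range 4, b i * x.1 ^ i + x.2 ^ 2 * ∑ i ∈ Finset.range 2, c i * x.1 ^ i))
        =O[𝓝 0] (fun x => ‖x.1‖ ^ 6 + ‖x.2‖ ^ 3) →
        (fun δ : ℝ => φ (graphPoint F ((δ : ℂ) * z, δ ^ 2 * u)) - ((a 1 * z) * δ
          + (a 2 * z ^ 2 + b 0 * ω) * δ ^ 2 + (a 3 * z ^ 3 + b 1 * z * ω) * δ ^ 3
          + (a 4 * z ^ 4 + b 2 * z ^ 2 * ω + c 0 * ω ^ 2) * δ ^ 4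
          + (a 5 * z ^ 5 + b 3 * z ^ 3 * ω + c 1 * z * ω ^ 2) * δ ^ 5)) =O[𝓝[>] 0] fun δ => δ ^ 6 := by
      intro φ a b c ha hφ
      have e1 := (hφ.comp_tendsto tg).trans hN'
      set m : ℝ → ℂ := fun δ => ∑ i ∈ Finset.range 4, b i * ((δ : ℂ) * z) ^ i
        + (2 * (δ : ℂ) ^ 2 * ω + e δ) * ∑ i ∈ Finset.range 2, c i * ((δ : ℂ) * z) ^ i with hm
      have hm1 : m =O[𝓝[>] 0] fun _ => (1 : ℝ) := by
        have s1 : ∀ (n : ℕ) (b : ℕ → ℂ), Tendsto (fun δ : ℝ => ∑ i ∈ Finset.range n, b i * ((δ : ℂ) * z) ^ i)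
            (𝓝[>] 0) (𝓝 (∑ i ∈ Finset.range n, b i * (0 : ℂ) ^ i)) := fun n b =>
          tendsto_finsetSum _ fun i _ => (tz.pow i).const_mul _
        have s2 : Tendsto (fun δ : ℝ => 2 * (δ : ℂ) ^ 2 * ω + e δ) (𝓝[>] 0) (𝓝 0) := by
          have h1 : Tendsto (fun δ : ℝ => (δ : ℂ) ^ 2 * ω) (𝓝[>] 0) (𝓝 0) := by
            have : ContinuousAt (fun δ : ℝ => (δ : ℂ) ^ 2 * ω) 0 := by fun_prop
            have := this.tendsto
            simp only [Complex.ofReal_zero, zero_mul, ne_eq, OfNat.ofNat_ne_zero, not_false_eq_true,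
              zero_pow] at this
            exact this.mono_left nhdsWithin_le_nhds
          have := tw.add h1
          simp only [add_zero] at this
          refine this.congr fun δ => ?_
          ring
        exact ((s1 4 b).add (s2.mul (s1 2 c))).isBigO_one ℝ
      have e2 := he6.mul hm1
      simp only [mul_one] at e2
      have e3 : (fun δ : ℝ => (δ : ℂ) ^ 6 * 0) =O[𝓝[>] 0] fun δ : ℝ => δ ^ 6 := by
        simpa using isBigO_zero _ _
      refine (e1.add e2).congr_left fun δ => ?_
      simp only [Function.comp, hm, hgp, Finset.sum_range_succ, Finset.sum_range_zero, ha]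
      ring
    have := coeff_eq_of_isBigO (tay ha0 hT) (tay ha0' hT') eE
    rw [hb0] at this
    simpa using this
  have hconj : ∀ z : ℂ, ‖z‖ = 1 → conj z * z = 1 := fun z hz => by
    rw [← Complex.normSq_eq_conj_mul_self, Complex.normSq_eq_norm_sq, hz]; simp
  have hre : ∀ (A B : ℂ), A.im = 2 * B.re → (-Complex.I * A - 2 * B).re = 0 := by
    intro A B hAB
    simp [hAB]
  have k3 : ∀ (u : ℝ), -Complex.I * b' 1 * (u + Complex.I) - 2 * conj (a 1) * a 2 = 0 := by
    intro u
    refine eq_zero_of_harmonics (C₃ := -Complex.I * a' 3) (C₅ := 0) fun z hz => ?_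
    have := hre _ _ (key z u hz _ rfl).1
    rw [← this]
    congr 1
    rw [map_mul]
    linear_combination (2 * conj (a 1) * a 2 * z) * hconj z hz
  have hb1 : b' 1 = 0 := by
    have e0 := k3 0
    have e1 := k3 1
    have : -Complex.I * b' 1 = 0 := by
      push_cast at e0 e1
      linear_combination e1 - e0
    simpa using this
  have ha2 : a 2 = 0 := by
    have e0 := k3 0
    rw [hb1] at e0
    simpa [h1] using e0
  have k5 : ∀ (u : ℝ), -Complex.I * c' 1 * (u + Complex.I) ^ 2 - 2 * conj (a 1) * b 2 * (u + Complex.I)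
      - 2 * (a 1) * conj (c 0) * (u - Complex.I) ^ 2 = 0 := by
    intro u
    refine eq_zero_of_harmonics (C₃ := -Complex.I * b' 3 * (u + Complex.I) - 2 * conj (a 1) * a 4)
      (C₅ := -Complex.I * a' 5) fun z hz => ?_
    have := hre _ _ (key z u hz _ rfl).2
    rw [ha2] at this
    have hcc : ∀ A B : ℂ, (A - 2 * B).re = (A - 2 * conj B).re := by simp
    have e1 : (z * (2 * (a 1) * conj (c 0) * (u - Complex.I) ^ 2)).re =
        (2 * (conj (a 1) * conj z * (c 0 * (u + Complex.I) ^ 2))).re := by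
      rw [← Complex.conj_re]
      simp only [map_mul, map_pow, map_sub, Complex.conj_conj, Complex.conj_ofReal, Complex.conj_I,
        map_ofNat]
      congr 1
      ring
    have e2 : (-Complex.I * (a' 5 * z ^ 5 + b' 3 * z ^ 3 * (u + Complex.I) + c' 1 * z * (u + Complex.I) ^ 2)
        - 2 * (conj (a 1) * conj z * (a 4 * z ^ 4 + b 2 * z ^ 2 * (u + Complex.I)))
        - 2 * (conj (a 1) * conj z * (c 0 * (u + Complex.I) ^ 2))).re = 0 := by
      rw [← this]
      congr 1
      simp only [map_mul, map_zero, zero_mul]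
      ring
    rw [Complex.sub_re, ← e1, ← Complex.sub_re] at e2
    rw [← e2]
    congr 1
    linear_combination (2 * conj (a 1) * (a 4 * z ^ 3 + b 2 * z * (u + Complex.I))) * hconj z hz
  have hA : a 1 * conj (c 0) = 0 := by
    have e0 := k5 0
    have e1 := k5 1
    have e2 := k5 (-1)
    push_cast at e0 e1 e2
    have hsq : ∀ u : ℂ, (u + Complex.I) ^ 2 = u ^ 2 + 2 * u * Complex.I - 1 := fun u => by
      linear_combination Complex.I_sq
    have hsq' : ∀ u : ℂ, (u - Complex.I) ^ 2 = u ^ 2 - 2 * u * Complex.I - 1 := fun u => by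
      linear_combination Complex.I_sq
    rw [hsq, hsq'] at e0 e1 e2
    linear_combination (1 / 8) * (e0 - (1 / 2) * (e1 + e2 - 2 * e0) - (Complex.I / 2) * (e1 - e2))
      - (1 / 8) * (2 * Complex.I * c' 1 - 4 * (a 1 * conj (c 0))) * Complex.I_sq
  have := (mul_eq_zero.1 hA).resolve_left h1
  simpa using this

end invariance
section pointwise

variable {M : Set (ℂ × ℂ)} {q : ℂ × ℂ} {Φ Φ' : OpenPartialHomeomorph (ℂ × ℂ) (ℂ × ℂ)}
  {F F' : ℂ × ℝ → ℝ}

theorem isBigO_norm_sq_of_pow_six :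
    (fun x : ℂ × ℝ => ‖x.1‖ ^ 6 + |x.2| ^ 3) =O[𝓝 0] fun x => ‖x‖ ^ 2 := by
  have t : Tendsto (fun x : ℂ × ℝ => ‖x‖) (𝓝 0) (𝓝 0) := tendsto_norm_zero
  refine IsBigO.of_bound 2 ?_
  filter_upwards [t.eventually (gt_mem_nhds one_pos)] with x hx
  rw [Real.norm_of_nonneg (by positivity), Real.norm_of_nonneg (by positivity)]
  have h1 : ‖x.1‖ ≤ ‖x‖ := norm_fst_le x
  have h2 : |x.2| ≤ ‖x‖ := norm_snd_le x
  have h3 : ‖x.1‖ ^ 6 ≤ ‖x‖ ^ 6 := by gcongr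
  have h4 : |x.2| ^ 3 ≤ ‖x‖ ^ 3 := by gcongr
  have h5 : ‖x‖ ^ 6 ≤ ‖x‖ ^ 2 := pow_le_pow_of_le_one (norm_nonneg _) hx.le (by norm_num)
  have h6 : ‖x‖ ^ 3 ≤ ‖x‖ ^ 2 := pow_le_pow_of_le_one (norm_nonneg _) hx.le (by norm_num)
  linarith

theorem isBigO_normSq_fst : (fun x : ℂ × ℝ => Complex.normSq x.1) =O[𝓝 0] fun x => ‖x‖ ^ 2 :=
  IsBigO.of_bound 1 (Eventually.of_forall fun x => by
    rw [Complex.normSq_eq_norm_sq, one_mul, norm_pow, norm_pow, norm_norm, norm_norm]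
    gcongr
    exact norm_fst_le x)

theorem zero_and_hasFDerivAt_of_isBigO (h : F =O[𝓝 0] fun x => ‖x‖ ^ 2) :
    F 0 = 0 ∧ HasFDerivAt F (0 : ℂ × ℝ →L[ℝ] ℝ) 0 := by
  have h' : F =O[𝓝 0] fun x => ‖x - 0‖ ^ 2 := by simpa using h
  exact ⟨h'.eq_zero_of_norm_pow (by norm_num), h'.hasFDerivAt (𝕜 := ℝ) (by norm_num)⟩

theorem isBigO_sq_of_normalized
    (h : (fun x : ℂ × ℝ => F x - Complex.normSq x.1) =O[𝓝 0] fun x => ‖x.1‖ ^ 6 + |x.2| ^ 3) :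
    F =O[𝓝 0] fun x => ‖x‖ ^ 2 := by
  refine ((h.trans isBigO_norm_sq_of_pow_six).add isBigO_normSq_fst).congr_left fun x => ?_
  ring

/-- A holomorphic change of coordinates which brings the graph to the form `v = |z|² + O(6)`
yields normalizing coordinates. -/
theorem exists_isNormalizingAt (h : IsHolomorphicChartAt Φ q) (hF : IsGraphedBy M q Φ F)
    (hF2 : F =O[𝓝 0] fun x => ‖x‖ ^ 2) {H : ℂ × ℂ → ℂ × ℂ} (hH : AnalyticAt ℂ H 0) (h0 : H 0 = 0)
    {L : ℂ × ℂ →L[ℂ] ℂ × ℂ} (hL : HasFDerivAt H L 0) (hinj : ∀ X, L X = 0 → X = 0)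
    (hL2 : ∀ X, (L X).2 = X.2)
    (hE : (fun x => (H (graphPoint F x)).2.im - Complex.normSq (H (graphPoint F x)).1)
      =O[𝓝 0] fun x => weightSize x ^ 6) :
    ∃ Φ' : OpenPartialHomeomorph (ℂ × ℂ) (ℂ × ℂ), IsNormalizingAt M q Φ' ∧
      ∀ x, Φ' x = H (Φ x) := by
  obtain ⟨hF0, hdF⟩ := zero_and_hasFDerivAt_of_isBigO hF2
  obtain ⟨Φ', h', hΦ', hD⟩ := h.postcomp hH h0 hL hinj
  have hr : ∀ X, (fderiv ℂ Φ' q X).2 = (1 : ℝ) * (fderiv ℂ Φ q X).2 := fun X => by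
    rw [hD, hL2]; simp
  obtain ⟨F', hF', hF'0, hdF'⟩ := hF.exists_graph h hdF hF0 h' one_ne_zero hr
  obtain ⟨C, hC⟩ := (isBigO_weightSize_pow_six_iff.2 hE).bound
  refine ⟨Φ', isNormalizingAt_of_isBigO h h' hF' hF'0 hdF' one_ne_zero hr (C := C) ?_, hΦ'⟩
  have t : Tendsto (fun x => ((Φ x).1, (Φ x).2.re)) (𝓝 q) (𝓝 (0 : ℂ × ℝ)) := by
    have : ContinuousAt (fun y : ℂ × ℂ => (y.1, y.2.re)) 0 := by fun_prop
    exact this.tendsto.comp h.tendsto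
  filter_upwards [t.eventually hC, hF.2] with x e1 e2 hx
  have e3 : graphPoint F ((Φ x).1, (Φ x).2.re) = Φ x := by
    rw [graphPoint, ← e2.1 hx, realPoint_eq]
  rw [e3, Real.norm_eq_abs, Real.norm_of_nonneg (by positivity)] at e1
  rw [hΦ']
  exact e1

variable {c : ℝ → ℂ × ℂ} {t : ℝ}

theorem IsHolomorphicChartAt.curve (h : IsHolomorphicChartAt Φ q) (hc : ContDiffAt ℝ 2 c t)
    (hq : c t = q) : ContDiffAt ℝ 2 (fun s => Φ (c s)) t ∧
      deriv (fun s => Φ (c s)) t = fderiv ℂ Φ q (deriv c t) := by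
  subst hq
  have h1 := h.analyticAt h.mem_source
  have h2 : AnalyticAt ℝ Φ (c t) := h1.restrictScalars
  refine ⟨(h2.contDiffAt (n := 2)).comp t hc, ?_⟩
  exact ((h1.differentiableAt.hasFDerivAt.restrictScalars ℝ).comp_hasDerivAt t
    (hc.differentiableAt (by norm_num)).hasDerivAt).deriv

theorem IsHolomorphicChartAt.curve_fst (h : IsHolomorphicChartAt Φ q) (hc : ContDiffAt ℝ 2 c t)
    (hq : c t = q) : ContDiffAt ℝ 2 (fun s => (Φ (c s)).1) t ∧
      deriv (fun s => (Φ (c s)).1) t = (fderiv ℂ Φ q (deriv c t)).1 := by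
  obtain ⟨h1, h2⟩ := h.curve hc hq
  refine ⟨h1.fst, ?_⟩
  rw [← h2]
  exact (deriv_clm_comp (ContinuousLinearMap.fst ℝ ℂ ℂ) h1).1

theorem IsHolomorphicChartAt.curve_snd (h : IsHolomorphicChartAt Φ q) (hc : ContDiffAt ℝ 2 c t)
    (hq : c t = q) : ContDiffAt ℝ 2 (fun s => (Φ (c s)).2) t ∧
      deriv (fun s => (Φ (c s)).2) t = (fderiv ℂ Φ q (deriv c t)).2 := by
  obtain ⟨h1, h2⟩ := h.curve hc hq
  refine ⟨h1.snd, ?_⟩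
  rw [← h2]
  exact (deriv_clm_comp (ContinuousLinearMap.snd ℝ ℂ ℂ) h1).1

theorem HasTwoJet.isBigO_sub {φ : ℝ → ℂ} {a b : ℂ} (h : HasTwoJet φ t a b) :
    φ =O[𝓝 t] fun s => s - t := by
  have t1 : Tendsto (fun s : ℝ => s - t) (𝓝 t) (𝓝 0) := by
    have : ContinuousAt (fun s : ℝ => s - t) t := by fun_prop
    simpa using this.tendsto
  have e2 : (fun s : ℝ => (s - t) ^ 2) =O[𝓝 t] fun s => s - t := by
    simpa [sq] using (t1.isBigO_one ℝ).mul (isBigO_refl (fun s : ℝ => s - t) (𝓝 t))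
  have e1 : (fun s : ℝ => a * ((s - t : ℝ) : ℂ) + b * ((s - t : ℝ) : ℂ) ^ 2) =O[𝓝 t]
      fun s => s - t := by
    refine IsBigO.add ?_ (IsBigO.trans ?_ e2)
    · exact IsBigO.of_bound ‖a‖ (Eventually.of_forall fun s => by
        rw [norm_mul, Complex.norm_real])
    · exact IsBigO.of_bound ‖b‖ (Eventually.of_forall fun s => by
        rw [norm_mul, norm_pow, norm_pow, Complex.norm_real])
  refine (((IsLittleO.isBigO h).trans e2).add e1).congr_left fun s => ?_
  ring

theorem isLittleO_cube : (fun s : ℝ => (s - t) ^ 3) =o[𝓝 t] fun s => (s - t) ^ 2 := by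
  have t1 : Tendsto (fun s : ℝ => s - t) (𝓝 t) (𝓝 0) := by
    have : ContinuousAt (fun s : ℝ => s - t) t := by fun_prop
    simpa using this.tendsto
  have := ((isLittleO_one_iff ℝ).2 t1).mul_isBigO (isBigO_refl (fun s : ℝ => (s - t) ^ 2) (𝓝 t))
  refine (this.congr_left fun s => ?_).congr_right fun s => ?_
  · ring
  · ring

/-- On a curve in a normalized graph one has `v'' = 2 |z'|²`. -/
theorem snd_jet_of_mem {φ ψ : ℝ → ℂ} {a b a' b' : ℂ} (hφ : HasTwoJet φ t a b)
    (hψ : HasTwoJet ψ t a' b')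
    (hF : (fun x : ℂ × ℝ => F x - Complex.normSq x.1) =O[𝓝 0] fun x => ‖x.1‖ ^ 6 + |x.2| ^ 3)
    (h : ∀ᶠ s in 𝓝 t, (ψ s).im = F (φ s, (ψ s).re)) : a'.im = 0 ∧ b'.im = Complex.normSq a := by
  have t1 : Tendsto (fun s : ℝ => s - t) (𝓝 t) (𝓝 0) := by
    have : ContinuousAt (fun s : ℝ => s - t) t := by fun_prop
    simpa using this.tendsto
  have oφ := hφ.isBigO_sub
  have oψ := hψ.isBigO_sub
  have oψr : (fun s => (ψ s).re) =O[𝓝 t] fun s => s - t :=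
    (IsBigO.of_bound 1 (Eventually.of_forall fun s => by
      rw [one_mul]; exact Complex.abs_re_le_norm _)).trans oψ
  have tx : Tendsto (fun s => (φ s, (ψ s).re)) (𝓝 t) (𝓝 0) :=
    (oφ.trans_tendsto t1).prodMk_nhds (oψr.trans_tendsto t1)
  have e1 : (fun s => (ψ s).im - Complex.normSq (φ s)) =o[𝓝 t] fun s => (s - t) ^ 2 := by
    have e2 := hF.comp_tendsto tx
    have e3 : (fun s => ‖φ s‖ ^ 6 + |(ψ s).re| ^ 3) =O[𝓝 t] fun s => (s - t) ^ 3 := by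
      refine IsBigO.add ?_ ?_
      · refine (oφ.norm_left.pow 6).trans ?_
        have := ((t1.pow 3).isBigO_one ℝ).mul (isBigO_refl (fun s : ℝ => (s - t) ^ 3) (𝓝 t))
        refine (this.congr_left fun s => ?_).congr_right fun s => ?_
        · ring
        · ring
      · exact oψr.norm_left.pow 3
    have e4 := (e2.trans e3).trans_isLittleO isLittleO_cube
    refine e4.congr' ?_ EventuallyEq.rfl
    filter_upwards [h] with s hs
    simp only [Function.comp, ← hs]
  have e5 : (fun s => Complex.normSq (φ s) - Complex.normSq a * (s - t) ^ 2) =o[𝓝 t]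
      fun s => (s - t) ^ 2 := by
    have f1 : (fun s => φ s - a * ((s - t : ℝ) : ℂ)) =O[𝓝 t] fun s => (s - t) ^ 2 := by
      have f2 : (fun s : ℝ => b * ((s - t : ℝ) : ℂ) ^ 2) =O[𝓝 t] fun s => (s - t) ^ 2 :=
        IsBigO.of_bound ‖b‖ (Eventually.of_forall fun s => by
          rw [norm_mul, norm_pow, norm_pow, Complex.norm_real])
      refine ((IsLittleO.isBigO hφ).add f2).congr_left fun s => ?_
      ring
    have f3 : (fun s => φ s + a * ((s - t : ℝ) : ℂ)) =O[𝓝 t] fun s => s - t :=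
      oφ.add (IsBigO.of_bound ‖a‖ (Eventually.of_forall fun s => by
        rw [norm_mul, Complex.norm_real]))
    have f4 := f1.norm_left.mul f3.norm_left
    have f5 : (fun s : ℝ => (s - t) ^ 2 * (s - t)) =o[𝓝 t] fun s => (s - t) ^ 2 :=
      isLittleO_cube.congr_left fun s => by ring
    refine (IsBigO.of_bound 1 (Eventually.of_forall fun s => ?_)).trans_isLittleO
      (f4.trans_isLittleO f5)
    have e3 : Complex.normSq (φ s) - Complex.normSq a * (s - t) ^ 2 =
        ((φ s - a * ((s - t : ℝ) : ℂ)) * conj (φ s + a * ((s - t : ℝ) : ℂ))).re := by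
      simp only [Complex.normSq_apply, map_add, map_mul, Complex.conj_ofReal, Complex.mul_re,
        Complex.mul_im, Complex.add_re, Complex.add_im, Complex.sub_re, Complex.sub_im,
        Complex.conj_re, Complex.conj_im, Complex.ofReal_re, Complex.ofReal_im]
      ring
    rw [e3, one_mul, Real.norm_eq_abs]
    refine (Complex.abs_re_le_norm _).trans (le_of_eq ?_)
    rw [norm_mul, norm_mul, norm_norm, norm_norm, RCLike.norm_conj]
  have e6 : HasTwoJet (fun s => ((ψ s).im : ℂ)) t 0 (Complex.normSq a : ℂ) := by
    refine (IsBigO.of_bound 1 (Eventually.of_forall fun s => ?_)).trans_isLittleO (e1.add e5)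
    rw [one_mul, ← Complex.norm_real]
    refine le_of_eq (congrArg _ ?_)
    push_cast
    ring
  have e7 : HasTwoJet (fun s => ((ψ s).im : ℂ)) t (a'.im : ℂ) (b'.im : ℂ) := by
    refine (IsBigO.of_bound 1 (Eventually.of_forall fun s => ?_)).trans_isLittleO hψ
    rw [one_mul]
    refine le_trans (le_of_eq ?_) (Complex.abs_im_le_norm _)
    rw [← Real.norm_eq_abs, ← Complex.norm_real]
    refine (congrArg _ ?_)
    rw [Complex.sub_im, Complex.add_im, ← Complex.ofReal_pow, Complex.im_mul_ofReal,
      Complex.im_mul_ofReal]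
    push_cast
    ring
  obtain ⟨h1, h2⟩ := e7.unique e6
  exact ⟨by exact_mod_cast h1, by exact_mod_cast h2⟩

/-- The complex form of the chain locus. -/
theorem jetInChainLocus_iff (hφ : ContDiffAt ℝ 2 c t) (hw : deriv (fun s => (c s).2.re) t ≠ 0) :
    JetInChainLocus c t ↔
      deriv (deriv fun s => (c s).1) t * ((deriv (fun s => (c s).2.re) t : ℝ) : ℂ)
        - deriv (fun s => (c s).1) t * ((deriv (deriv fun s => (c s).2.re) t : ℝ) : ℂ) =
      2 * Complex.I * deriv (fun s => (c s).1) t * Complex.normSq (deriv (fun s => (c s).1) t) := by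
  obtain ⟨r1, r2⟩ := deriv_clm_comp Complex.reCLM hφ.fst
  obtain ⟨i1, i2⟩ := deriv_clm_comp Complex.imCLM hφ.fst
  simp only [Complex.reCLM_apply, Complex.imCLM_apply] at r1 r2 i1 i2
  rw [JetInChainLocus, InChainLocus, jetOne, jetOne, jetTwo, jetTwo, r1, r2, i1, i2]
  set a := deriv (fun s => (c s).1) t
  set b := deriv (deriv fun s => (c s).1) t
  set u := deriv (fun s => (c s).2.re) t
  set v := deriv (deriv fun s => (c s).2.re) t
  rw [Complex.ext_iff]
  simp only [Complex.normSq_apply, Complex.sub_re, Complex.sub_im, Complex.mul_re, Complex.mul_im,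
    Complex.ofReal_re, Complex.ofReal_im, Complex.I_re, Complex.I_im, Complex.re_ofNat,
    Complex.im_ofNat]
  refine and_congr ?_ ?_
  · field_simp
    constructor <;> intro h <;> linarith
  · field_simp
    constructor <;> intro h <;> linarith

end pointwise

section flat

variable {M : Set (ℂ × ℂ)} {q : ℂ × ℂ} {Φ Φ' : OpenPartialHomeomorph (ℂ × ℂ) (ℂ × ℂ)}
  {F F' : ℂ × ℝ → ℝ} {c : ℝ → ℂ × ℂ} {t : ℝ}

/-- The automorphisms `(z + β w, w) / (1 - 2 i β̄ z - i |β|² w)` of the quadric, applied with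
`β = -a`. -/
theorem im_sub_normSq_div {a z w D : ℂ} (hD : D ≠ 0)
    (h : D = 1 + 2 * Complex.I * conj a * z - Complex.I * Complex.normSq a * w) :
    (w / D).im - Complex.normSq ((z - a * w) / D) = (w.im - Complex.normSq z) / Complex.normSq D := by
  have hn : Complex.normSq D ≠ 0 := by simpa using hD
  rw [Complex.normSq_div, Complex.div_im]
  field_simp
  rw [h]
  simp only [Complex.normSq_apply, Complex.sub_re, Complex.sub_im, Complex.mul_re, Complex.mul_im,
    Complex.add_re, Complex.add_im, Complex.one_re, Complex.one_im, Complex.conj_re, Complex.conj_im,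
    Complex.ofReal_re, Complex.ofReal_im, Complex.I_re, Complex.I_im, Complex.re_ofNat,
    Complex.im_ofNat]
  ring

theorem exists_flat_isNormalizingAt (hN : IsNormalizingAt M q Φ) (hc : ContDiffAt ℝ 2 c t)
    (hq : c t = q) (hM : ∀ᶠ s in 𝓝 t, c s ∈ M) (hT : IsCRTransversal M q (deriv c t))
    (hJ : JetInChainLocus (fun s => Φ (c s)) t) :
    ∃ Φ' : OpenPartialHomeomorph (ℂ × ℂ) (ℂ × ℂ), IsNormalizingAt M q Φ' ∧
      deriv (fun s => (Φ' (c s)).1) t = 0 ∧ deriv (deriv fun s => (Φ' (c s)).1) t = 0 := by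
  obtain ⟨h, F, hF, hE⟩ := hN
  have hF2 := isBigO_sq_of_normalized hE
  obtain ⟨hF0, hdF⟩ := zero_and_hasFDerivAt_of_isBigO hF2
  obtain ⟨hcu, -⟩ := h.curve hc hq
  obtain ⟨hz, hz1⟩ := h.curve_fst hc hq
  obtain ⟨hw, hw1⟩ := h.curve_snd hc hq
  obtain ⟨hTi, hTr⟩ := (hF.isCRTransversal_iff h hF0 hdF _).1 hT
  rw [← hw1] at hTi hTr
  set w₁ := deriv (fun s => (Φ (c s)).2) t with hw₁
  set w₂ := deriv (deriv fun s => (Φ (c s)).2) t with hw₂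
  set z₁ := deriv (fun s => (Φ (c s)).1) t with hz₁
  set z₂ := deriv (deriv fun s => (Φ (c s)).1) t with hz₂
  have hct : Φ (c t) = 0 := by rw [hq, h.map_center]
  have jz := hasTwoJet_of_contDiffAt hz (by rw [hct]; rfl)
  have jw := hasTwoJet_of_contDiffAt hw (by rw [hct]; rfl)
  have tc : Tendsto c (𝓝 t) (𝓝 q) := by rw [← hq]; exact hc.continuousAt.tendsto
  have hgr : ∀ᶠ s in 𝓝 t, (Φ (c s)).2.im = F ((Φ (c s)).1, (Φ (c s)).2.re) := by
    filter_upwards [tc.eventually hF.2, hM] with s e1 e2 using e1.1 e2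
  obtain ⟨-, hv⟩ := snd_jet_of_mem jz jw hE hgr
  obtain ⟨r1, r2⟩ := deriv_clm_comp Complex.reCLM hw
  simp only [Complex.reCLM_apply] at r1 r2
  rw [← hw₁] at r1
  rw [← hw₂] at r2
  have hJ' := (jetInChainLocus_iff hcu (by rw [r1]; exact hTr)).1 hJ
  rw [r1, r2, ← hz₁, ← hz₂] at hJ'
  rw [← hz₁, ← hz₂] at jz
  rw [← hw₁, ← hw₂] at jw
  rw [← hw₂, ← hz₁] at hv
  have hw1r : w₁ = (w₁.re : ℂ) := by
    apply Complex.ext <;> simp [hTi]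
  have hw10 : (w₁.re : ℂ) ≠ 0 := by exact_mod_cast hTr
  set a : ℂ := z₁ / w₁.re with ha
  have haz : z₁ = a * w₁ := by
    rw [hw1r, ha]; field_simp
  have haz2 : z₂ = a * w₂ := by
    have e1 : w₂ = w₂.re + Complex.I * (2 * Complex.normSq z₁) := by
      have : w₂.im = 2 * Complex.normSq z₁ := by
        have : (w₂ / 2).im = w₂.im / 2 := by simp
        rw [this] at hv; linarith
      rw [mul_comm, ← Complex.ofReal_ofNat, ← Complex.ofReal_mul, ← this, Complex.re_add_im]
    rw [e1, ha]
    field_simp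
    linear_combination hJ'
  set D : ℂ × ℂ → ℂ := fun x => 1 + 2 * Complex.I * conj a * x.1 - Complex.I * Complex.normSq a * x.2
    with hD
  have hDa : AnalyticAt ℂ D 0 := by fun_prop
  have hD0 : D 0 = 1 := by simp [hD]
  have hDn : D 0 ≠ 0 := by rw [hD0]; exact one_ne_zero
  set H : ℂ × ℂ → ℂ × ℂ := fun x => ((x.1 - a * x.2) / D x, x.2 / D x) with hH
  have hHa : AnalyticAt ℂ H 0 := by
    refine AnalyticAt.prod ?_ ?_
    · exact AnalyticAt.div (by fun_prop) hDa hDn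
    · exact AnalyticAt.div (by fun_prop) hDa hDn
  have hH0 : H 0 = 0 := by simp [hH]
  set L : ℂ × ℂ →L[ℂ] ℂ × ℂ := ((ContinuousLinearMap.fst ℂ ℂ ℂ) -
    a • (ContinuousLinearMap.snd ℂ ℂ ℂ)).prod (ContinuousLinearMap.snd ℂ ℂ ℂ) with hL
  have hHL : HasFDerivAt H L 0 := by
    have key : ∀ {f : ℂ × ℂ → ℂ} {K : ℂ × ℂ →L[ℂ] ℂ}, HasFDerivAt f K 0 → f 0 = 0 →
        HasFDerivAt (fun x => f x / D x) K 0 := by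
      intro f K hf hf0
      have hi : DifferentiableAt ℂ (fun x => (D x)⁻¹) 0 := (hDa.inv hDn).differentiableAt
      have := hf.mul hi.hasFDerivAt
      rw [hf0, hD0] at this
      simp only [div_eq_mul_inv]
      refine HasFDerivAt.congr_fderiv (f := fun x => f x * (D x)⁻¹) this ?_
      ext <;> simp
    refine HasFDerivAt.prodMk (key ?_ (by simp)) (key hasFDerivAt_snd (by simp))
    exact hasFDerivAt_fst.sub (hasFDerivAt_snd.const_mul a)
  have hLi : ∀ X, L X = 0 → X = 0 := by
    rintro ⟨x, y⟩ hX
    have e1 : (x - a * y, y) = (0 : ℂ × ℂ) := hX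
    obtain ⟨e2, e3⟩ := Prod.mk_eq_zero.1 e1
    rw [e3, mul_zero, sub_zero] at e2
    rw [e2, e3]; rfl
  have hgt := tendsto_graphPoint hF.1 hF0
  have hDt : ∀ᶠ x in 𝓝 (0 : ℂ × ℂ), D x ≠ 0 ∧ 1 / 2 ≤ Complex.normSq (D x) := by
    refine (hDa.continuousAt.eventually_ne hDn).and ?_
    have : ContinuousAt (fun x => Complex.normSq (D x)) 0 :=
      Complex.continuous_normSq.continuousAt.comp hDa.continuousAt
    have h2 := this.tendsto.eventually (lt_mem_nhds (b := Complex.normSq (D 0)) (a := 1 / 2)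
      (by rw [hD0]; norm_num))
    exact h2.mono fun x hx => hx.le
  have hHE : (fun x => (H (graphPoint F x)).2.im - Complex.normSq (H (graphPoint F x)).1)
      =O[𝓝 0] fun x => weightSize x ^ 6 := by
    refine IsBigO.trans (IsBigO.of_bound 2 ?_) (isBigO_weightSize_pow_six_iff.1 hE)
    filter_upwards [hgt.eventually hDt] with x hx
    simp only [hH]
    rw [im_sub_normSq_div hx.1 rfl, norm_div, graphPoint_snd_im,
      Real.norm_of_nonneg (Complex.normSq_nonneg _), div_le_iff₀ (by linarith [hx.2])]
    have e1 : (graphPoint F x).1 = x.1 := by rw [graphPoint_apply]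
    rw [e1]
    nlinarith [norm_nonneg (F x - Complex.normSq x.1), hx.2]
  obtain ⟨Φ', hN', hΦ'⟩ := exists_isNormalizingAt h hF hF2 hHa hH0 hHL hLi (fun X => rfl) hHE
  refine ⟨Φ', hN', ?_⟩
  obtain ⟨hz', -⟩ := hN'.1.curve_fst hc hq
  have jz' := hasTwoJet_of_contDiffAt hz' (by rw [hq, hN'.1.map_center]; rfl)
  have jN : HasTwoJet (fun s => (Φ' (c s)).1) t 0 0 := by
    have e1 : (fun s => (Φ (c s)).1 - a * (Φ (c s)).2) =o[𝓝 t] fun s => (s - t) ^ 2 := by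
      refine (IsLittleO.sub jz (IsLittleO.const_mul_left jw a)).congr_left fun s => ?_
      rw [haz, haz2]
      ring
    have e2 : Tendsto (fun s => (D (Φ (c s)))⁻¹) (𝓝 t) (𝓝 ((D 0)⁻¹)) := by
      have : ContinuousAt (fun x => (D x)⁻¹) 0 := hDa.continuousAt.inv₀ hDn
      exact this.tendsto.comp (h.tendsto.comp tc)
    have e3 := e1.mul_isBigO (e2.isBigO_one ℝ)
    rw [HasTwoJet]
    refine (e3.congr_left fun s => ?_).congr_right fun s => by ring
    rw [hΦ']
    simp [hH, div_eq_mul_inv]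
  obtain ⟨u1, u2⟩ := jz'.unique jN
  exact ⟨u1, by simpa using u2⟩

end flat

section chainCondition

variable {M : Set (ℂ × ℂ)} {q : ℂ × ℂ} {Φ Φ' : OpenPartialHomeomorph (ℂ × ℂ) (ℂ × ℂ)}
  {F F' : ℂ × ℝ → ℝ} {c : ℝ → ℂ × ℂ} {t : ℝ}

/-- Two normalizing charts in which the curve is tangent to the `u`-axis see the same second order
contact with this axis. -/
theorem second_deriv_eq_zero_of_flat (hN : IsNormalizingAt M q Φ) (hN' : IsNormalizingAt M q Φ')
    (hc : ContDiffAt ℝ 2 c t)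
    (hq : c t = q) (hT : IsCRTransversal M q (deriv c t))
    (h1 : deriv (fun s => (Φ (c s)).1) t = 0)
    (h1' : deriv (fun s => (Φ' (c s)).1) t = 0) (h2' : deriv (deriv fun s => (Φ' (c s)).1) t = 0) :
    deriv (deriv fun s => (Φ (c s)).1) t = 0 := by
  obtain ⟨h, F, hF, hE⟩ := hN
  obtain ⟨h', F', hF', hE'⟩ := hN'
  have hF2 := isBigO_sq_of_normalized hE
  obtain ⟨hF0, hdF⟩ := zero_and_hasFDerivAt_of_isBigO hF2
  have hF2' := isBigO_sq_of_normalized hE'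
  obtain ⟨hF0', hdF'⟩ := zero_and_hasFDerivAt_of_isBigO hF2'
  obtain ⟨hz, hz1⟩ := h.curve_fst hc hq
  obtain ⟨hw, hw1⟩ := h.curve_snd hc hq
  obtain ⟨hz', hz1'⟩ := h'.curve_fst hc hq
  obtain ⟨hTi, hTr⟩ := (hF.isCRTransversal_iff h hF0 hdF _).1 hT
  rw [← hw1] at hTi hTr
  set w₁ := deriv (fun s => (Φ (c s)).2) t with hw₁
  set w₂ := deriv (deriv fun s => (Φ (c s)).2) t with hw₂
  set z₂ := deriv (deriv fun s => (Φ (c s)).1) t with hz₂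
  have hct : Φ (c t) = 0 := by rw [hq, h.map_center]
  have hct' : Φ' (c t) = 0 := by rw [hq, h'.map_center]
  have jz := hasTwoJet_of_contDiffAt hz (by rw [hct]; rfl)
  have jw := hasTwoJet_of_contDiffAt hw (by rw [hct]; rfl)
  have jz' := hasTwoJet_of_contDiffAt hz' (by rw [hct']; rfl)
  rw [h1, ← hz₂] at jz
  rw [h1', h2'] at jz'
  rw [← hw₁, ← hw₂] at jw
  have tc : Tendsto c (𝓝 t) (𝓝 q) := by rw [← hq]; exact hc.continuousAt.tendsto
  set K : ℂ × ℂ → ℂ × ℂ := fun y => Φ' (Φ.symm y) with hK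
  have hKa : AnalyticAt ℂ K 0 := AnalyticAt.fun_comp_of_eq (h'.analyticAt h'.mem_source)
    (h.analyticAt_symm h.zero_mem_target) h.symm_zero
  have hK0 : K 0 = 0 := by simp only [hK, h.symm_zero, h'.map_center]
  set L : ℂ × ℂ →L[ℂ] ℂ × ℂ := (fderiv ℂ Φ' q) ∘L (fderiv ℂ Φ.symm 0) with hL
  have hKd : HasFDerivAt K L 0 := by
    have e1 := (h'.analyticAt h'.mem_source).differentiableAt.hasFDerivAt
    rw [← h.symm_zero] at e1
    have e2 := e1.comp 0 (h.analyticAt_symm h.zero_mem_target).differentiableAt.hasFDerivAt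
    rwa [h.symm_zero] at e2
  have hLinj : ∀ X, L X = 0 → X = 0 := by
    intro X hX
    have e1 : fderiv ℂ Φ.symm 0 X = 0 := by
      have := h'.fderiv_symm_apply (fderiv ℂ Φ.symm 0 X)
      rw [← this]
      have e2 : fderiv ℂ Φ' q (fderiv ℂ Φ.symm 0 X) = 0 := hX
      rw [e2, map_zero]
    have := h.fderiv_apply_symm X
    rw [← this, e1, map_zero]
  have hD : ∀ X, fderiv ℂ Φ' q X = L (fderiv ℂ Φ q X) := by
    intro X
    change _ = fderiv ℂ Φ' q (fderiv ℂ Φ.symm 0 (fderiv ℂ Φ q X))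
    rw [h.fderiv_symm_apply]
  have hL01 : (L (0, 1)).1 = 0 := by
    have e1 : fderiv ℂ Φ q (deriv c t) = w₁ • ((0 : ℂ), (1 : ℂ)) := by
      ext1
      · rw [← hz1, h1]; simp
      · rw [← hw1]; simp
    have e2 := hz1'
    rw [h1', hD, e1, map_smul] at e2
    have hw10 : w₁ ≠ 0 := fun e => hTr (by rw [e]; rfl)
    have e3 : w₁ * (L (0, 1)).1 = 0 := e2.symm
    exact (mul_eq_zero.1 e3).resolve_left hw10
  obtain ⟨b, hb⟩ : ∃ b : ℂ, ∀ X, (L X).2 = b * X.2 := by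
    obtain ⟨d1, d2⟩ := hF.isDefiningFunction h hdF
    obtain ⟨d1', d2'⟩ := hF'.isDefiningFunction h' hdF'
    have hqM := hF.mem_of_zero h hF0
    have e1 : ∀ X : ℂ × ℂ, X.2.im = 0 → (L X).2.im = 0 := by
      intro X hX
      have f1 : IsTangent M q (fderiv ℂ Φ.symm 0 X) := by
        rw [isTangent_iff hqM d1, d2, h.fderiv_apply_symm, hX]
      rw [isTangent_iff hqM d1', d2'] at f1
      exact f1
    have e2 : (L (1, 0)).2 = 0 := by
      apply Complex.ext
      · have := e1 (Complex.I • ((1 : ℂ), (0 : ℂ))) (by simp)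
        rw [map_smul] at this
        simpa using this
      · simpa using e1 (1, 0) (by simp)
    refine ⟨(L (0, 1)).2, fun X => ?_⟩
    have e3 : X = X.1 • ((1 : ℂ), (0 : ℂ)) + X.2 • ((0 : ℂ), (1 : ℂ)) := by
      ext1 <;> simp
    conv_lhs => rw [e3, map_add, map_smul, map_smul]
    simp [e2, mul_comm]
  have hE2 : (fun x => (K (graphPoint F x)).2.im - Complex.normSq (K (graphPoint F x)).1)
      =O[𝓝 0] fun x => ‖x.1‖ ^ 6 + |x.2| ^ 3 := by
    have hgt := tendsto_graphPoint hF.1 hF0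
    have tK : Tendsto (fun x => K (graphPoint F x)) (𝓝 0) (𝓝 0) := by
      have := hKa.continuousAt.tendsto
      rw [hK0] at this
      exact this.comp hgt
    have tx : Tendsto (fun x => ((K (graphPoint F x)).1, (K (graphPoint F x)).2.re)) (𝓝 0)
        (𝓝 (0 : ℂ × ℝ)) := by
      have : ContinuousAt (fun y : ℂ × ℂ => (y.1, y.2.re)) 0 := by fun_prop
      exact this.tendsto.comp tK
    have e1 : (fun x => F' ((K (graphPoint F x)).1, (K (graphPoint F x)).2.re)
        - Complex.normSq (K (graphPoint F x)).1) =O[𝓝 0]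
        fun x => ‖(K (graphPoint F x)).1‖ ^ 6 + |(K (graphPoint F x)).2.re| ^ 3 :=
      hE'.comp_tendsto tx
    have e2 := isBigO_comp_graphPoint hKa hK0 hKd hb hF.1 hF0 hdF
    refine isBigO_weightSize_pow_six_iff.2 ?_
    refine (e1.trans e2).congr' ?_ EventuallyEq.rfl
    filter_upwards [(h.tendsto_symm.comp hgt).eventually hF'.2, hF.eventually_mem h hF0] with x f1 f2
    simp only [hK]
    simp only [Function.comp] at f1
    rw [← f1.1 f2.1]
  have hL10 : (L (1, 0)).1 ≠ 0 := by
    intro e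
    have e1 : L (1, 0) = 0 := by
      ext1
      · exact e
      · rw [hb]; simp
    have := hLinj _ e1
    simp at this
  obtain ⟨α, β, γ, hT, hα0, hα1, hβ, hγ⟩ := second_order_rigidity (f := fun x => (K x).1)
    (g := fun x => (K x).2) (analyticAt_fst_comp hKa) (analyticAt_snd_comp hKa)
    (by simp only [hK0]; rfl) (by simp only [hK0]; rfl)
    (L := (ContinuousLinearMap.fst ℂ ℂ ℂ) ∘L L) hKd.fst hL10 hL01 hE hE2
  set z : ℝ → ℂ := fun s => (Φ (c s)).1 with hzd
  set w : ℝ → ℂ := fun s => (Φ (c s)).2 with hwd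
  have t1 : Tendsto (fun s : ℝ => s - t) (𝓝 t) (𝓝 0) := by
    have : ContinuousAt (fun s : ℝ => s - t) t := by fun_prop
    simpa using this.tendsto
  have oz : z =O[𝓝 t] fun s => (s - t) ^ 2 := by
    have e2 : (fun s : ℝ => z₂ / 2 * ((s - t : ℝ) : ℂ) ^ 2) =O[𝓝 t] fun s => (s - t) ^ 2 :=
      IsBigO.of_bound ‖z₂ / 2‖ (Eventually.of_forall fun s => by
        rw [norm_mul, norm_pow, norm_pow, Complex.norm_real])
    refine ((IsLittleO.isBigO jz).add e2).congr_left fun s => ?_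
    ring
  have tz : Tendsto z (𝓝 t) (𝓝 0) := oz.trans_tendsto (by simpa using t1.pow 2)
  have ow := jw.isBigO_sub
  have tw : Tendsto w (𝓝 t) (𝓝 0) := ow.trans_tendsto t1
  have hN3 : (fun s => ‖z s‖ ^ 6 + ‖w s‖ ^ 3) =o[𝓝 t] fun s => (s - t) ^ 2 := by
    refine IsBigO.trans_isLittleO (IsBigO.add ?_ ?_) isLittleO_cube
    · refine (oz.norm_left.pow 6).trans ?_
      have := ((t1.pow 9).isBigO_one ℝ).mul (isBigO_refl (fun s : ℝ => (s - t) ^ 3) (𝓝 t))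
      refine (this.congr_left fun s => ?_).congr_right fun s => ?_
      · ring
      · ring
    · exact ow.norm_left.pow 3
  have e1 := (hT.comp_tendsto (tz.prodMk_nhds tw)).trans_isLittleO hN3
  set m : ℝ → ℂ := fun s => z s * (α 2 + α 3 * z s + α 4 * z s ^ 2 + α 5 * z s ^ 3)
    + w s * (β 1 + β 2 * z s + β 3 * z s ^ 2) + w s ^ 2 * γ 1 with hm
  have tm : Tendsto m (𝓝 t) (𝓝 0) := by
    have := ((tz.mul ((((tendsto_const_nhds (x := α 2)).add (tz.const_mul (α 3))).add
      ((tz.pow 2).const_mul (α 4))).add ((tz.pow 3).const_mul (α 5)))).add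
      (tw.mul (((tendsto_const_nhds (x := β 1)).add (tz.const_mul (β 2))).add
        ((tz.pow 2).const_mul (β 3))))).add ((tw.pow 2).mul_const (γ 1))
    simpa using this
  have e2 := oz.mul_isLittleO ((isLittleO_one_iff ℝ).2 tm)
  simp only [mul_one] at e2
  have e3 := IsLittleO.const_mul_left jz (α 1)
  have e4 : HasTwoJet (fun s => (Φ' (c s)).1) t 0 (α 1 * (z₂ / 2)) := by
    refine ((e1.add e2).add e3).congr' ?_ EventuallyEq.rfl
    filter_upwards [tc.eventually h.eventually_apply_symm] with s hs
    have e5 : K (z s, w s) = Φ' (c s) := by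
      simp only [hK, hzd, hwd, Prod.mk.eta]
      rw [hs]
    simp only [Function.comp, hm, e5, Finset.sum_range_succ, Finset.sum_range_zero, hα0, hβ, hγ]
    ring
  have e5 := (e4.unique jz').2
  simpa [hα1] using e5

theorem polynomial_change_identity (z k κ : ℂ) (u N η r₀ : ℝ) (hN : N = Complex.normSq z)
    (hκ : k = -conj κ / 4) :
    let w₀ : ℂ := u + Complex.I * N
    let w : ℂ := w₀ + Complex.I * η
    let A : ℂ → ℂ := fun w => -(Complex.I * r₀ / 2) * z * w + k * w ^ 2 +
      4 * Complex.I * conj k * z ^ 2 * w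
    (w + 2 * Complex.I * conj k * z * w ^ 2).im - Complex.normSq (z + A w) =
      (η - N ^ 2 * (r₀ + 2 * (κ * z).re))
      + (2 * Complex.I * conj k * z * (2 * w₀ * (Complex.I * η) + (Complex.I * η) ^ 2)).im
      - 2 * (conj z * (A w - A w₀)).re - Complex.normSq (A w) := by
  intro w₀ w A
  have h1 : (w₀ + 2 * Complex.I * conj k * z * w₀ ^ 2).im - N - 2 * (conj z * A w₀).re =
      - N ^ 2 * (r₀ + 2 * (κ * z).re) := by
    simp only [w₀, A, hN, hκ, Complex.normSq_apply]
    have e3 : (2 : ℂ) * Complex.I * conj (-conj κ / 4) = -(Complex.I * κ / 2) := by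
      rw [map_div₀, map_neg, Complex.conj_conj, map_ofNat]; ring
    have e4 : (4 : ℂ) * Complex.I * conj (-conj κ / 4) = -(Complex.I * κ) := by
      rw [map_div₀, map_neg, Complex.conj_conj, map_ofNat]; ring
    rw [e3, e4]
    have e5 : ∀ x : ℂ, x / 2 = ((1 / 2 : ℝ) : ℂ) * x := fun x => by push_cast; ring
    have e6 : ∀ x : ℂ, x / 4 = ((1 / 4 : ℝ) : ℂ) * x := fun x => by push_cast; ring
    rw [e5, e5, e6]
    simp only [sq, Complex.mul_re, Complex.mul_im,
      Complex.neg_re, Complex.neg_im,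
      Complex.add_re, Complex.add_im, Complex.conj_re, Complex.conj_im,
      Complex.ofReal_re, Complex.ofReal_im, Complex.I_re, Complex.I_im]
    ring
  have h2 : Complex.normSq (z + A w) = N + 2 * (conj z * A w).re + Complex.normSq (A w) := by
    rw [Complex.normSq_add, hN]
    have : (z * conj (A w)).re = (conj z * A w).re := by
      simp only [Complex.mul_re, Complex.conj_re, Complex.conj_im]; ring
    rw [this]; ring
  have h3 : (conj z * (A w - A w₀)).re = (conj z * A w).re - (conj z * A w₀).re := by
    rw [mul_sub, Complex.sub_re]
  have h4 : (w + 2 * Complex.I * conj k * z * w ^ 2).im =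
      (w₀ + 2 * Complex.I * conj k * z * w₀ ^ 2).im + η +
      (2 * Complex.I * conj k * z * (2 * w₀ * (Complex.I * η) + (Complex.I * η) ^ 2)).im := by
    have : w + 2 * Complex.I * conj k * z * w ^ 2 = (w₀ + 2 * Complex.I * conj k * z * w₀ ^ 2)
      + Complex.I * η + 2 * Complex.I * conj k * z * (2 * w₀ * (Complex.I * η) + (Complex.I * η) ^ 2) := by
      simp only [w]; ring
    rw [this, Complex.add_im, Complex.add_im]
    simp
  rw [h2, h3, h4]
  linear_combination h1

/-- In coordinates in which `M` is `v = |z|² + |z|⁴ (r₀ + 2 Re (κ z)) + O(6)` and in which a curve is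
tangent to the `u`-axis, the chain condition is a second order condition on the curve. -/
theorem chain_condition_iff (h : IsHolomorphicChartAt Φ q) (hF : IsGraphedBy M q Φ F)
    {r₀ : ℝ} {κ : ℂ}
    (hE : (fun x : ℂ × ℝ => F x - Complex.normSq x.1
      - Complex.normSq x.1 ^ 2 * (r₀ + 2 * (κ * x.1).re)) =O[𝓝 0] fun x => weightSize x ^ 6)
    (hc : ContDiffAt ℝ 2 c t)
    (hq : c t = q) (hM : ∀ᶠ s in 𝓝 t, c s ∈ M) (hT : IsCRTransversal M q (deriv c t))
    (h1 : deriv (fun s => (Φ (c s)).1) t = 0) :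
    (∃ Φ' : OpenPartialHomeomorph (ℂ × ℂ) (ℂ × ℂ), IsNormalizingAt M q Φ' ∧
        JetInChainLocus (fun s => Φ' (c s)) t) ↔
      deriv (deriv fun s => (Φ (c s)).1) t = conj κ / 2 * (deriv (fun s => (Φ (c s)).2) t) ^ 2 := by
  set N : ℂ × ℝ → ℝ := fun x => Complex.normSq x.1 with hN
  have oz : (fun x : ℂ × ℝ => x.1) =O[𝓝 0] weightSize := isBigO_fst_weightSize
  have ou : (fun x : ℂ × ℝ => (x.2 : ℂ)) =O[𝓝 0] fun x => weightSize x ^ 2 :=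
    isBigO_norm_left.1 (by simpa using isBigO_snd_weightSize.norm_left)
  have oN : N =O[𝓝 0] fun x => weightSize x ^ 2 := by
    refine (oz.norm_left.pow 2).congr_left fun x => ?_
    simp only [hN, Complex.normSq_eq_norm_sq]
  set η : ℂ × ℝ → ℝ := fun x => F x - N x with hη
  have oη : η =O[𝓝 0] fun x => weightSize x ^ 4 := by
    have e1 : (fun x : ℂ × ℝ => r₀ + 2 * (κ * x.1).re) =O[𝓝 0] fun _ => (1 : ℝ) := by
      have : Continuous fun x : ℂ × ℝ => r₀ + 2 * (κ * x.1).re := by fun_prop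
      exact (this.tendsto 0).isBigO_one ℝ
    have e2 := (oN.pow 2).mul e1
    have e3 := (hE.trans (isBigO_weightSize_pow (m := 4) (n := 6) (by norm_num))).add
      (e2.trans (IsBigO.of_bound 1 (Eventually.of_forall fun x => by
        rw [← pow_mul]; simp)))
    refine e3.congr_left fun x => ?_
    simp only [hη, hN]
    ring
  have tws := tendsto_weightSize
  have lift : ∀ {m n : ℕ}, m ≤ n → (fun x => weightSize x ^ n) =O[𝓝 0] fun x => weightSize x ^ m :=
    fun h => isBigO_weightSize_pow h
  have hF2 : F =O[𝓝 0] fun x => ‖x‖ ^ 2 := by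
    have e0 : Continuous fun x : ℂ × ℝ => 1 + Complex.normSq x.1 * (r₀ + 2 * (κ * x.1).re) := by
      have := Complex.continuous_normSq
      fun_prop
    have e1 := isBigO_normSq_fst.mul ((e0.tendsto 0).isBigO_one ℝ)
    simp only [mul_one] at e1
    refine (((isBigO_weightSize_pow_six_iff.2 hE).trans isBigO_norm_sq_of_pow_six).add e1).congr_left
      fun x => ?_
    ring
  set k : ℂ := -conj κ / 4 with hk
  set A : ℂ → ℂ → ℂ := fun z w => -(Complex.I * r₀ / 2) * z * w + k * w ^ 2 +
      4 * Complex.I * conj k * z ^ 2 * w with hA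
  set H : ℂ × ℂ → ℂ × ℂ := fun x => (x.1 + A x.1 x.2, x.2 + 2 * Complex.I * conj k * x.1 * x.2 ^ 2)
    with hH
  have hHa : AnalyticAt ℂ H 0 := by
    simp only [hH, hA]
    exact AnalyticAt.prod (by fun_prop) (by fun_prop)
  have hH0 : H 0 = 0 := by simp [hH, hA]
  have hHd : HasFDerivAt H (ContinuousLinearMap.id ℂ (ℂ × ℂ)) 0 := by
    have key : ∀ {f g : ℂ × ℂ → ℂ}, DifferentiableAt ℂ f 0 → DifferentiableAt ℂ g 0 → f 0 = 0 →
        g 0 = 0 → HasFDerivAt (fun x => f x * g x) (0 : ℂ × ℂ →L[ℂ] ℂ) 0 := by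
      intro f g hf hg hf0 hg0
      refine HasFDerivAt.congr_fderiv (f := fun x => f x * g x)
        (hf.hasFDerivAt.mul hg.hasFDerivAt) ?_
      rw [hf0, hg0]
      ext <;> simp
    have e1 : HasFDerivAt (fun x : ℂ × ℂ => A x.1 x.2) (0 : ℂ × ℂ →L[ℂ] ℂ) 0 := by
      refine (key (f := fun x => x.2) (g := fun x => -(Complex.I * r₀ / 2) * x.1 + k * x.2 +
        4 * Complex.I * conj k * x.1 ^ 2) (by fun_prop) (by fun_prop) rfl (by simp)).congr_of_eventuallyEq
        (Eventually.of_forall fun x => ?_)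
      simp only [hA]
      ring
    have e2 : HasFDerivAt (fun x : ℂ × ℂ => 2 * Complex.I * conj k * x.1 * x.2 ^ 2)
        (0 : ℂ × ℂ →L[ℂ] ℂ) 0 := by
      refine (key (f := fun x => x.2) (g := fun x => 2 * Complex.I * conj k * x.1 * x.2)
        (by fun_prop) (by fun_prop) rfl (by simp)).congr_of_eventuallyEq
        (Eventually.of_forall fun x => ?_)
      ring
    have e3 := (hasFDerivAt_fst (p := (0 : ℂ × ℂ)) (𝕜 := ℂ)).add e1
    have e4 := (hasFDerivAt_snd (p := (0 : ℂ × ℂ)) (𝕜 := ℂ)).add e2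
    refine HasFDerivAt.congr_fderiv (e3.prodMk e4) ?_
    ext <;> simp
  set W₀ : ℂ × ℝ → ℂ := fun x => x.2 + Complex.I * N x with hW₀
  set W : ℂ × ℝ → ℂ := fun x => W₀ x + Complex.I * η x with hW
  have oNc : (fun x => Complex.I * (N x : ℂ)) =O[𝓝 0] fun x => weightSize x ^ 2 := by
    refine IsBigO.const_mul_left (isBigO_norm_left.1 ?_) _
    simpa using oN.norm_left
  have oηc : (fun x => Complex.I * (η x : ℂ)) =O[𝓝 0] fun x => weightSize x ^ 4 := by
    refine IsBigO.const_mul_left (isBigO_norm_left.1 ?_) _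
    simpa using oη.norm_left
  have oW₀ : W₀ =O[𝓝 0] fun x => weightSize x ^ 2 := ou.add oNc
  have oW : W =O[𝓝 0] fun x => weightSize x ^ 2 := oW₀.add (oηc.trans (lift (by norm_num)))
  have hgp : ∀ x, graphPoint F x = (x.1, W x) := by
    intro x
    rw [graphPoint_apply]
    simp only [hW, hW₀, hη]
    ext1
    · rfl
    · push_cast; ring
  have oA : (fun x => A x.1 (W x)) =O[𝓝 0] fun x => weightSize x ^ 3 := by
    have a1 := (oz.mul oW).const_mul_left (-(Complex.I * r₀ / 2))
    have a2 := ((oW.pow 2).const_mul_left k)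
    have a3 := ((oz.pow 2).mul oW).const_mul_left (4 * Complex.I * conj k)
    simp only [← pow_mul, ← pow_succ', ← pow_add] at a1 a2 a3
    refine ((a1.add (a2.trans (lift (by norm_num)))).add (a3.trans (lift (by norm_num)))).congr_left
      fun x => ?_
    simp only [hA]
    ring
  have oA' : (fun x => A x.1 (W x) - A x.1 (W₀ x)) =O[𝓝 0] fun x => weightSize x ^ 5 := by
    have a1 := oz.const_mul_left (-(Complex.I * r₀ / 2))
    have a2 := ((oW₀.add oW).const_mul_left k).trans (lift (m := 1) (by norm_num))
    have a3 := ((oz.pow 2).const_mul_left (4 * Complex.I * conj k)).trans (lift (m := 1) (by norm_num))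
    simp only [pow_one] at a2 a3
    have a4 := oηc.mul ((a1.add a2).add a3)
    simp only [← pow_succ] at a4
    refine a4.congr_left fun x => ?_
    simp only [hA, hW]
    ring
  have im_le : ∀ {f : ℂ × ℝ → ℂ} {g : ℂ × ℝ → ℝ}, f =O[𝓝 0] g → (fun x => (f x).im) =O[𝓝 0] g :=
    fun hf => (IsBigO.of_bound 1 (Eventually.of_forall fun x => by
      rw [one_mul]; exact Complex.abs_im_le_norm _)).trans hf
  have re_le : ∀ {f : ℂ × ℝ → ℂ} {g : ℂ × ℝ → ℝ}, f =O[𝓝 0] g → (fun x => (f x).re) =O[𝓝 0] g :=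
    fun hf => (IsBigO.of_bound 1 (Eventually.of_forall fun x => by
      rw [one_mul]; exact Complex.abs_re_le_norm _)).trans hf
  have hHE : (fun x => (H (graphPoint F x)).2.im - Complex.normSq (H (graphPoint F x)).1)
      =O[𝓝 0] fun x => weightSize x ^ 6 := by
    have b1 : (fun x => (2 * Complex.I * conj k * x.1 * (2 * W₀ x * (Complex.I * η x)
        + (Complex.I * η x) ^ 2)).im) =O[𝓝 0] fun x => weightSize x ^ 6 := by
      refine im_le ?_
      have c1 := (oW₀.mul oηc).const_mul_left 2
      have c2 := oηc.pow 2
      simp only [← pow_mul, ← pow_add] at c1 c2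
      have c3 := (oz.const_mul_left (2 * Complex.I * conj k)).mul
        (c1.add (c2.trans (lift (by norm_num))))
      simp only [← pow_succ'] at c3
      refine (c3.trans (lift (by norm_num))).congr_left fun x => ?_
      ring
    have b2 : (fun x => 2 * (conj x.1 * (A x.1 (W x) - A x.1 (W₀ x))).re) =O[𝓝 0]
        fun x => weightSize x ^ 6 := by
      refine IsBigO.const_mul_left (re_le ?_) 2
      have c1 : (fun x : ℂ × ℝ => conj x.1) =O[𝓝 0] weightSize :=
        isBigO_norm_left.1 (by simpa using oz.norm_left)
      have c2 := c1.mul oA'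
      simpa only [← pow_succ'] using c2
    have b3 : (fun x => Complex.normSq (A x.1 (W x))) =O[𝓝 0] fun x => weightSize x ^ 6 := by
      have c1 := oA.norm_left.pow 2
      simp only [← pow_mul] at c1
      exact c1.congr_left fun x => (Complex.normSq_eq_norm_sq _).symm
    have b0 : (fun x => η x - N x ^ 2 * (r₀ + 2 * (κ * x.1).re)) =O[𝓝 0]
        fun x => weightSize x ^ 6 := hE
    refine (((b0.add b1).sub b2).sub b3).congr_left fun x => ?_
    rw [hgp]
    exact (polynomial_change_identity x.1 k κ x.2 (N x) (η x) r₀ rfl hk).symm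
  obtain ⟨Φ₁, hN₁, hΦ₁⟩ := exists_isNormalizingAt h hF hF2 hHa hH0 hHd (fun X hX => hX)
    (fun X => rfl) hHE
  have hct : Φ (c t) = 0 := by rw [hq, h.map_center]
  obtain ⟨hz, -⟩ := h.curve_fst hc hq
  obtain ⟨hw, -⟩ := h.curve_snd hc hq
  obtain ⟨hz₁, -⟩ := hN₁.1.curve_fst hc hq
  have jz := hasTwoJet_of_contDiffAt hz (by rw [hct]; rfl)
  have jw := hasTwoJet_of_contDiffAt hw (by rw [hct]; rfl)
  have jz₁ := hasTwoJet_of_contDiffAt hz₁ (by rw [hq, hN₁.1.map_center]; rfl)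
  set w₁ := deriv (fun s => (Φ (c s)).2) t with hw₁
  set w₂ := deriv (deriv fun s => (Φ (c s)).2) t with hw₂
  set z₂ := deriv (deriv fun s => (Φ (c s)).1) t with hz₂
  rw [h1] at jz
  set z : ℝ → ℂ := fun s => (Φ (c s)).1 with hzd
  set w : ℝ → ℂ := fun s => (Φ (c s)).2 with hwd
  have t1 : Tendsto (fun s : ℝ => s - t) (𝓝 t) (𝓝 0) := by
    have : ContinuousAt (fun s : ℝ => s - t) t := by fun_prop
    simpa using this.tendsto
  have osq : ∀ b : ℂ, (fun s : ℝ => b * ((s - t : ℝ) : ℂ) ^ 2) =O[𝓝 t] fun s => (s - t) ^ 2 :=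
    fun b => IsBigO.of_bound ‖b‖ (Eventually.of_forall fun s => by
        rw [norm_mul, norm_pow, norm_pow, Complex.norm_real])
  have oz' : z =O[𝓝 t] fun s => (s - t) ^ 2 := by
    refine ((IsLittleO.isBigO jz).add (osq (z₂ / 2))).congr_left fun s => ?_
    ring
  have ow := jw.isBigO_sub
  have tz : Tendsto z (𝓝 t) (𝓝 0) := oz'.trans_tendsto (by simpa using t1.pow 2)
  have tw : Tendsto w (𝓝 t) (𝓝 0) := ow.trans_tendsto t1
  have jA : HasTwoJet (fun s => (Φ₁ (c s)).1) t 0 (z₂ / 2 + k * w₁ ^ 2) := by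
    have f1 : (fun s => z s * (w s * (-(Complex.I * r₀ / 2) + 4 * Complex.I * conj k * z s))) =o[𝓝 t]
        fun s => (s - t) ^ 2 := by
      have : Tendsto (fun s => w s * (-(Complex.I * r₀ / 2) + 4 * Complex.I * conj k * z s)) (𝓝 t)
          (𝓝 0) := by
        simpa using tw.mul ((tz.const_mul (4 * Complex.I * conj k)).const_add (-(Complex.I * r₀ / 2)))
      simpa using oz'.mul_isLittleO ((isLittleO_one_iff ℝ).2 this)
    have f2 : (fun s => k * (w s ^ 2 - w₁ ^ 2 * ((s - t : ℝ) : ℂ) ^ 2)) =o[𝓝 t]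
        fun s => (s - t) ^ 2 := by
      refine IsLittleO.const_mul_left ?_ k
      have g1 : (fun s => w s - w₁ * ((s - t : ℝ) : ℂ)) =O[𝓝 t] fun s => (s - t) ^ 2 := by
        refine ((IsLittleO.isBigO jw).add (osq (w₂ / 2))).congr_left fun s => ?_
        ring
      have g2 : (fun s => w s + w₁ * ((s - t : ℝ) : ℂ)) =O[𝓝 t] fun s => s - t :=
        ow.add (IsBigO.of_bound ‖w₁‖ (Eventually.of_forall fun s => by
          rw [norm_mul, Complex.norm_real]))
      have g3 := (g1.mul g2).trans_isLittleO ((isLittleO_cube (t := t)).congr_left fun s => by ring)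
      refine g3.congr_left fun s => ?_
      ring
    refine ((IsLittleO.add jz f1).add f2).congr_left fun s => ?_
    simp only [hΦ₁, hH, hA, hzd, hwd]
    ring
  obtain ⟨d1, d2⟩ := jz₁.unique jA
  have d3 : deriv (deriv fun s => (Φ₁ (c s)).1) t = z₂ - conj κ / 2 * w₁ ^ 2 := by
    rw [hk] at d2
    linear_combination 2 * d2
  constructor
  · rintro ⟨Φ', hN', hJ⟩
    obtain ⟨Φ₂, hN₂, e1, e2⟩ := exists_flat_isNormalizingAt hN' hc hq hM hT hJ
    have e3 := second_deriv_eq_zero_of_flat hN₁ hN₂ hc hq hT d1 e1 e2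
    rw [d3] at e3
    exact sub_eq_zero.1 e3
  · intro e
    refine ⟨Φ₁, hN₁, ?_⟩
    obtain ⟨h', F', hF', hE'⟩ := hN₁
    obtain ⟨hF0', hdF'⟩ := zero_and_hasFDerivAt_of_isBigO (isBigO_sq_of_normalized hE')
    obtain ⟨hw', hw1'⟩ := h'.curve_snd hc hq
    have e4 := ((hF'.isCRTransversal_iff h' hF0' hdF' _).1 hT).2
    rw [← hw1'] at e4
    obtain ⟨r1, -⟩ := deriv_clm_comp Complex.reCLM hw'
    simp only [Complex.reCLM_apply] at r1
    rw [jetInChainLocus_iff (h'.curve hc hq).1 (by rw [r1]; exact e4), d1, d3, e]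
    simp

end chainCondition
section realStructure

variable {E : Type*} [NormedAddCommGroup E] [NormedSpace ℂ E] [StarAddMonoid E] [StarModule ℂ E]
  [ContinuousStar E]

/-- The conjugate function with respect to the real structures. -/
def bar {A B : Type*} [Star A] [Star B] (f : A → B) : A → B := fun x => star (f (star x))

theorem analyticAt_bar {f : E → ℂ} {x : E} (hf : AnalyticAt ℂ f (star x)) :
    AnalyticAt ℂ (bar f) x :=
  AnalyticAt.conj_comp ((starL ℂ : E ≃L⋆[ℂ] E) : E →L⋆[ℂ] E) hf

theorem analyticAt_bar_pair {f : E → ℂ × ℂ} {x : E} (hf : AnalyticAt ℂ f (star x)) :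
    AnalyticAt ℂ (bar f) x :=
  (analyticAt_bar (analyticAt_fst_comp hf)).prod (analyticAt_bar (analyticAt_snd_comp hf))

theorem tendsto_star_zero {E : Type*} [TopologicalSpace E] [AddMonoid E] [StarAddMonoid E]
    [ContinuousStar E] : Tendsto (star : E → E) (𝓝 0) (𝓝 0) := by
  have : Continuous (star : E → E) := continuous_star
  simpa using this.tendsto 0

theorem exists_polarization {r : ℂ × ℂ → ℝ} (hr : AnalyticAt ℝ r 0) :
    ∃ R : (ℂ × ℂ) × ℂ × ℂ → ℂ, AnalyticAt ℂ R 0 ∧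
      (∀ x y, R (star y, star x) = conj (R (x, y))) ∧
      ∀ᶠ x in 𝓝 (0 : ℂ × ℂ), R (x, star x) = r x := by
  set f : (Fin 4 → ℝ) → ℝ := fun t => r (t 0 + Complex.I * t 1, t 2 + Complex.I * t 3) with hf
  have hl : AnalyticAt ℝ (fun t : Fin 4 → ℝ => ((t 0 + Complex.I * t 1 : ℂ), (t 2 + Complex.I * t 3 : ℂ)))
      0 := by
    have h : ∀ i, AnalyticAt ℝ (fun t : Fin 4 → ℝ => ((t i : ℝ) : ℂ)) 0 := fun i =>
      analyticAt_ofReal_comp ((ContinuousLinearMap.proj (R := ℝ) (φ := fun _ : Fin 4 => ℝ) i).analyticAt 0)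
    exact ((h 0).add (analyticAt_const.mul (h 1))).prod ((h 2).add (analyticAt_const.mul (h 3)))
  have hfa : AnalyticAt ℝ f 0 := AnalyticAt.fun_comp_of_eq hr hl (by simp)
  obtain ⟨g, hg, hge⟩ := exists_complexification hfa
  set ℓ : (ℂ × ℂ) × ℂ × ℂ → Fin 4 → ℂ := fun y => ![(y.1.1 + y.2.1) / 2,
    (y.1.1 - y.2.1) / (2 * Complex.I), (y.1.2 + y.2.2) / 2, (y.1.2 - y.2.2) / (2 * Complex.I)] with hℓ
  have hℓa : AnalyticAt ℂ ℓ 0 := by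
    rw [analyticAt_pi_iff]
    intro i
    fin_cases i <;> simp only [div_eq_mul_inv] <;> simp <;> fun_prop
  have hℓ0 : ℓ 0 = 0 := by
    funext i
    fin_cases i <;> simp [hℓ]
  set R₀ : (ℂ × ℂ) × ℂ × ℂ → ℂ := fun y => g (ℓ y) with hR₀
  have hR₀a : AnalyticAt ℂ R₀ 0 := AnalyticAt.fun_comp_of_eq hg hℓa hℓ0
  have hsw : AnalyticAt ℂ (fun y : (ℂ × ℂ) × ℂ × ℂ => bar R₀ (y.2, y.1)) 0 := by
    refine AnalyticAt.fun_comp_of_eq (x := 0) (y := 0) (g := bar R₀) (analyticAt_bar (by simpa using hR₀a)) ?_ rfl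
    exact analyticAt_snd.prod analyticAt_fst
  have hreal : ∀ᶠ x in 𝓝 (0 : ℂ × ℂ), R₀ (x, star x) = r x := by
    have t : Tendsto (fun x : ℂ × ℂ => (![x.1.re, x.1.im, x.2.re, x.2.im] : Fin 4 → ℝ)) (𝓝 0) (𝓝 0) := by
      have : Continuous (fun x : ℂ × ℂ => (![x.1.re, x.1.im, x.2.re, x.2.im] : Fin 4 → ℝ)) := by
        fun_prop
      have h0 := this.tendsto 0
      have e : (![(0 : ℂ × ℂ).1.re, (0 : ℂ × ℂ).1.im, (0 : ℂ × ℂ).2.re, (0 : ℂ × ℂ).2.im] : Fin 4 → ℝ) = 0 := by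
        funext i; fin_cases i <;> simp
      rwa [e] at h0
    filter_upwards [t.eventually hge] with x hx
    have e1 : ℓ (x, star x) = fun k => (((![x.1.re, x.1.im, x.2.re, x.2.im] : Fin 4 → ℝ) k : ℝ) : ℂ) := by
      have s1 : ∀ z : ℂ, (z + conj z) / 2 = z.re := fun z => by
        rw [Complex.add_conj]; push_cast; ring
      have s2 : ∀ z : ℂ, (z - conj z) / (2 * Complex.I) = z.im := fun z => by
        rw [Complex.sub_conj]; push_cast; field_simp
      funext i
      fin_cases i
      · exact s1 _
      · exact s2 _
      · exact s1 _
      · exact s2 _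
    simp only [hR₀]
    rw [e1, hx]
    simp only [hf]
    congr 2
    have s3 : ∀ z : ℂ, (z.re : ℂ) + Complex.I * z.im = z := fun z => by
      rw [mul_comm, Complex.re_add_im]
    ext1
    · exact s3 _
    · exact s3 _
  refine ⟨fun y => (R₀ y + bar R₀ (y.2, y.1)) / 2, (hR₀a.add hsw).div_const, fun x y => ?_, ?_⟩
  · simp only [bar, Prod.star_def, map_div₀, map_add, map_ofNat, Complex.star_def,
      Complex.conj_conj]
    ring
  · filter_upwards [hreal] with x hx
    have e1 : bar R₀ (star x, x) = r x := by
      have : star (star x, x) = (x, star x) := by simp [Prod.star_def]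
      rw [bar, this, hx]
      exact Complex.conj_ofReal _
    simp only [hx, e1]
    ring

end realStructure

section segre

variable {E : Type*} [NormedAddCommGroup E] [NormedSpace ℂ E] [StarAddMonoid E] [StarModule ℂ E]
  [ContinuousStar E]

/-- `R` is a polarized defining equation near `0` of a Levi nondegenerate hypersurface of `ℂ²`, and
`C` is a family of transversal curves in it, with parameters in `E`. -/
structure IsAdaptedFamily (R : (ℂ × ℂ) × ℂ × ℂ → ℂ) (C : E × ℂ → ℂ × ℂ) : Prop where
  analyticAt : AnalyticAt ℂ R 0
  symm : ∀ x y, R (star y, star x) = conj (R (x, y))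
  transversal : fderiv ℂ R 0 ((0, 1), 0) ≠ 0
  levi : ∀ g : ℂ → ℂ × ℂ, AnalyticAt ℂ g 0 → g 0 = 0 → deriv g 0 ≠ 0 →
    ¬ (fun z => R (g z, star (g z))) =O[𝓝 0] fun z => ‖z‖ ^ 3
  analyticAt_curve : AnalyticAt ℂ C 0
  curve_zero : C 0 = 0
  curve_deriv : HasDerivAt (fun s => C (0, s)) (0, 1) 0
  curve_mem : ∀ᶠ y in 𝓝 (0 : E × ℂ), R (C y, bar C y) = 0

variable {R : (ℂ × ℂ) × ℂ × ℂ → ℂ} {C : E × ℂ → ℂ × ℂ}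

theorem IsAdaptedFamily.analyticAt_bar_curve (h : IsAdaptedFamily R C) : AnalyticAt ℂ (bar C) 0 :=
  analyticAt_bar_pair (by simpa using h.analyticAt_curve)

theorem IsAdaptedFamily.bar_curve_zero (h : IsAdaptedFamily R C) : bar C 0 = 0 := by
  simp [bar, h.curve_zero]

/-- The chart whose first coordinate lines are pieces of Segre varieties through the curve. -/
theorem IsAdaptedFamily.exists_segre [CompleteSpace E] (h : IsAdaptedFamily R C) :
    ∃ T : E × ℂ × ℂ → ℂ × ℂ, AnalyticAt ℂ T 0 ∧ T 0 = 0 ∧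
      (∀ᶠ y in 𝓝 (0 : E × ℂ), T (y.1, 0, y.2) = C y) ∧
      (∀ᶠ x in 𝓝 (0 : E × ℂ × ℂ), R (T x, bar C (x.1, x.2.2)) = 0) ∧
      (fderiv ℂ T 0 (0, 1, 0)).1 = 1 := by
  set f : (E × ℂ × ℂ) × ℂ → ℂ := fun y => R ((y.1.2.1, 0) + C (y.1.1, y.2), bar C (y.1.1, y.1.2.2))
    with hf
  have hC0 : C (0, 0) = 0 := h.curve_zero
  have hbC0 : bar C (0, 0) = 0 := h.bar_curve_zero
  have hfa : AnalyticAt ℂ f (0, 0) := by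
    refine AnalyticAt.fun_comp_of_eq h.analyticAt (AnalyticAt.prod (AnalyticAt.add ?_ ?_) ?_) ?_
    · fun_prop
    · exact AnalyticAt.fun_comp_of_eq h.analyticAt_curve (by fun_prop) rfl
    · exact AnalyticAt.fun_comp_of_eq h.analyticAt_bar_curve (by fun_prop) rfl
    · simp [hC0, hbC0]
  have hR0 : R 0 = 0 := by
    have := h.curve_mem.self_of_nhds
    rwa [h.curve_zero, h.bar_curve_zero] at this
  have hf0 : f (0, 0) = 0 := by
    have e : f (0, 0) = R ((0, 0) + C (0, 0), bar C (0, 0)) := rfl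
    rw [e, hC0, hbC0, add_zero]
    exact hR0
  have hRd : HasFDerivAt R (fderiv ℂ R 0) 0 := h.analyticAt.differentiableAt.hasFDerivAt
  have hd : HasDerivAt (fun t => f (0, t)) (fderiv ℂ R 0 ((0, 1), 0)) 0 := by
    have e1 : HasDerivAt (fun t : ℂ => (((0 : ℂ), (0 : ℂ)) + C (0, t), bar C ((0 : E), 0)))
        ((0, 1), 0) 0 := (h.curve_deriv.const_add _).prodMk (hasDerivAt_const _ _)
    have e2 : (((0 : ℂ), (0 : ℂ)) + C (0, 0), bar C ((0 : E), 0)) = (0 : (ℂ × ℂ) × ℂ × ℂ) := by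
      rw [hC0, hbC0]; simp
    rw [← e2] at hRd ⊢
    exact HasFDerivAt.comp_hasDerivAt (0 : ℂ) hRd e1
  obtain ⟨Θ, hΘ, hΘ0, hΘe⟩ := exists_analyticAt_implicit hfa hf0 hd h.transversal
  have hCa : AnalyticAt ℂ (fun x : E × ℂ × ℂ => C (x.1, Θ x)) 0 :=
    AnalyticAt.fun_comp_of_eq h.analyticAt_curve (analyticAt_fst.prod hΘ) (by rw [hΘ0]; rfl)
  refine ⟨fun x => (x.2.1, 0) + C (x.1, Θ x), AnalyticAt.add (by fun_prop) hCa, ?_, ?_, ?_, ?_⟩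
  · simp [hΘ0, hC0]
  · have t : Tendsto (fun y : E × ℂ => (((y.1, (0 : ℂ), y.2) : E × ℂ × ℂ), y.2)) (𝓝 0)
        (𝓝 ((0 : E × ℂ × ℂ), (0 : ℂ))) := by
      have : Continuous (fun y : E × ℂ => (((y.1, (0 : ℂ), y.2) : E × ℂ × ℂ), y.2)) := by fun_prop
      exact this.tendsto 0
    filter_upwards [t.eventually hΘe, h.curve_mem] with y e1 e2
    have e3 : y.2 = Θ (y.1, 0, y.2) := by
      refine e1.1 ?_
      simp only [hf]
      have : (((0 : ℂ), (0 : ℂ)) : ℂ × ℂ) = 0 := rfl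
      rw [this, zero_add]
      exact e2
    simp only [← e3]
    have : (((0 : ℂ), (0 : ℂ)) : ℂ × ℂ) = 0 := rfl
    rw [this, zero_add]
  · have t : Tendsto (fun x : E × ℂ × ℂ => (x, Θ x)) (𝓝 0) (𝓝 ((0 : E × ℂ × ℂ), (0 : ℂ))) := by
      have := (continuousAt_id.prodMk hΘ.continuousAt).tendsto
      simpa [hΘ0] using this
    filter_upwards [t.eventually hΘe] with x hx
    exact hx.2 rfl
  · have e1 := hCa.differentiableAt.hasFDerivAt
    have e2 : HasFDerivAt (fun x : E × ℂ × ℂ => ((x.2.1, 0) : ℂ × ℂ))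
      (((ContinuousLinearMap.fst ℂ ℂ ℂ) ∘L (ContinuousLinearMap.snd ℂ E (ℂ × ℂ))).prod 0) 0 :=
      ((hasFDerivAt_fst.comp (0 : E × ℂ × ℂ) hasFDerivAt_snd).prodMk (hasFDerivAt_const _ _))
    have e3 := (e2.add e1).fderiv
    have e4 : fderiv ℂ (fun x : E × ℂ × ℂ => C (x.1, Θ x)) 0 (0, 1, 0) =
        (fderiv ℂ Θ 0 (0, 1, 0)) • ((0 : ℂ), (1 : ℂ)) := by
      have l1 : HasDerivAt (fun t : ℂ => ((0 : E), t, (0 : ℂ))) (0, 1, 0) 0 :=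
        (hasDerivAt_const _ _).prodMk ((hasDerivAt_id _).prodMk (hasDerivAt_const _ _))
      have l2 := HasFDerivAt.comp_hasDerivAt (0 : ℂ) (f := fun t : ℂ => ((0 : E), t, (0 : ℂ))) e1 l1
      have l3 := HasFDerivAt.comp_hasDerivAt (0 : ℂ) (f := fun t : ℂ => ((0 : E), t, (0 : ℂ)))
        hΘ.differentiableAt.hasFDerivAt l1
      have l4 : HasDerivAt (fun s => C (0, s)) (0, 1) ((Θ ∘ fun t : ℂ => ((0 : E), t, (0 : ℂ))) 0) := by
        have : (Θ ∘ fun t : ℂ => ((0 : E), t, (0 : ℂ))) 0 = 0 := hΘ0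
        rw [this]
        exact h.curve_deriv
      exact l2.unique (HasDerivAt.scomp (0 : ℂ) l4 l3)
    have e5 : (fun x : E × ℂ × ℂ => (x.2.1, (0 : ℂ)) + C (x.1, Θ x)) =
      (fun x : E × ℂ × ℂ => ((x.2.1, 0) : ℂ × ℂ)) + (fun x : E × ℂ × ℂ => C (x.1, Θ x)) := rfl
    rw [e5, e3, add_apply, e4]
    simp

end segre

section graph

variable {E : Type*} [NormedAddCommGroup E] [NormedSpace ℂ E] [StarAddMonoid E] [StarModule ℂ E]
  [ContinuousStar E]

/-- The real structure of `E × ℂ³`, `(μ, z, ζ, s) ↦ (μ̄, ζ̄, z̄, s̄)`; its real points are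
`(μ, z, z̄, s)` with real `μ` and `s`. -/
noncomputable def swapConj : E × ℂ × ℂ × ℂ →L⋆[ℂ] E × ℂ × ℂ × ℂ :=
  ((starL ℂ : (E × ℂ × ℂ × ℂ) ≃L⋆[ℂ] (E × ℂ × ℂ × ℂ)) :
    (E × ℂ × ℂ × ℂ) →L⋆[ℂ] (E × ℂ × ℂ × ℂ)).comp
  ((ContinuousLinearMap.fst ℂ E (ℂ × ℂ × ℂ)).prod
    (((ContinuousLinearMap.fst ℂ ℂ ℂ).comp
      ((ContinuousLinearMap.snd ℂ ℂ (ℂ × ℂ)).comp (ContinuousLinearMap.snd ℂ E (ℂ × ℂ × ℂ)))).prod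
    (((ContinuousLinearMap.fst ℂ ℂ (ℂ × ℂ)).comp (ContinuousLinearMap.snd ℂ E (ℂ × ℂ × ℂ))).prod
    ((ContinuousLinearMap.snd ℂ ℂ ℂ).comp
      ((ContinuousLinearMap.snd ℂ ℂ (ℂ × ℂ)).comp (ContinuousLinearMap.snd ℂ E (ℂ × ℂ × ℂ)))))))

theorem swapConj_apply (x : E × ℂ × ℂ × ℂ) :
    swapConj x = (star x.1, conj x.2.2.1, conj x.2.1, conj x.2.2.2) := rfl

/-- The average of `f` and its conjugate function. -/
noncomputable def symmetrization (f : E × ℂ × ℂ × ℂ → ℂ) : E × ℂ × ℂ × ℂ → ℂ :=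
  fun x => (f x + conj (f (swapConj x))) / 2

theorem swapConj_swapConj (x : E × ℂ × ℂ × ℂ) : swapConj (swapConj x) = x := by
  simp [swapConj_apply]

theorem symmetrization_swapConj (f : E × ℂ × ℂ × ℂ → ℂ) (x : E × ℂ × ℂ × ℂ) :
    symmetrization f (swapConj x) = conj (symmetrization f x) := by
  simp only [symmetrization, swapConj_swapConj, map_div₀, map_add, map_ofNat, Complex.conj_conj]
  ring

theorem analyticAt_symmetrization {f : E × ℂ × ℂ × ℂ → ℂ} (hf : AnalyticAt ℂ f 0) :
    AnalyticAt ℂ (symmetrization f) 0 := by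
  have hf' : AnalyticAt ℂ f (swapConj (0 : E × ℂ × ℂ × ℂ)) := by rw [map_zero]; exact hf
  have h : AnalyticAt ℂ (fun x => conj (f (swapConj x))) 0 :=
    AnalyticAt.conj_comp (swapConj : E × ℂ × ℂ × ℂ →L⋆[ℂ] E × ℂ × ℂ × ℂ) hf'
  exact (hf.add h).div_const

theorem tendsto_swapConj : Tendsto (swapConj : E × ℂ × ℂ × ℂ → E × ℂ × ℂ × ℂ) (𝓝 0) (𝓝 0) := by
  have := (swapConj : E × ℂ × ℂ × ℂ →L⋆[ℂ] E × ℂ × ℂ × ℂ).continuous.tendsto 0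
  simpa using this

variable {R : (ℂ × ℂ) × ℂ × ℂ → ℂ} {C : E × ℂ → ℂ × ℂ}

/-- A function vanishing on `z = 0` and on `ζ = 0` is divisible by `z ζ`. -/
theorem exists_eq_mul_mul {f : E × ℂ × ℂ × ℂ → ℂ} (hf : AnalyticAt ℂ f 0)
    (h1 : ∀ᶠ x in 𝓝 (0 : E × ℂ × ℂ × ℂ), x.2.1 = 0 → f x = 0)
    (h2 : ∀ᶠ x in 𝓝 (0 : E × ℂ × ℂ × ℂ), x.2.2.1 = 0 → f x = 0) :
    ∃ g : E × ℂ × ℂ × ℂ → ℂ, AnalyticAt ℂ g 0 ∧ ∀ᶠ x in 𝓝 0, f x = x.2.1 * x.2.2.1 * g x := by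
  set l₁ : E × ℂ × ℂ × ℂ →L[ℂ] ℂ := (ContinuousLinearMap.fst ℂ ℂ (ℂ × ℂ)).comp
      (ContinuousLinearMap.snd ℂ E (ℂ × ℂ × ℂ)) with hl₁
  set l₂ : E × ℂ × ℂ × ℂ →L[ℂ] ℂ := (ContinuousLinearMap.fst ℂ ℂ ℂ).comp
      ((ContinuousLinearMap.snd ℂ ℂ (ℂ × ℂ)).comp (ContinuousLinearMap.snd ℂ E (ℂ × ℂ × ℂ))) with hl₂
  obtain ⟨g, hg, e1⟩ := exists_eq_mul_of_eq_zero hf l₁ (e := (0, 1, 0, 0)) rfl rfl h1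
  have h3 : ∀ᶠ x in 𝓝 (0 : E × ℂ × ℂ × ℂ), l₂ x = 0 → g x = 0 := by
    have hc : ∀ᶠ x in 𝓝 (0 : E × ℂ × ℂ × ℂ), ContinuousAt g x :=
      hg.eventually_analyticAt.mono fun x hx => hx.continuousAt
    filter_upwards [hc, (e1.and h2).eventually_nhds] with x hx hev h0
    have t : Tendsto (fun t : ℂ => x + t • ((0 : E), (1 : ℂ), (0 : ℂ), (0 : ℂ))) (𝓝[≠] 0) (𝓝 x) := by
      have : Continuous (fun t : ℂ => x + t • ((0 : E), (1 : ℂ), (0 : ℂ), (0 : ℂ))) := by fun_prop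
      have h := this.tendsto 0
      rw [zero_smul, add_zero] at h
      exact h.mono_left nhdsWithin_le_nhds
    have t2 : Tendsto (fun t : ℂ => g (x + t • ((0 : E), (1 : ℂ), (0 : ℂ), (0 : ℂ)))) (𝓝[≠] 0)
        (𝓝 (g x)) := hx.tendsto.comp t
    have hne : ∀ᶠ t : ℂ in 𝓝[≠] 0, x.2.1 + t ≠ 0 := by
      by_cases hx0 : x.2.1 = 0
      · filter_upwards [self_mem_nhdsWithin] with t ht
        rw [hx0, zero_add]; exact ht
      · have : ContinuousAt (fun t : ℂ => x.2.1 + t) 0 := by fun_prop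
        exact (this.eventually_ne (by simpa using hx0)).filter_mono nhdsWithin_le_nhds
    refine tendsto_nhds_unique t2 (tendsto_const_nhds.congr' ?_)
    filter_upwards [t.eventually hev, hne] with s hs hs0
    have f0 := hs.2 (by simpa [hl₂] using h0)
    rw [hs.1] at f0
    have e3 : l₁ (x + s • ((0 : E), (1 : ℂ), (0 : ℂ), (0 : ℂ))) = x.2.1 + s := by simp [hl₁]
    rw [e3] at f0
    exact ((mul_eq_zero.1 f0).resolve_left hs0).symm
  obtain ⟨k, hk, e2⟩ := exists_eq_mul_of_eq_zero hg l₂ (e := (0, 0, 1, 0)) rfl rfl h3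
  refine ⟨k, hk, ?_⟩
  filter_upwards [e1, e2] with x f1 f2
  rw [f1, f2]
  change x.2.1 * (x.2.2.1 * k x) = _
  ring

theorem analyticAt_graphEquation (hR : AnalyticAt ℂ R 0) {T : E × ℂ × ℂ → ℂ × ℂ}
    (hT : AnalyticAt ℂ T 0) (hT0 : T 0 = 0) :
    AnalyticAt ℂ (fun y : (E × ℂ × ℂ × ℂ) × ℂ => R (T (y.1.1, y.1.2.1, y.1.2.2.2 + Complex.I * y.2),
          bar T (y.1.1, y.1.2.2.1, y.1.2.2.2 - Complex.I * y.2))) (0, 0) := by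
  have hbT : AnalyticAt ℂ (bar T) 0 := analyticAt_bar_pair (by simpa using hT)
  have hbT0 : bar T 0 = 0 := by simp [bar, hT0]
  have z1 : ((0 : E), (0 : ℂ), (0 : ℂ) + Complex.I * 0) = 0 := by simp
  have z2 : ((0 : E), (0 : ℂ), (0 : ℂ) - Complex.I * 0) = 0 := by simp
  refine AnalyticAt.fun_comp_of_eq hR (AnalyticAt.prod ?_ ?_)
    (y := 0) ?_
  · exact AnalyticAt.fun_comp_of_eq hT (by fun_prop) z1
  · exact AnalyticAt.fun_comp_of_eq hbT (by fun_prop) z2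
  · change (T ((0 : E), (0 : ℂ), (0 : ℂ) + Complex.I * 0),
      bar T ((0 : E), (0 : ℂ), (0 : ℂ) - Complex.I * 0)) = 0
    rw [z1, z2, hT0, hbT0]; rfl

/-- In the coordinates `T` the hypersurface is a graph `v = F (z, z̄, u)` with `F` divisible by
`z z̄`. -/
theorem IsAdaptedFamily.exists_graph [CompleteSpace E] (h : IsAdaptedFamily R C)
    {T : E × ℂ × ℂ → ℂ × ℂ} (hT : AnalyticAt ℂ T 0) (hT0 : T 0 = 0)
    (hTC : ∀ᶠ y in 𝓝 (0 : E × ℂ), T (y.1, 0, y.2) = C y)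
    (hTR : ∀ᶠ x in 𝓝 (0 : E × ℂ × ℂ), R (T x, bar C (x.1, x.2.2)) = 0) :
    ∃ F : E × ℂ × ℂ × ℂ → ℂ, AnalyticAt ℂ F 0 ∧ F 0 = 0 ∧
      (∀ᶠ y in 𝓝 ((0 : E × ℂ × ℂ × ℂ), (0 : ℂ)),
        R (T (y.1.1, y.1.2.1, y.1.2.2.2 + Complex.I * y.2),
          bar T (y.1.1, y.1.2.2.1, y.1.2.2.2 - Complex.I * y.2)) = 0 ↔ y.2 = F y.1) ∧
      (∀ᶠ x in 𝓝 (0 : E × ℂ × ℂ × ℂ), x.2.1 = 0 → F x = 0) ∧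
      (∀ᶠ x in 𝓝 (0 : E × ℂ × ℂ × ℂ), x.2.2.1 = 0 → F x = 0) ∧
      (∀ᶠ x in 𝓝 (0 : E × ℂ × ℂ × ℂ), F (swapConj x) = conj (F x)) := by
  set f : (E × ℂ × ℂ × ℂ) × ℂ → ℂ := fun y =>
    R (T (y.1.1, y.1.2.1, y.1.2.2.2 + Complex.I * y.2),
          bar T (y.1.1, y.1.2.2.1, y.1.2.2.2 - Complex.I * y.2)) with hf
  have hbT : AnalyticAt ℂ (bar T) 0 := analyticAt_bar_pair (by simpa using hT)
  have hbT0 : bar T 0 = 0 := by simp [bar, hT0]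
  have z1 : ((0 : E), (0 : ℂ), (0 : ℂ) + Complex.I * 0) = 0 := by simp
  have z2 : ((0 : E), (0 : ℂ), (0 : ℂ) - Complex.I * 0) = 0 := by simp
  have hR0 : R 0 = 0 := by
    have := h.curve_mem.self_of_nhds
    rwa [h.curve_zero, h.bar_curve_zero] at this
  have hfa : AnalyticAt ℂ f (0, 0) := analyticAt_graphEquation h.analyticAt hT hT0
  have hf0 : f (0, 0) = 0 := by
    change R (T ((0 : E), (0 : ℂ), (0 : ℂ) + Complex.I * 0),
        bar T ((0 : E), (0 : ℂ), (0 : ℂ) - Complex.I * 0)) = 0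
    rw [z1, z2, hT0, hbT0]; exact hR0
  have hRd : HasFDerivAt R (fderiv ℂ R 0) 0 := h.analyticAt.differentiableAt.hasFDerivAt
  have hbC' : HasDerivAt (fun s => bar C (0, s)) ((0 : ℂ), (1 : ℂ)) 0 := by
    have e0 : HasDerivAt (fun s => C (0, s)) ((0 : ℂ), (1 : ℂ)) (star 0) := by
      rw [star_zero]; exact h.curve_deriv
    have e1 := e0.star_conj
    simp only [RCLike.star_def, map_zero] at e1
    have e2 : star ((0 : ℂ), (1 : ℂ)) = (0, 1) := by simp [Prod.star_def]
    rw [e2] at e1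
    refine e1.congr_of_eventuallyEq (Eventually.of_forall fun s => ?_)
    simp [bar, Function.comp, Prod.star_def]
  have hC00 : C (0, 0) = 0 := h.curve_zero
  have hbC00 : bar C (0, 0) = 0 := h.bar_curve_zero
  have hsum : fderiv ℂ R 0 ((0, 1), 0) + fderiv ℂ R 0 (0, (0, 1)) = 0 := by
    have e1 := h.curve_deriv.prodMk hbC'
    have hRd' : HasFDerivAt R (fderiv ℂ R 0) (C (0, 0), bar C (0, 0)) := by
      rw [hC00, hbC00]; exact hRd
    have e2 := HasFDerivAt.comp_hasDerivAt (0 : ℂ) (f := fun s => (C (0, s), bar C (0, s))) hRd' e1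
    have t : Tendsto (fun s : ℂ => ((0 : E), s)) (𝓝 0) (𝓝 0) := by
      have : Continuous (fun s : ℂ => ((0 : E), s)) := by fun_prop
      exact this.tendsto 0
    have e3 := (hasDerivAt_const (0 : ℂ) (0 : ℂ)).congr_of_eventuallyEq (t.eventually h.curve_mem)
    have e4 := e2.unique e3
    have e5 : (((0 : ℂ), (1 : ℂ)), (0 : ℂ × ℂ)) + ((0 : ℂ × ℂ), ((0 : ℂ), (1 : ℂ))) =
      (((0 : ℂ), (1 : ℂ)), ((0 : ℂ), (1 : ℂ))) := by simp
    rw [← map_add, e5]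
    exact e4
  have hTd : HasDerivAt (fun t : ℂ => T (0, 0, (0 : ℂ) + Complex.I * t)) (Complex.I • ((0 : ℂ), (1 : ℂ))) 0 := by
    have e1 : HasDerivAt (fun t : ℂ => (0 : ℂ) + Complex.I * t) Complex.I 0 := by
      simpa using ((hasDerivAt_id (0 : ℂ)).const_mul Complex.I).const_add 0
    have e2 : HasDerivAt (fun s => C (0, s)) ((0 : ℂ), (1 : ℂ)) ((fun t : ℂ => (0 : ℂ) + Complex.I * t) 0) := by
      simpa using h.curve_deriv
    refine (HasDerivAt.scomp (0 : ℂ) e2 e1).congr_of_eventuallyEq ?_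
    have t : Tendsto (fun t : ℂ => ((0 : E), (0 : ℂ) + Complex.I * t)) (𝓝 0) (𝓝 0) := by
      have : Continuous (fun t : ℂ => ((0 : E), (0 : ℂ) + Complex.I * t)) := by fun_prop
      have h0 := this.tendsto 0
      simp only [mul_zero, add_zero] at h0
      exact h0
    exact t.eventually hTC
  have hbTC : ∀ᶠ y in 𝓝 (0 : E × ℂ), bar T (y.1, 0, y.2) = bar C y := by
    filter_upwards [(tendsto_star_zero (E := E × ℂ)).eventually hTC] with y hy
    simp only [bar]
    rw [← hy]
    simp [Prod.star_def]
  have hbTd : HasDerivAt (fun t : ℂ => bar T (0, 0, (0 : ℂ) - Complex.I * t))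
      ((-Complex.I) • ((0 : ℂ), (1 : ℂ))) 0 := by
    have e1 : HasDerivAt (fun t : ℂ => (0 : ℂ) - Complex.I * t) (-Complex.I) 0 := by
      simpa using ((hasDerivAt_id (0 : ℂ)).const_mul Complex.I).const_sub 0
    have e2 : HasDerivAt (fun s => bar C (0, s)) ((0 : ℂ), (1 : ℂ)) ((fun t : ℂ => (0 : ℂ) - Complex.I * t) 0) := by
      simpa using hbC'
    refine (HasDerivAt.scomp (0 : ℂ) e2 e1).congr_of_eventuallyEq ?_
    have t : Tendsto (fun t : ℂ => ((0 : E), (0 : ℂ) - Complex.I * t)) (𝓝 0) (𝓝 0) := by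
      have : Continuous (fun t : ℂ => ((0 : E), (0 : ℂ) - Complex.I * t)) := by fun_prop
      have h0 := this.tendsto 0
      simp only [mul_zero, sub_zero] at h0
      exact h0
    exact t.eventually hbTC
  have hd : HasDerivAt (fun t => f (0, t)) (2 * Complex.I * fderiv ℂ R 0 ((0, 1), 0)) 0 := by
    have hRd' : HasFDerivAt R (fderiv ℂ R 0) ((fun t : ℂ => (T (0, 0, (0 : ℂ) + Complex.I * t),
        bar T (0, 0, (0 : ℂ) - Complex.I * t))) 0) := by
      simp only
      rw [z1, z2, hT0, hbT0]; exact hRd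
    have e2 := HasFDerivAt.comp_hasDerivAt (0 : ℂ) hRd' (hTd.prodMk hbTd)
    refine e2.congr_deriv ?_
    have e3 : (Complex.I • ((0 : ℂ), (1 : ℂ)), (-Complex.I) • ((0 : ℂ), (1 : ℂ))) =
        Complex.I • (((0 : ℂ), (1 : ℂ)), (0 : ℂ × ℂ)) + (-Complex.I) • ((0 : ℂ × ℂ), ((0 : ℂ), (1 : ℂ))) := by
      simp
    rw [e3, map_add, map_smul, map_smul, smul_eq_mul, smul_eq_mul]
    linear_combination -Complex.I * hsum
  obtain ⟨F, hF, hF0, hFe⟩ := exists_analyticAt_implicit hfa hf0 hd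
    (mul_ne_zero (mul_ne_zero two_ne_zero Complex.I_ne_zero) h.transversal)
  have hbTR : ∀ᶠ x in 𝓝 (0 : E × ℂ × ℂ), R (C (x.1, x.2.2), bar T x) = 0 := by
    filter_upwards [(tendsto_star_zero (E := E × ℂ × ℂ)).eventually hTR] with x hx
    have e1 := h.symm (T (star x)) (bar C ((star x).1, (star x).2.2))
    rw [hx, map_zero] at e1
    have e2 : star (bar C ((star x).1, (star x).2.2)) = C (x.1, x.2.2) := by
      simp [bar, Prod.star_def]
    rwa [e2] at e1
  have tz : ∀ l : E × ℂ × ℂ × ℂ → (E × ℂ × ℂ × ℂ) × ℂ, Continuous l → l 0 = (0, 0) →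
      Tendsto l (𝓝 0) (𝓝 ((0 : E × ℂ × ℂ × ℂ), (0 : ℂ))) := fun l hl h0 => by
    have := hl.tendsto 0
    rwa [h0] at this
  refine ⟨F, hF, hF0, hFe, ?_, ?_, ?_⟩
  · have t1 := tz (fun x => (x, 0)) (by fun_prop) rfl
    have t2 : Tendsto (fun x : E × ℂ × ℂ × ℂ => (x.1, x.2.2)) (𝓝 0) (𝓝 (0 : E × ℂ × ℂ)) := by
      have : Continuous (fun x : E × ℂ × ℂ × ℂ => (x.1, x.2.2)) := by fun_prop
      exact this.tendsto 0
    have t3 : Tendsto (fun x : E × ℂ × ℂ × ℂ => (x.1, x.2.2.2)) (𝓝 0) (𝓝 (0 : E × ℂ)) := by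
      have : Continuous (fun x : E × ℂ × ℂ × ℂ => (x.1, x.2.2.2)) := by fun_prop
      exact this.tendsto 0
    filter_upwards [t1.eventually hFe, t2.eventually hbTR, t3.eventually hTC] with x e1 e2 e3 hx
    refine (e1.1 ?_).symm
    change R (T (x.1, x.2.1, x.2.2.2 + Complex.I * 0), bar T (x.1, x.2.2.1, x.2.2.2 - Complex.I * 0)) = 0
    rw [mul_zero, add_zero, sub_zero, hx, e3]
    exact e2
  · have t1 := tz (fun x => (x, 0)) (by fun_prop) rfl
    have t2 : Tendsto (fun x : E × ℂ × ℂ × ℂ => (x.1, x.2.1, x.2.2.2)) (𝓝 0) (𝓝 (0 : E × ℂ × ℂ)) := by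
      have : Continuous (fun x : E × ℂ × ℂ × ℂ => (x.1, x.2.1, x.2.2.2)) := by fun_prop
      exact this.tendsto 0
    have t3 : Tendsto (fun x : E × ℂ × ℂ × ℂ => (x.1, x.2.2.2)) (𝓝 0) (𝓝 (0 : E × ℂ)) := by
      have : Continuous (fun x : E × ℂ × ℂ × ℂ => (x.1, x.2.2.2)) := by fun_prop
      exact this.tendsto 0
    filter_upwards [t1.eventually hFe, t2.eventually hTR, t3.eventually hbTC] with x e1 e2 e3 hx
    refine (e1.1 ?_).symm
    change R (T (x.1, x.2.1, x.2.2.2 + Complex.I * 0), bar T (x.1, x.2.2.1, x.2.2.2 - Complex.I * 0)) = 0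
    rw [mul_zero, add_zero, sub_zero, hx, e3]
    exact e2
  · have tF : Tendsto F (𝓝 0) (𝓝 0) := by simpa [hF0] using hF.continuousAt.tendsto
    have t1 : Tendsto (fun x => (x, F x)) (𝓝 0) (𝓝 ((0 : E × ℂ × ℂ × ℂ), (0 : ℂ))) :=
      tendsto_id.prodMk_nhds tF
    have t2 : Tendsto (fun x => (swapConj x, conj (F x))) (𝓝 0) (𝓝 ((0 : E × ℂ × ℂ × ℂ), (0 : ℂ))) := by
      refine tendsto_swapConj.prodMk_nhds ?_
      have : Continuous (conj : ℂ → ℂ) := Complex.continuous_conj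
      have h0 := this.tendsto 0
      rw [map_zero] at h0
      exact h0.comp tF
    filter_upwards [t1.eventually hFe, t2.eventually hFe] with x e1 e2
    have f1 : R (T (x.1, x.2.1, x.2.2.2 + Complex.I * F x),
      bar T (x.1, x.2.2.1, x.2.2.2 - Complex.I * F x)) = 0 := e1.2 rfl
    refine (e2.1 ?_).symm
    have f2 := h.symm (T (x.1, x.2.1, x.2.2.2 + Complex.I * F x))
      (bar T (x.1, x.2.2.1, x.2.2.2 - Complex.I * F x))
    rw [f1, map_zero] at f2
    rw [← f2, swapConj_apply]
    simp only [hf]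
    congr 2
    · simp [bar, Prod.star_def]
    · simp [bar, Prod.star_def, sub_eq_add_neg]

theorem IsAdaptedFamily.graph_coeff_ne_zero (h : IsAdaptedFamily R C)
    {T : E × ℂ × ℂ → ℂ × ℂ} (hT : AnalyticAt ℂ T 0) (hT0 : T 0 = 0)
    (hT1 : (fderiv ℂ T 0 (0, 1, 0)).1 = 1) {F G : E × ℂ × ℂ × ℂ → ℂ}
    (hF : AnalyticAt ℂ F 0) (hF0 : F 0 = 0)
    (hFe : ∀ᶠ y in 𝓝 ((0 : E × ℂ × ℂ × ℂ), (0 : ℂ)),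
        R (T (y.1.1, y.1.2.1, y.1.2.2.2 + Complex.I * y.2),
          bar T (y.1.1, y.1.2.2.1, y.1.2.2.2 - Complex.I * y.2)) = 0 ↔ y.2 = F y.1)
    (hG : AnalyticAt ℂ G 0) (hFG : ∀ᶠ x in 𝓝 0, F x = x.2.1 * x.2.2.1 * G x) : G 0 ≠ 0 := by
  intro hG0
  set f : (E × ℂ × ℂ × ℂ) × ℂ → ℂ := fun y =>
    R (T (y.1.1, y.1.2.1, y.1.2.2.2 + Complex.I * y.2),
          bar T (y.1.1, y.1.2.2.1, y.1.2.2.2 - Complex.I * y.2)) with hf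
  have hfa : AnalyticAt ℂ f (0, 0) := analyticAt_graphEquation h.analyticAt hT hT0
  have l1 : HasDerivAt (fun t : ℂ => ((0 : E), t, (0 : ℂ))) (0, 1, 0) 0 :=
    (hasDerivAt_const _ _).prodMk ((hasDerivAt_id _).prodMk (hasDerivAt_const _ _))
  have l2 := HasFDerivAt.comp_hasDerivAt (0 : ℂ) (f := fun t : ℂ => ((0 : E), t, (0 : ℂ)))
    hT.differentiableAt.hasFDerivAt l1
  refine h.levi (fun z => T (0, z, 0)) (AnalyticAt.fun_comp_of_eq hT (by fun_prop) rfl) hT0 ?_ ?_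
  · intro h0
    have l3 : fderiv ℂ T 0 (0, 1, 0) = 0 := l2.deriv.symm.trans h0
    rw [l3] at hT1
    simp at hT1
  · set ℓ : ℂ → E × ℂ × ℂ × ℂ := fun z => (0, z, conj z, 0) with hℓ
    have tℓ : Tendsto ℓ (𝓝 0) (𝓝 0) := by
      have : Continuous ℓ := by
        have := Complex.continuous_conj
        fun_prop
      have h0 := this.tendsto 0
      have e : ℓ 0 = 0 := by simp [hℓ]
      rwa [e] at h0
    have oℓ : ℓ =O[𝓝 0] fun z => ‖z‖ := by
      refine IsBigO.of_bound 1 (Eventually.of_forall fun z => ?_)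
      simp [hℓ, Prod.norm_def]
    have oG : (fun z => G (ℓ z)) =O[𝓝 0] fun z => ‖z‖ := by
      have := hG.differentiableAt.hasFDerivAt.isBigO_sub
      simp only [hG0, sub_zero] at this
      exact (this.comp_tendsto tℓ).trans oℓ
    have oF : (fun z => F (ℓ z)) =O[𝓝 0] fun z => ‖z‖ ^ 3 := by
      have o1 : (fun z : ℂ => z * conj z) =O[𝓝 0] fun z => ‖z‖ ^ 2 :=
        IsBigO.of_bound 1 (Eventually.of_forall fun z => by simp [sq])
      refine ((o1.mul oG).congr' ?_ EventuallyEq.rfl).trans (IsBigO.of_bound 1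
        (Eventually.of_forall fun z => by rw [one_mul]; exact le_of_eq (by ring_nf)))
      filter_upwards [tℓ.eventually hFG] with z hz
      rw [hz]
    have tF : Tendsto (fun z => F (ℓ z)) (𝓝 0) (𝓝 0) := by
      have := hF.continuousAt.tendsto.comp tℓ
      rwa [hF0] at this
    have t2 : Tendsto (fun z => ((ℓ z, (0 : ℂ)), (ℓ z, F (ℓ z)))) (𝓝 0)
        (𝓝 (((0 : E × ℂ × ℂ × ℂ), (0 : ℂ)), ((0 : E × ℂ × ℂ × ℂ), (0 : ℂ)))) :=
      (tℓ.prodMk_nhds tendsto_const_nhds).prodMk_nhds (tℓ.prodMk_nhds tF)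
    have o2 := hfa.hasStrictFDerivAt.isBigO_sub.comp_tendsto t2
    have o3 : (fun z => f (ℓ z, 0)) =O[𝓝 0] fun z => F (ℓ z) := by
      refine (o2.congr' ?_ EventuallyEq.rfl).trans (IsBigO.of_bound 1
        (Eventually.of_forall fun z => by simp [Prod.norm_def]))
      filter_upwards [(tℓ.prodMk_nhds tF).eventually hFe] with z hz
      have : f (ℓ z, F (ℓ z)) = 0 := hz.2 rfl
      simp [this]
    refine (o3.trans oF).congr_left fun z => ?_
    simp [hf, hℓ, bar, Prod.star_def]

end graph

section normalizedGraph

variable {E : Type*} [NormedAddCommGroup E] [NormedSpace ℂ E] [StarAddMonoid E] [StarModule ℂ E]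
  [ContinuousStar E]

theorem eq_mul_mul_symmetrization {F G : E × ℂ × ℂ × ℂ → ℂ}
    (hFG : ∀ᶠ x in 𝓝 0, F x = x.2.1 * x.2.2.1 * G x)
    (hFs : ∀ᶠ x in 𝓝 (0 : E × ℂ × ℂ × ℂ), F (swapConj x) = conj (F x)) :
    ∀ᶠ x in 𝓝 0, F x = x.2.1 * x.2.2.1 * symmetrization G x := by
  filter_upwards [hFG, hFs, tendsto_swapConj.eventually hFG] with x h1 h2 h3
  have h4 : F x = x.2.1 * x.2.2.1 * conj (G (swapConj x)) := by
    rw [h3] at h2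
    have := congrArg conj h2
    simp only [Complex.conj_conj, map_mul, swapConj_apply] at this
    rw [← this, swapConj_apply]
    ring
  simp only [symmetrization]
  linear_combination h1 / 2 + h4 / 2

theorem tendsto_zero_of_continuous {A B : Type*} [TopologicalSpace A] [TopologicalSpace B] [Zero A]
    [Zero B] {l : A → B} (hl : Continuous l) (h0 : l 0 = 0) : Tendsto l (𝓝 0) (𝓝 0) := by
  simpa [h0] using hl.tendsto 0

/-- Rescaling of `z` by a holomorphic factor brings a graph `v = z ζ G` to the form
`v = z ζ + z² ζ² R`. -/
theorem exists_rescaling [CompleteSpace E] {F G : E × ℂ × ℂ × ℂ → ℂ} (hF : AnalyticAt ℂ F 0)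
    (hG : AnalyticAt ℂ G 0) (hG0 : G 0 ≠ 0) (hGs : ∀ x, G (swapConj x) = conj (G x))
    (hFG : ∀ᶠ x in 𝓝 0, F x = x.2.1 * x.2.2.1 * G x)
    (hFs : ∀ᶠ x in 𝓝 (0 : E × ℂ × ℂ × ℂ), F (swapConj x) = conj (F x)) :
    ∃ (ε : ℝ) (N : E × ℂ × ℂ → ℂ) (R : E × ℂ × ℂ × ℂ → ℂ), ε ^ 2 = 1 ∧ AnalyticAt ℂ N 0 ∧ N 0 ≠ 0 ∧
      AnalyticAt ℂ R 0 ∧ (∀ x, R (swapConj x) = conj (R x)) ∧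
      ∀ᶠ x in 𝓝 (0 : E × ℂ × ℂ × ℂ), swapConj x = x → ∀ Z,
        Z = x.2.1 * N (x.1, x.2.1, x.2.2.2 + Complex.I * F x) →
        ε * F x = Z * conj Z + (Z * conj Z) ^ 2 * R (x.1, Z, conj Z, ε * x.2.2.2) := by
  have hgr : ((G 0).re : ℂ) = G 0 := by
    have := hGs 0
    rw [map_zero] at this
    exact Complex.conj_eq_iff_re.1 this.symm
  set r := (G 0).re with hr
  have hr0 : r ≠ 0 := fun h => hG0 (by rw [← hgr, h]; simp)
  obtain ⟨ε, hε, hεr⟩ : ∃ ε : ℝ, ε ^ 2 = 1 ∧ 0 < ε * r := by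
    rcases lt_or_gt_of_ne hr0 with h | h
    · exact ⟨-1, by norm_num, by linarith⟩
    · exact ⟨1, by norm_num, by linarith⟩
  have hεc : (ε : ℂ) ^ 2 = 1 := by exact_mod_cast hε
  have hε0 : (ε : ℂ) ≠ 0 := fun h => by rw [h] at hεc; norm_num at hεc
  have hF0 : F 0 = 0 := by
    have := hFG.self_of_nhds
    simpa using this
  set g : E × ℂ → ℂ := fun y => ε * G (y.1, 0, 0, y.2) with hg
  have hga : AnalyticAt ℂ g 0 :=
    analyticAt_const.mul (AnalyticAt.fun_comp_of_eq hG (by fun_prop) rfl)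
  have hg0 : g 0 = ((ε * r : ℝ) : ℂ) := by
    have : g 0 = ε * G 0 := rfl
    rw [this, ← hgr]; push_cast; ring
  have hgs : ∀ᶠ y in 𝓝 (0 : E × ℂ), g y ∈ Complex.slitPlane := by
    refine hga.continuousAt.eventually_mem (Complex.isOpen_slitPlane.mem_nhds ?_)
    rw [hg0]
    exact Complex.ofReal_mem_slitPlane.2 hεr
  have hgc : ∀ y, g (star y) = conj (g y) := fun y => by
    simp only [hg, map_mul, Complex.conj_ofReal]
    rw [← hGs]
    simp [swapConj_apply]
  set S : E × ℂ → ℂ := fun y => Complex.exp (-(1 / 2) * Complex.log (g y)) with hS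
  have hSa : AnalyticAt ℂ S 0 :=
    AnalyticAt.cexp (analyticAt_const.mul (AnalyticAt.clog hga hgs.self_of_nhds))
  have hS2 : ∀ᶠ y in 𝓝 (0 : E × ℂ), g y * S y ^ 2 = 1 := by
    filter_upwards [hgs] with y hy
    have hy0 : g y ≠ 0 := Complex.slitPlane_ne_zero hy
    simp only [hS]
    rw [← Complex.exp_nat_mul]
    nth_rw 1 [← Complex.exp_log hy0]
    rw [← Complex.exp_add]
    have e0 : Complex.log (g y) + ((2 : ℕ) : ℂ) * (-(1 / 2) * Complex.log (g y)) = 0 := by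
      push_cast
      ring
    rw [e0, Complex.exp_zero]
  have hSc : ∀ᶠ y in 𝓝 (0 : E × ℂ), S (star y) = conj (S y) := by
    filter_upwards [hgs] with y hy
    simp only [hS]
    rw [hgc, Complex.log_conj _ (Complex.slitPlane_arg_ne_pi hy), ← Complex.exp_conj]
    congr 1
    simp only [map_mul, map_neg, map_div₀, map_one, map_ofNat]
  have hS0 : ∀ y, S y ≠ 0 := fun y => Complex.exp_ne_zero _
  set N : E × ℂ × ℂ → ℂ := fun y => G (y.1, y.2.1, 0, y.2.2) * S (y.1, y.2.2) with hN
  set N' : E × ℂ × ℂ → ℂ := fun y => G (y.1, 0, y.2.1, y.2.2) * S (y.1, y.2.2) with hN'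
  have hNa : AnalyticAt ℂ N 0 := by
    refine AnalyticAt.mul (AnalyticAt.fun_comp_of_eq (y := 0) hG ?_ rfl)
      (AnalyticAt.fun_comp_of_eq (y := 0) hSa ?_ rfl) <;> fun_prop
  have hN'a : AnalyticAt ℂ N' 0 := by
    refine AnalyticAt.mul (AnalyticAt.fun_comp_of_eq (y := 0) hG ?_ rfl)
      (AnalyticAt.fun_comp_of_eq (y := 0) hSa ?_ rfl) <;> fun_prop
  have hN0 : N 0 ≠ 0 := mul_ne_zero hG0 (hS0 _)
  have hN'0 : N' 0 ≠ 0 := mul_ne_zero hG0 (hS0 _)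
  have hNc : ∀ᶠ y in 𝓝 (0 : E × ℂ × ℂ), N' (star y) = conj (N y) := by
    have t : Tendsto (fun y : E × ℂ × ℂ => (y.1, y.2.2)) (𝓝 0) (𝓝 0) :=
      tendsto_zero_of_continuous (by fun_prop) rfl
    filter_upwards [t.eventually hSc] with y hy
    simp only [hN, hN', map_mul]
    rw [← hy, ← hGs]
    simp [swapConj_apply, Prod.star_def]
  set P : E × ℂ × ℂ × ℂ → ℂ := fun x => N (x.1, x.2.1, x.2.2.2 + Complex.I * F x) with hP
  set P' : E × ℂ × ℂ × ℂ → ℂ := fun x => N' (x.1, x.2.2.1, x.2.2.2 - Complex.I * F x) with hP'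
  have hPe : P 0 = N 0 := by simp only [hP, hF0]; simp; rfl
  have hP'e : P' 0 = N' 0 := by simp only [hP', hF0]; simp; rfl
  have l1a : AnalyticAt ℂ (fun x : E × ℂ × ℂ × ℂ => (x.1, x.2.1, x.2.2.2 + Complex.I * F x)) 0 := by
    fun_prop
  have l2a : AnalyticAt ℂ (fun x : E × ℂ × ℂ × ℂ => (x.1, x.2.2.1, x.2.2.2 - Complex.I * F x)) 0 := by
    fun_prop
  have l10 : ((0 : E × ℂ × ℂ × ℂ).1, (0 : E × ℂ × ℂ × ℂ).2.1,
    (0 : E × ℂ × ℂ × ℂ).2.2.2 + Complex.I * F 0) = 0 := by simp [hF0]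
  have l20 : ((0 : E × ℂ × ℂ × ℂ).1, (0 : E × ℂ × ℂ × ℂ).2.2.1,
    (0 : E × ℂ × ℂ × ℂ).2.2.2 - Complex.I * F 0) = 0 := by simp [hF0]
  have hPa : AnalyticAt ℂ P 0 := AnalyticAt.fun_comp_of_eq hNa l1a l10
  have hP'a : AnalyticAt ℂ P' 0 := AnalyticAt.fun_comp_of_eq hN'a l2a l20
  have hPc : ∀ᶠ x in 𝓝 (0 : E × ℂ × ℂ × ℂ), P' (swapConj x) = conj (P x) := by
    have t : Tendsto (fun x : E × ℂ × ℂ × ℂ => (x.1, x.2.1, x.2.2.2 + Complex.I * F x)) (𝓝 0)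
        (𝓝 0) := by
      have := l1a.continuousAt.tendsto
      rwa [l10] at this
    filter_upwards [t.eventually hNc, hFs] with x h1 h2
    simp only [hP, hP']
    rw [← h1, h2]
    congr 1
    simp [swapConj_apply, Prod.star_def, sub_eq_add_neg]
  set H : E × ℂ × ℂ × ℂ → ℂ := fun x => ε * G x - P x * P' x with hH
  have hHa : AnalyticAt ℂ H 0 := (analyticAt_const.mul hG).sub (hPa.mul hP'a)
  have tμs : Tendsto (fun x : E × ℂ × ℂ × ℂ => (x.1, x.2.2.2)) (𝓝 0) (𝓝 0) :=
    tendsto_zero_of_continuous (by fun_prop) rfl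
  obtain ⟨K, hK, hHK⟩ := exists_eq_mul_mul hHa
    (by
      filter_upwards [hFG, tμs.eventually hS2] with x h1 h2 h3
      obtain ⟨μ, z, ζ, s⟩ := x
      obtain rfl : z = 0 := h3
      have f0 : F (μ, 0, ζ, s) = 0 := by rw [h1]; simp
      simp only [hH, hP, hP', hN, hN', f0, mul_zero, add_zero, sub_zero]
      simp only [hg] at h2
      linear_combination (-ε * G (μ, 0, ζ, s)) * h2 + (G (μ, 0, ζ, s) * G (μ, 0, 0, s) *
        S (μ, s) ^ 2) * hεc)
    (by
      filter_upwards [hFG, tμs.eventually hS2] with x h1 h2 h3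
      obtain ⟨μ, z, ζ, s⟩ := x
      obtain rfl : ζ = 0 := h3
      have f0 : F (μ, z, 0, s) = 0 := by rw [h1]; simp
      simp only [hH, hP, hP', hN, hN', f0, mul_zero, add_zero, sub_zero]
      simp only [hg] at h2
      linear_combination (-ε * G (μ, z, 0, s)) * h2 + (G (μ, z, 0, s) * G (μ, 0, 0, s) *
        S (μ, s) ^ 2) * hεc)
  set m : E × ℂ × ℂ × ℂ → E × ℂ × ℂ × ℂ := fun x =>
    (x.1, x.2.1 * P x, x.2.2.1 * P' x, ε * x.2.2.2) with hm
  have hma : AnalyticAt ℂ m 0 := by fun_prop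
  have hm0 : m 0 = 0 := by simp [hm]
  set A : (E × ℂ × ℂ × ℂ) ≃L[ℂ] (E × ℂ × ℂ × ℂ) :=
    (ContinuousLinearEquiv.refl ℂ E).prodCongr
      ((ContinuousLinearEquiv.unitsEquivAut ℂ (Units.mk0 (N 0) hN0)).prodCongr
      ((ContinuousLinearEquiv.unitsEquivAut ℂ (Units.mk0 (N' 0) hN'0)).prodCongr
      (ContinuousLinearEquiv.unitsEquivAut ℂ (Units.mk0 (ε : ℂ) hε0)))) with hA
  have hmd : HasFDerivAt m (A : (E × ℂ × ℂ × ℂ) →L[ℂ] (E × ℂ × ℂ × ℂ)) 0 := by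
    have d0 : HasFDerivAt (fun x : E × ℂ × ℂ × ℂ => x) (ContinuousLinearMap.id ℂ _) 0 :=
      hasFDerivAt_id _
    have dz := d0.snd.fst
    have dζ := d0.snd.snd.fst
    have ds := d0.snd.snd.snd
    refine (d0.fst.prodMk ((dz.mul hPa.differentiableAt.hasFDerivAt).prodMk
      ((dζ.mul hP'a.differentiableAt.hasFDerivAt).prodMk (ds.const_mul (ε : ℂ))))).congr_fderiv ?_
    refine ContinuousLinearMap.ext fun x => ?_
    simp only [hA, hPe, hP'e]
    ext1
    · simp
    · simp only [Units.mk0]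
      simp [mul_comm]
      rfl
  obtain ⟨Ψ, hΨ0, hΨ, -, hΨs⟩ := exists_analytic_openPartialHomeomorph hma A hmd
  set K₁ : E × ℂ × ℂ × ℂ → ℂ := fun x => K x / (P x * P' x) ^ 2 with hK₁
  have hPP0 : (P 0 * P' 0) ^ 2 ≠ 0 := pow_ne_zero _ (mul_ne_zero (by rwa [hPe]) (by rwa [hP'e]))
  have hK₁a : AnalyticAt ℂ K₁ 0 := hK.div ((hPa.mul hP'a).pow 2) hPP0
  have hsy0 : Ψ.symm 0 = 0 := by
    have := Ψ.left_inv hΨ0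
    rwa [hΨ, hm0] at this
  have h0t : (0 : E × ℂ × ℂ × ℂ) ∈ Ψ.target := by
    have := Ψ.map_source hΨ0
    rwa [hΨ, hm0] at this
  set R₀ : E × ℂ × ℂ × ℂ → ℂ := fun x => K₁ (Ψ.symm x) with hR₀
  have hR₀a : AnalyticAt ℂ R₀ 0 := AnalyticAt.fun_comp_of_eq hK₁a (hΨs 0 h0t) hsy0
  have hmain : ∀ᶠ x in 𝓝 (0 : E × ℂ × ℂ × ℂ), ε * F x = (x.2.1 * P x) * (x.2.2.1 * P' x) +
      ((x.2.1 * P x) * (x.2.2.1 * P' x)) ^ 2 * R₀ (m x) := by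
    have hne : ∀ᶠ x in 𝓝 (0 : E × ℂ × ℂ × ℂ), (P x * P' x) ^ 2 ≠ 0 :=
      ((hPa.mul hP'a).pow 2).continuousAt.eventually_ne hPP0
    filter_upwards [hne, hHK, hFG, Ψ.open_source.mem_nhds hΨ0] with x h1 h2 h3 h4
    have e1 : R₀ (m x) = K₁ x := by
      simp only [hR₀]
      rw [← hΨ, Ψ.left_inv h4]
    rw [e1]
    simp only [hK₁, hH] at h2 ⊢
    have e2 : ((x.2.1 * P x) * (x.2.2.1 * P' x)) ^ 2 * (K x / (P x * P' x) ^ 2) =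
        (x.2.1 * x.2.2.1) ^ 2 * K x := by
      have h5 : (x.2.1 * P x * (x.2.2.1 * P' x)) ^ 2 = (x.2.1 * x.2.2.1) ^ 2 * (P x * P' x) ^ 2 := by
        ring
      rw [h5, mul_assoc, mul_div_cancel₀ _ h1]
    rw [e2]
    linear_combination (ε : ℂ) * h3 + x.2.1 * x.2.2.1 * h2
  refine ⟨ε, N, symmetrization R₀, hε, hNa, hN0, analyticAt_symmetrization hR₀a,
    symmetrization_swapConj R₀, ?_⟩
  filter_upwards [hmain, hPc, hFs] with x h1 h2 h3 hx Z hZ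
  rw [hx] at h2 h3
  have hZ1 : Z = x.2.1 * P x := hZ
  have hζ : x.2.2.1 = conj x.2.1 := by
    conv_lhs => rw [← hx]
    simp [swapConj_apply]
  have hs : x.2.2.2 = conj x.2.2.2 := by
    conv_lhs => rw [← hx]
    simp [swapConj_apply]
  have hμ : star x.1 = x.1 := by
    conv_rhs => rw [← hx]
    simp [swapConj_apply]
  have hZ2 : conj Z = x.2.2.1 * P' x := by rw [hZ1, map_mul, ← hζ, ← h2]
  have hmx : m x = (x.1, Z, conj Z, ε * x.2.2.2) := by
    simp only [hm]; rw [hZ2, hZ1]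
  have hsw : swapConj (m x) = m x := by
    rw [hmx, swapConj_apply]
    simp [hμ, ← hs]
  rw [← hmx]
  rw [← hZ1, ← hZ2] at h1
  have h4 := congrArg conj h1
  simp only [map_mul, map_add, map_pow, Complex.conj_conj, Complex.conj_ofReal, ← h3] at h4
  simp only [symmetrization, hsw]
  linear_combination h1 / 2 + h4 / 2

end normalizedGraph

section normalization

variable {E : Type*} [NormedAddCommGroup E] [NormedSpace ℂ E] [StarAddMonoid E] [StarModule ℂ E]
  [ContinuousStar E]

/-- The coordinates `(z, w) ↦ T (μ, z, w)` straighten the curves of the family `C`, and after the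
change `(z N, ε w)` the hypersurface becomes `v = z z̄ + z² z̄² Q (μ, z, z̄, u)`. -/
structure IsNormalization (R : (ℂ × ℂ) × ℂ × ℂ → ℂ) (C : E × ℂ → ℂ × ℂ) (ε : ℝ)
    (T : E × ℂ × ℂ → ℂ × ℂ) (N : E × ℂ × ℂ → ℂ) (F Q : E × ℂ × ℂ × ℂ → ℂ) : Prop where
  sq_eq_one : ε ^ 2 = 1
  analyticAt_coord : AnalyticAt ℂ T 0
  coord_zero : T 0 = 0
  coord_curve : ∀ᶠ y in 𝓝 (0 : E × ℂ), T (y.1, 0, y.2) = C y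
  coord_deriv : (fderiv ℂ T 0 (0, 1, 0)).1 = 1
  analyticAt_scale : AnalyticAt ℂ N 0
  scale_ne_zero : N 0 ≠ 0
  analyticAt_graph : AnalyticAt ℂ F 0
  graph_zero : ∀ᶠ x in 𝓝 (0 : E × ℂ × ℂ × ℂ), x.2.1 = 0 → F x = 0
  graph_symm : ∀ᶠ x in 𝓝 (0 : E × ℂ × ℂ × ℂ), F (swapConj x) = conj (F x)
  graph_iff : ∀ᶠ y in 𝓝 ((0 : E × ℂ × ℂ × ℂ), (0 : ℂ)),
    R (T (y.1.1, y.1.2.1, y.1.2.2.2 + Complex.I * y.2),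
      bar T (y.1.1, y.1.2.2.1, y.1.2.2.2 - Complex.I * y.2)) = 0 ↔ y.2 = F y.1
  analyticAt_remainder : AnalyticAt ℂ Q 0
  remainder_symm : ∀ x, Q (swapConj x) = conj (Q x)
  graph_eq : ∀ᶠ x in 𝓝 (0 : E × ℂ × ℂ × ℂ), swapConj x = x → ∀ Z,
    Z = x.2.1 * N (x.1, x.2.1, x.2.2.2 + Complex.I * F x) →
    ε * F x = Z * conj Z + (Z * conj Z) ^ 2 * Q (x.1, Z, conj Z, ε * x.2.2.2)

variable {R : (ℂ × ℂ) × ℂ × ℂ → ℂ} {C : E × ℂ → ℂ × ℂ}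

theorem IsAdaptedFamily.exists_isNormalization [CompleteSpace E] (h : IsAdaptedFamily R C) :
    ∃ (ε : ℝ) (T : E × ℂ × ℂ → ℂ × ℂ) (N : E × ℂ × ℂ → ℂ) (F Q : E × ℂ × ℂ × ℂ → ℂ),
      IsNormalization R C ε T N F Q := by
  obtain ⟨T, hT, hT0, hTC, hTR, hT1⟩ := h.exists_segre
  obtain ⟨F, hF, hF0, hFe, hF1, hF2, hFs⟩ := h.exists_graph hT hT0 hTC hTR
  obtain ⟨G, hG, hFG⟩ := exists_eq_mul_mul hF hF1 hF2
  have hFG' := eq_mul_mul_symmetrization hFG hFs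
  have hG' := analyticAt_symmetrization hG
  obtain ⟨ε, N, Q, hε, hN, hN0, hQ, hQs, hQe⟩ := exists_rescaling hF hG'
    (h.graph_coeff_ne_zero hT hT0 hT1 hF hF0 hFe hG' hFG') (symmetrization_swapConj G) hFG' hFs
  exact ⟨ε, T, N, F, Q, hε, hT, hT0, hTC, hT1, hN, hN0, hF, hF1, hFs, hFe, hQ, hQs, hQe⟩

theorem IsNormalization.eventually_exists_equiv {ε : ℝ} {T : E × ℂ × ℂ → ℂ × ℂ}
    {N : E × ℂ × ℂ → ℂ} {F Q : E × ℂ × ℂ × ℂ → ℂ} (h : IsNormalization R C ε T N F Q)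
    (hC : IsAdaptedFamily R C) :
    ∀ᶠ μ in 𝓝 (0 : E), ∃ A : (ℂ × ℂ) ≃L[ℂ] (ℂ × ℂ),
      HasFDerivAt (fun x : ℂ × ℂ => T (μ, x)) (A : (ℂ × ℂ) →L[ℂ] (ℂ × ℂ)) 0 := by
  have tμ : Tendsto (fun μ : E => (μ, (0 : ℂ × ℂ))) (𝓝 0) (𝓝 0) :=
    tendsto_zero_of_continuous (by fun_prop) rfl
  have hd : Tendsto (fun μ : E => (fderiv ℂ T (μ, (0 : ℂ × ℂ))).comp (.inr ℂ E (ℂ × ℂ))) (𝓝 0)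
      (𝓝 ((fderiv ℂ T 0).comp (.inr ℂ E (ℂ × ℂ)))) := by
    have h1 : ContinuousAt (fderiv ℂ T) 0 := h.analyticAt_coord.fderiv.continuousAt
    have h2 := h1.tendsto.comp tμ
    exact ((ContinuousLinearMap.compL ℂ (ℂ × ℂ) (E × ℂ × ℂ) (ℂ × ℂ)).flip
      (.inr ℂ E (ℂ × ℂ))).continuous.tendsto _ |>.comp h2
  have e1 : fderiv ℂ T 0 (0, 0, 1) = (0, 1) := by
    have l1 : HasDerivAt (fun t : ℂ => ((0 : E), (0 : ℂ), t)) (0, 0, 1) 0 :=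
      (hasDerivAt_const _ _).prodMk ((hasDerivAt_const _ _).prodMk (hasDerivAt_id _))
    have l2 := HasFDerivAt.comp_hasDerivAt (0 : ℂ) (f := fun t : ℂ => ((0 : E), (0 : ℂ), t))
      h.analyticAt_coord.differentiableAt.hasFDerivAt l1
    refine l2.unique (hC.curve_deriv.congr_of_eventuallyEq ?_)
    have t : Tendsto (fun s : ℂ => ((0 : E), s)) (𝓝 0) (𝓝 0) :=
      tendsto_zero_of_continuous (by fun_prop) rfl
    exact t.eventually h.coord_curve
  obtain ⟨A, hA⟩ := exists_equiv_of_injective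
    (L := (fderiv ℂ T 0).comp (.inr ℂ E (ℂ × ℂ))) (by
      intro x hx
      have e2 : ((0 : E), x) = x.1 • ((0 : E), (1 : ℂ), (0 : ℂ)) + x.2 • ((0 : E), (0 : ℂ), (1 : ℂ)) := by
        simp
      have e3 : x.1 • fderiv ℂ T 0 (0, 1, 0) + x.2 • fderiv ℂ T 0 (0, 0, 1) = 0 := by
        rw [← map_smul, ← map_smul, ← map_add, ← e2]; exact hx
      rw [e1] at e3
      have e4 := congrArg Prod.fst e3
      have e5 := congrArg Prod.snd e3
      simp only [Prod.fst_add, Prod.smul_fst, h.coord_deriv, smul_eq_mul, mul_one, mul_zero,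
        add_zero, Prod.fst_zero] at e4
      simp only [e4, zero_smul, Prod.snd_zero, zero_add, Prod.smul_snd, smul_eq_mul,
        mul_one] at e5
      exact Prod.ext e4 e5)
  rw [← hA] at hd
  filter_upwards [hd.eventually A.nhds, tμ.eventually h.analyticAt_coord.eventually_analyticAt]
    with μ h1 h2
  obtain ⟨B, hB⟩ := h1
  refine ⟨B, ?_⟩
  have e : (B : (ℂ × ℂ) →L[ℂ] (ℂ × ℂ)) = (fderiv ℂ T (μ, (0 : ℂ × ℂ))).comp (.inr ℂ E (ℂ × ℂ)) := hB
  rw [e]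
  exact HasFDerivAt.comp (g := T) (f := fun x : ℂ × ℂ => (μ, x)) (0 : ℂ × ℂ)
    h2.differentiableAt.hasFDerivAt (hasFDerivAt_prodMk_right μ (0 : ℂ × ℂ))

end normalization

section chart

variable {E : Type*} [NormedAddCommGroup E] [NormedSpace ℂ E] [StarAddMonoid E] [StarModule ℂ E]
  [ContinuousStar E]

/-- The real points `(μ, z, z̄, u)`. -/
noncomputable def realSlice (μ : E) (x : ℂ × ℝ) : E × ℂ × ℂ × ℂ := (μ, x.1, conj x.1, (x.2 : ℂ))

theorem swapConj_realSlice {μ : E} (hμ : star μ = μ) (x : ℂ × ℝ) :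
    swapConj (realSlice μ x) = realSlice μ x := by
  simp [swapConj_apply, realSlice, hμ]

theorem continuous_realSlice (μ : E) : Continuous (realSlice μ) := by
  have := Complex.continuous_conj
  unfold realSlice
  fun_prop

theorem tendsto_realSlice (μ : E) : Tendsto (realSlice μ) (𝓝 0) (𝓝 (μ, 0)) := by
  have := (continuous_realSlice μ).tendsto 0
  have e : realSlice μ 0 = (μ, 0) := by simp [realSlice]
  rwa [e] at this

theorem analyticAt_comp_realSlice {μ : E} {f : E × ℂ × ℂ × ℂ → ℂ} (hf : AnalyticAt ℂ f (μ, 0)) :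
    AnalyticAt ℝ (fun x => f (realSlice μ x)) 0 := by
  refine AnalyticAt.fun_comp_of_eq (hf.restrictScalars (𝕜 := ℝ)) (f := realSlice μ) ?_
    (by simp [realSlice])
  unfold realSlice
  fun_prop

/-- The graph function of a normalization at the real parameter `μ`. -/
noncomputable def sliceGraph (Q : E × ℂ × ℂ × ℂ → ℂ) (μ : E) (x : ℂ × ℝ) : ℝ :=
  Complex.normSq x.1 + Complex.normSq x.1 ^ 2 * (Q (realSlice μ x)).re

theorem analyticAt_normSq_comp {A : Type*} [NormedAddCommGroup A] [NormedSpace ℝ A] {f : A → ℂ}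
    {x : A} (hf : AnalyticAt ℝ f x) : AnalyticAt ℝ (fun y => Complex.normSq (f y)) x := by
  simp only [Complex.normSq_apply]
  fun_prop

theorem analyticAt_sliceGraph {Q : E × ℂ × ℂ × ℂ → ℂ} {μ : E} (hQ : AnalyticAt ℂ Q (μ, 0)) :
    AnalyticAt ℝ (sliceGraph Q μ) 0 := by
  have h1 : AnalyticAt ℝ (fun x : ℂ × ℝ => Complex.normSq x.1) 0 :=
    analyticAt_normSq_comp analyticAt_fst
  have h2 := analyticAt_re_comp (analyticAt_comp_realSlice hQ)
  exact h1.add ((h1.pow 2).mul h2)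

theorem graph_iff_of_forall_eq {ε : ℝ} (hε : ε ≠ 0) {H F : ℂ × ℝ → ℝ} {n : ℂ × ℂ → ℂ}
    (hH : AnalyticAt ℝ H 0) (hH0 : H 0 = 0) (hn : AnalyticAt ℝ n 0)
    (hF : Tendsto F (𝓝 0) (𝓝 0))
    (h : ∀ᶠ x in 𝓝 (0 : ℂ × ℝ), ε * F x = H (x.1 * n (x.1, x.2 + Complex.I * F x), ε * x.2)) :
    ∀ᶠ y in 𝓝 (0 : ℂ × ℂ), (ε * y.2.im = H (y.1 * n y, ε * y.2.re) ↔ y.2.im = F (y.1, y.2.re)) := by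
  set ψ : (ℂ × ℝ) × ℝ → ℝ := fun y =>
    ε * y.2 - H (y.1.1 * n (y.1.1, y.1.2 + Complex.I * y.2), ε * y.1.2) with hψ
  have hψa : AnalyticAt ℝ ψ (0, 0) := by
    refine AnalyticAt.sub (by fun_prop) (AnalyticAt.fun_comp_of_eq hH (AnalyticAt.prod
      (AnalyticAt.mul (by fun_prop) (AnalyticAt.fun_comp_of_eq hn (by fun_prop) (by simp)))
      (by fun_prop)) (by simp))
  have hψ0 : ψ (0, 0) = 0 := by
    have e : ψ (0, 0) = ε * 0 - H (0 * n (0, ((0 : ℝ) : ℂ) + Complex.I * (0 : ℝ)), ε * 0) := rfl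
    rw [e, zero_mul, mul_zero, sub_eq_zero]
    exact hH0.symm
  have hd : HasDerivAt (fun t => ψ (0, t)) ε 0 := by
    have e : (fun t => ψ (0, t)) = fun t => ε * t := by
      funext t
      have e : ψ (0, t) = ε * t - H (0 * n (0, ((0 : ℝ) : ℂ) + Complex.I * t), ε * 0) := rfl
      rw [e, zero_mul, mul_zero]
      have : H (0, 0) = 0 := hH0
      rw [this, sub_zero]
    rw [e]
    simpa using (hasDerivAt_id (0 : ℝ)).const_mul ε
  obtain ⟨g, hg, hg0, hge⟩ := exists_analyticAt_implicit hψa hψ0 hd hε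
  have e1 : ∀ᶠ x in 𝓝 (0 : ℂ × ℝ), F x = g x := by
    have t : Tendsto (fun x : ℂ × ℝ => (x, F x)) (𝓝 0) (𝓝 ((0 : ℂ × ℝ), (0 : ℝ))) :=
      tendsto_id.prodMk_nhds hF
    filter_upwards [t.eventually hge, h] with x h1 h2
    exact h1.1 (sub_eq_zero.2 h2)
  have t1 : Tendsto (fun y : ℂ × ℂ => (((y.1, y.2.re) : ℂ × ℝ), y.2.im)) (𝓝 0)
      (𝓝 ((0 : ℂ × ℝ), (0 : ℝ))) := tendsto_zero_of_continuous (by fun_prop) rfl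
  have t2 : Tendsto (fun y : ℂ × ℂ => ((y.1, y.2.re) : ℂ × ℝ)) (𝓝 0)
      (𝓝 (0 : ℂ × ℝ)) := tendsto_zero_of_continuous (by fun_prop) rfl
  filter_upwards [t1.eventually hge, t2.eventually e1] with y h1 h2
  rw [h2, ← h1, hψ]
  simp only
  rw [sub_eq_zero, mul_comm Complex.I, Complex.re_add_im]

theorem eventually_prodMk_zero {A B : Type*} [TopologicalSpace A] [TopologicalSpace B] [Zero A]
    [Zero B] {P : A × B → Prop} (h : ∀ᶠ x in 𝓝 (0 : A × B), P x) :
    ∀ᶠ μ in 𝓝 (0 : A), ∀ᶠ x in 𝓝 (μ, (0 : B)), P x := by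
  have t : Tendsto (fun μ : A => (μ, (0 : B))) (𝓝 0) (𝓝 0) :=
    tendsto_zero_of_continuous (by fun_prop) rfl
  exact t.eventually h.eventually_nhds

variable {R : (ℂ × ℂ) × ℂ × ℂ → ℂ} {C : E × ℂ → ℂ × ℂ} {ε : ℝ} {T : E × ℂ × ℂ → ℂ × ℂ}
    {N : E × ℂ × ℂ → ℂ} {F Q : E × ℂ × ℂ × ℂ → ℂ}

/-- The charts provided by a normalization at the real parameters. -/
theorem IsNormalization.exists_chart (h : IsNormalization R C ε T N F Q)
    (hC : IsAdaptedFamily R C) {M : Set (ℂ × ℂ)} {p : ℂ × ℂ} (L : (ℂ × ℂ) ≃L[ℂ] (ℂ × ℂ))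
    (hM : ∀ᶠ x in 𝓝 (0 : ℂ × ℂ), p + L x ∈ M ↔ R (x, star x) = 0) :
    ∀ᶠ μ in 𝓝 (0 : E), star μ = μ → ∃ Ψ Φ : OpenPartialHomeomorph (ℂ × ℂ) (ℂ × ℂ),
      IsHolomorphicChartAt Ψ (p + L (T (μ, 0))) ∧ IsHolomorphicChartAt Φ (p + L (T (μ, 0))) ∧
      IsGraphedBy M (p + L (T (μ, 0))) Φ (sliceGraph Q μ) ∧
      (∀ y, Φ y = ((Ψ y).1 * N (μ, Ψ y), ε * (Ψ y).2)) ∧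
      (∀ y ∈ Ψ.source, p + L (T (μ, Ψ y)) = y) ∧
      ∀ᶠ x in 𝓝 (0 : ℂ × ℂ), p + L (T (μ, x)) ∈ Φ.source ∧ p + L (T (μ, x)) ∈ Ψ.source ∧
        Ψ (p + L (T (μ, x))) = x := by
  have tμ : Tendsto (fun μ : E => (μ, (0 : ℂ × ℂ))) (𝓝 0) (𝓝 0) :=
    tendsto_zero_of_continuous (by fun_prop) rfl
  have tμ' : Tendsto (fun μ : E => (μ, (0 : ℂ × ℂ × ℂ))) (𝓝 0) (𝓝 0) :=
    tendsto_zero_of_continuous (by fun_prop) rfl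
  have tμ2 : Tendsto (fun μ : E => ((μ, (0 : ℂ × ℂ × ℂ)), (0 : ℂ))) (𝓝 0) (𝓝 0) :=
    tendsto_zero_of_continuous (by fun_prop) rfl
  have tT : Tendsto (fun μ : E => T (μ, (0 : ℂ × ℂ))) (𝓝 0) (𝓝 0) := by
    have := h.analyticAt_coord.continuousAt.tendsto.comp tμ
    rwa [h.coord_zero] at this
  have hε0 : ε ≠ 0 := fun h0 => by have := h.sq_eq_one; rw [h0] at this; norm_num at this
  have hεc : (ε : ℂ) ≠ 0 := by exact_mod_cast hε0
  filter_upwards [h.eventually_exists_equiv hC,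
    tμ.eventually h.analyticAt_coord.eventually_analyticAt,
    tμ.eventually h.analyticAt_scale.eventually_analyticAt,
    tμ.eventually (h.analyticAt_scale.continuousAt.eventually_ne h.scale_ne_zero),
    tμ'.eventually h.analyticAt_graph.eventually_analyticAt,
    tμ'.eventually h.analyticAt_remainder.eventually_analyticAt,
    eventually_prodMk_zero h.graph_zero, eventually_prodMk_zero h.graph_symm,
    eventually_prodMk_zero h.graph_eq, tμ2.eventually h.graph_iff.eventually_nhds,
    tT.eventually hM.eventually_nhds] with μ hA hT hN hN0 hF hQ hF0 hFs hFe hgr hMμ hμ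
  obtain ⟨A, hA⟩ := hA
  have lμ : ∀ x : ℂ × ℂ, AnalyticAt ℂ (fun x : ℂ × ℂ => (μ, x)) x := fun x => by fun_prop
  have hTμ : AnalyticAt ℂ (fun x : ℂ × ℂ => T (μ, x)) 0 :=
    AnalyticAt.fun_comp_of_eq hT (lμ 0) rfl
  have hNμ : AnalyticAt ℂ (fun x : ℂ × ℂ => N (μ, x)) 0 :=
    AnalyticAt.fun_comp_of_eq hN (lμ 0) rfl
  have hga : AnalyticAt ℂ (fun x : ℂ × ℂ => p + L (T (μ, x))) 0 :=
    analyticAt_const.add (AnalyticAt.fun_comp_of_eq ((L : (ℂ × ℂ) →L[ℂ] (ℂ × ℂ)).analyticAt _) hTμ rfl)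
  have hgd : HasFDerivAt (fun x : ℂ × ℂ => p + L (T (μ, x)))
      ((A.trans L : (ℂ × ℂ) ≃L[ℂ] (ℂ × ℂ)) : (ℂ × ℂ) →L[ℂ] (ℂ × ℂ)) 0 := by
    have := ((L : (ℂ × ℂ) →L[ℂ] (ℂ × ℂ)).hasFDerivAt.comp (0 : ℂ × ℂ) hA).const_add p
    exact this
  obtain ⟨G, hG0, hG, hGa, hGs⟩ := exists_analytic_openPartialHomeomorph hga (A.trans L) hgd
  set m : ℂ × ℂ → ℂ × ℂ := fun x => (x.1 * N (μ, x), ε * x.2) with hm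
  have hma : AnalyticAt ℂ m 0 := by fun_prop
  have hmd : HasFDerivAt m (((ContinuousLinearEquiv.unitsEquivAut ℂ (Units.mk0 (N (μ, 0)) hN0)).prodCongr
      (ContinuousLinearEquiv.unitsEquivAut ℂ (Units.mk0 (ε : ℂ) hεc)) :
        (ℂ × ℂ) ≃L[ℂ] (ℂ × ℂ)) : (ℂ × ℂ) →L[ℂ] (ℂ × ℂ)) 0 := by
    have d0 : HasFDerivAt (fun x : ℂ × ℂ => x) (ContinuousLinearMap.id ℂ _) 0 := hasFDerivAt_id _
    refine ((d0.fst.mul hNμ.differentiableAt.hasFDerivAt).prodMk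
      (d0.snd.const_mul (ε : ℂ))).congr_fderiv ?_
    refine ContinuousLinearMap.ext fun x => ?_
    simp only [Units.mk0]
    simp [mul_comm]
    rfl
  obtain ⟨H, hH0, hH, hHa, hHs⟩ := exists_analytic_openPartialHomeomorph hma _ hmd
  have hm0 : m 0 = 0 := by simp [hm]
  have hq : G 0 = p + L (T (μ, 0)) := hG 0
  have hsymq : G.symm (p + L (T (μ, 0))) = 0 := by rw [← hq]; exact G.left_inv hG0
  have hqt : p + L (T (μ, 0)) ∈ G.target := by rw [← hq]; exact G.map_source hG0
  have hΨ : IsHolomorphicChartAt G.symm (p + L (T (μ, 0))) := by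
    refine ⟨hqt, hsymq, ?_, ?_⟩
    · exact fun y hy => (hGs y hy).differentiableAt.differentiableWithinAt
    · exact fun y hy => (hGa y hy).differentiableAt.differentiableWithinAt
  have hΦ : IsHolomorphicChartAt (G.symm.trans H) (p + L (T (μ, 0))) := by
    refine ⟨?_, ?_, ?_, ?_⟩
    · rw [OpenPartialHomeomorph.trans_source]
      refine ⟨hqt, ?_⟩
      change G.symm _ ∈ H.source
      rw [hsymq]; exact hH0
    · rw [OpenPartialHomeomorph.coe_trans, Function.comp_apply, hsymq, hH, hm0]
    · intro y hy
      rw [OpenPartialHomeomorph.trans_source] at hy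
      exact ((hHa _ hy.2).differentiableAt.comp y (hGs _ hy.1).differentiableAt).differentiableWithinAt
    · intro y hy
      rw [OpenPartialHomeomorph.trans_target] at hy
      exact ((hGa _ hy.2).differentiableAt.comp y (hHs _ hy.1).differentiableAt).differentiableWithinAt
  have hmem : ∀ᶠ x in 𝓝 (0 : ℂ × ℂ), G x ∈ (G.symm.trans H).source := by
    have hc : ContinuousAt G 0 := G.continuousAt hG0
    refine hc.eventually_mem ((G.symm.trans H).open_source.mem_nhds ?_)
    rw [hq]; exact hΦ.mem_source
  refine ⟨G.symm, G.symm.trans H, hΨ, hΦ, ⟨analyticAt_sliceGraph hQ, ?_⟩, fun y => ?_,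
    fun y hy => ?_, ?_⟩
  · have hF' : Tendsto (fun x => (F (realSlice μ x)).re) (𝓝 0) (𝓝 0) := by
      have h1 := (analyticAt_re_comp (analyticAt_comp_realSlice hF)).continuousAt.tendsto
      have h2 : F (realSlice μ 0) = 0 := by
        have e : realSlice μ 0 = (μ, 0) := by simp [realSlice]
        rw [e]
        exact hF0.self_of_nhds rfl
      simpa [h2] using h1
    have hFr : ∀ᶠ x in 𝓝 (0 : ℂ × ℝ), ((F (realSlice μ x)).re : ℂ) = F (realSlice μ x) := by
      filter_upwards [(tendsto_realSlice μ).eventually hFs] with x hx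
      rw [swapConj_realSlice hμ] at hx
      exact Complex.conj_eq_iff_re.1 hx.symm
    have key := graph_iff_of_forall_eq hε0 (F := fun x => (F (realSlice μ x)).re)
      (analyticAt_sliceGraph hQ) (by simp [sliceGraph]) (hNμ.restrictScalars (𝕜 := ℝ)) hF' (by
        filter_upwards [hFr, (tendsto_realSlice μ).eventually hFe] with x h1 h2
        have h3 := h2 (swapConj_realSlice hμ x) _ rfl
        rw [← h1] at h3
        have e1 : (realSlice μ x).2.1 = x.1 := rfl
        have e2 : (realSlice μ x).2.2.2 = (x.2 : ℂ) := rfl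
        have e3 : (realSlice μ x).1 = μ := rfl
        simp only [e1, e2, e3] at h3
        have h4 := congrArg Complex.re h3
        rw [← Complex.ofReal_mul, Complex.ofReal_re] at h4
        rw [h4]
        simp only [sliceGraph, realSlice, Complex.mul_conj]
        rw [Complex.add_re, Complex.ofReal_re, ← Complex.ofReal_pow, Complex.re_ofReal_mul,
          ← Complex.ofReal_mul])
    have hR : ∀ᶠ y in 𝓝 (0 : ℂ × ℂ), (p + L (T (μ, y)) ∈ M ↔
        y.2.im = (F (realSlice μ (y.1, y.2.re))).re) := by
      have t1 : Tendsto (fun y : ℂ × ℂ => (realSlice μ (y.1, y.2.re), (y.2.im : ℂ))) (𝓝 0)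
          (𝓝 ((μ, (0 : ℂ × ℂ × ℂ)), (0 : ℂ))) := by
        have c : Continuous (fun y : ℂ × ℂ => (realSlice μ (y.1, y.2.re), (y.2.im : ℂ))) := by
          have := continuous_realSlice μ
          fun_prop
        have := c.tendsto 0
        simp [realSlice] at this
        exact this
      have t2 : Tendsto (fun y : ℂ × ℂ => ((y.1, y.2.re) : ℂ × ℝ)) (𝓝 0)
        (𝓝 (0 : ℂ × ℝ)) := tendsto_zero_of_continuous (by fun_prop) rfl
      filter_upwards [t1.eventually hgr, t2.eventually hFr, hTμ.continuousAt.tendsto.eventually hMμ]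
        with y h1 h2 h3
      have e1 : (realSlice μ (y.1, y.2.re)).1 = μ := rfl
      have e2 : (realSlice μ (y.1, y.2.re)).2.1 = y.1 := rfl
      have e3 : (realSlice μ (y.1, y.2.re)).2.2.1 = conj y.1 := rfl
      have e4 : (realSlice μ (y.1, y.2.re)).2.2.2 = (y.2.re : ℂ) := rfl
      simp only [e1, e2, e3, e4] at h1
      rw [← h2] at h1
      have e5 : (y.2.re : ℂ) + Complex.I * y.2.im = y.2 := by
        rw [mul_comm, Complex.re_add_im]
      have e6 : (y.2.re : ℂ) - Complex.I * y.2.im = conj y.2 := by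
        apply Complex.ext <;> simp
      have e7 : bar T (μ, conj y.1, conj y.2) = star (T (μ, y)) := by
        simp [bar, Prod.star_def, hμ]
      rw [e5, e6, e7] at h1
      rw [h3, h1, Complex.ofReal_inj]
    have tq := hΨ.tendsto
    filter_upwards [tq.eventually key, tq.eventually hR, G.open_target.mem_nhds hqt] with y h1 h2 h3
    have e1 : p + L (T (μ, G.symm y)) = y := by rw [← hG]; exact G.right_inv h3
    rw [e1] at h2
    rw [h2, ← h1]
    rw [OpenPartialHomeomorph.coe_trans, Function.comp_apply, hH]
    simp only [hm]
    rw [Complex.im_ofReal_mul, Complex.re_ofReal_mul]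
  · rw [OpenPartialHomeomorph.coe_trans, Function.comp_apply, hH]
  · rw [← hG]; exact G.right_inv hy
  · filter_upwards [hmem, G.open_source.mem_nhds hG0] with x h1 h2
    rw [← hG]
    exact ⟨h1, G.map_source h2, G.left_inv h2⟩

end chart

section expansion

variable {E : Type*} [NormedAddCommGroup E] [NormedSpace ℂ E] [StarAddMonoid E] [StarModule ℂ E]
  [ContinuousStar E]

theorem fderiv_conj_coord {Q : E × ℂ × ℂ × ℂ → ℂ} {μ : E} (hμ : star μ = μ)
    (hQ : AnalyticAt ℂ Q (μ, 0)) (hs : ∀ x, Q (swapConj x) = conj (Q x)) :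
    fderiv ℂ Q (μ, 0) (0, 0, 1, 0) = conj (fderiv ℂ Q (μ, 0) (0, 1, 0, 0)) := by
  have hd : HasFDerivAt Q ((fderiv ℂ Q (μ, 0)).restrictScalars ℝ) (μ, 0) :=
    hQ.differentiableAt.hasFDerivAt.restrictScalars ℝ
  have hl : ∀ v : E × ℂ × ℂ × ℂ, HasDerivAt (fun t : ℝ => (μ, (0 : ℂ × ℂ × ℂ)) + t • v) v 0 :=
    fun v => by simpa using ((hasDerivAt_id (0 : ℝ)).smul_const v).const_add (μ, (0 : ℂ × ℂ × ℂ))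
  have hc : ∀ v : E × ℂ × ℂ × ℂ, HasDerivAt (fun t : ℝ => Q ((μ, (0 : ℂ × ℂ × ℂ)) + t • v))
      (fderiv ℂ Q (μ, 0) v) 0 := fun v => by
    have hd' : HasFDerivAt Q ((fderiv ℂ Q (μ, 0)).restrictScalars ℝ)
        ((μ, (0 : ℂ × ℂ × ℂ)) + (0 : ℝ) • v) := by
      rw [zero_smul, add_zero]; exact hd
    exact HasFDerivAt.comp_hasDerivAt (0 : ℝ) hd' (hl v)
  have h1 := hc (0, 0, 1, 0)
  have h2 := (hc (0, 1, 0, 0)).star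
  refine h1.unique (h2.congr_of_eventuallyEq (Eventually.of_forall fun t => ?_))
  have e := hs ((μ, (0 : ℂ × ℂ × ℂ)) + t • ((0 : E), (1 : ℂ), (0 : ℂ), (0 : ℂ)))
  simp only [RCLike.star_def]
  rw [← e]
  congr 1
  simp [swapConj_apply, hμ]

theorem isBigO_sliceGraph_sub {Q : E × ℂ × ℂ × ℂ → ℂ} {μ : E} (hμ : star μ = μ)
    (hQ : AnalyticAt ℂ Q (μ, 0)) (hs : ∀ x, Q (swapConj x) = conj (Q x)) :
    (fun x : ℂ × ℝ => sliceGraph Q μ x - Complex.normSq x.1 - Complex.normSq x.1 ^ 2 *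
      ((Q (μ, 0)).re + 2 * (fderiv ℂ Q (μ, 0) (0, 1, 0, 0) * x.1).re)) =O[𝓝 0]
        fun x => weightSize x ^ 6 := by
  set κ := fderiv ℂ Q (μ, 0) (0, 1, 0, 0) with hκ
  set D := fderiv ℂ Q (μ, 0) with hD
  have h1 : (fun x : ℂ × ℝ => Q (realSlice μ x) - Q (μ, 0) - D (realSlice μ x - (μ, 0))) =O[𝓝 0]
      fun x => weightSize x ^ 2 := by
    have hf : AnalyticAt ℂ (fun y => Q ((μ, 0) + y) - Q (μ, 0)) 0 :=
      (AnalyticAt.fun_comp_of_eq hQ (by fun_prop) (by simp)).sub analyticAt_const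
    have hfd : HasFDerivAt (fun y => Q ((μ, 0) + y) - Q (μ, 0)) D 0 := by
      have e : HasFDerivAt (fun y : E × ℂ × ℂ × ℂ => (μ, (0 : ℂ × ℂ × ℂ)) + y)
        (ContinuousLinearMap.id ℂ _) 0 := (hasFDerivAt_id _).const_add _
      have hd' : HasFDerivAt Q D ((μ, (0 : ℂ × ℂ × ℂ)) + (0 : E × ℂ × ℂ × ℂ)) := by
        rw [add_zero]; exact hQ.differentiableAt.hasFDerivAt
      exact (HasFDerivAt.comp (0 : E × ℂ × ℂ × ℂ) hd' e).sub_const _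
    have t : Tendsto (fun x => realSlice μ x - (μ, 0)) (𝓝 0) (𝓝 0) := by
      have := (tendsto_realSlice μ).sub_const (μ, (0 : ℂ × ℂ × ℂ))
      rwa [sub_self] at this
    have o := (isBigO_sq_of_hasFDerivAt hf (by simp) hfd).comp_tendsto t
    simp only [Function.comp_def, add_sub_cancel] at o
    refine o.trans ?_
    have o2 : (fun x => ‖realSlice μ x - (μ, (0 : ℂ × ℂ × ℂ))‖) =O[𝓝 0] weightSize := by
      have o3 : (fun x : ℂ × ℝ => x.2) =O[𝓝 0] weightSize := by
        have := isBigO_snd_weightSize.trans (isBigO_weightSize_pow (m := 1) (n := 2) (by norm_num))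
        simpa using this
      have o4 : (fun x : ℂ × ℝ => ‖x.1‖ + ‖x.2‖) =O[𝓝 0] weightSize :=
        isBigO_fst_weightSize.norm_left.add o3.norm_left
      refine (IsBigO.of_bound 1 (Eventually.of_forall fun x => ?_)).trans o4
      have e : realSlice μ x - (μ, 0) = ((0 : E), x.1, conj x.1, (x.2 : ℂ)) := by
        simp [realSlice]
      rw [e, norm_norm, one_mul, Real.norm_of_nonneg (by positivity)]
      simp only [Prod.norm_def, norm_zero, RCLike.norm_conj, Complex.norm_real]
      refine max_le (by positivity) (max_le ?_ (max_le ?_ ?_)) <;>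
        linarith [norm_nonneg x.1, norm_nonneg x.2]
    exact o2.pow 2
  have h2 : (fun x : ℂ × ℝ => (Q (realSlice μ x)).re - (Q (μ, 0)).re - 2 * (κ * x.1).re) =O[𝓝 0]
      fun x => weightSize x ^ 2 := by
    have o1 : (fun x : ℂ × ℝ => (x.2 : ℝ) * (D (0, 0, 0, 1)).re) =O[𝓝 0] fun x => weightSize x ^ 2 := by
      simpa [mul_comm] using isBigO_snd_weightSize.const_mul_left (D (0, 0, 0, 1)).re
    have o2 : (fun x : ℂ × ℝ => (Q (realSlice μ x) - Q (μ, 0) - D (realSlice μ x - (μ, 0))).re)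
        =O[𝓝 0] fun x => weightSize x ^ 2 :=
      (IsBigO.of_bound 1 (Eventually.of_forall fun x => by
        rw [one_mul]; exact Complex.abs_re_le_norm _)).trans h1
    refine (o2.add o1).congr_left fun x => ?_
    have e1 : realSlice μ x - (μ, 0) = x.1 • ((0 : E), (1 : ℂ), (0 : ℂ), (0 : ℂ)) +
        conj x.1 • ((0 : E), (0 : ℂ), (1 : ℂ), (0 : ℂ)) +
        (x.2 : ℂ) • ((0 : E), (0 : ℂ), (0 : ℂ), (1 : ℂ)) := by
      simp [realSlice]
    rw [e1, map_add, map_add, map_smul, map_smul, map_smul, fderiv_conj_coord hμ hQ hs, ← hD, ← hκ]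
    simp only [Complex.sub_re, Complex.add_re, smul_eq_mul, Complex.re_ofReal_mul]
    have e2 : (conj x.1 * conj κ).re = (κ * x.1).re := by
      rw [← map_mul, Complex.conj_re, mul_comm]
    rw [e2, mul_comm x.1 κ]
    ring
  have o4 : (fun x : ℂ × ℝ => Complex.normSq x.1 ^ 2) =O[𝓝 0] fun x => weightSize x ^ 4 := by
    refine IsBigO.of_bound 1 (Eventually.of_forall fun x => ?_)
    rw [one_mul, Real.norm_of_nonneg (by positivity), Real.norm_of_nonneg
      (pow_nonneg (weightSize_nonneg x) _), Complex.normSq_eq_norm_sq, ← pow_mul]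
    exact pow_le_pow_left₀ (norm_nonneg _) (norm_fst_le_weightSize x) _
  refine (o4.mul h2).congr (fun x => ?_) (fun x => by ring)
  simp only [sliceGraph]
  ring

end expansion

section secondOrder

variable {t : ℝ}

theorem HasTwoJet.deriv_deriv_eq {φ : ℝ → ℂ} {b : ℂ} (hφ : ContDiffAt ℝ 2 φ t) (h0 : φ t = 0)
    (h : HasTwoJet φ t 0 b) : deriv φ t = 0 ∧ deriv (deriv φ) t = 2 * b := by
  obtain ⟨h1, h2⟩ := (hasTwoJet_of_contDiffAt hφ h0).unique h
  exact ⟨h1, by rw [← h2]; ring⟩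

theorem isBigO_sq_of_deriv_eq_zero {η : ℝ → ℂ} (hη : ContDiffAt ℝ 2 η t) (h0 : η t = 0)
    (h1 : deriv η t = 0) : η =O[𝓝 t] fun s => (s - t) ^ 2 := by
  have h := hasTwoJet_of_contDiffAt hη h0
  rw [h1, HasTwoJet] at h
  have o : (fun s => deriv (deriv η) t / 2 * ((s - t : ℝ) : ℂ) ^ 2) =O[𝓝 t] fun s => (s - t) ^ 2 :=
    IsBigO.of_bound ‖deriv (deriv η) t / 2‖ (Eventually.of_forall fun s => by
      rw [norm_mul, norm_pow, norm_pow, Complex.norm_real])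
  refine (h.isBigO.add o).congr_left fun s => ?_
  ring

theorem deriv_deriv_fst {y : ℝ → ℂ × ℂ} (hy : ContDiffAt ℝ 2 y t) :
    deriv (fun s => (y s).1) t = (deriv y t).1 ∧
      deriv (deriv fun s => (y s).1) t = (deriv (deriv y) t).1 :=
  deriv_clm_comp (ContinuousLinearMap.fst ℝ ℂ ℂ) hy

theorem deriv_deriv_snd {y : ℝ → ℂ × ℂ} (hy : ContDiffAt ℝ 2 y t) :
    deriv (fun s => (y s).2) t = (deriv y t).2 ∧
      deriv (deriv fun s => (y s).2) t = (deriv (deriv y) t).2 :=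
  deriv_clm_comp (ContinuousLinearMap.snd ℝ ℂ ℂ) hy

theorem contDiffAt_fst_comp {y : ℝ → ℂ × ℂ} (hy : ContDiffAt ℝ 2 y t) :
    ContDiffAt ℝ 2 (fun s => (y s).1) t :=
  (ContinuousLinearMap.fst ℝ ℂ ℂ).contDiff.contDiffAt.comp t hy

theorem contDiffAt_snd_comp {y : ℝ → ℂ × ℂ} (hy : ContDiffAt ℝ 2 y t) :
    ContDiffAt ℝ 2 (fun s => (y s).2) t :=
  (ContinuousLinearMap.snd ℝ ℂ ℂ).contDiff.contDiffAt.comp t hy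

theorem isBigO_sq_of_deriv_eq_zero_prod {η : ℝ → ℂ × ℂ} (hη : ContDiffAt ℝ 2 η t) (h0 : η t = 0)
    (h1 : deriv η t = 0) : η =O[𝓝 t] fun s => (s - t) ^ 2 := by
  have o1 := isBigO_sq_of_deriv_eq_zero (contDiffAt_fst_comp hη) (by simp [h0])
    (by rw [(deriv_deriv_fst hη).1, h1]; rfl)
  have o2 := isBigO_sq_of_deriv_eq_zero (contDiffAt_snd_comp hη) (by simp [h0])
    (by rw [(deriv_deriv_snd hη).1, h1]; rfl)
  exact o1.prod_left o2

/-- Two curves with the same tangent vector: their images under `f` differ at second order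
by the derivative of `f` applied to the difference of the second derivatives. -/
theorem deriv_deriv_comp_sub {f : ℂ × ℂ → ℂ × ℂ} (hf : AnalyticAt ℂ f 0) {B : (ℂ × ℂ) →L[ℂ] (ℂ × ℂ)}
    (hB : HasFDerivAt f B 0) {ψ χ : ℝ → ℂ × ℂ} (hψ : ContDiffAt ℝ 2 ψ t) (hχ : ContDiffAt ℝ 2 χ t)
    (hψ0 : ψ t = 0) (hχ0 : χ t = 0) (h1 : deriv ψ t = deriv χ t) :
    deriv (deriv fun s => f (ψ s)) t =
      deriv (deriv fun s => f (χ s)) t + B (deriv (deriv ψ) t - deriv (deriv χ) t) := by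
  have hfc : ContDiffAt ℝ 2 f 0 := (hf.restrictScalars (𝕜 := ℝ)).contDiffAt
  have hfψ : ContDiffAt ℝ 2 (fun s => f (ψ s)) t :=
    ContDiffAt.comp (g := f) t (by rw [hψ0]; exact hfc) hψ
  have hfχ : ContDiffAt ℝ 2 (fun s => f (χ s)) t :=
    ContDiffAt.comp (g := f) t (by rw [hχ0]; exact hfc) hχ
  set η : ℝ → ℂ × ℂ := fun s => ψ s - χ s with hη
  set D : ℝ → ℂ × ℂ := fun s => f (ψ s) - f (χ s) with hD
  have hsub : ∀ {a b : ℝ → ℂ × ℂ}, ContDiffAt ℝ 2 a t → ContDiffAt ℝ 2 b t →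
      deriv (fun s => a s - b s) t = deriv a t - deriv b t ∧
      deriv (deriv fun s => a s - b s) t = deriv (deriv a) t - deriv (deriv b) t := fun ha hb => by
    have e := deriv_clm_comp (ContinuousLinearMap.fst ℝ (ℂ × ℂ) (ℂ × ℂ) -
      ContinuousLinearMap.snd ℝ (ℂ × ℂ) (ℂ × ℂ)) (ha.prodMk hb)
    have e1 := deriv_clm_comp (ContinuousLinearMap.fst ℝ (ℂ × ℂ) (ℂ × ℂ)) (ha.prodMk hb)
    have e2 := deriv_clm_comp (ContinuousLinearMap.snd ℝ (ℂ × ℂ) (ℂ × ℂ)) (ha.prodMk hb)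
    simp only [sub_apply, ContinuousLinearMap.coe_fst',
      ContinuousLinearMap.coe_snd'] at e e1 e2
    rw [e.1, e.2, ← e1.1, ← e1.2, ← e2.1, ← e2.2]
    exact ⟨rfl, rfl⟩
  have hηc : ContDiffAt ℝ 2 η t := hψ.sub hχ
  have hDc : ContDiffAt ℝ 2 D t := hfψ.sub hfχ
  have hη0 : η t = 0 := by simp [hη, hψ0, hχ0]
  have hD0 : D t = 0 := by simp [hD, hψ0, hχ0]
  obtain ⟨eη1, eη2⟩ := hsub hψ hχ
  obtain ⟨-, eD2⟩ := hsub hfψ hfχ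
  rw [h1, sub_self] at eη1
  have oη : η =O[𝓝 t] fun s => (s - t) ^ 2 := isBigO_sq_of_deriv_eq_zero_prod hηc hη0 eη1
  have hst : HasStrictFDerivAt f B 0 := by
    have := hf.hasStrictFDerivAt
    rwa [hB.fderiv] at this
  have tt : Tendsto (fun s => (ψ s, χ s)) (𝓝 t) (𝓝 (0, 0)) := by
    have := hψ.continuousAt.tendsto.prodMk_nhds hχ.continuousAt.tendsto
    rwa [hψ0, hχ0] at this
  have oD : (fun s => D s - B (η s)) =o[𝓝 t] fun s => (s - t) ^ 2 :=
    (hst.isLittleO.comp_tendsto tt).trans_isBigO oη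
  have hBη : ContDiffAt ℝ 2 (fun s => B (η s)) t :=
    (B.restrictScalars ℝ).contDiff.contDiffAt.comp t hηc
  have eB := deriv_clm_comp (B.restrictScalars ℝ) hηc
  simp only [ContinuousLinearMap.coe_restrictScalars'] at eB
  have key : ∀ l : (ℂ × ℂ) →L[ℝ] ℂ, l (deriv (deriv D) t) = l (B (deriv (deriv η) t)) := fun l => by
    have hlD : ContDiffAt ℝ 2 (fun s => l (D s)) t := l.contDiff.contDiffAt.comp t hDc
    have hlB : ContDiffAt ℝ 2 (fun s => l (B (η s))) t := l.contDiff.contDiffAt.comp t hBη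
    have j := hasTwoJet_of_contDiffAt hlB (by simp [hη0])
    rw [(deriv_clm_comp l hBη).1, (deriv_clm_comp l hBη).2, eB.1, eB.2] at j
    have e0 : deriv η t = 0 := eη1
    rw [e0, map_zero, map_zero] at j
    have j2 : HasTwoJet (fun s => l (D s)) t 0 (l (B (deriv (deriv η) t)) / 2) := by
      have o2 : (fun s => l (D s - B (η s))) =o[𝓝 t] fun s => (s - t) ^ 2 :=
        (l.isBigO_comp _ _).trans_isLittleO oD
      refine (o2.add j).congr_left fun s => ?_
      rw [map_sub]; ring
    have e3 := (j2.deriv_deriv_eq hlD (by simp [hD0])).2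
    rw [(deriv_clm_comp l hDc).2] at e3
    rw [e3]; ring
  have e1 : deriv (deriv D) t = B (deriv (deriv η) t) :=
    Prod.ext (key (ContinuousLinearMap.fst ℝ ℂ ℂ)) (key (ContinuousLinearMap.snd ℝ ℂ ℂ))
  rw [eD2, eη2] at e1
  rw [← e1]
  abel

end secondOrder

section familyChain

variable {E : Type*} [NormedAddCommGroup E] [NormedSpace ℂ E] [StarAddMonoid E] [StarModule ℂ E]
  [ContinuousStar E]

theorem isBigO_sliceGraph {Q : E × ℂ × ℂ × ℂ → ℂ} {μ : E} (hQ : AnalyticAt ℂ Q (μ, 0)) :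
    sliceGraph Q μ =O[𝓝 0] fun x => ‖x.1‖ ^ 2 := by
  have h1 : (fun x : ℂ × ℝ => 1 + Complex.normSq x.1 * (Q (realSlice μ x)).re) =O[𝓝 0]
      fun _ => (1 : ℝ) := by
    have h2 : ContinuousAt (fun x : ℂ × ℝ => 1 + Complex.normSq x.1 * (Q (realSlice μ x)).re) 0 :=
      (analyticAt_const.add ((analyticAt_normSq_comp analyticAt_fst).mul
        (analyticAt_re_comp (analyticAt_comp_realSlice hQ)))).continuousAt
    exact h2.tendsto.isBigO_one ℝ
  have h3 : (fun x : ℂ × ℝ => Complex.normSq x.1) =O[𝓝 0] fun x : ℂ × ℝ => ‖x.1‖ ^ 2 :=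
    IsBigO.of_bound 1 (Eventually.of_forall fun x => by simp [Complex.normSq_eq_norm_sq])
  refine (h3.mul h1).congr (fun x => ?_) (fun x => mul_one _)
  simp only [sliceGraph]
  ring

variable {R : (ℂ × ℂ) × ℂ × ℂ → ℂ} {C : E × ℂ → ℂ × ℂ} {ε : ℝ} {T : E × ℂ × ℂ → ℂ × ℂ}
    {N : E × ℂ × ℂ → ℂ} {F Q : E × ℂ × ℂ × ℂ → ℂ}

/-- The chain condition for curves tangent to the curve of parameter `μ`. -/
theorem IsNormalization.eventually_chain_iff (h : IsNormalization R C ε T N F Q)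
    (hC : IsAdaptedFamily R C) {M : Set (ℂ × ℂ)} {p : ℂ × ℂ} (L : (ℂ × ℂ) ≃L[ℂ] (ℂ × ℂ))
    (hM : ∀ᶠ x in 𝓝 (0 : ℂ × ℂ), p + L x ∈ M ↔ R (x, star x) = 0) :
    ∀ᶠ μ in 𝓝 (0 : E), star μ = μ → ∀ (x : ℝ → ℂ × ℂ) (t : ℝ), ContDiffAt ℝ 2 x t →
      x t = T (μ, 0) → (∀ᶠ s in 𝓝 t, p + L (x s) ∈ M) →
      deriv x t = fderiv ℂ T (μ, 0) (0, 0, 1) →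
      IsCRTransversal M (p + L (x t)) (L (deriv x t)) ∧
      ∃ (ζ : ℂ) (ω : ℝ), deriv (deriv x) t = deriv (deriv fun s : ℝ => T (μ, (0, (s : ℂ)))) 0 +
        ζ • fderiv ℂ T (μ, 0) (0, 1, 0) + (ω : ℂ) • fderiv ℂ T (μ, 0) (0, 0, 1) ∧
        ((∃ Φ : OpenPartialHomeomorph (ℂ × ℂ) (ℂ × ℂ), IsNormalizingAt M (p + L (x t)) Φ ∧
          JetInChainLocus (fun s => Φ (p + L (x s))) t) ↔
          ζ * N (μ, 0) = conj (fderiv ℂ Q (μ, 0) (0, 1, 0, 0)) / 2) := by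
  have tμ : Tendsto (fun μ : E => (μ, (0 : ℂ × ℂ))) (𝓝 0) (𝓝 0) :=
    tendsto_zero_of_continuous (by fun_prop) rfl
  have tμ' : Tendsto (fun μ : E => (μ, (0 : ℂ × ℂ × ℂ))) (𝓝 0) (𝓝 0) :=
    tendsto_zero_of_continuous (by fun_prop) rfl
  filter_upwards [h.exists_chart hC L hM, h.eventually_exists_equiv hC,
    tμ.eventually h.analyticAt_coord.eventually_analyticAt,
    tμ.eventually h.analyticAt_scale.eventually_analyticAt,
    tμ'.eventually h.analyticAt_remainder.eventually_analyticAt] with μ hch hA hT hN hQ hμ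
  intro x t hx hx0 hxM hx1
  obtain ⟨Ψ, Φ, hΨ, hΦ, hgr, hΦΨ, hΨT, -⟩ := hch hμ
  obtain ⟨A, hA⟩ := hA
  have eA : (A : (ℂ × ℂ) →L[ℂ] (ℂ × ℂ)) = (fderiv ℂ T (μ, (0 : ℂ × ℂ))).comp (.inr ℂ E (ℂ × ℂ)) :=
    hA.unique (HasFDerivAt.comp (g := T) (f := fun x : ℂ × ℂ => (μ, x)) (0 : ℂ × ℂ)
      hT.differentiableAt.hasFDerivAt (hasFDerivAt_prodMk_right μ (0 : ℂ × ℂ)))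
  have eAv : ∀ v : ℂ × ℂ, A v = fderiv ℂ T (μ, 0) (0, v) := fun v =>
    congrArg (fun f : (ℂ × ℂ) →L[ℂ] (ℂ × ℂ) => f v) eA
  have hTμ : AnalyticAt ℂ (fun x : ℂ × ℂ => T (μ, x)) 0 :=
    AnalyticAt.fun_comp_of_eq hT (by fun_prop) rfl
  have hNμ : AnalyticAt ℂ (fun x : ℂ × ℂ => N (μ, x)) 0 :=
    AnalyticAt.fun_comp_of_eq hN (by fun_prop) rfl
  set c : ℝ → ℂ × ℂ := fun s => p + L (x s) with hc
  have hcc : ContDiffAt ℝ 2 c t :=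
    contDiffAt_const.add (((L : (ℂ × ℂ) →L[ℂ] (ℂ × ℂ)).restrictScalars ℝ).contDiff.contDiffAt.comp t hx)
  have hcd : deriv c t = L (deriv x t) := by
    have := (deriv_clm_comp ((L : (ℂ × ℂ) →L[ℂ] (ℂ × ℂ)).restrictScalars ℝ) hx).1
    rw [hc, deriv_const_add]
    exact this
  have hct : c t = p + L (T (μ, 0)) := by simp only [hc, hx0]
  set ψ : ℝ → ℂ × ℂ := fun s => Ψ (c s) with hψ
  have hψc : ContDiffAt ℝ 2 ψ t := (hΨ.curve hcc hct).1
  have hψ0 : ψ t = 0 := by simp only [hψ, hct]; exact hΨ.map_center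
  have hxψ : ∀ᶠ s in 𝓝 t, T (μ, ψ s) = x s := by
    have : ∀ᶠ s in 𝓝 t, c s ∈ Ψ.source := hcc.continuousAt.eventually_mem
      (Ψ.open_source.mem_nhds (by rw [hct]; exact hΨ.mem_source))
    filter_upwards [this] with s hs
    have := hΨT _ hs
    exact L.injective (add_left_cancel this)
  have hfψ : HasDerivAt (fun s => T (μ, ψ s)) (A (deriv ψ t)) t := by
    have hA' : HasFDerivAt (fun x : ℂ × ℂ => T (μ, x)) ((A : (ℂ × ℂ) →L[ℂ] (ℂ × ℂ)).restrictScalars ℝ)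
        (ψ t) := by rw [hψ0]; exact hA.restrictScalars ℝ
    exact hA'.comp_hasDerivAt t (hψc.differentiableAt (by norm_num)).hasDerivAt
  have hψ1 : deriv ψ t = (0, 1) := by
    apply A.injective
    rw [← hfψ.deriv, EventuallyEq.deriv_eq hxψ, hx1, eAv]
  obtain ⟨d1, d2⟩ := deriv_deriv_fst hψc
  obtain ⟨d3, d4⟩ := deriv_deriv_snd hψc
  rw [hψ1] at d1 d3
  have c1 := contDiffAt_fst_comp hψc
  have c2 := contDiffAt_snd_comp hψc
  have z1 : (ψ t).1 = 0 := by rw [hψ0]; rfl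
  have z2 : (ψ t).2 = 0 := by rw [hψ0]; rfl
  set ζ := (deriv (deriv ψ) t).1 with hζ
  set w := (deriv (deriv ψ) t).2 with hw
  have o1 : (fun s => (ψ s).1) =O[𝓝 t] fun s => (s - t) ^ 2 := isBigO_sq_of_deriv_eq_zero c1 z1 d1
  have hj2 := hasTwoJet_of_contDiffAt c2 z2
  rw [d3, d4] at hj2
  have hε0 : ε ≠ 0 := fun h0 => by have := h.sq_eq_one; rw [h0] at this; norm_num at this
  have tΦ : Tendsto (fun s => ((Φ (c s)).1, (Φ (c s)).2.re)) (𝓝 t) (𝓝 0) := by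
    have e1 := hΦ.tendsto.comp (hct ▸ hcc.continuousAt.tendsto)
    have e2 : Tendsto (fun x : ℂ × ℂ => ((x.1, x.2.re) : ℂ × ℝ)) (𝓝 0) (𝓝 0) :=
      tendsto_zero_of_continuous (by fun_prop) rfl
    exact e2.comp e1
  have tψ : Tendsto ψ (𝓝 t) (𝓝 0) := by
    have := hψc.continuousAt.tendsto
    rwa [hψ0] at this
  have oΦ1 : (fun s => (Φ (c s)).1) =O[𝓝 t] fun s => (s - t) ^ 2 := by
    have e1 : (fun s => N (μ, ψ s)) =O[𝓝 t] fun _ => (1 : ℝ) :=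
      (hNμ.continuousAt.tendsto.comp tψ).isBigO_one ℝ
    refine (o1.mul e1).congr (fun s => ?_) (fun s => mul_one _)
    rw [hΦΨ]
  have tst : Tendsto (fun s : ℝ => s - t) (𝓝 t) (𝓝 0) := by
    have : ContinuousAt (fun s : ℝ => s - t) t := by fun_prop
    simpa using this.tendsto
  have oIm : (fun s => (ψ s).2.im) =o[𝓝 t] fun s => (s - t) ^ 2 := by
    have e1 := (isBigO_sliceGraph hQ).comp_tendsto tΦ
    have e2 : (fun s => ‖(Φ (c s)).1‖ ^ 2) =O[𝓝 t] fun s => ((s - t) ^ 2) ^ 2 :=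
      oΦ1.norm_left.pow 2
    have e3 : (fun s : ℝ => ((s - t) ^ 2) ^ 2) =o[𝓝 t] fun s => (s - t) ^ 2 := by
      have e4 : (fun s : ℝ => (s - t) ^ 2) =o[𝓝 t] fun _ => (1 : ℝ) :=
        (isLittleO_one_iff ℝ).2 (by simpa using tst.pow 2)
      refine (e4.mul_isBigO (isBigO_refl (fun s : ℝ => (s - t) ^ 2) (𝓝 t))).congr (fun s => ?_)
        (fun s => one_mul _)
      ring
    refine (((e1.trans e2).trans_isLittleO e3).const_mul_left ε).congr' ?_ EventuallyEq.rfl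
    have hgr' : ∀ᶠ s in 𝓝 t, (c s ∈ M ↔ (Φ (c s)).2.im = sliceGraph Q μ ((Φ (c s)).1, (Φ (c s)).2.re)) :=
      (hct ▸ hcc.continuousAt.tendsto).eventually hgr.2
    filter_upwards [hgr', hxM] with s h1 h2
    have h3 := h1.1 h2
    simp only [Function.comp]
    rw [← h3, hΦΨ]
    simp only [Complex.im_ofReal_mul]
    rw [← mul_assoc, ← sq, h.sq_eq_one, one_mul]
  have hwr : conj w = w := by
    have hjc : HasTwoJet (fun s => (ψ s).2) t 1 (conj (w / 2)) := by
      have e1 : (fun s => conj ((ψ s).2 - (1 * ((s - t : ℝ) : ℂ) + w / 2 * ((s - t : ℝ) : ℂ) ^ 2))) =o[𝓝 t]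
          fun s => (s - t) ^ 2 := by
        refine (isLittleO_norm_left.1 ?_)
        simp only [RCLike.norm_conj]
        exact hj2.norm_left
      have e2 : (fun s => 2 * Complex.I * ((ψ s).2.im : ℂ)) =o[𝓝 t] fun s => (s - t) ^ 2 := by
        refine IsLittleO.const_mul_left ?_ _
        refine isLittleO_norm_left.1 ?_
        simp only [Complex.norm_real]
        exact oIm.norm_left
      refine (e1.add e2).congr_left fun s => ?_
      have e3 : (2 * Complex.I * ((ψ s).2.im : ℂ)) = (ψ s).2 - conj (ψ s).2 := by
        rw [Complex.sub_conj]; push_cast; ring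
      rw [e3]
      simp only [map_sub, map_add, map_mul, map_pow, map_one, Complex.conj_ofReal]
      ring
    have := (hjc.unique hj2).2
    simp only [map_div₀, map_ofNat] at this
    linear_combination 2 * this
  obtain ⟨k1, k2⟩ := hΦ.curve_fst hcc hct
  obtain ⟨k3, k4⟩ := hΦ.curve_snd hcc hct
  have hΦ1 : deriv (fun s => (Φ (c s)).1) t = 0 ∧
      deriv (deriv fun s => (Φ (c s)).1) t = ζ * N (μ, 0) := by
    have hj : HasTwoJet (fun s => (Φ (c s)).1) t 0 (ζ * N (μ, 0) / 2) := by
      have hj1 := hasTwoJet_of_contDiffAt c1 z1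
      rw [d1, d2, HasTwoJet] at hj1
      have e1 : (fun s => N (μ, ψ s) - N (μ, 0)) =o[𝓝 t] fun _ => (1 : ℝ) := by
        refine (isLittleO_one_iff ℝ).2 ?_
        have := (hNμ.continuousAt.tendsto.comp tψ).sub_const (N (μ, 0))
        rwa [sub_self] at this
      have e2 := (o1.mul_isLittleO e1).congr_right fun s => mul_one _
      refine ((hj1.const_mul_left (N (μ, 0))).add e2).congr_left fun s => ?_
      simp only [hΦΨ, hψ]
      ring
    obtain ⟨g1, g2⟩ := hj.deriv_deriv_eq k1 (by rw [hct, hΦ.map_center]; rfl)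
    exact ⟨g1, by rw [g2]; ring⟩
  have hΦ2 : deriv (fun s => (Φ (c s)).2) t = ε := by
    have e : (fun s => (Φ (c s)).2) = fun s => (ε : ℂ) * (ψ s).2 := by
      funext s; rw [hΦΨ]
    rw [e, deriv_const_mul _ (c2.differentiableAt (by norm_num)), d3]
    simp
  have hgO : sliceGraph Q μ =O[𝓝 0] fun x => ‖x‖ ^ 2 :=
    (isBigO_sliceGraph hQ).trans (IsBigO.of_bound 1 (Eventually.of_forall fun x => by
      rw [one_mul, norm_pow, norm_pow, norm_norm, norm_norm]
      gcongr
      exact norm_fst_le x))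
  obtain ⟨g0, gd⟩ := zero_and_hasFDerivAt_of_isBigO hgO
  have hTr : IsCRTransversal M (p + L (T (μ, 0))) (deriv c t) := by
    rw [hgr.isCRTransversal_iff hΦ g0 gd, ← k4, hΦ2]
    simpa using hε0
  refine ⟨by rw [hx0, ← hcd]; exact hTr, ζ, w.re, ?_, ?_⟩
  · set χ : ℝ → ℂ × ℂ := fun s => (0, ((s - t : ℝ) : ℂ)) with hχ
    have hχd : ∀ s, HasDerivAt χ ((0 : ℂ), (1 : ℂ)) s := fun s => by
      have e1 : HasDerivAt (fun s : ℝ => ((s - t : ℝ) : ℂ)) 1 s := by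
        have := ((hasDerivAt_id s).sub_const t).ofReal_comp
        simpa using this
      exact (hasDerivAt_const s (0 : ℂ)).prodMk e1
    have hχ1 : deriv χ = fun _ => (0, 1) := funext fun s => (hχd s).deriv
    have hχc : ContDiffAt ℝ 2 χ t := by
      refine contDiffAt_const.prodMk ?_
      exact Complex.ofRealCLM.contDiff.contDiffAt.comp t (contDiffAt_id.sub contDiffAt_const)
    have e1 := deriv_deriv_comp_sub hTμ hA hψc hχc hψ0 (by simp [hχ]) (by rw [hψ1, hχ1])
    have e2 : deriv (deriv χ) t = 0 := by rw [hχ1]; simp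
    have e3 : deriv (deriv fun s => T (μ, ψ s)) t = deriv (deriv x) t := by
      have : deriv (fun s => T (μ, ψ s)) =ᶠ[𝓝 t] deriv x := EventuallyEq.deriv hxψ
      exact this.deriv_eq
    have e4 : deriv (deriv fun s => T (μ, χ s)) t = deriv (deriv fun s : ℝ => T (μ, (0, (s : ℂ)))) 0 := by
      have f1 : (fun s => T (μ, χ s)) = fun s => (fun r : ℝ => T (μ, (0, (r : ℂ)))) (s - t) := rfl
      have f2 : deriv (fun s => T (μ, χ s)) = fun s => deriv (fun r : ℝ => T (μ, (0, (r : ℂ)))) (s - t) := by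
        rw [f1]
        funext s
        exact deriv_comp_sub_const (f := fun r : ℝ => T (μ, (0, (r : ℂ)))) t s
      rw [f2, deriv_comp_sub_const, sub_self]
    rw [e3, e4, e2, sub_zero] at e1
    rw [e1, add_assoc]
    congr 1
    have e5 : deriv (deriv ψ) t = ζ • ((1 : ℂ), (0 : ℂ)) + w • ((0 : ℂ), (1 : ℂ)) := by
      simp [hζ, hw]
    have e6 : ((w.re : ℝ) : ℂ) = w := Complex.conj_eq_iff_re.1 hwr
    rw [e5, map_add, map_smul, map_smul, e6]
    change ζ • A (1, 0) + w • A (0, 1) = _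
    rw [eAv, eAv]
  · have e := chain_condition_iff hΦ hgr (isBigO_sliceGraph_sub hμ hQ h.remainder_symm) hcc hct hxM
      hTr hΦ1.1
    rw [hΦ1.2, hΦ2] at e
    have e2 : (ε : ℂ) ^ 2 = 1 := by exact_mod_cast h.sq_eq_one
    rw [e2, mul_one] at e
    have e3 : p + L (x t) = p + L (T (μ, 0)) := by rw [hx0]
    rw [e3]
    exact e

end familyChain
section polarizedEquation

variable {M : Set (ℂ × ℂ)} {p ξ : ℂ × ℂ}

theorem deriv_eq_zero_of_isBigO_cube {f : ℝ → ℝ} (hf : ContDiffAt ℝ 2 f 0)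
    (h : f =O[𝓝 0] fun s => s ^ 3) : deriv f 0 = 0 ∧ deriv (deriv f) 0 = 0 := by
  have h0 : f 0 = 0 := by
    obtain ⟨c, hc⟩ := h.bound
    have := hc.self_of_nhds
    simpa using this
  have hF : ContDiffAt ℝ 2 (fun s => (f s : ℂ)) 0 :=
    Complex.ofRealCLM.contDiff.contDiffAt.comp 0 hf
  have hj : HasTwoJet (fun s => (f s : ℂ)) 0 0 0 := by
    have h1 : (fun s => (f s : ℂ)) =O[𝓝 0] fun s => (s - 0) ^ 3 := by
      refine (IsBigO.of_bound 1 (Eventually.of_forall fun s => ?_)).trans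
        (h.congr_right fun s => by rw [sub_zero])
      rw [Complex.norm_real, one_mul]
    refine (h1.trans_isLittleO isLittleO_cube).congr_left fun s => ?_
    ring
  obtain ⟨e1, e2⟩ := hj.deriv_deriv_eq hF (by simp [h0])
  obtain ⟨d1, d2⟩ := deriv_clm_comp Complex.ofRealCLM hf
  have d1' : deriv (fun s => (f s : ℂ)) 0 = (deriv f 0 : ℝ) := d1
  have d2' : deriv (deriv fun s => (f s : ℂ)) 0 = (deriv (deriv f) 0 : ℝ) := d2
  rw [e1] at d1'
  rw [e2, mul_zero] at d2'
  exact ⟨by exact_mod_cast d1'.symm, by exact_mod_cast d2'.symm⟩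

theorem deriv_comp_curve {ρ : ℂ × ℂ → ℝ} (hρ : AnalyticAt ℝ ρ p) {c : ℝ → ℂ × ℂ}
    (hc : ContDiffAt ℝ 2 c 0) (h0 : c 0 = p) :
    ContDiffAt ℝ 2 (fun s => ρ (c s)) 0 ∧ deriv (fun s => ρ (c s)) 0 = fderiv ℝ ρ p (deriv c 0) ∧
    deriv (deriv fun s => ρ (c s)) 0 =
      fderiv ℝ (fderiv ℝ ρ) p (deriv c 0) (deriv c 0) + fderiv ℝ ρ p (deriv (deriv c) 0) := by
  have hev : ∀ᶠ s in 𝓝 (0 : ℝ), HasDerivAt (fun s => ρ (c s)) (fderiv ℝ ρ (c s) (deriv c s)) s := by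
    have h1 : ∀ᶠ s in 𝓝 (0 : ℝ), AnalyticAt ℝ ρ (c s) :=
      (h0 ▸ hc.continuousAt.tendsto).eventually hρ.eventually_analyticAt
    filter_upwards [h1, hc.eventually (by norm_num)] with s h2 h3
    exact h2.differentiableAt.hasFDerivAt.comp_hasDerivAt s
      (h3.differentiableAt (by norm_num)).hasDerivAt
  have hev' : deriv (fun s => ρ (c s)) =ᶠ[𝓝 0] fun s => fderiv ℝ ρ (c s) (deriv c s) :=
    hev.mono fun s hs => hs.deriv
  refine ⟨?_, ?_, ?_⟩
  · exact ContDiffAt.comp (g := ρ) 0 (by rw [h0]; exact hρ.contDiffAt) hc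
  · rw [hev'.self_of_nhds]
    simp only [h0]
  · rw [hev'.deriv_eq]
    have d1 : HasDerivAt c (deriv c 0) 0 := (hc.differentiableAt (by norm_num)).hasDerivAt
    have d2 : HasDerivAt (deriv c) (deriv (deriv c) 0) 0 :=
      ((contDiffAt_deriv hc).differentiableAt (by norm_num)).hasDerivAt
    have d3 : HasFDerivAt (fderiv ℝ ρ) (fderiv ℝ (fderiv ℝ ρ) p) (c 0) := by
      rw [h0]; exact hρ.fderiv.differentiableAt.hasFDerivAt
    have d4 := (d3.comp_hasDerivAt (0 : ℝ) d1).clm_apply d2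
    refine d4.deriv.trans ?_
    simp only [Function.comp, h0]

/-- A linear change of coordinates with `w`-axis along the transversal direction `ξ`, and the
polarized defining equation in these coordinates. -/
theorem exists_polarized_equation (hL : IsLeviNondegenerate M) (hp : p ∈ M)
    (hξ : IsCRTransversal M p ξ) :
    ∃ (L : (ℂ × ℂ) ≃L[ℂ] (ℂ × ℂ)) (R : (ℂ × ℂ) × ℂ × ℂ → ℂ), L (0, 1) = ξ ∧
      AnalyticAt ℂ R 0 ∧ R 0 = 0 ∧ (∀ x y, R (star y, star x) = conj (R (x, y))) ∧
      (∀ᶠ x in 𝓝 (0 : ℂ × ℂ), p + L x ∈ M ↔ R (x, star x) = 0) ∧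
      fderiv ℂ R 0 ((0, 1), 0) ≠ 0 ∧
      fderiv ℂ R 0 ((0, 1), 0) + fderiv ℂ R 0 (0, (0, 1)) = 0 ∧
      (∀ g : ℂ → ℂ × ℂ, AnalyticAt ℂ g 0 → g 0 = 0 → deriv g 0 ≠ 0 →
        ¬ (fun z => R (g z, star (g z))) =O[𝓝 0] fun z => ‖z‖ ^ 3) := by
  obtain ⟨ρ, hρ, hlevi⟩ := hL p hp
  have hξ1 : fderiv ℝ ρ p ξ = 0 := (isTangent_iff hp hρ ξ).1 hξ.1
  have hξ2 : fderiv ℝ ρ p (Complex.I • ξ) ≠ 0 := fun h => hξ.2 ((isTangent_iff hp hρ _).2 h)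
  have hξ0 : ξ ≠ 0 := fun h => hξ2 (by rw [h]; simp)
  obtain ⟨L, hL1⟩ := exists_equiv_of_injective (L := (ContinuousLinearMap.fst ℂ ℂ ℂ).smulRight
      (-conj ξ.2, conj ξ.1) + (ContinuousLinearMap.snd ℂ ℂ ℂ).smulRight ξ) (by
    intro x hx
    have e1 : x.1 * -conj ξ.2 + x.2 * ξ.1 = 0 := congrArg Prod.fst hx
    have e2 : x.1 * conj ξ.1 + x.2 * ξ.2 = 0 := congrArg Prod.snd hx
    have e3 : ξ.1 * conj ξ.1 + ξ.2 * conj ξ.2 ≠ 0 := by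
      rw [Complex.mul_conj, Complex.mul_conj, ← Complex.ofReal_add]
      intro h
      have h1 : Complex.normSq ξ.1 + Complex.normSq ξ.2 = 0 := by exact_mod_cast h
      have h2 := Complex.normSq_nonneg ξ.1
      have h3 := Complex.normSq_nonneg ξ.2
      refine hξ0 (Prod.ext (Complex.normSq_eq_zero.1 (by linarith))
        (Complex.normSq_eq_zero.1 (by linarith)))
    refine Prod.ext ((mul_eq_zero.1 (?_ : x.1 * (ξ.1 * conj ξ.1 + ξ.2 * conj ξ.2) = 0)).resolve_right e3)
      ((mul_eq_zero.1 (?_ : x.2 * (ξ.1 * conj ξ.1 + ξ.2 * conj ξ.2) = 0)).resolve_right e3)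
    · linear_combination ξ.1 * e2 - ξ.2 * e1
    · linear_combination conj ξ.1 * e1 + conj ξ.2 * e2)
  have hLa : ∀ x, L x = x.1 • (-conj ξ.2, conj ξ.1) + x.2 • ξ := fun x =>
    congrArg (fun f : (ℂ × ℂ) →L[ℂ] (ℂ × ℂ) => f x) hL1
  have hLξ : L (0, 1) = ξ := by rw [hLa]; simp
  have hla : AnalyticAt ℝ (fun x => p + L x) 0 := analyticAt_const.add
    (((L : (ℂ × ℂ) →L[ℂ] (ℂ × ℂ)).analyticAt _).restrictScalars (𝕜 := ℝ))
  have hr : AnalyticAt ℝ (fun x => ρ (p + L x)) 0 :=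
    AnalyticAt.fun_comp_of_eq hρ.1 hla (by simp)
  obtain ⟨R, hR, hRs, hRr⟩ := exists_polarization hr
  have hρ0 : ρ p = 0 := hρ.apply_eq_zero hp
  have hR0 : R 0 = 0 := by
    have := hRr.self_of_nhds
    simp only [star_zero, map_zero, add_zero, hρ0, Complex.ofReal_zero] at this
    exact this
  have hRd : HasFDerivAt R ((fderiv ℂ R 0).restrictScalars ℝ) 0 :=
    hR.differentiableAt.hasFDerivAt.restrictScalars ℝ
  have hdir : ∀ v : ℂ × ℂ, fderiv ℂ R 0 (v, star v) = (fderiv ℝ ρ p (L v) : ℝ) := fun v => by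
    have l1 : HasDerivAt (fun t : ℝ => t • v) v 0 := by
      simpa using (hasDerivAt_id (0 : ℝ)).smul_const v
    have l1' : HasDerivAt (fun t : ℝ => star (t • v)) (star v) 0 := by
      have := ((hasDerivAt_id (0 : ℝ)).smul_const (star v))
      simpa [Prod.star_def] using this
    have l2 := l1.prodMk l1'
    have hRd' : HasFDerivAt R ((fderiv ℂ R 0).restrictScalars ℝ)
        ((fun t : ℝ => (t • v, star (t • v))) 0) := by simp only [zero_smul, star_zero]; exact hRd
    have d1 := HasFDerivAt.comp_hasDerivAt (0 : ℝ) hRd' l2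
    have l3 : HasDerivAt (fun t : ℝ => p + L (t • v)) (L v) 0 :=
      (HasFDerivAt.comp_hasDerivAt (0 : ℝ)
        ((L : (ℂ × ℂ) →L[ℂ] (ℂ × ℂ)).restrictScalars ℝ).hasFDerivAt l1).const_add p
    have hρd : HasFDerivAt ρ (fderiv ℝ ρ p) ((fun t : ℝ => p + L (t • v)) 0) := by
      simp only [zero_smul, map_zero, add_zero]; exact hρ.1.differentiableAt.hasFDerivAt
    have d2 := (HasFDerivAt.comp_hasDerivAt (0 : ℝ) hρd l3).ofReal_comp
    refine d1.unique (d2.congr_of_eventuallyEq ?_)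
    have t : Tendsto (fun t : ℝ => t • v) (𝓝 0) (𝓝 0) :=
      tendsto_zero_of_continuous (by fun_prop) (zero_smul _ _)
    exact t.eventually hRr
  have hsum : fderiv ℂ R 0 ((0, 1), 0) + fderiv ℂ R 0 (0, (0, 1)) = 0 := by
    have := hdir (0, 1)
    rw [hLξ, hξ1, Complex.ofReal_zero] at this
    rw [← map_add]
    refine Eq.trans ?_ this
    congr 1
    simp [Prod.star_def]
  refine ⟨L, R, hLξ, hR, hR0, hRs, ?_, ?_, hsum, ?_⟩
  · have t : Tendsto (fun x => p + L x) (𝓝 0) (𝓝 p) := by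
      have := hla.continuousAt.tendsto
      simpa using this
    filter_upwards [t.eventually hρ.2.2, hRr] with x h1 h2
    rw [h1, h2, Complex.ofReal_eq_zero]
  · intro h0
    rw [h0, zero_add] at hsum
    have := hdir (0, Complex.I)
    have e1 : (((0 : ℂ), Complex.I), star ((0 : ℂ), Complex.I)) = Complex.I • (((0 : ℂ), (1 : ℂ)), (0 : ℂ × ℂ))
      + (-Complex.I) • ((0 : ℂ × ℂ), ((0 : ℂ), (1 : ℂ))) := by
      simp [Prod.star_def]
    rw [e1, map_add, map_smul, map_smul, h0, hsum, smul_zero, smul_zero, add_zero] at this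
    have e2 : L (0, Complex.I) = Complex.I • ξ := by rw [hLa]; simp
    rw [e2] at this
    exact hξ2 (by exact_mod_cast this.symm)
  · intro g hg hg0 hg1 hO
    have hO' : (fun z => ρ (p + L (g z))) =O[𝓝 0] fun z : ℂ => ‖z‖ ^ 3 := by
      refine (IsBigO.of_bound 1 ?_).trans hO
      have t : Tendsto g (𝓝 0) (𝓝 0) := by
        have := hg.continuousAt.tendsto
        rwa [hg0] at this
      filter_upwards [t.eventually hRr] with z hz
      rw [hz, one_mul, Complex.norm_real]
    set X := L (deriv g 0) with hX
    have key : ∀ v : ℂ, ‖v‖ = 1 → fderiv ℝ ρ p (v • X) = 0 ∧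
        fderiv ℝ (fderiv ℝ ρ) p (v • X) (v • X) +
          fderiv ℝ ρ p (v ^ 2 • L (deriv (deriv g) 0)) = 0 := fun v hv => by
      set c : ℝ → ℂ × ℂ := fun t => p + L (g (t * v)) with hc
      have lv : ∀ t : ℝ, HasDerivAt (fun t : ℝ => (t : ℂ) * v) v t := fun t => by
        simpa using ((hasDerivAt_id t).ofReal_comp).mul_const v
      have tv : Tendsto (fun t : ℝ => (t : ℂ) * v) (𝓝 0) (𝓝 0) :=
        tendsto_zero_of_continuous (by fun_prop) (by simp)
      have hca : AnalyticAt ℝ c 0 := by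
        have e1 : AnalyticAt ℝ (fun t : ℝ => (t : ℂ) * v) 0 :=
          (analyticAt_ofReal_comp analyticAt_id).mul analyticAt_const
        have e2 : AnalyticAt ℝ (fun t : ℝ => g (t * v)) 0 :=
          AnalyticAt.fun_comp_of_eq (hg.restrictScalars (𝕜 := ℝ)) e1 (by simp)
        exact AnalyticAt.fun_comp_of_eq (g := fun x => p + L x) (y := 0) hla e2 (by simp [hg0])
      have hcd : ∀ᶠ t : ℝ in 𝓝 (0 : ℝ), HasDerivAt c (v • L (deriv g ((t : ℂ) * v))) t := by
        filter_upwards [tv.eventually hg.eventually_analyticAt] with t ht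
        have e1 := HasDerivAt.scomp t ht.differentiableAt.hasDerivAt (lv t)
        have e2 := (((L : (ℂ × ℂ) →L[ℂ] (ℂ × ℂ)).restrictScalars ℝ).hasFDerivAt.comp_hasDerivAt t e1).const_add p
        refine e2.congr_deriv ?_
        exact map_smul L v _
      have hc1 : deriv c =ᶠ[𝓝 0] fun t : ℝ => v • L (deriv g ((t : ℂ) * v)) := hcd.mono fun t h => h.deriv
      have hc10 : deriv c 0 = v • X := by
        rw [hc1.self_of_nhds, hX]; simp
      have hc2 : deriv (deriv c) 0 = v ^ 2 • L (deriv (deriv g) 0) := by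
        rw [hc1.deriv_eq]
        have hg' : HasDerivAt (deriv g) (deriv (deriv g) 0) (((0 : ℝ) : ℂ) * v) := by
          rw [Complex.ofReal_zero, zero_mul]
          exact hg.deriv.differentiableAt.hasDerivAt
        have e1 := HasDerivAt.scomp (0 : ℝ) hg' (lv 0)
        have e2 := (((L : (ℂ × ℂ) →L[ℂ] (ℂ × ℂ)).restrictScalars ℝ).hasFDerivAt.comp_hasDerivAt (0 : ℝ)
          e1).const_smul v
        refine e2.deriv.trans ?_
        simp [sq, mul_smul]
      have hc0 : c 0 = p := by simp [hc, hg0]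
      obtain ⟨k1, k2, k3⟩ := deriv_comp_curve hρ.1 hca.contDiffAt hc0
      have hO3 : (fun s => ρ (c s)) =O[𝓝 0] fun s : ℝ => s ^ 3 := by
        refine (hO'.comp_tendsto tv).trans (IsBigO.of_bound 1 (Eventually.of_forall fun s => ?_))
        simp [hv]
      obtain ⟨z1, z2⟩ := deriv_eq_zero_of_isBigO_cube k1 hO3
      rw [k2, hc10] at z1
      rw [k3, hc10, hc2] at z2
      exact ⟨z1, z2⟩
    obtain ⟨a1, a2⟩ := key 1 (by simp)
    obtain ⟨b1, b2⟩ := key Complex.I (by simp)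
    rw [one_smul] at a1 a2
    rw [one_pow, one_smul] at a2
    rw [Complex.I_sq, neg_one_smul, map_neg] at b2
    refine hlevi X (fun h => hg1 ?_) a1 b1 ?_
    · exact L.injective (by rw [map_zero]; exact h)
    · rw [leviForm]
      have : fderiv ℝ (fderiv ℝ ρ) p X X + fderiv ℝ (fderiv ℝ ρ) p (Complex.I • X) (Complex.I • X) = 0 := by
        linarith
      rw [this, zero_div]

end polarizedEquation

section lineFamily

variable {R : (ℂ × ℂ) × ℂ × ℂ → ℂ}

/-- The complexified graph equation `v = F (z, ζ, s)` of a polarized equation. -/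
theorem exists_polarized_graph (hR : AnalyticAt ℂ R 0) (hR0 : R 0 = 0)
    (hRs : ∀ x y, R (star y, star x) = conj (R (x, y)))
    (hw : fderiv ℂ R 0 ((0, 1), 0) ≠ 0)
    (hsum : fderiv ℂ R 0 ((0, 1), 0) + fderiv ℂ R 0 (0, (0, 1)) = 0) :
    ∃ F : ℂ × ℂ × ℂ → ℂ, AnalyticAt ℂ F 0 ∧ F 0 = 0 ∧
      (∀ᶠ y in 𝓝 ((0 : ℂ × ℂ × ℂ), (0 : ℂ)), R ((y.1.1, y.1.2.2 + Complex.I * y.2),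
        (y.1.2.1, y.1.2.2 - Complex.I * y.2)) = 0 ↔ y.2 = F y.1) ∧
      (∀ᶠ x in 𝓝 (0 : ℂ × ℂ × ℂ), F (conj x.2.1, conj x.1, conj x.2.2) = conj (F x)) ∧
      HasDerivAt (fun s => F (0, 0, s)) 0 0 := by
  set f : (ℂ × ℂ × ℂ) × ℂ → ℂ := fun y => R ((y.1.1, y.1.2.2 + Complex.I * y.2),
        (y.1.2.1, y.1.2.2 - Complex.I * y.2)) with hf
  have hfa : AnalyticAt ℂ f (0, 0) :=
    AnalyticAt.fun_comp_of_eq hR (by fun_prop) (by simp [Prod.zero_eq_mk])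
  have hRd : HasFDerivAt R (fderiv ℂ R 0) 0 := hR.differentiableAt.hasFDerivAt
  have e0 : (((0 : ℂ), (0 : ℂ) + Complex.I * 0), ((0 : ℂ), (0 : ℂ) - Complex.I * 0)) = 0 := by
    simp
  have hf0 : f (0, 0) = 0 := by
    change R (((0 : ℂ), (0 : ℂ) + Complex.I * 0), ((0 : ℂ), (0 : ℂ) - Complex.I * 0)) = 0
    rw [e0, hR0]
  have hcomb : ∀ a b : ℂ, fderiv ℂ R 0 (((0 : ℂ), a), ((0 : ℂ), b)) =
      (a - b) * fderiv ℂ R 0 ((0, 1), 0) := fun a b => by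
    have e1 : (((0 : ℂ), a), ((0 : ℂ), b)) = a • (((0 : ℂ), (1 : ℂ)), (0 : ℂ × ℂ)) +
        b • ((0 : ℂ × ℂ), ((0 : ℂ), (1 : ℂ))) := by simp
    rw [e1, map_add, map_smul, map_smul, smul_eq_mul, smul_eq_mul]
    linear_combination b * hsum
  have hd : HasDerivAt (fun t => f (0, t)) (2 * Complex.I * fderiv ℂ R 0 ((0, 1), 0)) 0 := by
    have l1 : HasDerivAt (fun t : ℂ => (((0 : ℂ), (0 : ℂ) + Complex.I * t), ((0 : ℂ), (0 : ℂ) - Complex.I * t)))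
        (((0 : ℂ), Complex.I), ((0 : ℂ), -Complex.I)) 0 := by
      have e1 : HasDerivAt (fun t : ℂ => (0 : ℂ) + Complex.I * t) Complex.I 0 := by
        simpa using ((hasDerivAt_id (0 : ℂ)).const_mul Complex.I).const_add 0
      have e2 : HasDerivAt (fun t : ℂ => (0 : ℂ) - Complex.I * t) (-Complex.I) 0 := by
        simpa using ((hasDerivAt_id (0 : ℂ)).const_mul Complex.I).const_sub 0
      exact ((hasDerivAt_const _ _).prodMk e1).prodMk ((hasDerivAt_const _ _).prodMk e2)
    have hRd' : HasFDerivAt R (fderiv ℂ R 0) ((fun t : ℂ => (((0 : ℂ), (0 : ℂ) + Complex.I * t),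
        ((0 : ℂ), (0 : ℂ) - Complex.I * t))) 0) := by
      simp only [e0]; exact hRd
    refine (HasFDerivAt.comp_hasDerivAt (0 : ℂ) hRd' l1).congr_deriv ?_
    rw [hcomb]; ring
  obtain ⟨F, hF, hF0, hFe⟩ := exists_analyticAt_implicit hfa hf0 hd
    (mul_ne_zero (mul_ne_zero two_ne_zero Complex.I_ne_zero) hw)
  have tF : Tendsto F (𝓝 0) (𝓝 0) := by simpa [hF0] using hF.continuousAt.tendsto
  have tg : Tendsto (fun x => (x, F x)) (𝓝 0) (𝓝 ((0 : ℂ × ℂ × ℂ), (0 : ℂ))) :=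
    tendsto_id.prodMk_nhds tF
  have hzero : ∀ᶠ x in 𝓝 (0 : ℂ × ℂ × ℂ), R ((x.1, x.2.2 + Complex.I * F x),
      (x.2.1, x.2.2 - Complex.I * F x)) = 0 := by
    filter_upwards [tg.eventually hFe] with x hx
    exact hx.2 rfl
  refine ⟨F, hF, hF0, hFe, ?_, ?_⟩
  · have t2 : Tendsto (fun x : ℂ × ℂ × ℂ => (((conj x.2.1, conj x.1, conj x.2.2) : ℂ × ℂ × ℂ), conj (F x)))
        (𝓝 0) (𝓝 ((0 : ℂ × ℂ × ℂ), (0 : ℂ))) := by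
      have hcc := Complex.continuous_conj
      refine Tendsto.prodMk_nhds (tendsto_zero_of_continuous (by fun_prop) (by simp)) ?_
      have := (tendsto_zero_of_continuous hcc (map_zero _)).comp tF
      exact this
    filter_upwards [t2.eventually hFe, hzero] with x h1 h2
    refine (h1.1 ?_).symm
    have h3 := hRs (x.1, x.2.2 + Complex.I * F x) (x.2.1, x.2.2 - Complex.I * F x)
    rw [h2, map_zero] at h3
    rw [← h3]
    simp only [hf, Prod.star_def]
    congr 2
    · simp
    · simp [sub_eq_add_neg]
  · have l1 : HasDerivAt (fun s : ℂ => ((0 : ℂ), (0 : ℂ), s)) ((0 : ℂ), (0 : ℂ), (1 : ℂ)) 0 :=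
      (hasDerivAt_const _ _).prodMk ((hasDerivAt_const _ _).prodMk (hasDerivAt_id _))
    have l2 : HasDerivAt (fun s : ℂ => F (0, 0, s)) (fderiv ℂ F 0 (0, 0, 1)) 0 :=
      HasFDerivAt.comp_hasDerivAt (0 : ℂ) (f := fun s : ℂ => ((0 : ℂ), (0 : ℂ), s))
        hF.differentiableAt.hasFDerivAt l1
    set d := fderiv ℂ F 0 (0, 0, 1) with hd'
    have l3 : HasDerivAt (fun s : ℂ => (((0 : ℂ), s + Complex.I * F (0, 0, s)),
        ((0 : ℂ), s - Complex.I * F (0, 0, s))))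
        (((0 : ℂ), 1 + Complex.I * d), ((0 : ℂ), 1 - Complex.I * d)) 0 :=
      ((hasDerivAt_const _ _).prodMk ((hasDerivAt_id _).add (l2.const_mul _))).prodMk
        ((hasDerivAt_const _ _).prodMk ((hasDerivAt_id _).sub (l2.const_mul _)))
    have hF00 : F (0, 0, 0) = 0 := hF0
    have hRd' : HasFDerivAt R (fderiv ℂ R 0) ((fun s : ℂ => (((0 : ℂ), s + Complex.I * F (0, 0, s)),
        ((0 : ℂ), s - Complex.I * F (0, 0, s)))) 0) := by
      simp only [hF00, mul_zero, add_zero, sub_zero]; exact hRd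
    have l4 := HasFDerivAt.comp_hasDerivAt (0 : ℂ) hRd' l3
    have t : Tendsto (fun s : ℂ => ((0 : ℂ), (0 : ℂ), s)) (𝓝 0) (𝓝 0) :=
      tendsto_zero_of_continuous (by fun_prop) rfl
    have l5 := l4.unique ((hasDerivAt_const (0 : ℂ) (0 : ℂ)).congr_of_eventuallyEq (t.eventually hzero))
    rw [hcomb] at l5
    have l6 : d = 0 := by
      have : 1 + Complex.I * d - (1 - Complex.I * d) = 0 := (mul_eq_zero.1 l5).resolve_right hw
      have h7 : (2 * Complex.I) * d = 0 := by linear_combination this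
      exact (mul_eq_zero.1 h7).resolve_left (mul_ne_zero two_ne_zero Complex.I_ne_zero)
    rwa [l6] at l2

/-- The argument `(z, z̄, u)` along the line of parameter `μ`. -/
noncomputable def linePoint (y : (Fin 5 → ℂ) × ℂ) : ℂ × ℂ × ℂ :=
  ((y.1 0 + Complex.I * y.1 1) + (y.1 3 + Complex.I * y.1 4) * y.2,
    (y.1 0 - Complex.I * y.1 1) + (y.1 3 - Complex.I * y.1 4) * y.2, y.1 2 + y.2)

/-- The family of the curves of a hypersurface `v = F (z, z̄, u)` that lie over real lines. -/
noncomputable def lineFamily (F : ℂ × ℂ × ℂ → ℂ) (y : (Fin 5 → ℂ) × ℂ) : ℂ × ℂ :=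
  ((linePoint y).1, (linePoint y).2.2 + Complex.I * F (linePoint y))

theorem analyticAt_linePoint (y : (Fin 5 → ℂ) × ℂ) : AnalyticAt ℂ linePoint y := by
  have h : ∀ i, AnalyticAt ℂ (fun y : (Fin 5 → ℂ) × ℂ => y.1 i) y := fun i =>
    ((ContinuousLinearMap.proj (R := ℂ) (φ := fun _ : Fin 5 => ℂ) i).comp
      (ContinuousLinearMap.fst ℂ (Fin 5 → ℂ) ℂ)).analyticAt y
  have h0 := h 0
  have h1 := h 1
  have h2 := h 2
  have h3 := h 3
  have h4 := h 4
  unfold linePoint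
  fun_prop

theorem linePoint_zero : linePoint 0 = 0 := by simp [linePoint]

theorem linePoint_star (y : (Fin 5 → ℂ) × ℂ) :
    linePoint (star y) = (conj (linePoint y).2.1, conj (linePoint y).1, conj (linePoint y).2.2) := by
  simp [linePoint, sub_eq_add_neg]

theorem tendsto_linePoint : Tendsto linePoint (𝓝 0) (𝓝 0) := by
  have := (analyticAt_linePoint 0).continuousAt.tendsto
  rwa [linePoint_zero] at this

theorem isAdaptedFamily_lineFamily (hR : AnalyticAt ℂ R 0)
    (hRs : ∀ x y, R (star y, star x) = conj (R (x, y)))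
    (hw : fderiv ℂ R 0 ((0, 1), 0) ≠ 0)
    (hlevi : ∀ g : ℂ → ℂ × ℂ, AnalyticAt ℂ g 0 → g 0 = 0 → deriv g 0 ≠ 0 →
        ¬ (fun z => R (g z, star (g z))) =O[𝓝 0] fun z => ‖z‖ ^ 3)
    {F : ℂ × ℂ × ℂ → ℂ} (hF : AnalyticAt ℂ F 0) (hF0 : F 0 = 0)
    (hFe : ∀ᶠ y in 𝓝 ((0 : ℂ × ℂ × ℂ), (0 : ℂ)), R ((y.1.1, y.1.2.2 + Complex.I * y.2),
        (y.1.2.1, y.1.2.2 - Complex.I * y.2)) = 0 ↔ y.2 = F y.1)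
    (hFs : ∀ᶠ x in 𝓝 (0 : ℂ × ℂ × ℂ), F (conj x.2.1, conj x.1, conj x.2.2) = conj (F x))
    (hFd : HasDerivAt (fun s => F (0, 0, s)) 0 0) :
    IsAdaptedFamily R (lineFamily F) := by
  refine ⟨hR, hRs, hw, hlevi, ?_, ?_, ?_, ?_⟩
  · have h1 := analyticAt_linePoint 0
    have h2 : AnalyticAt ℂ (fun y => F (linePoint y)) 0 :=
      AnalyticAt.fun_comp_of_eq hF h1 linePoint_zero
    exact (analyticAt_fst_comp h1).prod ((analyticAt_snd_comp (analyticAt_snd_comp h1)).add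
      (analyticAt_const.mul h2))
  · simp [lineFamily, linePoint_zero, hF0]
  · have e : (fun s => lineFamily F (0, s)) = fun s => (0, s + Complex.I * F (0, 0, s)) := by
      funext s
      simp [lineFamily, linePoint]
    rw [e]
    have := (hasDerivAt_const (0 : ℂ) (0 : ℂ)).prodMk ((hasDerivAt_id (0 : ℂ)).add
      (hFd.const_mul Complex.I))
    simpa using this
  · have tF : Tendsto F (𝓝 0) (𝓝 0) := by simpa [hF0] using hF.continuousAt.tendsto
    have tg : Tendsto (fun x => (x, F x)) (𝓝 0) (𝓝 ((0 : ℂ × ℂ × ℂ), (0 : ℂ))) :=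
      tendsto_id.prodMk_nhds tF
    filter_upwards [tendsto_linePoint.eventually (tg.eventually hFe), tendsto_linePoint.eventually hFs]
      with y h1 h2
    have h3 := h1.2 rfl
    refine Eq.trans ?_ h3
    congr 2
    have e : bar (lineFamily F) y = star (lineFamily F (star y)) := rfl
    rw [e, lineFamily, linePoint_star, h2]
    simp [Prod.star_def, sub_eq_add_neg]

end lineFamily

section chainEquation

variable {M : Set (ℂ × ℂ)} {p : ℂ × ℂ}

/-- The real parameter of the family of lines corresponding to the initial data `(z, u, dz/du)`. -/
noncomputable def lineParam (ν : ℂ × ℝ × ℂ) : Fin 5 → ℂ :=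
  ![(ν.1.re : ℂ), (ν.1.im : ℂ), (ν.2.1 : ℂ), (ν.2.2.re : ℂ), (ν.2.2.im : ℂ)]

theorem star_lineParam (ν : ℂ × ℝ × ℂ) : star (lineParam ν) = lineParam ν := by
  funext i
  fin_cases i <;> simp [lineParam]

theorem analyticAt_lineParam (ν : ℂ × ℝ × ℂ) : AnalyticAt ℝ lineParam ν := by
  rw [analyticAt_pi_iff]
  intro i
  fin_cases i <;> simp [lineParam] <;> fun_prop

theorem lineParam_zero : lineParam 0 = 0 := by
  funext i
  fin_cases i <;> simp [lineParam]

theorem tendsto_lineParam : Tendsto lineParam (𝓝 0) (𝓝 0) := by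
  have := (analyticAt_lineParam 0).continuousAt.tendsto
  rwa [lineParam_zero] at this

theorem linePoint_lineParam (ν : ℂ × ℝ × ℂ) (s : ℝ) : linePoint (lineParam ν, (s : ℂ)) =
    (ν.1 + ν.2.2 * s, conj (ν.1 + ν.2.2 * s), ((ν.2.1 + s : ℝ) : ℂ)) := by
  have h1 : ∀ z : ℂ, (z.re : ℂ) + Complex.I * z.im = z := fun z => by
    rw [mul_comm, Complex.re_add_im]
  have h2 : ∀ z : ℂ, (z.re : ℂ) - Complex.I * z.im = conj z := fun z => by
    apply Complex.ext <;> simp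
  refine Prod.ext ?_ (Prod.ext ?_ ?_)
  · change (ν.1.re + Complex.I * ν.1.im) + (ν.2.2.re + Complex.I * ν.2.2.im) * s = _
    rw [h1, h1]
  · change (ν.1.re - Complex.I * ν.1.im) + (ν.2.2.re - Complex.I * ν.2.2.im) * s = _
    rw [h2, h2]
    simp
  · change (ν.2.1 : ℂ) + s = _
    push_cast
    rfl

theorem eq_of_sub_re_mul_eq {a b w z z' : ℂ} (h : ‖b‖ * ‖w‖ < ‖a‖)
    (e : z * a - ((z * b).re : ℂ) * w = z' * a - ((z' * b).re : ℂ) * w) : z = z' := by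
  by_contra hne
  have h1 : (z - z') * a = (((z - z') * b).re : ℂ) * w := by
    rw [sub_mul, sub_mul, Complex.sub_re]
    push_cast
    linear_combination e
  have h2 : ‖z - z'‖ * ‖a‖ ≤ ‖z - z'‖ * (‖b‖ * ‖w‖) := by
    rw [← norm_mul, h1, norm_mul, Complex.norm_real, ← mul_assoc, ← norm_mul]
    exact mul_le_mul_of_nonneg_right (Complex.abs_re_le_norm _) (norm_nonneg _)
  have h3 : 0 < ‖z - z'‖ := norm_pos_iff.2 (sub_ne_zero.2 hne)
  have h4 := le_of_mul_le_mul_left h2 h3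
  linarith

/-- Over the real graph equation, chains are the solutions of a second order differential equation
`d²z/du² = q (z, u, dz/du)` with real-analytic right-hand side. -/
theorem exists_chain_equation (L : (ℂ × ℂ) ≃L[ℂ] (ℂ × ℂ)) {R : (ℂ × ℂ) × ℂ × ℂ → ℂ}
    (hR : AnalyticAt ℂ R 0) (hR0 : R 0 = 0)
    (hRs : ∀ x y, R (star y, star x) = conj (R (x, y)))
    (hM : ∀ᶠ x in 𝓝 (0 : ℂ × ℂ), p + L x ∈ M ↔ R (x, star x) = 0)
    (hw : fderiv ℂ R 0 ((0, 1), 0) ≠ 0)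
    (hsum : fderiv ℂ R 0 ((0, 1), 0) + fderiv ℂ R 0 (0, (0, 1)) = 0)
    (hlevi : ∀ g : ℂ → ℂ × ℂ, AnalyticAt ℂ g 0 → g 0 = 0 → deriv g 0 ≠ 0 →
        ¬ (fun z => R (g z, star (g z))) =O[𝓝 0] fun z => ‖z‖ ^ 3) :
    ∃ (f : ℂ × ℝ → ℝ) (q : ℂ × ℝ × ℂ → ℂ), AnalyticAt ℝ f 0 ∧ f 0 = 0 ∧
      HasDerivAt (fun u : ℝ => f (0, u)) 0 0 ∧
      (∀ᶠ x in 𝓝 (0 : ℂ × ℂ), p + L x ∈ M ↔ x.2.im = f (x.1, x.2.re)) ∧ AnalyticAt ℝ q 0 ∧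
      ∀ᶠ ν in 𝓝 (0 : ℂ × ℝ × ℂ), ∀ (z : ℝ → ℂ) (u : ℝ), ContDiffAt ℝ 2 z u →
        (z u, u, deriv z u) = ν →
        IsCRTransversal M (p + L (graphPoint f (z u, u)))
          (L (deriv (fun s => graphPoint f (z s, s)) u)) ∧
        ((∃ Φ : OpenPartialHomeomorph (ℂ × ℂ) (ℂ × ℂ),
          IsNormalizingAt M (p + L (graphPoint f (z u, u))) Φ ∧
          JetInChainLocus (fun s => Φ (p + L (graphPoint f (z s, s)))) u) ↔
        deriv (deriv z) u = q ν) := by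
  obtain ⟨F, hF, hF0, hFe, hFs, hFd⟩ := exists_polarized_graph hR hR0 hRs hw hsum
  have hC := isAdaptedFamily_lineFamily hR hRs hw hlevi hF hF0 hFe hFs hFd
  obtain ⟨ε, T, N, F₂, Q, hN⟩ := hC.exists_isNormalization
  set r : ℂ × ℝ → ℂ × ℂ × ℂ := fun y => (y.1, conj y.1, (y.2 : ℂ)) with hr
  have hra : AnalyticAt ℝ r 0 := by fun_prop
  have tr : Tendsto r (𝓝 0) (𝓝 0) := by
    have := hra.continuousAt.tendsto
    have e : r 0 = 0 := by simp [hr]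
    rwa [e] at this
  set f : ℂ × ℝ → ℝ := fun y => (F (r y)).re with hf
  have hfa : AnalyticAt ℝ f 0 := analyticAt_re_comp
    (AnalyticAt.fun_comp_of_eq (hF.restrictScalars (𝕜 := ℝ)) hra (by simp [hr]))
  have hf0 : f 0 = 0 := by
    have : r 0 = 0 := by simp [hr]
    simp only [hf, this, hF0, Complex.zero_re]
  have hfF : ∀ᶠ y in 𝓝 (0 : ℂ × ℝ), (f y : ℂ) = F (r y) := by
    filter_upwards [tr.eventually hFs] with y hy
    have : (conj (r y).2.1, conj (r y).1, conj (r y).2.2) = r y := by simp [hr]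
    rw [this] at hy
    exact Complex.conj_eq_iff_re.1 hy.symm
  have hMf : ∀ᶠ x in 𝓝 (0 : ℂ × ℂ), p + L x ∈ M ↔ x.2.im = f (x.1, x.2.re) := by
    have t1 : Tendsto (fun x : ℂ × ℂ => (r (x.1, x.2.re), (x.2.im : ℂ))) (𝓝 0)
        (𝓝 ((0 : ℂ × ℂ × ℂ), (0 : ℂ))) := by
      have hcc := Complex.continuous_conj
      refine tendsto_zero_of_continuous (by fun_prop) ?_
      simp [hr]
    have t2 : Tendsto (fun x : ℂ × ℂ => ((x.1, x.2.re) : ℂ × ℝ)) (𝓝 0) (𝓝 0) :=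
      tendsto_zero_of_continuous (by fun_prop) rfl
    filter_upwards [hM, t1.eventually hFe, t2.eventually hfF] with x h1 h2 h3
    rw [← h3] at h2
    have e5 : (x.2.re : ℂ) + Complex.I * x.2.im = x.2 := by
      rw [mul_comm, Complex.re_add_im]
    have e6 : (x.2.re : ℂ) - Complex.I * x.2.im = conj x.2 := by
      apply Complex.ext <;> simp
    simp only [hr, e5, e6] at h2
    rw [h1, ← Complex.ofReal_inj, ← h2]
    rfl
  set κ : (Fin 5 → ℂ) → ℂ := fun μ => fderiv ℂ Q (μ, 0) (0, 1, 0, 0) with hκ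
  set b : (Fin 5 → ℂ) → ℂ × ℂ := fun μ => fderiv ℂ T (μ, 0) (0, 1, 0) with hb
  have hbot : ∀ {G : Type} [NormedAddCommGroup G] [NormedSpace ℂ G],
      AnalyticAt ℂ (fun μ : Fin 5 → ℂ => (μ, (0 : G))) 0 := by intros; fun_prop
  have hκa : AnalyticAt ℂ κ 0 := by
    have h1 : AnalyticAt ℂ (fun μ : Fin 5 → ℂ => fderiv ℂ Q (μ, 0)) 0 :=
      AnalyticAt.fun_comp_of_eq hN.analyticAt_remainder.fderiv hbot rfl
    exact ((ContinuousLinearMap.apply ℂ ℂ ((0 : Fin 5 → ℂ), (1 : ℂ), (0 : ℂ), (0 : ℂ))).analyticAt _).comp h1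
  have hba : AnalyticAt ℂ b 0 := by
    have h1 : AnalyticAt ℂ (fun μ : Fin 5 → ℂ => fderiv ℂ T (μ, 0)) 0 :=
      AnalyticAt.fun_comp_of_eq hN.analyticAt_coord.fderiv hbot rfl
    exact ((ContinuousLinearMap.apply ℂ (ℂ × ℂ) ((0 : Fin 5 → ℂ), (1 : ℂ), (0 : ℂ))).analyticAt _).comp h1
  have hNa : AnalyticAt ℂ (fun μ : Fin 5 → ℂ => N (μ, 0)) 0 :=
    AnalyticAt.fun_comp_of_eq hN.analyticAt_scale hbot rfl
  have hlp := analyticAt_lineParam 0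
  have toR : ∀ {g : (Fin 5 → ℂ) → ℂ}, AnalyticAt ℂ g 0 → AnalyticAt ℝ (fun ν => g (lineParam ν)) 0 :=
    fun hg => AnalyticAt.fun_comp_of_eq (hg.restrictScalars (𝕜 := ℝ)) hlp lineParam_zero
  set ζ : ℂ × ℝ × ℂ → ℂ := fun ν => conj (κ (lineParam ν)) / 2 / N (lineParam ν, 0) with hζ
  have hζa : AnalyticAt ℝ ζ 0 := by
    refine AnalyticAt.div ((analyticAt_conj_comp (toR hκa)).div_const) (toR hNa) ?_
    rw [lineParam_zero]
    exact hN.scale_ne_zero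
  have hb1 := toR (analyticAt_fst_comp hba)
  have hb2 := toR (analyticAt_snd_comp hba)
  set q : ℂ × ℝ × ℂ → ℂ := fun ν => ζ ν * (b (lineParam ν)).1 -
    ((ζ ν * (b (lineParam ν)).2).re : ℂ) * ν.2.2 with hq
  have hqa : AnalyticAt ℝ q 0 := by
    refine (hζa.mul hb1).sub (AnalyticAt.mul (analyticAt_ofReal_comp
      (analyticAt_re_comp (hζa.mul hb2))) ?_)
    fun_prop
  refine ⟨f, q, hfa, hf0, ?_, hMf, hqa, ?_⟩
  · have h1 : HasDerivAt (fun u : ℝ => F (0, 0, (u : ℂ))) 0 0 := by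
      have hFd' : HasDerivAt (fun s => F (0, 0, s)) 0 ((0 : ℝ) : ℂ) := by simpa using hFd
      exact hFd'.comp_ofReal
    have h2 := (Complex.reCLM.hasFDerivAt.comp_hasDerivAt (0 : ℝ) h1)
    rw [map_zero] at h2
    refine h2.congr_of_eventuallyEq (Eventually.of_forall fun u => ?_)
    simp [hf, hr]
  · have tν1 : Tendsto (fun ν : ℂ × ℝ × ℂ => ((ν.1, ν.2.1) : ℂ × ℝ)) (𝓝 0) (𝓝 0) :=
      tendsto_zero_of_continuous (by fun_prop) rfl
    have tG : Tendsto (fun ν : ℂ × ℝ × ℂ => graphPoint f (ν.1, ν.2.1)) (𝓝 0) (𝓝 0) :=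
      (tendsto_graphPoint hfa hf0).comp tν1
    have tinj : ∀ᶠ ν in 𝓝 (0 : ℂ × ℝ × ℂ), ‖(b (lineParam ν)).2‖ * ‖ν.2.2‖ < ‖(b (lineParam ν)).1‖ := by
      have h1 : ContinuousAt (fun ν : ℂ × ℝ × ℂ => ‖(b (lineParam ν)).2‖ * ‖ν.2.2‖) 0 :=
        hb2.continuousAt.norm.mul (by fun_prop)
      refine h1.eventually_lt hb1.continuousAt.norm ?_
      rw [lineParam_zero]
      have : (b 0).1 = 1 := hN.coord_deriv
      rw [this]
      simp
    have tT : Tendsto (fun μ : Fin 5 → ℂ => (μ, (0 : ℂ × ℂ))) (𝓝 0) (𝓝 0) :=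
      tendsto_zero_of_continuous (by fun_prop) rfl
    filter_upwards [tendsto_lineParam.eventually (hN.eventually_chain_iff hC L hM),
      tendsto_lineParam.eventually (eventually_prodMk_zero hN.coord_curve),
      tν1.eventually hfF.eventually_nhds, tν1.eventually hfa.eventually_analyticAt,
      tG.eventually hMf.eventually_nhds, tinj,
      tendsto_lineParam.eventually (tT.eventually hN.analyticAt_coord.eventually_analyticAt),
      tendsto_lineParam.eventually (hNa.continuousAt.eventually_ne hN.scale_ne_zero)] with ν
      hch hTC hfν hfaν hMν hinj hTν hNν z u hz hν
    obtain ⟨z₀, u₀, z₁⟩ := ν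
    simp only [Prod.mk.injEq] at hν
    obtain ⟨rfl, rfl, rfl⟩ := hν
    set μ := lineParam (z u, u, deriv z u) with hμ
    have hμs : star μ = μ := star_lineParam _
    set G := graphPoint f with hG
    have hGa : AnalyticAt ℝ G (z u, u) := by
      have : G = fun x => (x.1, (x.2 : ℂ) + Complex.I * f x) := funext fun x => graphPoint_apply f x
      rw [this]
      exact analyticAt_fst.prod ((analyticAt_ofReal_comp analyticAt_snd).add
        (analyticAt_const.mul (analyticAt_ofReal_comp hfaν)))
    set ℓ : ℝ → ℂ × ℝ := fun s => (z u + deriv z u * s, u + s) with hℓ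
    have hℓa : AnalyticAt ℝ ℓ 0 := by
      refine AnalyticAt.prod (analyticAt_const.add (analyticAt_const.mul
        (analyticAt_ofReal_comp analyticAt_id))) (by fun_prop)
    have hℓ0 : ℓ 0 = (z u, u) := by simp [hℓ]
    have tℓ : Tendsto ℓ (𝓝 0) (𝓝 (z u, u)) := by
      have := hℓa.continuousAt.tendsto
      rwa [hℓ0] at this
    have hℓd : ∀ s, HasDerivAt ℓ (deriv z u, 1) s := fun s => by
      have e1 : HasDerivAt (fun s : ℝ => z u + deriv z u * (s : ℂ)) (deriv z u) s := by
        simpa using (((hasDerivAt_id s).ofReal_comp).const_mul (deriv z u)).const_add (z u)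
      exact e1.prodMk ((hasDerivAt_id s).const_add u)
    have hTG : ∀ᶠ s : ℝ in 𝓝 (0 : ℝ), T (μ, (0, (s : ℂ))) = G (ℓ s) := by
      have t1 : Tendsto (fun s : ℝ => (μ, (s : ℂ))) (𝓝 0) (𝓝 (μ, 0)) := by
        have : Continuous (fun s : ℝ => (μ, (s : ℂ))) := by fun_prop
        simpa using this.tendsto 0
      filter_upwards [t1.eventually hTC, tℓ.eventually hfν] with s h1 h2
      rw [h1, lineFamily, hμ, linePoint_lineParam, hG, graphPoint_apply, h2]
    have hT0 : T (μ, 0) = G (z u, u) := by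
      have := hTG.self_of_nhds
      rw [hℓ0, Complex.ofReal_zero] at this
      exact this
    set x : ℝ → ℂ × ℂ := fun s => G (z s, s) with hx
    have hzd : HasDerivAt z (deriv z u) u := (hz.differentiableAt (by norm_num)).hasDerivAt
    have hxc : ContDiffAt ℝ 2 x u :=
      ContDiffAt.comp (g := G) u hGa.contDiffAt (hz.prodMk contDiffAt_id)
    have hGd := hGa.differentiableAt.hasFDerivAt
    have hxd : HasDerivAt x (fderiv ℝ G (z u, u) (deriv z u, 1)) u :=
      HasFDerivAt.comp_hasDerivAt u (f := fun s => (z s, s)) hGd (hzd.prodMk (hasDerivAt_id u))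
    have hyd : HasDerivAt (fun s => G (ℓ s)) (fderiv ℝ G (z u, u) (deriv z u, 1)) 0 := by
      rw [← hℓ0] at hGd ⊢
      exact HasFDerivAt.comp_hasDerivAt (0 : ℝ) hGd (hℓd 0)
    have hTd : HasDerivAt (fun s : ℝ => T (μ, (0, (s : ℂ)))) (fderiv ℂ T (μ, 0) (0, 0, 1)) 0 := by
      have l1 : HasDerivAt (fun s : ℝ => (μ, ((0 : ℂ), (s : ℂ)))) (0, 0, 1) 0 := by
        have := (hasDerivAt_id (0 : ℝ)).ofReal_comp
        exact (hasDerivAt_const _ _).prodMk ((hasDerivAt_const _ _).prodMk (by simpa using this))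
      have hTd' : HasFDerivAt T ((fderiv ℂ T (μ, 0)).restrictScalars ℝ)
          ((fun s : ℝ => (μ, ((0 : ℂ), (s : ℂ)))) 0) := by
        simp only [Complex.ofReal_zero]
        exact hTν.differentiableAt.hasFDerivAt.restrictScalars ℝ
      exact HasFDerivAt.comp_hasDerivAt (0 : ℝ) hTd' l1
    have hx1 : deriv x u = fderiv ℂ T (μ, 0) (0, 0, 1) := by
      rw [hxd.deriv, ← hyd.deriv, ← hTd.deriv]
      exact (EventuallyEq.deriv_eq hTG).symm
    have hxM : ∀ᶠ s in 𝓝 u, p + L (x s) ∈ M := by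
      have t : Tendsto x (𝓝 u) (𝓝 (G (z u, u))) := hxc.continuousAt.tendsto
      filter_upwards [t.eventually hMν] with s hs
      rw [hs, hx]
      simp only [hG, graphPoint_snd_re, graphPoint_snd_im]
      simp only [graphPoint_apply]
    obtain ⟨hcr, ζ', ω, hdd, hiff⟩ := hch hμs x u hxc hT0.symm hxM hx1
    refine ⟨hcr, hiff.trans ?_⟩
    have hyc : ContDiffAt ℝ 2 (fun s => G (ℓ s)) 0 :=
      ContDiffAt.comp (g := G) 0 (by rw [hℓ0]; exact hGa.contDiffAt) hℓa.contDiffAt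
    have hTc : ContDiffAt ℝ 2 (fun s : ℝ => T (μ, (0, (s : ℂ)))) 0 := hyc.congr_of_eventuallyEq hTG
    have hyy : deriv (deriv fun s : ℝ => T (μ, (0, (s : ℂ)))) 0 = deriv (deriv fun s => G (ℓ s)) 0 :=
      (EventuallyEq.deriv hTG).deriv_eq
    have hre : ∀ (c : ℝ → ℂ × ℝ) (t : ℝ), ContDiffAt ℝ 2 (fun s => G (c s)) t →
        (deriv (fun s => G (c s)) t).2.re = deriv (fun s => (c s).2) t ∧
        (deriv (deriv fun s => G (c s)) t).2.re = deriv (deriv fun s => (c s).2) t ∧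
        (deriv (deriv fun s => G (c s)) t).1 = deriv (deriv fun s => (c s).1) t := fun c t hc => by
      have k1 := deriv_clm_comp (Complex.reCLM.comp (ContinuousLinearMap.snd ℝ ℂ ℂ)) hc
      have k2 := (deriv_deriv_fst hc).2
      have k3 : (fun s => (Complex.reCLM.comp (ContinuousLinearMap.snd ℝ ℂ ℂ)) (G (c s))) =
        fun s => (c s).2 := funext fun s => graphPoint_snd_re f (c s)
      have k4 : (fun s => (G (c s)).1) = fun s => (c s).1 := funext fun s => by
        rw [hG, graphPoint_apply]
      rw [k3] at k1
      rw [k4] at k2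
      exact ⟨k1.1.symm, k1.2.symm, k2.symm⟩
    have hℓ1 : deriv (deriv fun s => (ℓ s).1) 0 = 0 ∧ deriv (deriv fun s => (ℓ s).2) 0 = 0 := by
      have e1 : deriv (fun s => (ℓ s).1) = fun _ => deriv z u := funext fun s => by
        have := (ContinuousLinearMap.fst ℝ ℂ ℝ).hasFDerivAt.comp_hasDerivAt s (hℓd s)
        exact this.deriv
      have e2 : deriv (fun s => (ℓ s).2) = fun _ => 1 := funext fun s => by
        have := (ContinuousLinearMap.snd ℝ ℂ ℝ).hasFDerivAt.comp_hasDerivAt s (hℓd s)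
        exact this.deriv
      rw [e1, e2]
      simp
    obtain ⟨-, y2, y3⟩ := hre ℓ 0 hyc
    obtain ⟨x1, x2, x3⟩ := hre (fun s => (z s, s)) u hxc
    have d1 : deriv (fun s : ℝ => s) = fun _ => 1 := funext fun s => (hasDerivAt_id s).deriv
    simp only [d1, deriv_const] at x1 x2
    have x4 : (deriv x u).1 = deriv z u := by
      have e1 := (deriv_deriv_fst hxc).1
      have e2 : (fun s => (x s).1) = z := funext fun s => by
        simp only [hx, hG, graphPoint_apply]
      rw [e2] at e1
      exact e1.symm
    rw [hyy] at hdd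
    have h1 := congrArg Prod.fst hdd
    have h2 := congrArg (fun v : ℂ × ℂ => v.2.re) hdd
    simp only [Prod.fst_add, Prod.snd_add, Prod.smul_fst, Prod.smul_snd, smul_eq_mul,
      Complex.add_re, Complex.re_ofReal_mul] at h1 h2
    rw [← hx1, x4, y3, hℓ1.1, zero_add] at h1
    rw [← hx1] at h2
    have x1' : (deriv x u).2.re = 1 := x1
    have x2' : (deriv (deriv x) u).2.re = 0 := x2
    have x3' : (deriv (deriv x) u).1 = deriv (deriv z) u := x3
    rw [x1', x2', y2, hℓ1.2, zero_add, mul_one] at h2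
    rw [x3'] at h1
    have hb' : b μ = fderiv ℂ T (μ, 0) (0, 1, 0) := rfl
    rw [← hb'] at h1 h2
    have h3 : deriv (deriv z) u = ζ' * (b μ).1 - ((ζ' * (b μ).2).re : ℂ) * deriv z u := by
      rw [h1]
      have : ω = -(ζ' * (b μ).2).re := by linarith
      rw [this]
      push_cast
      ring
    have hζμ : ζ (z u, u, deriv z u) = conj (κ μ) / 2 / N (μ, 0) := rfl
    have hqμ : q (z u, u, deriv z u) = ζ (z u, u, deriv z u) * (b μ).1 -
      ((ζ (z u, u, deriv z u) * (b μ).2).re : ℂ) * deriv z u := rfl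
    rw [← eq_div_iff hNν]
    change ζ' = conj (κ μ) / 2 / N (μ, 0) ↔ _
    rw [← hζμ, h3, hqμ]
    exact ⟨fun e => by rw [e], fun e => eq_of_sub_re_mul_eq hinj e⟩

end chainEquation

section realODE

theorem eventuallyEq_of_hasDerivAt {F : Type*} [NormedAddCommGroup F] [NormedSpace ℝ F]
    [CompleteSpace F] {V : F → F} {f g : ℝ → F} (hV : ContDiffAt ℝ 1 V (f 0)) (h0 : f 0 = g 0)
    (hf : ∀ᶠ t in 𝓝 0, HasDerivAt f (V (f t)) t) (hg : ∀ᶠ t in 𝓝 0, HasDerivAt g (V (g t)) t) :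
    f =ᶠ[𝓝 0] g := by
  obtain ⟨K, s, hs, hK⟩ := hV.exists_lipschitzOnWith
  have cf : ContinuousAt f 0 := hf.self_of_nhds.continuousAt
  have cg : ContinuousAt g 0 := hg.self_of_nhds.continuousAt
  refine ODE_solution_unique_of_eventually (v := fun _ => V) (s := fun _ => s)
    (Eventually.of_forall fun _ => hK) (hf.and (cf.eventually_mem hs))
    (hg.and (cg.eventually_mem (by rwa [← h0]))) h0

variable {ι : Type*} [Fintype ι]

/-- The solutions of an equation with real coefficients are real on the real axis. -/
theorem exists_symmetric_solution {V : (ι → ℂ) → ι → ℂ} (hVa : AnalyticAt ℂ V 0)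
    (hVs : ∀ x, V (star x) = star (V x)) :
    ∃ Y : ℂ → ι → ℂ, Y 0 = 0 ∧ AnalyticAt ℂ Y 0 ∧ (∀ᶠ t in 𝓝 (0 : ℂ), HasDerivAt Y (V (Y t)) t) ∧
      (∀ᶠ t : ℝ in 𝓝 0, HasDerivAt (fun t : ℝ => Y t) (V (Y t)) t) ∧
      ∀ᶠ t : ℝ in 𝓝 0, Y t = star (Y t) := by
  obtain ⟨Y, hY0, hYa, hYd⟩ := exists_holomorphic_solution hVa
  have tR : Tendsto (fun t : ℝ => (t : ℂ)) (𝓝 0) (𝓝 0) :=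
    tendsto_zero_of_continuous Complex.continuous_ofReal rfl
  have h1 : ∀ᶠ t : ℝ in 𝓝 0, HasDerivAt (fun t : ℝ => Y t) (V (Y t)) t :=
    (tR.eventually hYd).mono fun t ht => by
      have h := HasDerivAt.scomp t ht (hasDerivAt_id t).ofReal_comp
      rw [Complex.ofReal_one, one_smul] at h
      exact h
  have h2 : ∀ᶠ t : ℝ in 𝓝 0, HasDerivAt (fun t : ℝ => star (Y t)) (V (star (Y t))) t :=
    h1.mono fun t ht => by rw [hVs]; exact ht.star
  exact ⟨Y, hY0, hYa, hYd, h1, eventuallyEq_of_hasDerivAt (f := fun t : ℝ => Y t)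
    (g := fun t : ℝ => star (Y t)) (V := V) (by
      simp only [Complex.ofReal_zero, hY0]
      exact (hVa.restrictScalars (𝕜 := ℝ)).contDiffAt) (by simp [hY0]) h1 h2⟩

theorem exists_real_solution {v : (ι → ℝ) → ι → ℝ} (hv : AnalyticAt ℝ v 0) :
    ∃ y : ℝ → ι → ℝ, AnalyticAt ℝ y 0 ∧ y 0 = 0 ∧ ∀ᶠ t in 𝓝 (0 : ℝ), HasDerivAt y (v (y t)) t := by
  have hv' : ∀ i, AnalyticAt ℝ (fun x => v x i) 0 := fun i => analyticAt_pi_iff.1 hv i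
  choose g hg hge using fun i => exists_complexification (hv' i)
  set V : (ι → ℂ) → ι → ℂ := fun x i => (g i x + bar (g i) x) / 2 with hV
  have hVa : AnalyticAt ℂ V 0 := by
    rw [analyticAt_pi_iff]
    intro i
    exact ((hg i).add (analyticAt_bar (by rw [star_zero]; exact hg i))).div_const
  have hVs : ∀ x, V (star x) = star (V x) := fun x => by
    funext i
    simp only [hV, bar, star_star, Pi.star_apply, RCLike.star_def, map_div₀, map_add, map_ofNat,
      Complex.conj_conj]
    rw [add_comm]
  have hVr : ∀ᶠ x in 𝓝 (0 : ι → ℝ), V (fun k => (x k : ℂ)) = fun k => (v x k : ℂ) := by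
    filter_upwards [eventually_all.2 hge] with x hx
    funext i
    have e1 : star (fun k => (x k : ℂ)) = fun k => (x k : ℂ) := by
      funext k; simp
    simp only [hV, bar, e1, hx i]
    simp
  obtain ⟨Y, hY0, hYa, -, h1, h3⟩ := exists_symmetric_solution hVa hVs
  set y : ℝ → ι → ℝ := fun t i => (Y t i).re with hy
  have hyY : ∀ᶠ t : ℝ in 𝓝 0, (fun k => (y t k : ℂ)) = Y t := by
    filter_upwards [h3] with t ht
    funext k
    have := congrFun ht k
    exact Complex.conj_eq_iff_re.1 this.symm
  have hya : AnalyticAt ℝ y 0 := by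
    rw [analyticAt_pi_iff]
    intro i
    refine analyticAt_re_comp ?_
    have e1 : AnalyticAt ℂ (fun s => Y s i) ((0 : ℝ) : ℂ) := by
      rw [Complex.ofReal_zero]; exact analyticAt_pi_iff.1 hYa i
    exact (e1.restrictScalars (𝕜 := ℝ)).comp (analyticAt_ofReal_comp (x := (0 : ℝ)) analyticAt_id)
  have hy0 : y 0 = 0 := by
    funext i
    simp [hy, hY0]
  refine ⟨y, hya, hy0, ?_⟩
  have ty : Tendsto y (𝓝 0) (𝓝 0) := by
    have := hya.continuousAt.tendsto
    rwa [hy0] at this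
  filter_upwards [h1, hyY, ty.eventually hVr] with t k1 k2 k3
  rw [hasDerivAt_pi]
  intro i
  have k4 := hasDerivAt_pi.1 k1 i
  rw [← k2, k3] at k4
  have k5 := Complex.reCLM.hasFDerivAt.comp_hasDerivAt t k4
  simp at k5
  exact k5

/-- Real-analytic second order equations have real-analytic solutions. -/
theorem exists_second_order_solution {q : ℂ × ℝ × ℂ → ℂ} (hq : AnalyticAt ℝ q 0) :
    ∃ z : ℝ → ℂ, AnalyticAt ℝ z 0 ∧ z 0 = 0 ∧ deriv z 0 = 0 ∧
      ∀ᶠ u in 𝓝 0, deriv (deriv z) u = q (z u, u, deriv z u) := by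
  have hp : ∀ i, AnalyticAt ℝ (fun x : Fin 5 → ℝ => x i) 0 := fun i =>
    (ContinuousLinearMap.proj (R := ℝ) (φ := fun _ : Fin 5 => ℝ) i).analyticAt 0
  have hpc : ∀ i, AnalyticAt ℝ (fun x : Fin 5 → ℝ => (x i : ℂ)) 0 := fun i =>
    analyticAt_ofReal_comp (hp i)
  set ν : (Fin 5 → ℝ) → ℂ × ℝ × ℂ := fun x => (x 0 + Complex.I * x 1, x 2, x 3 + Complex.I * x 4) with hν
  have hνa : AnalyticAt ℝ ν 0 := by
    have h0 := hp 2
    have h1 := hpc 0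
    have h2 := hpc 1
    have h3 := hpc 3
    have h4 := hpc 4
    exact (h1.add (analyticAt_const.mul h2)).prod (h0.prod (h3.add (analyticAt_const.mul h4)))
  have hqν : AnalyticAt ℝ (fun x => q (ν x)) 0 :=
    AnalyticAt.fun_comp_of_eq hq hνa (by simp [hν])
  set v : (Fin 5 → ℝ) → Fin 5 → ℝ := fun x => ![x 3, x 4, 1, (q (ν x)).re, (q (ν x)).im] with hv
  have hva : AnalyticAt ℝ v 0 := by
    rw [analyticAt_pi_iff]
    intro i
    fin_cases i
    · exact hp 3
    · exact hp 4
    · exact analyticAt_const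
    · exact analyticAt_re_comp hqν
    · exact analyticAt_im_comp hqν
  obtain ⟨y, hya, hy0, hyd⟩ := exists_real_solution hva
  have hyi : ∀ i, AnalyticAt ℝ (fun t => y t i) 0 := fun i => analyticAt_pi_iff.1 hya i
  have hdi : ∀ i, ∀ᶠ t in 𝓝 (0 : ℝ), HasDerivAt (fun t => y t i) (v (y t) i) t := fun i =>
    hyd.mono fun t ht => hasDerivAt_pi.1 ht i
  have hu : ∀ᶠ t in 𝓝 (0 : ℝ), y t 2 = t :=
    eventuallyEq_of_hasDerivAt (f := fun t => y t 2) (g := fun t => t) (V := fun _ => 1)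
      contDiffAt_const (by simp [hy0]) (hdi 2) (Eventually.of_forall fun t => hasDerivAt_id t)
  set z : ℝ → ℂ := fun t => y t 0 + Complex.I * y t 1 with hz
  have hzd : ∀ᶠ t in 𝓝 (0 : ℝ), HasDerivAt z (y t 3 + Complex.I * y t 4) t := by
    filter_upwards [hdi 0, hdi 1] with t h0 h1
    exact h0.ofReal_comp.add (h1.ofReal_comp.const_mul Complex.I)
  have hzd' : deriv z =ᶠ[𝓝 0] fun t => y t 3 + Complex.I * y t 4 := hzd.mono fun t ht => ht.deriv
  refine ⟨z, ?_, by simp [hz, hy0], by rw [hzd'.self_of_nhds]; simp [hy0], ?_⟩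
  · exact (analyticAt_ofReal_comp (hyi 0)).add (analyticAt_const.mul (analyticAt_ofReal_comp (hyi 1)))
  · filter_upwards [hzd'.eventually_nhds, hdi 3, hdi 4, hu] with t h1 h3 h4 h2
    have h5 : deriv z t = y t 3 + Complex.I * y t 4 := h1.self_of_nhds
    have h6 : ν (y t) = (z t, t, deriv z t) := by rw [h5]; simp only [hν, hz, h2]
    rw [EventuallyEq.deriv_eq h1, ← h6]
    refine (h3.ofReal_comp.add (h4.ofReal_comp.const_mul Complex.I)).deriv.trans ?_
    change ((q (ν (y t))).re : ℂ) + Complex.I * ((q (ν (y t))).im : ℂ) = _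
    rw [mul_comm, Complex.re_add_im]

theorem second_order_solution_unique {q : ℂ × ℝ × ℂ → ℂ} (hq : AnalyticAt ℝ q 0) {z w : ℝ → ℂ}
    (hz : ContDiffAt ℝ 2 z 0) (hw : ContDiffAt ℝ 2 w 0) (hz0 : z 0 = 0) (hw0 : w 0 = 0)
    (hz1 : deriv z 0 = 0) (hw1 : deriv w 0 = 0)
    (hzq : ∀ᶠ u in 𝓝 0, deriv (deriv z) u = q (z u, u, deriv z u))
    (hwq : ∀ᶠ u in 𝓝 0, deriv (deriv w) u = q (w u, u, deriv w u)) : z =ᶠ[𝓝 0] w := by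
  have key : ∀ {z : ℝ → ℂ}, ContDiffAt ℝ 2 z 0 →
      (∀ᶠ u in 𝓝 0, deriv (deriv z) u = q (z u, u, deriv z u)) →
      ∀ᶠ u in 𝓝 0, HasDerivAt (fun u => (z u, u, deriv z u))
        ((fun ν : ℂ × ℝ × ℂ => (ν.2.2, (1 : ℝ), q ν)) (z u, u, deriv z u)) u := fun {z} hz hzq => by
    filter_upwards [hz.eventually (by norm_num), hzq] with u h1 h2
    rw [← h2]
    exact (h1.differentiableAt (by norm_num)).hasDerivAt.prodMk ((hasDerivAt_id u).prodMk
      ((contDiffAt_deriv h1).differentiableAt (by norm_num)).hasDerivAt)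
  have hV : AnalyticAt ℝ (fun ν : ℂ × ℝ × ℂ => (ν.2.2, (1 : ℝ), q ν)) 0 := by fun_prop
  have := eventuallyEq_of_hasDerivAt (f := fun u => (z u, u, deriv z u))
    (g := fun u => (w u, u, deriv w u)) (V := fun ν : ℂ × ℝ × ℂ => (ν.2.2, (1 : ℝ), q ν))
    (by rw [hz0, hz1]; exact hV.contDiffAt) (by rw [hz0, hz1, hw0, hw1]) (key hz hzq) (key hw hwq)
  filter_upwards [this] with u hu
  exact congrArg Prod.fst hu

end realODE

section reparametrization

theorem deriv_deriv_comp {V : Type*} [NormedAddCommGroup V] [NormedSpace ℝ V] {a : ℝ → V} {ϑ : ℝ → ℝ}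
    {u : ℝ} (ha : ContDiffAt ℝ 2 a (ϑ u)) (hϑ : ContDiffAt ℝ 2 ϑ u) :
    deriv (fun s => a (ϑ s)) u = deriv ϑ u • deriv a (ϑ u) ∧
    deriv (deriv fun s => a (ϑ s)) u =
      deriv ϑ u ^ 2 • deriv (deriv a) (ϑ u) + deriv (deriv ϑ) u • deriv a (ϑ u) := by
  have hev : deriv (fun s => a (ϑ s)) =ᶠ[𝓝 u] fun s => deriv ϑ s • deriv a (ϑ s) := by
    filter_upwards [hϑ.continuousAt.eventually (ha.eventually (by norm_num)),
      hϑ.eventually (by norm_num)] with s h1 h2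
    exact (HasDerivAt.scomp s (h1.differentiableAt (by norm_num)).hasDerivAt
      (h2.differentiableAt (by norm_num)).hasDerivAt).deriv
  refine ⟨hev.self_of_nhds, ?_⟩
  have d1 := ((contDiffAt_deriv hϑ).differentiableAt (by norm_num)).hasDerivAt
  have d2 := HasDerivAt.scomp u ((contDiffAt_deriv ha).differentiableAt (by norm_num)).hasDerivAt
    (hϑ.differentiableAt (by norm_num)).hasDerivAt
  rw [hev.deriv_eq]
  refine (d1.smul d2).deriv.trans ?_
  rw [smul_smul, ← sq]
  rfl

theorem jetInChainLocus_comp {c : ℝ → ℂ × ℂ} {ϑ : ℝ → ℝ} {u : ℝ} (hc : ContDiffAt ℝ 2 c (ϑ u))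
    (hϑ : ContDiffAt ℝ 2 ϑ u) (h1 : deriv ϑ u ≠ 0)
    (hw : deriv (fun s => (c s).2.re) (ϑ u) ≠ 0) (h : JetInChainLocus c (ϑ u)) :
    JetInChainLocus (fun s => c (ϑ s)) u := by
  have hre : ContDiffAt ℝ 2 (fun s => (c s).2.re) (ϑ u) :=
    (Complex.reCLM.comp (ContinuousLinearMap.snd ℝ ℂ ℂ)).contDiff.contDiffAt.comp _ hc
  have hcϑ : ContDiffAt ℝ 2 (fun s => c (ϑ s)) u := ContDiffAt.comp (g := c) u hc hϑ
  obtain ⟨a1, a2⟩ := deriv_deriv_comp (contDiffAt_fst_comp hc) hϑ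
  obtain ⟨w1, w2⟩ := deriv_deriv_comp hre hϑ
  have h' := (jetInChainLocus_iff hc hw).1 h
  rw [jetInChainLocus_iff hcϑ (by rw [w1]; exact mul_ne_zero h1 hw), a1, a2, w1, w2]
  simp only [smul_eq_mul, Complex.real_smul, map_mul, Complex.normSq_ofReal]
  push_cast
  linear_combination ((deriv ϑ u : ℝ) : ℂ) ^ 3 * h'

theorem IsNormalizingAt.deriv_snd_re_ne_zero {M : Set (ℂ × ℂ)}
    {Φ : OpenPartialHomeomorph (ℂ × ℂ) (ℂ × ℂ)} {c : ℝ → ℂ × ℂ} {t : ℝ}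
    (h : IsNormalizingAt M (c t) Φ) (hc : ContDiffAt ℝ 2 c t)
    (hT : IsCRTransversal M (c t) (deriv c t)) : deriv (fun s => (Φ (c s)).2.re) t ≠ 0 := by
  obtain ⟨hΦ, F, hF, hFo⟩ := h
  obtain ⟨h0, hd⟩ := zero_and_hasFDerivAt_of_isBigO (isBigO_sq_of_normalized hFo)
  have h1 := ((hF.isCRTransversal_iff hΦ h0 hd _).1 hT).2
  obtain ⟨k1, k2⟩ := hΦ.curve hc rfl
  have k3 := (deriv_clm_comp (Complex.reCLM.comp (ContinuousLinearMap.snd ℝ ℂ ℂ)) k1).1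
  rw [k2] at k3
  exact fun h => h1 (k3.symm.trans h)

theorem exists_local_inverse {θ : ℝ → ℝ} (hθ : ContDiffAt ℝ 2 θ 0) (h0 : θ 0 = 0)
    (h1 : deriv θ 0 ≠ 0) : ∃ ϑ : ℝ → ℝ, ContDiffAt ℝ 2 ϑ 0 ∧ ϑ 0 = 0 ∧ deriv ϑ 0 ≠ 0 ∧
      (∀ᶠ s in 𝓝 0, ϑ (θ s) = s) ∧ ∀ᶠ s in 𝓝 0, θ (ϑ s) = s := by
  have hd : HasFDerivAt θ ((ContinuousLinearEquiv.unitsEquivAut ℝ (Units.mk0 _ h1) : ℝ ≃L[ℝ] ℝ) :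
      ℝ →L[ℝ] ℝ) 0 := by
    have := (hθ.differentiableAt (by norm_num)).hasDerivAt.hasFDerivAt
    refine this.congr_fderiv ?_
    ext
    simp
  have hn : (2 : WithTop ℕ∞) ≠ 0 := by norm_num
  set Θ := hθ.toOpenPartialHomeomorph θ hd hn with hΘ
  have hs : (0 : ℝ) ∈ Θ.source := hθ.mem_toOpenPartialHomeomorph_source hd hn
  have hc : ContDiffAt ℝ 2 (hθ.localInverse hd hn) (θ 0) := hθ.to_localInverse hd hn
  have e1 : hθ.localInverse hd hn = Θ.symm := rfl
  have e2 : ∀ y, Θ y = θ y := fun y => by rw [hΘ, ContDiffAt.toOpenPartialHomeomorph_coe]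
  rw [e1, h0] at hc
  have hΘ0 : Θ.symm 0 = 0 := by
    have := Θ.left_inv hs
    rwa [e2, h0] at this
  have ht : (0 : ℝ) ∈ Θ.target := by
    have := Θ.map_source hs
    rwa [e2, h0] at this
  have i1 : ∀ᶠ s in 𝓝 0, Θ.symm (θ s) = s := by
    filter_upwards [Θ.open_source.mem_nhds hs] with s hs
    rw [← e2]; exact Θ.left_inv hs
  have i2 : ∀ᶠ s in 𝓝 0, θ (Θ.symm s) = s := by
    filter_upwards [Θ.open_target.mem_nhds ht] with s hs
    rw [← e2]; exact Θ.right_inv hs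
  refine ⟨Θ.symm, hc, hΘ0, fun h => ?_, i1, i2⟩
  have d1 : HasDerivAt Θ.symm 0 0 := by
    have := (hc.differentiableAt (by norm_num)).hasDerivAt
    rwa [h] at this
  have d2 : HasDerivAt θ (deriv θ 0) (Θ.symm 0) := by
    rw [hΘ0]; exact (hθ.differentiableAt (by norm_num)).hasDerivAt
  have d3 := (d2.comp (0 : ℝ) d1).congr_of_eventuallyEq (f₁ := fun s => s)
    (i2.mono fun s hs => hs.symm)
  have := d3.unique (hasDerivAt_id 0)
  simp at this

end reparametrization

section chains

variable {M : Set (ℂ × ℂ)} {p ξ : ℂ × ℂ}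

theorem IsMoserChainThrough.contDiffAt {γ : ℝ → ℂ × ℂ} {ε : ℝ} (h : IsMoserChainThrough M p ξ γ ε)
    {t : ℝ} (ht : t ∈ Ioo (-ε) ε) : ContDiffAt ℝ 2 γ t :=
  h.2.1.1.contDiffAt (isOpen_Ioo.mem_nhds ht)

/-- A chain, in the coordinates where the hypersurface is a graph, is a reparametrized graph over
the `u`-axis that satisfies the chain equation. -/
theorem IsMoserChainThrough.exists_graph_parametrization (L : (ℂ × ℂ) ≃L[ℂ] (ℂ × ℂ)) (hLξ : L (0, 1) = ξ)
    {f : ℂ × ℝ → ℝ} {q : ℂ × ℝ × ℂ → ℂ}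
    (hMf : ∀ᶠ x in 𝓝 (0 : ℂ × ℂ), p + L x ∈ M ↔ x.2.im = f (x.1, x.2.re))
    (hq : ∀ᶠ ν in 𝓝 (0 : ℂ × ℝ × ℂ), ∀ (z : ℝ → ℂ) (u : ℝ), ContDiffAt ℝ 2 z u →
        (z u, u, deriv z u) = ν →
        IsCRTransversal M (p + L (graphPoint f (z u, u)))
          (L (deriv (fun s => graphPoint f (z s, s)) u)) ∧
        ((∃ Φ : OpenPartialHomeomorph (ℂ × ℂ) (ℂ × ℂ),
          IsNormalizingAt M (p + L (graphPoint f (z u, u))) Φ ∧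
          JetInChainLocus (fun s => Φ (p + L (graphPoint f (z s, s)))) u) ↔
        deriv (deriv z) u = q ν))
    {γ : ℝ → ℂ × ℂ} {ε : ℝ} (h : IsMoserChainThrough M p ξ γ ε) :
    ∃ (z : ℝ → ℂ) (θ : ℝ → ℝ), ContDiffAt ℝ 2 z 0 ∧ z 0 = 0 ∧ deriv z 0 = 0 ∧
      (∀ᶠ u in 𝓝 0, deriv (deriv z) u = q (z u, u, deriv z u)) ∧
      ContDiffAt ℝ 2 θ 0 ∧ θ 0 = 0 ∧ deriv θ 0 ≠ 0 ∧
      ∀ᶠ s in 𝓝 0, γ s = p + L (graphPoint f (z (θ s), θ s)) := by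
  obtain ⟨hε, hch, hγ0, r, hr, hγ1⟩ := id h
  have h0 : (0 : ℝ) ∈ Ioo (-ε) ε := ⟨by linarith, hε⟩
  have hγc : ContDiffAt ℝ 2 γ 0 := h.contDiffAt h0
  set Li : (ℂ × ℂ) →L[ℝ] (ℂ × ℂ) := (L.symm : (ℂ × ℂ) →L[ℂ] (ℂ × ℂ)).restrictScalars ℝ with hLi
  have hLi' : ∀ v, Li v = L.symm v := fun v => rfl
  set x : ℝ → ℂ × ℂ := fun s => Li (γ s - p) with hx
  have hxγ : ∀ s, p + L (x s) = γ s := fun s => by simp [hx, hLi']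
  have hγpc : ContDiffAt ℝ 2 (fun s => γ s - p) 0 := hγc.sub contDiffAt_const
  have hxc : ContDiffAt ℝ 2 x 0 := Li.contDiff.contDiffAt.comp (0 : ℝ) hγpc
  have hx0 : x 0 = 0 := by simp [hx, hγ0]
  have hx1 : deriv x 0 = (0, (r : ℂ)) := by
    rw [hx, (deriv_clm_comp Li hγpc).1, deriv_sub_const, hγ1, hLi', ← hLξ]
    have : (r : ℝ) • L (0, 1) = L (r • ((0 : ℂ), (1 : ℂ))) :=
      (((L : (ℂ × ℂ) →L[ℂ] (ℂ × ℂ)).restrictScalars ℝ).map_smul r _).symm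
    rw [this, L.symm_apply_apply]
    simp
  set ℓ : (ℂ × ℂ) →L[ℝ] ℝ := Complex.reCLM.comp (ContinuousLinearMap.snd ℝ ℂ ℂ) with hℓ
  set θ : ℝ → ℝ := fun s => ℓ (x s) with hθ
  have hθc : ContDiffAt ℝ 2 θ 0 := ℓ.contDiff.contDiffAt.comp (0 : ℝ) hxc
  have hθ0 : θ 0 = 0 := by simp [hθ, hx0]
  have hθ1 : deriv θ 0 ≠ 0 := by
    rw [hθ, (deriv_clm_comp ℓ hxc).1, hx1]
    simpa [hℓ] using hr
  obtain ⟨ϑ, hϑc, hϑ0, hϑ1, i1, i2⟩ := exists_local_inverse hθc hθ0 hθ1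
  have tϑ : Tendsto ϑ (𝓝 0) (𝓝 0) := by
    have := hϑc.continuousAt.tendsto
    rwa [hϑ0] at this
  have tx : Tendsto x (𝓝 0) (𝓝 0) := by
    have := hxc.continuousAt.tendsto
    rwa [hx0] at this
  set z : ℝ → ℂ := fun u => (x (ϑ u)).1 with hz
  have hxϑc : ContDiffAt ℝ 2 (fun u => x (ϑ u)) 0 :=
    ContDiffAt.comp (g := x) 0 (by rw [hϑ0]; exact hxc) hϑc
  have hzc : ContDiffAt ℝ 2 z 0 := contDiffAt_fst_comp hxϑc
  have hz0 : z 0 = 0 := by simp [hz, hϑ0, hx0]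
  have hz1 : deriv z 0 = 0 := by
    rw [hz, (deriv_deriv_fst hxϑc).1, (deriv_deriv_comp (by rw [hϑ0]; exact hxc) hϑc).1, hϑ0, hx1]
    simp
  have hmem : ∀ᶠ t in 𝓝 (0 : ℝ), t ∈ Ioo (-ε) ε := isOpen_Ioo.mem_nhds h0
  have hgr : ∀ᶠ u in 𝓝 0, x (ϑ u) = graphPoint f (z u, u) := by
    filter_upwards [(tx.comp tϑ).eventually hMf, tϑ.eventually hmem, i2] with u h1 h2 h3
    simp only [Function.comp] at h1
    rw [hxγ] at h1
    have h4 := h1.1 (hch.2 _ h2).1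
    have h5 : (x (ϑ u)).2.re = u := h3
    rw [h5] at h4
    rw [graphPoint_apply]
    refine Prod.ext rfl ?_
    have h6 : (x (ϑ u)).2 = (u : ℂ) + Complex.I * (f ((x (ϑ u)).1, u) : ℝ) := by
      rw [← h4]
      apply Complex.ext <;> simp [h5]
    exact h6
  have tν : Tendsto (fun u => (z u, u, deriv z u)) (𝓝 0) (𝓝 (0 : ℂ × ℝ × ℂ)) := by
    have c := (hzc.continuousAt.prodMk (continuousAt_id.prodMk (contDiffAt_deriv hzc).continuousAt)).tendsto
    simp only [hz0, hz1, id] at c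
    exact c
  refine ⟨z, θ, hzc, hz0, hz1, ?_, hθc, hθ0, hθ1, ?_⟩
  · have hϑ1' : ∀ᶠ u in 𝓝 0, deriv ϑ u ≠ 0 :=
      (contDiffAt_deriv hϑc).continuousAt.eventually_ne hϑ1
    filter_upwards [tν.eventually hq, hzc.eventually (by norm_num), tϑ.eventually hmem,
      hgr.eventually_nhds, hϑc.eventually (by norm_num), hϑ1'] with u h1 h2 h3 h4 h5 h6
    refine ((h1 z u h2 rfl).2).1 ?_
    obtain ⟨-, hT, Φ, hΦ, hJ⟩ := hch.2 _ h3
    have e : ∀ᶠ s in 𝓝 u, p + L (graphPoint f (z s, s)) = γ (ϑ s) := by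
      filter_upwards [h4] with s hs
      rw [← hs, hxγ]
    refine ⟨Φ, ?_, ?_⟩
    · rw [e.self_of_nhds]; exact hΦ
    · have hγt := h.contDiffAt h3
      have hJ' := jetInChainLocus_comp (c := fun s => Φ (γ s)) (hΦ.1.curve hγt rfl).1 h5 h6
        (hΦ.deriv_snd_re_ne_zero hγt hT) hJ
      have hcomp : ContDiffAt ℝ 2 (fun s => Φ (γ (ϑ s))) u :=
        ContDiffAt.comp (g := fun s => Φ (γ s)) u (hΦ.1.curve hγt rfl).1 h5
      have ee : (fun s => Φ (γ (ϑ s))) =ᶠ[𝓝 u] fun s => Φ (p + L (graphPoint f (z s, s))) := by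
        filter_upwards [e] with s hs
        rw [hs]
      have e1 : ∀ g : ℂ × ℂ → ℝ, (fun s => g (Φ (γ (ϑ s)))) =ᶠ[𝓝 u]
          fun s => g (Φ (p + L (graphPoint f (z s, s)))) := fun g => ee.fun_comp g
      simp only [JetInChainLocus, jetOne, jetTwo] at hJ' ⊢
      rw [← (e1 fun y => y.1.re).deriv_eq, ← (e1 fun y => y.1.im).deriv_eq,
        ← (e1 fun y => y.2.re).deriv_eq, ← (e1 fun y => y.1.re).deriv.deriv_eq,
        ← (e1 fun y => y.1.im).deriv.deriv_eq, ← (e1 fun y => y.2.re).deriv.deriv_eq]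
      exact hJ'
  · have tθ : Tendsto θ (𝓝 0) (𝓝 0) := by
      have := hθc.continuousAt.tendsto
      rwa [hθ0] at this
    filter_upwards [tθ.eventually hgr, i1] with s h1 h2
    rw [← h1, h2, hxγ]

end chains

section chainGerms

variable {M : Set (ℂ × ℂ)} {p ξ : ℂ × ℂ}

theorem exists_Ioo_of_eventually {P : ℝ → Prop} (h : ∀ᶠ t in 𝓝 (0 : ℝ), P t) :
    ∃ ε > 0, ∀ t ∈ Ioo (-ε) ε, P t := by
  obtain ⟨ε, hε, h⟩ := Metric.eventually_nhds_iff_ball.1 h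
  refine ⟨ε, hε, fun t ht => h t ?_⟩
  rwa [Real.ball_eq_Ioo, zero_sub, zero_add]

/-- Analytic solutions of the chain equation give analytic chains. -/
theorem exists_isMoserChainThrough (L : (ℂ × ℂ) ≃L[ℂ] (ℂ × ℂ)) (hLξ : L (0, 1) = ξ)
    {f : ℂ × ℝ → ℝ} {q : ℂ × ℝ × ℂ → ℂ} (hf : AnalyticAt ℝ f 0) (hf0 : f 0 = 0)
    (hfd : HasDerivAt (fun u : ℝ => f (0, u)) 0 0)
    (hMf : ∀ᶠ x in 𝓝 (0 : ℂ × ℂ), p + L x ∈ M ↔ x.2.im = f (x.1, x.2.re))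
    (hq : ∀ᶠ ν in 𝓝 (0 : ℂ × ℝ × ℂ), ∀ (z : ℝ → ℂ) (u : ℝ), ContDiffAt ℝ 2 z u →
        (z u, u, deriv z u) = ν →
        IsCRTransversal M (p + L (graphPoint f (z u, u)))
          (L (deriv (fun s => graphPoint f (z s, s)) u)) ∧
        ((∃ Φ : OpenPartialHomeomorph (ℂ × ℂ) (ℂ × ℂ),
          IsNormalizingAt M (p + L (graphPoint f (z u, u))) Φ ∧
          JetInChainLocus (fun s => Φ (p + L (graphPoint f (z s, s)))) u) ↔
          deriv (deriv z) u = q ν))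
    {z : ℝ → ℂ} (hz : AnalyticAt ℝ z 0) (hz0 : z 0 = 0) (hz1 : deriv z 0 = 0)
    (hzq : ∀ᶠ u in 𝓝 0, deriv (deriv z) u = q (z u, u, deriv z u)) :
    AnalyticAt ℝ (fun u => graphPoint f (z u, u)) 0 ∧
    HasDerivAt (fun u => graphPoint f (z u, u)) (0, 1) 0 ∧
    ∃ ε, IsMoserChainThrough M p ξ (fun u => p + L (graphPoint f (z u, u))) ε ∧
      AnalyticOnNhd ℝ (fun u => p + L (graphPoint f (z u, u))) (Ioo (-ε) ε) := by
  have ha : AnalyticAt ℝ (fun u => graphPoint f (z u, u)) 0 :=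
    AnalyticAt.fun_comp_of_eq (analyticAt_graphPoint hf) (hz.prod analyticAt_id) (by simp [hz0])
  set L' : (ℂ × ℂ) →L[ℝ] (ℂ × ℂ) := (L : (ℂ × ℂ) →L[ℂ] (ℂ × ℂ)).restrictScalars ℝ with hL'
  have hγa : ∀ {u}, AnalyticAt ℝ (fun u => graphPoint f (z u, u)) u →
      AnalyticAt ℝ (fun u => p + L (graphPoint f (z u, u))) u := fun h =>
    analyticAt_const.add ((L'.analyticAt _).comp h)
  have hd : ∀ {u}, AnalyticAt ℝ (fun u => graphPoint f (z u, u)) u →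
      deriv (fun u => p + L (graphPoint f (z u, u))) u = L (deriv (fun u => graphPoint f (z u, u)) u) :=
    fun h => ((L'.hasFDerivAt.comp_hasDerivAt _ h.differentiableAt.hasDerivAt).const_add p).deriv
  have hcz : HasDerivAt (fun u : ℝ => (z u, u)) (0, 1) 0 := by
    have := hz.differentiableAt.hasDerivAt
    rw [hz1] at this
    exact this.prodMk (hasDerivAt_id 0)
  have h0 : graphPoint f (z 0, 0) = 0 := by
    rw [graphPoint_apply, hz0]
    have : f (0, 0) = 0 := hf0
    simp [this]
  have hg1 : HasDerivAt (fun u => graphPoint f (z u, u)) ((0 : ℂ), (1 : ℂ)) 0 := by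
    have hfD := hf.differentiableAt.hasFDerivAt
    have e1 : HasDerivAt (fun u => f (z u, u)) 0 0 := by
      have e2 : HasDerivAt (fun u : ℝ => ((0 : ℂ), u)) ((0 : ℂ), (1 : ℝ)) 0 :=
        (hasDerivAt_const 0 0).prodMk (hasDerivAt_id 0)
      have e3 := HasFDerivAt.comp_hasDerivAt_of_eq (0 : ℝ) hfD e2 rfl
      have e4 := HasFDerivAt.comp_hasDerivAt_of_eq (0 : ℝ) hfD hcz (by simp only [hz0]; rfl)
      rwa [e3.unique hfd] at e4
    have e5 := hz.differentiableAt.hasDerivAt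
    rw [hz1] at e5
    have e6 := e5.prodMk ((hasDerivAt_id (0 : ℝ)).ofReal_comp.add (e1.ofReal_comp.const_mul Complex.I))
    simp only [graphPoint_apply]
    simpa using e6
  refine ⟨ha, hg1, ?_⟩
  have tν : Tendsto (fun u => (z u, u, deriv z u)) (𝓝 0) (𝓝 (0 : ℂ × ℝ × ℂ)) := by
    have c := (hz.continuousAt.prodMk (continuousAt_id.prodMk hz.deriv.continuousAt)).tendsto
    simp only [hz0, hz1, id] at c
    exact c
  have tg : Tendsto (fun u => graphPoint f (z u, u)) (𝓝 0) (𝓝 0) := by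
    have := ha.continuousAt.tendsto
    rwa [h0] at this
  obtain ⟨ε, hε, hall⟩ := exists_Ioo_of_eventually (ha.eventually_analyticAt.and
    ((tν.eventually hq).and (hzq.and ((tg.eventually hMf).and hz.eventually_analyticAt))))
  refine ⟨ε, ⟨hε, ⟨?_, fun t ht => ?_⟩, by simp [h0], 1, one_ne_zero, ?_⟩,
    fun t ht => hγa (hall t ht).1⟩
  · exact fun t ht => (hγa (hall t ht).1).contDiffAt.contDiffWithinAt
  · obtain ⟨h1, h2, h3, h4, h5⟩ := hall t ht
    obtain ⟨k1, k2⟩ := h2 z t h5.contDiffAt rfl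
    rw [hd h1]
    exact ⟨h4.2 (by rw [graphPoint_snd_im, graphPoint_snd_re]; rfl), k1, k2.2 h3⟩
  · rw [hd ha, hg1.deriv, hLξ, one_smul]

theorem sameCurveGerm_of_comp {Γ γ σ : ℝ → ℂ × ℂ} {θ₁ θ₂ : ℝ → ℝ} (h₁ : ContDiffAt ℝ 2 θ₁ 0)
    (h₁0 : θ₁ 0 = 0) (h₁1 : deriv θ₁ 0 ≠ 0) (hγ : ∀ᶠ s in 𝓝 0, γ s = Γ (θ₁ s))
    (h₂ : ContDiffAt ℝ 2 θ₂ 0) (h₂0 : θ₂ 0 = 0) (h₂1 : deriv θ₂ 0 ≠ 0)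
    (hσ : ∀ᶠ s in 𝓝 0, σ s = Γ (θ₂ s)) : SameCurveGerm γ σ := by
  obtain ⟨ϑ, hϑ, hϑ0, hϑ1, -, i2⟩ := exists_local_inverse h₁ h₁0 h₁1
  have hϑ' : ContDiffAt ℝ 2 ϑ (θ₂ 0) := by rwa [h₂0]
  have t2 : Tendsto θ₂ (𝓝 0) (𝓝 0) := by
    have := h₂.continuousAt.tendsto
    rwa [h₂0] at this
  have t1 : Tendsto ϑ (𝓝 0) (𝓝 0) := by
    have := hϑ.continuousAt.tendsto
    rwa [hϑ0] at this
  refine ⟨fun s => ϑ (θ₂ s), hϑ'.comp (0 : ℝ) h₂, by simp [h₂0, hϑ0], ?_, ?_⟩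
  · rw [(deriv_deriv_comp hϑ' h₂).1, h₂0]
    exact mul_ne_zero h₂1 hϑ1
  · filter_upwards [hσ, t2.eventually i2, (t1.comp t2).eventually hγ] with s e1 e2 e3
    simp only [Function.comp] at e3
    rw [e3, e2, e1]

/-- The image of a small interval under a `C¹` function with nonzero derivative. -/
theorem exists_image_Ioo {k : ℝ → ℝ} (hk : ContDiffAt ℝ 1 k 0) (h0 : k 0 = 0) (h1 : deriv k 0 ≠ 0)
    {P : ℝ → Prop} (hP : ∀ᶠ t in 𝓝 0, P t) {ε : ℝ} (hε : 0 < ε) :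
    ∃ η a b : ℝ, 0 < η ∧ η ≤ ε ∧ a < 0 ∧ 0 < b ∧ (∀ t ∈ Ioo (-η) η, P t) ∧
      k '' Ioo (-η) η = Ioo a b := by
  have hc : ContinuousAt (deriv k) 0 := by
    have := hk.fderiv_right (m := 0) (by norm_num)
    exact (this.clm_apply contDiffAt_const).continuousAt
  have hd : ∀ᶠ t in 𝓝 0, DifferentiableAt ℝ k t :=
    (hk.eventually (by norm_num)).mono fun t ht => ht.differentiableAt (by norm_num)
  wlog hpos : 0 < deriv k 0 generalizing k
  · have hneg : ∀ t, deriv (fun s => -k s) t = -deriv k t := fun t => deriv.fun_neg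
    obtain ⟨η, a, b, e1, e2, e3, e4, e5, e6⟩ := this (k := fun s => -k s) hk.neg (by simp [h0])
      (by rw [hneg]; simpa using h1) (by simp only [funext hneg]; exact hc.neg)
      (hd.mono fun t ht => ht.neg) (by rw [hneg]; have := lt_of_le_of_ne (not_lt.1 hpos) h1; linarith)
    refine ⟨η, -b, -a, e1, e2, by linarith, by linarith, e5, ?_⟩
    have : k '' Ioo (-η) η = (fun y => -y) '' ((fun s => -k s) '' Ioo (-η) η) := by
      rw [image_image]; simp
    rw [this, e6]
    simp
  obtain ⟨δ, hδ, hall⟩ := exists_Ioo_of_eventually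
    ((hP.and hd).and (hc.eventually (lt_mem_nhds hpos)))
  set η := min (δ / 2) ε with hη
  have hη0 : 0 < η := lt_min (by linarith) hε
  have hηδ : η < δ := (min_le_left _ _).trans_lt (by linarith)
  have hsub : ∀ t ∈ Icc (-η) η, t ∈ Ioo (-δ) δ := fun t ht => ⟨by linarith [ht.1], by linarith [ht.2]⟩
  have hcont : ContinuousOn k (Icc (-η) η) := fun t ht =>
    (hall t (hsub t ht)).1.2.continuousAt.continuousWithinAt
  have hmono : StrictMonoOn k (Icc (-η) η) :=
    strictMonoOn_of_deriv_pos (convex_Icc _ _) hcont fun t ht => by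
      rw [interior_Icc] at ht
      exact (hall t (hsub t (Ioo_subset_Icc_self ht))).2
  have m0 : (0 : ℝ) ∈ Icc (-η) η := ⟨by linarith, hη0.le⟩
  have ml : -η ∈ Icc (-η) η := ⟨le_rfl, by linarith⟩
  have mr : η ∈ Icc (-η) η := ⟨by linarith, le_rfl⟩
  refine ⟨η, k (-η), k η, hη0, min_le_right _ _, h0 ▸ hmono ml m0 (by linarith),
    by conv_lhs => rw [← h0]
       exact hmono m0 mr hη0, fun t ht => (hall t (hsub t (Ioo_subset_Icc_self ht))).1.1, ?_⟩
  refine Subset.antisymm ?_ (intermediate_value_Ioo (by linarith) hcont)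
  rintro - ⟨t, ht, rfl⟩
  exact ⟨hmono ml (Ioo_subset_Icc_self ht) ht.1, hmono (Ioo_subset_Icc_self ht) mr ht.2⟩

end chainGerms

section holomorphicTools

theorem tendsto_ofReal_zero : Tendsto (fun t : ℝ => (t : ℂ)) (𝓝 0) (𝓝 0) :=
  tendsto_zero_of_continuous Complex.continuous_ofReal rfl

/-- The identity theorem for a germ of the real axis. -/
theorem eventuallyEq_of_real {g h : ℂ → ℂ} (hg : AnalyticAt ℂ g 0) (hh : AnalyticAt ℂ h 0)
    (e : ∀ᶠ t : ℝ in 𝓝 0, g t = h t) : g =ᶠ[𝓝 0] h := by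
  refine hg.frequently_eq_iff_eventually_eq hh |>.1 ?_
  have t : Tendsto (fun t : ℝ => (t : ℂ)) (𝓝[≠] 0) (𝓝[≠] 0) :=
    tendsto_nhdsWithin_iff.2 ⟨tendsto_ofReal_zero.mono_left nhdsWithin_le_nhds,
      eventually_mem_nhdsWithin.mono fun t ht => by simpa using ht⟩
  exact t.frequently (e.filter_mono nhdsWithin_le_nhds).frequently

theorem exists_holomorphic_extension {a : ℝ → ℂ} (ha : AnalyticAt ℝ a 0) :
    ∃ g : ℂ → ℂ, AnalyticAt ℂ g 0 ∧ ∀ᶠ t : ℝ in 𝓝 0, g t = a t := by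
  have key : ∀ {b : ℝ → ℝ}, AnalyticAt ℝ b 0 →
      ∃ g : ℂ → ℂ, AnalyticAt ℂ g 0 ∧ ∀ᶠ t : ℝ in 𝓝 0, g t = b t := fun {b} hb => by
    have h1 : AnalyticAt ℝ (fun x : Fin 1 → ℝ => b (x 0)) 0 := AnalyticAt.fun_comp_of_eq hb
      ((ContinuousLinearMap.proj (R := ℝ) (φ := fun _ : Fin 1 => ℝ) 0).analyticAt 0) rfl
    obtain ⟨g, hg, he⟩ := exists_complexification h1
    refine ⟨fun s => g fun _ => s, AnalyticAt.fun_comp_of_eq hg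
      (analyticAt_pi_iff.2 fun _ => analyticAt_id) rfl, ?_⟩
    have t : Tendsto (fun (t : ℝ) (_ : Fin 1) => t) (𝓝 0) (𝓝 0) :=
      tendsto_zero_of_continuous (by fun_prop) rfl
    exact t.eventually he
  obtain ⟨g, hg, hge⟩ := key (analyticAt_re_comp ha)
  obtain ⟨h, hh, hhe⟩ := key (analyticAt_im_comp ha)
  refine ⟨fun s => g s + h s * Complex.I, hg.add (hh.mul analyticAt_const), ?_⟩
  filter_upwards [hge, hhe] with t h1 h2
  rw [h1, h2, Complex.re_add_im]

theorem deriv_of_eq_add_mul {g k : ℂ → ℂ} {c : ℂ} (hk : AnalyticAt ℂ k 0)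
    (h : ∀ᶠ v in 𝓝 (0 : ℂ), g v = c + v * k v) :
    deriv g 0 = k 0 ∧ deriv (deriv g) 0 = 2 * deriv k 0 ∧
      deriv (deriv (deriv g)) 0 = 3 * deriv (deriv k) 0 := by
  have h1 : deriv g =ᶠ[𝓝 0] fun v => k v + v * deriv k v := by
    filter_upwards [h.eventually_nhds, hk.eventually_analyticAt] with v h2 h3
    rw [EventuallyEq.deriv_eq h2]
    have := ((hasDerivAt_id v).mul h3.differentiableAt.hasDerivAt).const_add c
    simpa using this.deriv
  have h2 : deriv (deriv g) =ᶠ[𝓝 0] fun v => 2 * deriv k v + v * deriv (deriv k) v := by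
    filter_upwards [h1.eventually_nhds, hk.eventually_analyticAt] with v h2 h3
    rw [EventuallyEq.deriv_eq h2]
    have := h3.differentiableAt.hasDerivAt.add
      ((hasDerivAt_id v).mul h3.deriv.differentiableAt.hasDerivAt)
    refine this.deriv.trans ?_
    simp only [id]
    ring
  refine ⟨by simpa using h1.self_of_nhds, by simpa using h2.self_of_nhds, ?_⟩
  rw [h2.deriv_eq]
  have := (hk.deriv.differentiableAt.hasDerivAt.const_mul 2).add
      ((hasDerivAt_id (0 : ℂ)).mul hk.deriv.deriv.differentiableAt.hasDerivAt)
  refine this.deriv.trans ?_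
  simp only [id]
  ring

theorem tendsto_prodMk_zero {A B : Type*} [TopologicalSpace A] [TopologicalSpace B] [Zero A]
    [Zero B] : Tendsto (fun s : A => (s, (0 : B))) (𝓝 0) (𝓝 0) :=
  tendsto_zero_of_continuous (by fun_prop) rfl

theorem tendsto_prodMk_left {A B : Type*} [TopologicalSpace A] [TopologicalSpace B] [Zero B] (s : A) :
    Tendsto (fun v : B => (s, v)) (𝓝 0) (𝓝 (s, 0)) := by
  have : Continuous fun v : B => (s, v) := by fun_prop
  exact this.tendsto 0

/-- Taylor's formula of order three in the second variable, with analytic remainder. -/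
theorem exists_taylor_snd {G : ℂ × ℂ → ℂ} (hG : AnalyticAt ℂ G 0) :
    ∃ K : ℂ × ℂ → ℂ, AnalyticAt ℂ K 0 ∧
      (∀ᶠ x in 𝓝 (0 : ℂ × ℂ), G x = G (x.1, 0) + x.2 * deriv (fun v => G (x.1, v)) 0 +
        x.2 ^ 2 / 2 * deriv (deriv fun v => G (x.1, v)) 0 + x.2 ^ 3 * K x) ∧
      ∀ᶠ s in 𝓝 (0 : ℂ), K (s, 0) = deriv (deriv (deriv fun v => G (s, v))) 0 / 6 := by
  obtain ⟨K₁, h₁, e₁⟩ := exists_eq_add_snd_mul hG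
  obtain ⟨K₂, h₂, e₂⟩ := exists_eq_add_snd_mul h₁
  obtain ⟨K₃, h₃, e₃⟩ := exists_eq_add_snd_mul h₂
  have slice : ∀ {f k : ℂ × ℂ → ℂ}, AnalyticAt ℂ k 0 → (∀ᶠ x in 𝓝 0, f x = f (x.1, 0) + x.2 * k x) →
      ∀ᶠ s in 𝓝 (0 : ℂ), deriv (fun v => f (s, v)) 0 = k (s, 0) ∧
        deriv (deriv fun v => f (s, v)) 0 = 2 * deriv (fun v => k (s, v)) 0 ∧
        deriv (deriv (deriv fun v => f (s, v))) 0 = 3 * deriv (deriv fun v => k (s, v)) 0 := by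
    intro f k hk e
    filter_upwards [eventually_prodMk_zero e, tendsto_prodMk_zero.eventually hk.eventually_analyticAt]
      with s h1 h2
    exact deriv_of_eq_add_mul (AnalyticAt.fun_comp_of_eq h2 (by fun_prop) rfl) (c := f (s, 0)) ((tendsto_prodMk_left s).eventually h1)
  have s₁ := slice h₁ e₁
  have s₂ := slice h₂ e₂
  have s₃ := slice h₃ e₃
  refine ⟨K₃, h₃, ?_, ?_⟩
  · filter_upwards [e₁, e₂, e₃, (continuous_fst.tendsto' (0 : ℂ × ℂ) 0 rfl).eventually s₁,
      (continuous_fst.tendsto' (0 : ℂ × ℂ) 0 rfl).eventually s₂] with x a1 a2 a3 ⟨b1, b2, _⟩ ⟨b3, _⟩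
    rw [b1, b2, b3]
    linear_combination a1 + x.2 * a2 + x.2 ^ 2 * a3
  · filter_upwards [s₁, s₂, s₃] with s ⟨_, _, b1⟩ ⟨_, b2, _⟩ ⟨b3, _⟩
    rw [b1, b2, b3]
    ring

/-- A function vanishing on `z = ζ = 0` is in the ideal generated by `z` and `ζ`. -/
theorem exists_eq_mul_add_mul {f : ℂ × ℂ × ℂ → ℂ} (hf : AnalyticAt ℂ f 0)
    (h : ∀ᶠ s in 𝓝 (0 : ℂ), f (0, 0, s) = 0) :
    ∃ a b : ℂ × ℂ × ℂ → ℂ, AnalyticAt ℂ a 0 ∧ AnalyticAt ℂ b 0 ∧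
      ∀ᶠ x in 𝓝 (0 : ℂ × ℂ × ℂ), f x = x.1 * a x + x.2.1 * b x := by
  have h1 : AnalyticAt ℂ (fun x : ℂ × ℂ × ℂ => f (0, x.2)) 0 :=
    AnalyticAt.fun_comp_of_eq hf (by fun_prop) rfl
  obtain ⟨a, ha, ea⟩ := exists_eq_mul_of_eq_zero (f := fun x => f x - f (0, x.2)) (hf.sub h1)
    (ContinuousLinearMap.fst ℂ ℂ (ℂ × ℂ)) (e := (1, 0, 0)) rfl rfl
    (Eventually.of_forall fun x hx => by
      obtain ⟨z, w⟩ := x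
      have : z = 0 := hx
      simp [this])
  have t : Tendsto (fun x : ℂ × ℂ × ℂ => x.2.2) (𝓝 0) (𝓝 0) :=
    tendsto_zero_of_continuous (by fun_prop) rfl
  obtain ⟨b, hb, eb⟩ := exists_eq_mul_of_eq_zero h1
    ((ContinuousLinearMap.fst ℂ ℂ ℂ).comp (ContinuousLinearMap.snd ℂ ℂ (ℂ × ℂ))) (e := (0, 1, 0))
    rfl rfl ((t.eventually h).mono fun x hx hx0 => by
      obtain ⟨z, w, s⟩ := x
      have : w = 0 := hx0
      simp only [this]
      exact hx)
  refine ⟨a, b, ha, hb, ?_⟩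
  filter_upwards [ea, eb] with x h1 h2
  simp only [ContinuousLinearMap.comp_apply, ContinuousLinearMap.coe_fst',
    ContinuousLinearMap.coe_snd'] at h1 h2
  linear_combination h1 + h2

end holomorphicTools

section normalizingFunctions

/-- Solution of the differential equations that determine the last change of coordinates. -/
theorem exists_normalizing_solution {r c : ℂ → ℂ} (hr : AnalyticAt ℂ r 0) (hc : AnalyticAt ℂ c 0)
    (hrs : ∀ s, r (conj s) = conj (r s)) (hcs : ∀ s, c (conj s) = conj (c s)) :
    ∃ a b θ h : ℂ → ℂ, AnalyticAt ℂ b 0 ∧ AnalyticAt ℂ θ 0 ∧ AnalyticAt ℂ h 0 ∧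
      b 0 = 0 ∧ θ 0 = 0 ∧ h 0 = 0 ∧
      (∀ᶠ s in 𝓝 0, HasDerivAt a (3 / 2 * (c s - 3 / 2 * r s ^ 2) - a s ^ 2) s) ∧
      (∀ᶠ s in 𝓝 0, HasDerivAt b (a s) s) ∧ (∀ᶠ s in 𝓝 0, HasDerivAt θ (-(r s) / 2) s) ∧
      (∀ᶠ s in 𝓝 0, HasDerivAt h (Complex.exp (-2 * b s)) s) ∧
      ∀ᶠ s in 𝓝 0, b (conj s) = conj (b s) ∧ θ (conj s) = conj (θ s) ∧ h (conj s) = conj (h s) := by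
  set V : (Fin 5 → ℂ) → Fin 5 → ℂ := fun x => ![3 / 2 * (c (x 4) - 3 / 2 * r (x 4) ^ 2) - x 0 ^ 2,
    x 0, -(r (x 4)) / 2, Complex.exp (-2 * x 1), 1] with hV
  have hp : ∀ i, AnalyticAt ℂ (fun x : Fin 5 → ℂ => x i) 0 := fun i =>
    (ContinuousLinearMap.proj (R := ℂ) (φ := fun _ : Fin 5 => ℂ) i).analyticAt 0
  have hr4 : AnalyticAt ℂ (fun x : Fin 5 → ℂ => r (x 4)) 0 := AnalyticAt.fun_comp_of_eq hr (hp 4) rfl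
  have hc4 : AnalyticAt ℂ (fun x : Fin 5 → ℂ => c (x 4)) 0 := AnalyticAt.fun_comp_of_eq hc (hp 4) rfl
  have hVa : AnalyticAt ℂ V 0 := by
    rw [analyticAt_pi_iff]
    intro i
    fin_cases i
    · exact (analyticAt_const.mul (hc4.sub (analyticAt_const.mul (hr4.pow 2)))).sub ((hp 0).pow 2)
    · exact hp 0
    · exact hr4.neg.div_const
    · exact (analyticAt_const.mul (hp 1)).cexp
    · exact analyticAt_const
  have hVs : ∀ x, V (star x) = star (V x) := fun x => by
    funext i
    fin_cases i <;> simp [hV, hrs, hcs, ← Complex.exp_conj, Complex.conj_ofNat]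
  obtain ⟨Y, hY0, hYa, hYd, hYr, hYs⟩ := exists_symmetric_solution hVa hVs
  have ha : ∀ i, AnalyticAt ℂ (fun s => Y s i) 0 := fun i => analyticAt_pi_iff.1 hYa i
  have h4 : ∀ᶠ s in 𝓝 (0 : ℂ), Y s 4 = s := by
    refine eventuallyEq_of_real (ha 4) analyticAt_id ?_
    refine eventuallyEq_of_hasDerivAt (f := fun t : ℝ => Y t 4) (g := fun t : ℝ => (t : ℂ))
      (V := fun _ => (1 : ℂ)) contDiffAt_const (by simp [hY0]) (hYr.mono fun t ht => ?_)
      (Eventually.of_forall fun t => (hasDerivAt_id t).ofReal_comp)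
    exact hasDerivAt_pi.1 ht 4
  have hs : ∀ i, ∀ᶠ s in 𝓝 (0 : ℂ), Y (conj s) i = conj (Y s i) := fun i => by
    have e := eventuallyEq_of_real (ha i)
      (analyticAt_bar (f := fun s => Y s i) (by rw [star_zero]; exact ha i)) (hYs.mono fun t ht => by
        have e1 := congrFun ht i
        have e2 : bar (fun s => Y s i) (t : ℂ) = conj (Y t i) := by simp [bar]
        rw [e2]; exact e1)
    filter_upwards [e] with s hs
    rw [hs]
    simp [bar]
  refine ⟨fun s => Y s 0, fun s => Y s 1, fun s => Y s 2, fun s => Y s 3, ha 1, ha 2, ha 3,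
    by simp [hY0], by simp [hY0], by simp [hY0], ?_, ?_, ?_, ?_,
    (hs 1).and ((hs 2).and (hs 3))⟩
  · filter_upwards [hYd, h4] with s h h'
    simpa [hV, h'] using hasDerivAt_pi.1 h 0
  · exact hYd.mono fun s h => by simpa [hV] using hasDerivAt_pi.1 h 1
  · filter_upwards [hYd, h4] with s h h'
    simpa [hV, h'] using hasDerivAt_pi.1 h 2
  · exact hYd.mono fun s h => by simpa [hV] using hasDerivAt_pi.1 h 3

theorem exists_normalizing_functions {r c : ℂ → ℂ} (hr : AnalyticAt ℂ r 0) (hc : AnalyticAt ℂ c 0)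
    (hrs : ∀ s, r (conj s) = conj (r s)) (hcs : ∀ s, c (conj s) = conj (c s)) :
    ∃ (l l' h m : ℂ → ℂ) (P K : ℂ × ℂ → ℂ), AnalyticAt ℂ l 0 ∧ AnalyticAt ℂ l' 0 ∧ AnalyticAt ℂ h 0 ∧
      AnalyticAt ℂ m 0 ∧ AnalyticAt ℂ P 0 ∧ AnalyticAt ℂ K 0 ∧ l 0 = 1 ∧ l' 0 = 1 ∧ h 0 = 0 ∧
      HasDerivAt h 1 0 ∧ (∀ᶠ s in 𝓝 0, l' (conj s) = conj (l s) ∧ h (conj s) = conj (h s)) ∧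
      (∀ᶠ x in 𝓝 (0 : ℂ × ℂ), l (x.1 + Complex.I * x.2) * l' (x.1 - Complex.I * x.2) =
        m x.1 * (1 + x.2 * r x.1) + x.2 ^ 2 * P x) ∧
      (∀ᶠ x in 𝓝 (0 : ℂ × ℂ), (h (x.1 + Complex.I * x.2) - h (x.1 - Complex.I * x.2)) /
        (2 * Complex.I) = x.2 * m x.1 + x.2 ^ 3 * K x) ∧
      ∀ᶠ s in 𝓝 0, K (s, 0) - P (s, 0) + m s * (c s - r s ^ 2) = 0 := by
  obtain ⟨a, b, θ, h, hb, hθ, hh, hb0, hθ0, hh0, da, db, dθ, dh, hs⟩ :=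
    exists_normalizing_solution hr hc hrs hcs
  set l : ℂ → ℂ := fun s => Complex.exp (Complex.I * θ s - b s) with hl
  set l' : ℂ → ℂ := fun s => Complex.exp (-(Complex.I * θ s) - b s) with hl'
  set m : ℂ → ℂ := fun s => Complex.exp (-2 * b s) with hm
  have hla : AnalyticAt ℂ l 0 := ((analyticAt_const.mul hθ).sub hb).cexp
  have hla' : AnalyticAt ℂ l' 0 := ((analyticAt_const.mul hθ).neg.sub hb).cexp
  have hma : AnalyticAt ℂ m 0 := (analyticAt_const.mul hb).cexp
  have tp : Tendsto (fun x : ℂ × ℂ => x.1 + Complex.I * x.2) (𝓝 0) (𝓝 0) :=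
    tendsto_zero_of_continuous (by fun_prop) (by simp)
  have tm : Tendsto (fun x : ℂ × ℂ => x.1 - Complex.I * x.2) (𝓝 0) (𝓝 0) :=
    tendsto_zero_of_continuous (by fun_prop) (by simp)
  have cp : ∀ {g : ℂ → ℂ}, AnalyticAt ℂ g 0 →
      AnalyticAt ℂ (fun x : ℂ × ℂ => g (x.1 + Complex.I * x.2)) 0 := fun hg =>
    AnalyticAt.fun_comp_of_eq hg (by fun_prop) (by simp)
  have cm : ∀ {g : ℂ → ℂ}, AnalyticAt ℂ g 0 →
      AnalyticAt ℂ (fun x : ℂ × ℂ => g (x.1 - Complex.I * x.2)) 0 := fun hg =>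
    AnalyticAt.fun_comp_of_eq hg (by fun_prop) (by simp)
  obtain ⟨Q, hQ, eQ, eQ'⟩ := exists_taylor_snd
    (G := fun x => l (x.1 + Complex.I * x.2) * l' (x.1 - Complex.I * x.2)) ((cp hla).mul (cm hla'))
  obtain ⟨K, hK, eK, eK'⟩ := exists_taylor_snd
    (G := fun x => (h (x.1 + Complex.I * x.2) - h (x.1 - Complex.I * x.2)) * (2 * Complex.I)⁻¹)
    (((cp hh).sub (cm hh)).mul analyticAt_const)
  have dp : ∀ s v : ℂ, HasDerivAt (fun v => s + Complex.I * v) Complex.I v := fun s v => by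
    simpa using ((hasDerivAt_id v).const_mul Complex.I).const_add s
  have dm : ∀ s v : ℂ, HasDerivAt (fun v => s - Complex.I * v) (-Complex.I) v := fun s v => by
    simpa using ((hasDerivAt_id v).const_mul Complex.I).const_sub s
  have all := da.and (db.and (dθ.and (dh.and hr.eventually_analyticAt)))
  have hslice := (eventually_prodMk_zero ((tp.eventually all).and (tm.eventually all))).mono
    fun s hs => (tendsto_prodMk_left s).eventually hs
  have dΛ : ∀ᶠ s in 𝓝 (0 : ℂ),
      deriv (fun v => l (s + Complex.I * v) * l' (s - Complex.I * v)) 0 = m s * r s ∧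
      deriv (deriv fun v => l (s + Complex.I * v) * l' (s - Complex.I * v)) 0 =
        m s * (r s ^ 2 + 2 * (3 / 2 * (c s - 3 / 2 * r s ^ 2) - a s ^ 2)) := by
    filter_upwards [hslice] with s hs
    set B : ℂ → ℂ := fun v => (r (s + Complex.I * v) + r (s - Complex.I * v)) / 2 -
      Complex.I * (a (s + Complex.I * v) - a (s - Complex.I * v)) with hB
    have d1 : ∀ᶠ v in 𝓝 (0 : ℂ), HasDerivAt (fun v => l (s + Complex.I * v) * l' (s - Complex.I * v))
        (l (s + Complex.I * v) * l' (s - Complex.I * v) * B v) v := by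
      filter_upwards [hs] with v ⟨⟨_, b1, θ1, _⟩, ⟨_, b2, θ2, _⟩⟩
      have e1 := (((θ1.comp v (dp s v)).const_mul Complex.I).sub (b1.comp v (dp s v))).cexp
      have e2 := ((((θ2.comp v (dm s v)).const_mul Complex.I).neg).sub (b2.comp v (dm s v))).cexp
      refine (e1.mul e2).congr_deriv ?_
      simp only [Function.comp_apply, hl, hl', hB]
      have hI := Complex.I_sq
      simp only [Pi.neg_apply, Pi.sub_apply, Function.comp_apply]
      linear_combination (Complex.exp (Complex.I * θ (s + Complex.I * v) - b (s + Complex.I * v)) *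
        Complex.exp (-(Complex.I * θ (s - Complex.I * v)) - b (s - Complex.I * v))) *
        (-(r (s + Complex.I * v)) / 2 - r (s - Complex.I * v) / 2) * hI
    obtain ⟨⟨a1, -, -, -, r1⟩, ⟨a2, -, -, -, r2⟩⟩ := hs.self_of_nhds
    have dB := (((r1.differentiableAt.hasDerivAt.comp 0 (dp s 0)).add
      (r2.differentiableAt.hasDerivAt.comp 0 (dm s 0))).div_const 2).sub
      (((a1.comp 0 (dp s 0)).sub (a2.comp 0 (dm s 0))).const_mul Complex.I)
    have d2 : deriv (fun v => l (s + Complex.I * v) * l' (s - Complex.I * v)) =ᶠ[𝓝 0]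
        fun v => l (s + Complex.I * v) * l' (s - Complex.I * v) * B v := d1.mono fun v hv => hv.deriv
    have e0 : l s * l' s = m s := by
      simp only [hl, hl', hm, ← Complex.exp_add]
      ring_nf
    refine ⟨?_, ?_⟩
    · rw [d1.self_of_nhds.deriv]
      simp only [hB, mul_zero, add_zero, sub_zero, e0, sub_self]
      ring
    · rw [d2.deriv_eq]
      refine (d1.self_of_nhds.mul dB).deriv.trans ?_
      simp only [hB, mul_zero, add_zero, sub_zero, e0, sub_self, Pi.add_apply, Pi.sub_apply, Function.comp_apply]
      have hI := Complex.I_sq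
      linear_combination (-2 * m s * (3 / 2 * (c s - 3 / 2 * r s ^ 2) - a s ^ 2)) * hI
  have dH : ∀ᶠ s in 𝓝 (0 : ℂ),
      deriv (fun v => (h (s + Complex.I * v) - h (s - Complex.I * v)) * (2 * Complex.I)⁻¹) 0 = m s ∧
      deriv (deriv fun v => (h (s + Complex.I * v) - h (s - Complex.I * v)) * (2 * Complex.I)⁻¹) 0 =
        0 ∧
      deriv (deriv (deriv fun v => (h (s + Complex.I * v) - h (s - Complex.I * v)) *
        (2 * Complex.I)⁻¹)) 0 =
        m s * (2 * (3 / 2 * (c s - 3 / 2 * r s ^ 2) - a s ^ 2) - 4 * a s ^ 2) := by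
    filter_upwards [hslice] with s hs
    have hI := Complex.I_sq
    have hI0 := Complex.I_ne_zero
    have hm' : ∀ {v : ℂ}, HasDerivAt b (a v) v → HasDerivAt m (-2 * a v * m v) v := fun hv =>
      (hv.const_mul (-2)).cexp.congr_deriv (by simp only [hm]; ring)
    have d1 : deriv (fun v => (h (s + Complex.I * v) - h (s - Complex.I * v)) * (2 * Complex.I)⁻¹)
        =ᶠ[𝓝 0] fun v => (m (s + Complex.I * v) + m (s - Complex.I * v)) / 2 := by
      filter_upwards [hs] with v ⟨⟨_, _, _, h1, _⟩, ⟨_, _, _, h2, _⟩⟩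
      refine (((h1.comp v (dp s v)).sub (h2.comp v (dm s v))).mul_const _).deriv.trans ?_
      simp only [hm]
      field_simp
      ring
    have d2 : deriv (deriv fun v => (h (s + Complex.I * v) - h (s - Complex.I * v)) *
        (2 * Complex.I)⁻¹) =ᶠ[𝓝 0] fun v => -Complex.I * (a (s + Complex.I * v) * m (s + Complex.I * v)
          - a (s - Complex.I * v) * m (s - Complex.I * v)) := by
      filter_upwards [d1.eventually_nhds, hs] with v hv ⟨⟨_, b1, _⟩, ⟨_, b2, _⟩⟩
      rw [EventuallyEq.deriv_eq hv]
      refine ((((hm' b1).comp v (dp s v)).add ((hm' b2).comp v (dm s v))).div_const 2).deriv.trans ?_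
      ring
    refine ⟨?_, ?_, ?_⟩
    · rw [d1.self_of_nhds]
      simp
    · rw [d2.self_of_nhds]
      simp
    · rw [d2.deriv_eq]
      obtain ⟨⟨a1, b1, -⟩, ⟨a2, b2, -⟩⟩ := hs.self_of_nhds
      refine ((((a1.mul (hm' b1)).comp 0 (dp s 0)).sub
        ((a2.mul (hm' b2)).comp 0 (dm s 0))).const_mul (-Complex.I)).deriv.trans ?_
      simp only [mul_zero, add_zero, sub_zero]
      linear_combination (-2 * m s * (3 / 2 * (c s - 3 / 2 * r s ^ 2) - a s ^ 2 - 2 * a s ^ 2)) * hI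
  have t1 : Tendsto (fun x : ℂ × ℂ => x.1) (𝓝 0) (𝓝 0) := continuous_fst.tendsto' 0 0 rfl
  refine ⟨l, l', h, m, fun x => m x.1 * (r x.1 ^ 2 + 2 * (deriv a x.1)) / 2 + x.2 * Q x, K, hla, hla',
    hh, hma, ?_, hK, by simp [hl, hθ0, hb0], by simp [hl', hθ0, hb0], hh0, ?_, ?_, ?_, ?_, ?_⟩
  · have f1 : ∀ {g : ℂ → ℂ}, AnalyticAt ℂ g 0 → AnalyticAt ℂ (fun x : ℂ × ℂ => g x.1) 0 :=
      fun hg => AnalyticAt.fun_comp_of_eq hg analyticAt_fst rfl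
    have ha : AnalyticAt ℂ (deriv a) 0 := by
      have : AnalyticAt ℂ a 0 := hb.deriv.congr (db.mono fun s hs => hs.deriv)
      exact this.deriv
    exact ((f1 hma).mul (((f1 hr).pow 2).add (analyticAt_const.mul (f1 ha)))).div_const.add
      (analyticAt_snd.mul hQ)
  · simpa [hb0] using dh.self_of_nhds
  · filter_upwards [hs] with s ⟨h1, h2, h3⟩
    refine ⟨?_, h3⟩
    simp only [hl, hl', h1, h2, ← Complex.exp_conj, map_sub, map_mul, Complex.conj_I, neg_mul]
  · filter_upwards [eQ, t1.eventually dΛ, t1.eventually da] with x e1 ⟨e2, e3⟩ e4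
    rw [e1, e2, e3, e4.deriv]
    have e0 : l x.1 * l' x.1 = m x.1 := by
      simp only [hl, hl', hm, ← Complex.exp_add]
      ring_nf
    simp only [mul_zero, add_zero, sub_zero, e0]
    ring
  · filter_upwards [eK, t1.eventually dH] with x e1 ⟨e2, e3, _⟩
    rw [div_eq_mul_inv, e1, e2, e3]
    simp
  · filter_upwards [eK', dH, da] with s e1 ⟨_, _, e2⟩ e3
    rw [e1, e2, e3.deriv]
    ring

end normalizingFunctions

section normalForm

/-- The function `x ↦ conj (f (ζ̄, z̄, s̄))`. -/
def swapBar (f : ℂ × ℂ × ℂ → ℂ) (x : ℂ × ℂ × ℂ) : ℂ := bar f (x.2.1, x.1, x.2.2)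

theorem swapBar_apply (f : ℂ × ℂ × ℂ → ℂ) (x : ℂ × ℂ × ℂ) :
    swapBar f x = conj (f (conj x.2.1, conj x.1, conj x.2.2)) := rfl

theorem swapBar_swapBar (f : ℂ × ℂ × ℂ → ℂ) : swapBar (swapBar f) = f := by
  funext x
  simp [swapBar_apply]

theorem analyticAt_swapBar {f : ℂ × ℂ × ℂ → ℂ} (hf : AnalyticAt ℂ f 0) :
    AnalyticAt ℂ (swapBar f) 0 :=
  AnalyticAt.fun_comp_of_eq (f := fun x : ℂ × ℂ × ℂ => (x.2.1, x.1, x.2.2))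
    (analyticAt_bar (x := (0 : ℂ × ℂ × ℂ)) (by rwa [star_zero])) (by fun_prop) rfl

theorem eventually_swapBar_eq {f a b : ℂ × ℂ × ℂ → ℂ}
    (h : ∀ᶠ x in 𝓝 (0 : ℂ × ℂ × ℂ), f x = x.1 * a x + x.2.1 * b x) :
    ∀ᶠ x in 𝓝 (0 : ℂ × ℂ × ℂ), swapBar f x = x.1 * swapBar b x + x.2.1 * swapBar a x := by
  have hc := Complex.continuous_conj
  have t : Tendsto (fun x : ℂ × ℂ × ℂ => (conj x.2.1, conj x.1, conj x.2.2)) (𝓝 0) (𝓝 0) :=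
    tendsto_zero_of_continuous (by fun_prop) (by simp)
  filter_upwards [t.eventually h] with x hx
  simp only [swapBar_apply, hx, map_add, map_mul, Complex.conj_conj]
  ring

/-- Second order expansion in `(z, ζ)` of a symmetric function without linear terms. -/
theorem exists_quadratic_expansion {Q : ℂ × ℂ × ℂ → ℂ} (hQ : AnalyticAt ℂ Q 0)
    (hQs : swapBar Q = Q) (hκ : ∀ᶠ s in 𝓝 (0 : ℂ), fderiv ℂ Q (0, 0, s) (1, 0, 0) = 0) :
    ∃ A C : ℂ × ℂ × ℂ → ℂ, AnalyticAt ℂ A 0 ∧ AnalyticAt ℂ C 0 ∧ swapBar C = C ∧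
      ∀ᶠ x in 𝓝 (0 : ℂ × ℂ × ℂ), Q x = Q (0, 0, x.2.2) + x.1 ^ 2 * A x + x.2.1 ^ 2 * swapBar A x +
        x.1 * x.2.1 * C x := by
  have h0 : AnalyticAt ℂ (fun x : ℂ × ℂ × ℂ => Q (0, 0, x.2.2)) 0 :=
    AnalyticAt.fun_comp_of_eq hQ (by fun_prop) rfl
  set f : ℂ × ℂ × ℂ → ℂ := fun x => Q x - Q (0, 0, x.2.2) with hf
  have hfs : swapBar f = f := by
    funext x
    have e : ∀ y, conj (Q (conj y.2.1, conj y.1, conj y.2.2)) = Q y := fun y => congrFun hQs y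
    have e2 := e (0, 0, x.2.2)
    simp only [map_zero] at e2
    simp only [swapBar_apply, hf, map_sub, e, e2]
  obtain ⟨a, b, ha, hb, e1⟩ := exists_eq_mul_add_mul (hQ.sub h0)
    (Eventually.of_forall fun s => sub_self _)
  have e1' := eventually_swapBar_eq (f := f) e1
  rw [hfs] at e1'
  set a' : ℂ × ℂ × ℂ → ℂ := fun x => (a x + swapBar b x) / 2 with ha'
  have ha'a : AnalyticAt ℂ a' 0 := (ha.add (analyticAt_swapBar hb)).div_const
  have hb' : ∀ x, swapBar a' x = (b x + swapBar a x) / 2 := fun x => by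
    have e := congrFun (swapBar_swapBar b) x
    rw [swapBar_apply] at e
    rw [swapBar_apply]
    simp only [ha', map_div₀, map_add, map_ofNat, e]
    rw [swapBar_apply a, add_comm]
  have e2 : ∀ᶠ x in 𝓝 (0 : ℂ × ℂ × ℂ), f x = x.1 * a' x + x.2.1 * swapBar a' x := by
    filter_upwards [e1, e1'] with x h1 h2
    rw [hb']
    simp only [ha']
    have h1' : f x = x.1 * a x + x.2.1 * b x := h1
    linear_combination h1' / 2 + h2 / 2
  have t0 : Tendsto (fun s : ℂ => ((0 : ℂ), (0 : ℂ), s)) (𝓝 0) (𝓝 0) :=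
    tendsto_zero_of_continuous (by fun_prop) rfl
  have ha0 : ∀ᶠ s in 𝓝 (0 : ℂ), a' (0, 0, s) = 0 := by
    filter_upwards [hκ, t0.eventually hQ.eventually_analyticAt, t0.eventually e2.eventually_nhds,
      t0.eventually ha'a.eventually_analyticAt] with s k1 k2 k3 k4
    have c : ContinuousAt (fun t : ℂ => (t, (0 : ℂ), s)) 0 := by fun_prop
    have d : HasDerivAt (fun t : ℂ => (t, (0 : ℂ), s)) (1, 0, 0) 0 :=
      (hasDerivAt_id (0 : ℂ)).prodMk (hasDerivAt_const _ _)
    have d1 := (HasFDerivAt.comp_hasDerivAt_of_eq (0 : ℂ) k2.differentiableAt.hasFDerivAt d rfl).sub_const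
      (Q (0, 0, s))
    rw [k1] at d1
    have d2 := (hasDerivAt_id (0 : ℂ)).mul
      (HasFDerivAt.comp_hasDerivAt_of_eq (0 : ℂ) k4.differentiableAt.hasFDerivAt d rfl)
    have d3 := d2.congr_of_eventuallyEq (f₁ := fun t => f (t, 0, s)) (by
      filter_upwards [c.tendsto.eventually k3] with t ht
      rw [ht]
      simp)
    have := d3.unique d1
    simpa using this
  obtain ⟨A, C, hA, hC, e3⟩ := exists_eq_mul_add_mul ha'a ha0
  have hCs := analyticAt_swapBar hC
  refine ⟨A, fun x => C x + swapBar C x, hA, hC.add hCs, ?_, ?_⟩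
  · funext x
    have e := congrFun (swapBar_swapBar C) x
    rw [swapBar_apply] at e
    simp only [swapBar_apply (fun x => C x + swapBar C x), map_add, e]
    rw [swapBar_apply C, add_comm]
  · filter_upwards [e2, e3, eventually_swapBar_eq e3] with x h1 h2 h3
    simp only [hf] at h1
    linear_combination h1 + x.1 * h2 + x.2.1 * h3

/-- The last change of coordinates, which preserves the `u`-axis. -/
theorem exists_normal_form_change {Q : ℂ × ℂ × ℂ → ℂ} (hQ : AnalyticAt ℂ Q 0)
    (hQs : swapBar Q = Q) (hκ : ∀ᶠ s in 𝓝 (0 : ℂ), fderiv ℂ Q (0, 0, s) (1, 0, 0) = 0) :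
    ∃ (l h : ℂ → ℂ) (A : ℂ × ℂ × ℂ → ℂ), AnalyticAt ℂ l 0 ∧ AnalyticAt ℂ h 0 ∧ AnalyticAt ℂ A 0 ∧
      l 0 = 1 ∧ h 0 = 0 ∧ HasDerivAt h 1 0 ∧ (∀ᶠ s in 𝓝 0, h (conj s) = conj (h s)) ∧
      ∀ᶠ x in 𝓝 (0 : ℂ × ℝ), ∀ (v : ℝ) (w Z : ℂ),
        v = Complex.normSq x.1 + Complex.normSq x.1 ^ 2 * (Q (x.1, conj x.1, x.2)).re →
        w = x.2 + Complex.I * v → Z = x.1 * l w →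
        (h w).im = Complex.normSq Z + Complex.normSq Z ^ 2 * (Z ^ 2 * A (Z, conj Z, (h w).re)).re := by
  obtain ⟨A, C, hA, hC, hCs, eQ⟩ := exists_quadratic_expansion hQ hQs hκ
  have a0 : AnalyticAt ℂ (fun s : ℂ => ((0 : ℂ), (0 : ℂ), s)) 0 := by fun_prop
  set r : ℂ → ℂ := fun s => Q (0, 0, s) with hr
  set c : ℂ → ℂ := fun s => C (0, 0, s) with hc
  have hra : AnalyticAt ℂ r 0 := AnalyticAt.fun_comp_of_eq hQ a0 rfl
  have hca : AnalyticAt ℂ c 0 := AnalyticAt.fun_comp_of_eq hC a0 rfl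
  have sym : ∀ {f : ℂ × ℂ × ℂ → ℂ}, swapBar f = f → ∀ s, f (0, 0, conj s) = conj (f (0, 0, s)) :=
    fun {f} h s => by
      have := congrFun h (0, 0, conj s)
      rw [swapBar_apply] at this
      simpa using this.symm
  obtain ⟨l, l', h, m, P, K, hl, hl', hh, hm, hP, hK, hl0, hl0', hh0, hh1, hs, eP, eK, e0⟩ :=
    exists_normalizing_functions hra hca (sym hQs) (sym hCs)
  set φ : ℂ × ℂ × ℂ → ℂ := fun x => x.1 * x.2.1 * (1 + x.1 * x.2.1 * Q x) with hφ
  have hφa : AnalyticAt ℂ φ 0 := by fun_prop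
  have hφ0 : φ 0 = 0 := by simp [hφ]
  have sa : AnalyticAt ℂ (fun x : ℂ × ℂ × ℂ => x.2.2) 0 := by fun_prop
  have a1 : AnalyticAt ℂ (fun x => (x.2.2, φ x)) 0 := sa.prod hφa
  have t1 : Tendsto (fun x => (x.2.2, φ x)) (𝓝 0) (𝓝 (0 : ℂ × ℂ)) := by
    have := a1.continuousAt.tendsto
    rw [hφ0] at this
    exact this
  have c1 : ∀ {f : ℂ × ℂ → ℂ}, AnalyticAt ℂ f 0 → AnalyticAt ℂ (fun x => f (x.2.2, φ x)) 0 :=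
    fun hf => AnalyticAt.fun_comp_of_eq hf a1 (by rw [hφ0]; rfl)
  have cs : ∀ {f : ℂ → ℂ}, AnalyticAt ℂ f 0 → AnalyticAt ℂ (fun x : ℂ × ℂ × ℂ => f x.2.2) 0 :=
    fun hf => AnalyticAt.fun_comp_of_eq hf sa rfl
  have cp : ∀ {f : ℂ → ℂ}, AnalyticAt ℂ f 0 →
      AnalyticAt ℂ (fun x : ℂ × ℂ × ℂ => f (x.2.2 + Complex.I * φ x)) 0 :=
    fun hf => AnalyticAt.fun_comp_of_eq hf (sa.add (analyticAt_const.mul hφa)) (by rw [hφ0]; simp)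
  have cm : ∀ {f : ℂ → ℂ}, AnalyticAt ℂ f 0 →
      AnalyticAt ℂ (fun x : ℂ × ℂ × ℂ => f (x.2.2 - Complex.I * φ x)) 0 :=
    fun hf => AnalyticAt.fun_comp_of_eq hf (sa.sub (analyticAt_const.mul hφa)) (by rw [hφ0]; simp)
  set D : ℂ × ℂ × ℂ → ℂ := fun x => m x.2.2 * C x - r x.2.2 * m x.2.2 * Q x +
    (1 + x.1 * x.2.1 * Q x) ^ 3 * K (x.2.2, φ x) - (1 + x.1 * x.2.1 * Q x) ^ 2 * P (x.2.2, φ x) with hD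
  have hDa : AnalyticAt ℂ D 0 := by
    have g : AnalyticAt ℂ (fun x : ℂ × ℂ × ℂ => 1 + x.1 * x.2.1 * Q x) 0 := by fun_prop
    exact ((((cs hm).mul hC).sub (((cs hra).mul (cs hm)).mul hQ)).add ((g.pow 3).mul (c1 hK))).sub
      ((g.pow 2).mul (c1 hP))
  obtain ⟨D₁, D₂, hD₁, hD₂, eD⟩ := exists_eq_mul_add_mul hDa (e0.mono fun s hs => by
    simp only [hD, hφ, zero_mul, add_zero, one_pow, one_mul]
    linear_combination hs)
  set X : ℂ × ℂ × ℂ → ℂ := fun x => m x.2.2 * A x + x.2.1 * D₁ x with hX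
  set Y : ℂ × ℂ × ℂ → ℂ := fun x => m x.2.2 * swapBar A x + x.1 * D₂ x with hY
  have hXa : AnalyticAt ℂ X 0 := ((cs hm).mul hA).add (AnalyticAt.mul (by fun_prop) hD₁)
  have hYa : AnalyticAt ℂ Y 0 :=
    ((cs hm).mul (analyticAt_swapBar hA)).add (AnalyticAt.mul (by fun_prop) hD₂)
  have key : ∀ᶠ x in 𝓝 (0 : ℂ × ℂ × ℂ), (h (x.2.2 + Complex.I * φ x) - h (x.2.2 - Complex.I * φ x)) /
      (2 * Complex.I) = x.1 * x.2.1 * (l (x.2.2 + Complex.I * φ x) * l' (x.2.2 - Complex.I * φ x)) +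
        (x.1 * x.2.1) ^ 2 * (x.1 ^ 2 * X x + x.2.1 ^ 2 * Y x) := by
    filter_upwards [eQ, eD, t1.eventually eP, t1.eventually eK] with x k1 k2 k3 k4
    rw [k3, k4]
    simp only [hX, hY]
    have k5 : Q x = r x.2.2 + x.1 ^ 2 * A x + x.2.1 ^ 2 * swapBar A x + x.1 * x.2.1 * C x := k1
    have k6 : φ x = x.1 * x.2.1 * (1 + x.1 * x.2.1 * Q x) := rfl
    simp only [hD] at k2
    generalize K (x.2.2, φ x) = K₀ at k2 ⊢
    generalize P (x.2.2, φ x) = P₀ at k2 ⊢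
    rw [k6]
    linear_combination (x.1 * x.2.1) ^ 3 * k2 + (x.1 * x.2.1) ^ 2 * m x.2.2 * k5
  set G : ℂ × ℂ × ℂ → ℂ × ℂ × ℂ := fun x => (x.1 * l (x.2.2 + Complex.I * φ x),
    x.2.1 * l' (x.2.2 - Complex.I * φ x),
    (h (x.2.2 + Complex.I * φ x) + h (x.2.2 - Complex.I * φ x)) / 2) with hG
  have hGa : AnalyticAt ℂ G 0 := (AnalyticAt.mul (by fun_prop) (cp hl)).prod
    ((AnalyticAt.mul (by fun_prop) (cm hl')).prod ((cp hh).add (cm hh)).div_const)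
  have hG0 : G 0 = 0 := by simp [hG, hφ0, hh0]
  have hGd : HasFDerivAt G ((ContinuousLinearEquiv.refl ℂ (ℂ × ℂ × ℂ) : (ℂ × ℂ × ℂ) ≃L[ℂ] _) :
      (ℂ × ℂ × ℂ) →L[ℂ] ℂ × ℂ × ℂ) 0 := by
    have f2 : HasFDerivAt (fun x : ℂ × ℂ × ℂ => x.2.2) _ 0 := ((ContinuousLinearMap.snd ℂ ℂ ℂ).comp
      (ContinuousLinearMap.snd ℂ ℂ (ℂ × ℂ))).hasFDerivAt
    have f1 : HasFDerivAt (fun x : ℂ × ℂ × ℂ => x.2.1) _ 0 := ((ContinuousLinearMap.fst ℂ ℂ ℂ).comp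
      (ContinuousLinearMap.snd ℂ ℂ (ℂ × ℂ))).hasFDerivAt
    have fφ := hφa.differentiableAt.hasFDerivAt.const_mul Complex.I
    have hp : HasDerivAt h 1 ((0 : ℂ × ℂ × ℂ).2.2 + Complex.I * φ 0) := by simpa [hφ0] using hh1
    have hn : HasDerivAt h 1 ((0 : ℂ × ℂ × ℂ).2.2 - Complex.I * φ 0) := by simpa [hφ0] using hh1
    have g1 := (hasFDerivAt_fst (𝕜 := ℂ) (p := (0 : ℂ × ℂ × ℂ))).mul
      (cp hl).differentiableAt.hasFDerivAt
    have g2 := f1.mul (cm hl').differentiableAt.hasFDerivAt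
    have g3 := ((hp.comp_hasFDerivAt (0 : ℂ × ℂ × ℂ) (f2.add fφ)).add
      (hn.comp_hasFDerivAt (0 : ℂ × ℂ × ℂ) (f2.sub fφ))).mul_const (2 : ℂ)⁻¹
    refine (g1.prodMk (g2.prodMk g3)).congr_fderiv (ContinuousLinearMap.ext fun V => ?_)
    refine Prod.ext ?_ (Prod.ext ?_ ?_)
    · simp [hφ0, hl0]
    · simp [hφ0, hl0']
    · simp
      ring
  obtain ⟨Θ, hΘ0, hΘ, -, hΘs⟩ := exists_analytic_openPartialHomeomorph hGa _ hGd
  have hΘ0' : (0 : ℂ × ℂ × ℂ) ∈ Θ.target := by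
    have := Θ.map_source hΘ0
    rwa [hΘ, hG0] at this
  have hΘ1 : Θ.symm 0 = 0 := by
    have := Θ.left_inv hΘ0
    rwa [hΘ, hG0] at this
  set A₁ : ℂ × ℂ × ℂ → ℂ := fun x => (X x + swapBar Y x) / (l (x.2.2 + Complex.I * φ x) ^ 2 *
    (l (x.2.2 + Complex.I * φ x) * l' (x.2.2 - Complex.I * φ x)) ^ 2) with hA₁
  have hA₁a : AnalyticAt ℂ A₁ 0 := by
    refine (hXa.add (analyticAt_swapBar hYa)).div (((cp hl).pow 2).mul (((cp hl).mul (cm hl')).pow 2)) ?_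
    simp [hφ0, hl0, hl0']
  refine ⟨l, h, fun y => A₁ (Θ.symm y), hl, hh, AnalyticAt.fun_comp_of_eq hA₁a (hΘs 0 hΘ0') hΘ1, hl0, hh0,
    hh1, hs.mono fun s hs => hs.2, ?_⟩
  have hcc := Complex.continuous_conj
  have tr : Tendsto (fun x : ℂ × ℝ => (x.1, conj x.1, (x.2 : ℂ))) (𝓝 0) (𝓝 0) :=
    tendsto_zero_of_continuous (by fun_prop) (by simp)
  have tw : Tendsto (fun x : ℂ × ℂ × ℂ => x.2.2 + Complex.I * φ x) (𝓝 0) (𝓝 0) := by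
    have := (cp (analyticAt_id (z := (0 : ℂ)))).continuousAt.tendsto
    simpa [hφ0] using this
  have hl1 : ∀ᶠ w in 𝓝 (0 : ℂ), l w ≠ 0 := hl.continuousAt.eventually_ne (by rw [hl0]; exact one_ne_zero)
  filter_upwards [tr.eventually key, (tw.comp tr).eventually (hs.and hl1),
    tr.eventually (Θ.open_source.mem_nhds hΘ0)] with x k1 k2 k3 v w Z hv hw hZ
  set y : ℂ × ℂ × ℂ := (x.1, conj x.1, (x.2 : ℂ)) with hy
  have hyQ : ((Q y).re : ℂ) = Q y := by
    have := congrFun hQs y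
    rw [swapBar_apply] at this
    simp only [hy, Complex.conj_conj, Complex.conj_ofReal] at this ⊢
    exact Complex.conj_eq_iff_re.1 this
  have hzz : x.1 * conj x.1 = (Complex.normSq x.1 : ℂ) := Complex.mul_conj _
  have hφv : φ y = v := by
    have : φ y = x.1 * conj x.1 * (1 + x.1 * conj x.1 * Q y) := rfl
    rw [this, hzz, ← hyQ, hv]
    push_cast
    ring
  have hw1 : y.2.2 + Complex.I * φ y = w := by rw [hφv, hw]
  have hw2 : y.2.2 - Complex.I * φ y = conj w := by
    rw [hφv, hw, map_add, map_mul, Complex.conj_I, Complex.conj_ofReal, Complex.conj_ofReal]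
    ring
  simp only [Function.comp_apply] at k2
  rw [hw1] at k2
  obtain ⟨⟨k4, k5⟩, k6⟩ := k2
  have hGy : G y = (Z, conj Z, ((h w).re : ℂ)) := by
    simp only [hG, hw1, hw2, k4, k5, hZ, map_mul]
    refine Prod.ext rfl (Prod.ext rfl ?_)
    simp only
    rw [Complex.add_conj]
    push_cast
    ring
  have hΘy : Θ.symm (Z, conj Z, ((h w).re : ℂ)) = y := by
    rw [← hGy, ← hΘ]
    exact Θ.left_inv k3
  rw [hw1, hw2, k4, k5] at k1
  simp only [hΘy, hA₁, hw1, hw2, k4]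
  have hN : Complex.normSq Z = Complex.normSq x.1 * Complex.normSq (l w) := by
    rw [hZ, Complex.normSq_mul]
  have hYr : swapBar Y y = conj (Y y) := by
    rw [swapBar_apply]
    simp [hy]
  have k7 : ((h w).im : ℂ) = Complex.normSq Z + Complex.normSq x.1 ^ 2 *
      (x.1 ^ 2 * X y + conj x.1 ^ 2 * Y y) := by
    have e1 : (h w - conj (h w)) / (2 * Complex.I) = (h w).im := by
      rw [Complex.sub_conj]
      have := Complex.I_ne_zero
      push_cast
      field_simp
    rw [← e1, k1, hN]
    have e2 : y.1 * y.2.1 = (Complex.normSq x.1 : ℂ) := hzz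
    rw [e2, Complex.mul_conj]
    push_cast
    rfl
  have k8 := congrArg Complex.re k7
  rw [← Complex.ofReal_pow, Complex.add_re, Complex.ofReal_re, Complex.ofReal_re, Complex.re_ofReal_mul] at k8
  rw [k8, hYr]
  have e3 : (x.1 ^ 2 * X y + conj x.1 ^ 2 * Y y).re = (x.1 ^ 2 * (X y + conj (Y y))).re := by
    have e5 : (conj x.1 ^ 2 * Y y).re = (x.1 ^ 2 * conj (Y y)).re :=
      (Complex.conj_re _).symm.trans (by simp only [map_mul, map_pow, Complex.conj_conj])
    rw [Complex.add_re, e5, ← Complex.add_re, ← mul_add]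
  have e4 : Z ^ 2 * ((X y + conj (Y y)) / (l w ^ 2 * (l w * conj (l w)) ^ 2)) =
      (((Complex.normSq (l w) ^ 2)⁻¹ : ℝ) : ℂ) * (x.1 ^ 2 * (X y + conj (Y y))) := by
    rw [hZ, Complex.mul_conj]
    push_cast
    have : (Complex.normSq (l w) : ℂ) ≠ 0 := by
      rw [Ne, Complex.ofReal_eq_zero, Complex.normSq_eq_zero]; exact k6
    field_simp
  rw [e3, e4, Complex.re_ofReal_mul, hN]
  have : Complex.normSq (l w) ≠ 0 := by rw [Ne, Complex.normSq_eq_zero]; exact k6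
  field_simp

end normalForm

section expansionOfNormalForm

theorem hasSum_of_forall_eq {ι : Type*} {f g : ι → ℂ} {a b : ℂ} (h : HasSum f a)
    (hg : ∀ i, g i = f i) (hb : b = a) : HasSum g b := by
  rwa [funext hg, hb]

theorem isMoserNormalForm_of_analyticAt {A : ℂ × ℂ × ℂ → ℂ} (hA : AnalyticAt ℂ A 0) :
    IsMoserNormalForm fun x =>
      Complex.normSq x.1 + Complex.normSq x.1 ^ 2 * (x.1 ^ 2 * A (x.1, conj x.1, x.2)).re := by
  obtain ⟨δ, c, hδ, hc, hsum⟩ := exists_double_expansion hA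
  set a : ℕ → ℕ → ℝ → ℂ := fun j k u => if 4 ≤ j ∧ 2 ≤ k then c (j - 4) (k - 2) u else 0 with ha
  have hball : ∀ u ∈ Ioo (-δ) δ, ‖((u : ℝ) : ℂ)‖ < δ := fun u hu => by
    rw [Complex.norm_real, Real.norm_eq_abs]
    exact abs_lt.2 hu
  have haa : ∀ j k, ∀ u ∈ Ioo (-δ) δ, AnalyticAt ℝ (a j k) u := fun j k u hu => by
    simp only [ha]
    split_ifs
    · exact AnalyticAt.fun_comp_of_eq ((hc _ _ u (by simpa using hball u hu)).restrictScalars (𝕜 := ℝ))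
        (analyticAt_ofReal_comp analyticAt_id) rfl
    · exact analyticAt_const
  refine ⟨δ, fun j k u => (a j k u + conj (a k j u)) / 2, hδ, fun j k u hu =>
    ((haa j k u hu).add (analyticAt_conj_comp (haa k j u hu))).div_const, fun j k u _ => ?_,
    fun z hz u hu => ?_⟩
  · simp only [map_div₀, map_add, map_ofNat, Complex.conj_conj]
    rw [add_comm]
  have h0 := (hsum z (conj z) u hz (by rwa [RCLike.norm_conj]) (hball u hu)).mul_left
    (z ^ 4 * conj z ^ 2)
  set g : ℕ × ℕ → ℂ := fun i => z ^ i.1 * conj z ^ i.2 * a i.1 i.2 u with hg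
  have h1 : HasSum g (z ^ 4 * conj z ^ 2 * A (z, conj z, u)) := by
    have inj : Function.Injective fun i : ℕ × ℕ => (i.1 + 4, i.2 + 2) := fun i j hij => by
      simpa [Prod.ext_iff] using hij
    refine (inj.hasSum_iff fun i hi => ?_).1 ?_
    · have : ¬(4 ≤ i.1 ∧ 2 ≤ i.2) := fun h => hi ⟨(i.1 - 4, i.2 - 2), by
        ext <;> simp only <;> omega⟩
      simp [hg, ha, this]
    · refine hasSum_of_forall_eq h0 (fun i => ?_) rfl
      simp [hg, ha, pow_add]
      ring
  have h2 : HasSum (fun i : ℕ × ℕ => conj (g i.swap)) (conj (z ^ 4 * conj z ^ 2 * A (z, conj z, u))) :=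
    ((Equiv.prodComm ℕ ℕ).hasSum_iff (f := fun i => conj (g i))).2
      (h1.map (starRingEnd ℂ) Complex.continuous_conj)
  set f : ℕ × ℕ → ℂ := fun i => z ^ i.1 * conj z ^ i.2 * ((a i.1 i.2 u + conj (a i.2 i.1 u)) / 2)
    with hf
  have h3 := (((h1.add h2).div_const 2).sub (hasSum_ite_eq (4, 2) (f (4, 2)))).sub
    (hasSum_ite_eq (2, 4) (f (2, 4)))
  have hfg : ∀ i, (g i + conj (g i.swap)) / 2 = f i := fun i => by
    simp only [hg, hf, Prod.fst_swap, Prod.snd_swap, map_mul, map_pow, Complex.conj_conj]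
    ring
  simp only [hfg] at h3
  have hN : ∀ j k : ℕ, ¬(4 ≤ j ∧ 2 ≤ k) → ¬(4 ≤ k ∧ 2 ≤ j) → f (j, k) = 0 := fun j k k1 k2 => by
    simp [hf, ha, k1, k2]
  have h4 := (hasSum_subtype_iff_of_support_subset
    (s := {i : ℕ × ℕ | 2 ≤ i.1 ∧ 2 ≤ i.2 ∧ 7 ≤ i.1 + i.2}) (fun i hi => ?_)).2 h3
  · refine hasSum_of_forall_eq h4 ?_ ?_
    · rintro ⟨⟨j, k⟩, h⟩
      simp only at h
      have k1 : ¬((j, k) = (4, 2)) := fun e => by simp only [Prod.mk.injEq] at e; omega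
      have k2 : ¬((j, k) = (2, 4)) := fun e => by simp only [Prod.mk.injEq] at e; omega
      simp only [Function.comp_apply, if_neg k1, if_neg k2, sub_zero, hf]
    · have e1 : ((z ^ 2 * A (z, conj z, u)).re : ℂ) =
          (z ^ 2 * A (z, conj z, u) + conj (z ^ 2 * A (z, conj z, u))) / 2 := by
        rw [Complex.add_conj]
        push_cast
        ring
      push_cast
      rw [e1, ← Complex.mul_conj]
      simp only [hf, map_mul, map_pow, Complex.conj_conj]
      ring
  · by_contra hn
    refine hi ?_
    obtain ⟨j, k⟩ := i
    by_cases k1 : (j, k) = (4, 2)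
    · rw [k1]; simp
    by_cases k2 : (j, k) = (2, 4)
    · rw [k2]; simp
    simp only [if_neg k1, if_neg k2, sub_zero]
    simp only [Prod.mk.injEq] at k1 k2
    refine hN j k (fun h => hn ⟨?_, ?_, ?_⟩) fun h => hn ⟨?_, ?_, ?_⟩ <;> simp only <;> omega

end expansionOfNormalForm

section normalFormChart

variable {M : Set (ℂ × ℂ)} {p ξ : ℂ × ℂ} {Φ : OpenPartialHomeomorph (ℂ × ℂ) (ℂ × ℂ)} {F : ℂ × ℝ → ℝ}

theorem exists_normal_form_chart (hΦ : IsHolomorphicChartAt Φ p) (hF : IsGraphedBy M p Φ F)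
    (h0 : F 0 = 0) (hdF : HasFDerivAt F (0 : ℂ × ℝ →L[ℝ] ℝ) 0) {Q : ℂ × ℂ × ℂ → ℂ}
    (hQ : AnalyticAt ℂ Q 0) (hQs : swapBar Q = Q)
    (hκ : ∀ᶠ s in 𝓝 (0 : ℂ), fderiv ℂ Q (0, 0, s) (1, 0, 0) = 0)
    (hFQ : ∀ x, F x = Complex.normSq x.1 + Complex.normSq x.1 ^ 2 * (Q (x.1, conj x.1, x.2)).re) :
    ∃ (Φ' : OpenPartialHomeomorph (ℂ × ℂ) (ℂ × ℂ)) (F' : ℂ × ℝ → ℝ) (h : ℂ → ℂ),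
      IsHolomorphicChartAt Φ' p ∧ IsGraphedBy M p Φ' F' ∧ IsMoserNormalForm F' ∧ AnalyticAt ℂ h 0 ∧
      h 0 = 0 ∧ HasDerivAt h 1 0 ∧ (∀ᶠ s in 𝓝 0, h (conj s) = conj (h s)) ∧
      ∀ y, (Φ y).1 = 0 → Φ' y = (0, h (Φ y).2) := by
  obtain ⟨l, h, A, hl, hh, hA, hl0, hh0, hh1, hhs, eN⟩ := exists_normal_form_change hQ hQs hκ
  set H : ℂ × ℂ → ℂ × ℂ := fun y => (y.1 * l y.2, h y.2) with hH
  have l2 : AnalyticAt ℂ (fun y : ℂ × ℂ => l y.2) 0 := AnalyticAt.fun_comp_of_eq hl analyticAt_snd rfl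
  have hHa : AnalyticAt ℂ H 0 :=
    (analyticAt_fst.mul l2).prod (AnalyticAt.fun_comp_of_eq hh analyticAt_snd rfl)
  have hHd : HasFDerivAt H (ContinuousLinearMap.id ℂ (ℂ × ℂ)) 0 := by
    have h2 : HasDerivAt h 1 ((0 : ℂ × ℂ).2) := hh1
    have g1 := (hasFDerivAt_fst (𝕜 := ℂ) (p := (0 : ℂ × ℂ))).mul l2.differentiableAt.hasFDerivAt
    have g2 := h2.comp_hasFDerivAt (0 : ℂ × ℂ) (hasFDerivAt_snd (𝕜 := ℂ) (E := ℂ) (F := ℂ))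
    refine (g1.prodMk g2).congr_fderiv (ContinuousLinearMap.ext fun V => Prod.ext ?_ ?_)
    · simp [hl0]
    · simp
  obtain ⟨Φ', hΦ', e1, e2⟩ := hΦ.postcomp hHa (by simp [hH, hh0]) hHd fun X hX => hX
  obtain ⟨F₁, hF₁, hF₁0, -⟩ := hF.exists_graph hΦ hdF h0 hΦ' (r := 1) one_ne_zero fun X => by
    rw [e2]; simp
  set F' : ℂ × ℝ → ℝ := fun x =>
    Complex.normSq x.1 + Complex.normSq x.1 ^ 2 * (x.1 ^ 2 * A (x.1, conj x.1, x.2)).re with hF'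
  have t1 : Tendsto (fun y : ℂ × ℂ => ((y.1, y.2.re) : ℂ × ℝ)) (𝓝 0) (𝓝 0) :=
    tendsto_zero_of_continuous (by fun_prop) rfl
  have t2 := hΦ'.tendsto_symm.comp (tendsto_graphPoint hF₁.1 hF₁0)
  have e3 : F₁ =ᶠ[𝓝 0] F' := by
    filter_upwards [hF₁.eventually_mem hΦ' hF₁0, t2.eventually hF.2,
      ((t1.comp hΦ.tendsto).comp t2).eventually eN] with x k1 k2 k3
    simp only [Function.comp_apply] at k2 k3
    have k4 := k2.1 k1.1
    rw [hFQ] at k4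
    have k5 := k3 _ (Φ (Φ'.symm (graphPoint F₁ x))).2 _ k4
      (by rw [mul_comm, Complex.re_add_im]) rfl
    have k6 := k1.2
    rw [e1] at k6
    have k7 := congrArg Prod.fst k6
    have k8 := congrArg Prod.snd k6
    simp only [hH] at k7 k8
    rw [k7, k8, graphPoint_snd_im, graphPoint_snd_re] at k5
    exact k5
  refine ⟨Φ', F', h, hΦ', ⟨hF₁.1.congr e3, ?_⟩, isMoserNormalForm_of_analyticAt hA, hh, hh0, hh1, hhs,
    fun y hy => ?_⟩
  · filter_upwards [hF₁.2, (t1.comp hΦ'.tendsto).eventually e3] with y k1 k2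
    rw [k1]
    simp only [Function.comp_apply] at k2
    rw [k2]
  · rw [e1, hH]
    simp [hy]

theorem IsHolomorphicChartAt.translate {q : ℂ × ℂ} (h : IsHolomorphicChartAt Φ p) (hq : q ∈ Φ.source) :
    IsHolomorphicChartAt (Φ.transHomeomorph (Homeomorph.addRight (-Φ q))) q := by
  refine ⟨hq, by simp, ?_, ?_⟩
  · exact h.holomorphic.add_const _
  · refine h.holomorphic_symm.comp (f := fun x => x + - -Φ q)
      (differentiableOn_id.add_const _) fun x hx => ?_
    exact hx

variable {R : (ℂ × ℂ) × ℂ × ℂ → ℂ}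

/-- Near an analytic chain there are coordinates in which it is straight and in which the
hypersurface has no terms of type `(3, 2)`. -/
theorem exists_chain_chart (L : (ℂ × ℂ) ≃L[ℂ] (ℂ × ℂ)) (hR : AnalyticAt ℂ R 0)
    (hRs : ∀ x y, R (star y, star x) = conj (R (x, y)))
    (hM : ∀ᶠ x in 𝓝 (0 : ℂ × ℂ), p + L x ∈ M ↔ R (x, star x) = 0)
    (hw : fderiv ℂ R 0 ((0, 1), 0) ≠ 0)
    (hlevi : ∀ g : ℂ → ℂ × ℂ, AnalyticAt ℂ g 0 → g 0 = 0 → deriv g 0 ≠ 0 →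
        ¬ (fun z => R (g z, star (g z))) =O[𝓝 0] fun z => ‖z‖ ^ 3)
    {γ : ℝ → ℂ × ℂ} {ε₀ : ℝ} (hγ : IsMoserChainThrough M p ξ γ ε₀) {c : ℂ → ℂ × ℂ}
    (hc : AnalyticAt ℂ c 0) (hc0 : c 0 = 0) (hc1 : HasDerivAt c (0, 1) 0)
    (hcγ : ∀ᶠ t : ℝ in 𝓝 0, γ t = p + L (c t)) :
    ∃ (Φ : OpenPartialHomeomorph (ℂ × ℂ) (ℂ × ℂ)) (F : ℂ × ℝ → ℝ) (Q : ℂ × ℂ × ℂ → ℂ) (ε : ℝ),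
      ε ≠ 0 ∧ IsHolomorphicChartAt Φ p ∧ IsGraphedBy M p Φ F ∧ F 0 = 0 ∧
      HasFDerivAt F (0 : ℂ × ℝ →L[ℝ] ℝ) 0 ∧ AnalyticAt ℂ Q 0 ∧ swapBar Q = Q ∧
      (∀ᶠ s in 𝓝 (0 : ℂ), fderiv ℂ Q (0, 0, s) (1, 0, 0) = 0) ∧
      (∀ x, F x = Complex.normSq x.1 + Complex.normSq x.1 ^ 2 * (Q (x.1, conj x.1, x.2)).re) ∧
      ∀ᶠ t : ℝ in 𝓝 0, Φ (γ t) = (0, ((ε * t : ℝ) : ℂ)) := by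
  have tR := tendsto_ofReal_zero
  have tc : Tendsto c (𝓝 0) (𝓝 0) := by
    have := hc.continuousAt.tendsto
    rwa [hc0] at this
  have t0 : ∀ᶠ t : ℝ in 𝓝 0, t ∈ Ioo (-ε₀) ε₀ := isOpen_Ioo.mem_nhds ⟨by linarith [hγ.1], hγ.1⟩
  have hbc : AnalyticAt ℂ (bar c) 0 := analyticAt_bar_pair (by rwa [star_zero])
  have hmem : ∀ᶠ s in 𝓝 (0 : ℂ), R (c s, bar c s) = 0 := by
    have h1 : AnalyticAt ℂ (fun s => R (c s, bar c s)) 0 :=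
      AnalyticAt.fun_comp_of_eq hR (hc.prod hbc) (by simp [bar, hc0])
    refine eventuallyEq_of_real h1 (analyticAt_const (v := (0 : ℂ))) ?_
    filter_upwards [hcγ, t0, (tc.comp tR).eventually hM] with t k1 k2 k3
    simp only [Function.comp_apply] at k3
    have k4 := k3.1 (k1 ▸ (hγ.2.1.2 t k2).1)
    simpa [bar] using k4
  have hC : IsAdaptedFamily R fun y : ℂ × ℂ => c y.2 :=
    ⟨hR, hRs, hw, hlevi, AnalyticAt.fun_comp_of_eq hc analyticAt_snd rfl, hc0, hc1,
      (continuous_snd.tendsto' (0 : ℂ × ℂ) 0 rfl).eventually hmem⟩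
  obtain ⟨ε, T, N, G, Q, hN⟩ := hC.exists_isNormalization
  have hε0 : ε ≠ 0 := fun h => by have := hN.sq_eq_one; rw [h] at this; norm_num at this
  obtain ⟨Ψ, Φ, -, hΦ, hgr, hΦΨ, -, hΨ⟩ := (hN.exists_chart hC L hM).self_of_nhds (star_zero _)
  have hT0 : T (0, 0) = 0 := hN.coord_zero
  rw [hT0, map_zero, add_zero] at hΦ hgr
  have hΦγ : ∀ᶠ t : ℝ in 𝓝 0, Φ (γ t) = (0, ((ε * t : ℝ) : ℂ)) := by
    have s1 : Tendsto (fun t : ℝ => ((0 : ℂ), (t : ℂ))) (𝓝 0) (𝓝 0) :=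
      tendsto_zero_of_continuous (by fun_prop) rfl
    filter_upwards [hcγ, s1.eventually hN.coord_curve, s1.eventually hΨ] with t k1 k2 k3
    rw [k1, hΦΨ, ← k2, k3.2.2]
    simp
  have hQa := hN.analyticAt_remainder
  obtain ⟨g0, gd⟩ := zero_and_hasFDerivAt_of_isBigO (F := sliceGraph Q 0)
    ((isBigO_sliceGraph hQa).trans (IsBigO.of_bound 1 (Eventually.of_forall fun x => by
      rw [one_mul, norm_pow, norm_pow, norm_norm, norm_norm]
      gcongr
      exact norm_fst_le x)))
  have ιa : ∀ x : ℂ × ℂ × ℂ, HasFDerivAt (fun x : ℂ × ℂ × ℂ => ((0 : ℂ), x))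
      (ContinuousLinearMap.inr ℂ ℂ (ℂ × ℂ × ℂ)) x :=
    fun x => (ContinuousLinearMap.inr ℂ ℂ (ℂ × ℂ × ℂ)).hasFDerivAt
  have sa : AnalyticAt ℂ (fun s : ℂ => ((0 : ℂ), (0 : ℂ), (0 : ℂ), s)) 0 := by fun_prop
  have st : Tendsto (fun s : ℂ => ((0 : ℂ), (0 : ℂ), (0 : ℂ), s)) (𝓝 0) (𝓝 0) :=
    tendsto_zero_of_continuous (by fun_prop) rfl
  have real : ∀ᶠ t : ℝ in 𝓝 0, fderiv ℂ Q (0, 0, 0, ((ε * t : ℝ) : ℂ)) (0, 1, 0, 0) = 0 := by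
    have tε : Tendsto (fun t : ℝ => ((ε * t : ℝ) : ℂ)) (𝓝 0) (𝓝 0) :=
      tendsto_zero_of_continuous (by fun_prop) (by simp)
    have tγ : Tendsto γ (𝓝 0) (𝓝 p) := by
      have := (hγ.contDiffAt t0.self_of_nhds).continuousAt.tendsto
      rwa [hγ.2.2.1] at this
    filter_upwards [hΦγ.eventually_nhds, t0.eventually_nhds,
      (st.comp tε).eventually hQa.eventually_analyticAt, tγ.eventually hgr.2.eventually_nhds,
      tγ.eventually (Φ.open_source.mem_nhds hΦ.mem_source)] with t k1 k2 k3 k4 k5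
    obtain ⟨-, hT, hJ⟩ := hγ.2.1.2 t k2.self_of_nhds
    set a : ℂ × ℂ × ℂ × ℂ := (0, 0, 0, ((ε * t : ℝ) : ℂ)) with ha
    have hQ' : AnalyticAt ℂ (fun x => Q (x + a)) ((0 : ℂ), (0 : ℂ × ℂ × ℂ)) :=
      AnalyticAt.fun_comp_of_eq k3 (analyticAt_id.add analyticAt_const) (by simp [ha])
    have hs' : ∀ x, Q (swapConj x + a) = conj (Q (x + a)) := fun x => by
      rw [← hN.remainder_symm]
      congr 1
      simp [swapConj_apply, ha]
    set Φ' := Φ.transHomeomorph (Homeomorph.addRight (-Φ (γ t))) with hΦ'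
    have e1 : ∀ y, Φ' y = Φ y - Φ (γ t) := fun y => by simp [hΦ', sub_eq_add_neg]
    have hgr' : IsGraphedBy M (γ t) Φ' (sliceGraph (fun x => Q (x + a)) 0) := by
      refine ⟨analyticAt_sliceGraph hQ', ?_⟩
      filter_upwards [k4] with y hy
      rw [hy, e1, k1.self_of_nhds]
      simp [sliceGraph, realSlice, ha]
    have e2 : (fun s => (Φ' (γ s)).1) =ᶠ[𝓝 t] fun _ => 0 := by
      filter_upwards [k1] with s hs
      rw [e1, hs, k1.self_of_nhds]
      simp
    have e3 : (fun s => (Φ' (γ s)).2) =ᶠ[𝓝 t] fun s => ((ε * s : ℝ) : ℂ) - ((ε * t : ℝ) : ℂ) := by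
      filter_upwards [k1] with s hs
      rw [e1, hs, k1.self_of_nhds]
      simp
    have d3 : deriv (fun s => (Φ' (γ s)).2) t = ε := by
      rw [e3.deriv_eq]
      simpa using ((((hasDerivAt_id t).const_mul ε).ofReal_comp).sub_const ((ε * t : ℝ) : ℂ)).deriv
    have key := (chain_condition_iff (hΦ.translate k5) hgr'
      (isBigO_sliceGraph_sub (star_zero _) hQ' hs') (hγ.contDiffAt k2.self_of_nhds) rfl
      (k2.mono fun s hs => (hγ.2.1.2 s hs).1) hT (by rw [e2.deriv_eq]; simp)).1 hJ
    rw [e2.deriv.deriv_eq, d3, fderiv_comp_add_right] at key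
    have hεc : (ε : ℂ) ≠ 0 := by exact_mod_cast hε0
    have e5 : ((0 : ℂ), (0 : ℂ × ℂ × ℂ)) + a = a := zero_add a
    rw [e5] at key
    simpa [hεc] using key.symm
  refine ⟨Φ, sliceGraph Q 0, fun x => Q (0, x), ε, hε0, hΦ, hgr, g0, gd,
    AnalyticAt.fun_comp_of_eq hQa (by fun_prop) rfl, ?_, ?_, fun x => rfl, hΦγ⟩
  · funext x
    have := hN.remainder_symm (0, conj x.2.1, conj x.1, conj x.2.2)
    rw [swapBar_apply, ← this]
    simp [swapConj_apply]
  · have h1 : AnalyticAt ℂ (fun s : ℂ => fderiv ℂ Q (0, 0, 0, s) (0, 1, 0, 0)) 0 :=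
      ((ContinuousLinearMap.apply ℂ ℂ ((0 : ℂ), (1 : ℂ), (0 : ℂ), (0 : ℂ))).analyticAt _).comp
        (AnalyticAt.fun_comp_of_eq hQa.fderiv sa rfl)
    have tε : Tendsto (fun t : ℝ => ε * t) (𝓝 0) (𝓝 0) :=
      tendsto_zero_of_continuous (by fun_prop) (by simp)
    have h2 := eventuallyEq_of_real h1 (analyticAt_const (v := (0 : ℂ)))
      ((tε.eventually real).mono fun t ht => by
        rw [← mul_assoc, ← sq, hN.sq_eq_one, one_mul] at ht
        exact ht)
    filter_upwards [h2, st.eventually hQa.eventually_analyticAt] with s k1 k2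
    exact (DFunLike.congr_fun (HasFDerivAt.comp (g := Q) (0, 0, s) k2.differentiableAt.hasFDerivAt
      (ιa _)).fderiv _).trans k1

end normalFormChart

section straightening

theorem isStraightenedBy_of_eventually {Φ : OpenPartialHomeomorph (ℂ × ℂ) (ℂ × ℂ)} {γ : ℝ → ℂ × ℂ}
    {k : ℝ → ℝ} {ε : ℝ} (hε : 0 < ε) (hk : ContDiffAt ℝ 1 k 0) (h0 : k 0 = 0) (h1 : deriv k 0 ≠ 0)
    (h : ∀ᶠ t in 𝓝 0, γ t ∈ Φ.source ∧ Φ (γ t) = (0, (k t : ℂ))) : IsStraightenedBy Φ γ ε := by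
  obtain ⟨η, a, b, e1, e2, e3, e4, e5, e6⟩ := exists_image_Ioo hk h0 h1 h hε
  refine ⟨η, a, b, e1, e2, e3, e4, fun t ht => (e5 t ht).1, ?_⟩
  rw [← e6, image_image]
  exact image_congr fun t ht => (e5 t ht).2

theorem exists_holomorphic_curve {g : ℝ → ℂ × ℂ} (hg : AnalyticAt ℝ g 0) (h0 : g 0 = 0)
    {v : ℂ × ℂ} (h1 : HasDerivAt g v 0) :
    ∃ c : ℂ → ℂ × ℂ, AnalyticAt ℂ c 0 ∧ c 0 = 0 ∧ HasDerivAt c v 0 ∧ ∀ᶠ t : ℝ in 𝓝 0, c t = g t := by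
  obtain ⟨c₁, a₁, e₁⟩ := exists_holomorphic_extension (analyticAt_fst_comp hg)
  obtain ⟨c₂, a₂, e₂⟩ := exists_holomorphic_extension (analyticAt_snd_comp hg)
  have e : (fun t : ℝ => (c₁ t, c₂ t)) =ᶠ[𝓝 0] g := by
    filter_upwards [e₁, e₂] with t k1 k2
    rw [k1, k2]
  refine ⟨fun s => (c₁ s, c₂ s), a₁.prod a₂, ?_, ?_, e⟩
  · have := e.self_of_nhds
    rw [h0] at this
    simpa using this
  · have d1 : HasDerivAt c₁ (deriv c₁ 0) ((0 : ℝ) : ℂ) := by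
      simpa using a₁.differentiableAt.hasDerivAt
    have d2 : HasDerivAt c₂ (deriv c₂ 0) ((0 : ℝ) : ℂ) := by
      simpa using a₂.differentiableAt.hasDerivAt
    have d3 := (d1.comp_ofReal.prodMk d2.comp_ofReal).unique (h1.congr_of_eventuallyEq e)
    rw [← d3]
    exact a₁.differentiableAt.hasDerivAt.prodMk a₂.differentiableAt.hasDerivAt

end straightening
end MoserChain

open MoserChain

theorem proposition12p6 (M : Set (ℂ × ℂ))
    (hM : MoserChain.IsAnalyticHypersurface M) (hL : MoserChain.IsLeviNondegenerate M)
    (p : ℂ × ℂ) (hp : p ∈ M) (ξ : ℂ × ℂ) (hξ : MoserChain.IsCRTransversal M p ξ) :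
    (∃ (γ : ℝ → ℂ × ℂ) (ε : ℝ), MoserChain.IsMoserChainThrough M p ξ γ ε ∧
      AnalyticOnNhd ℝ γ (Set.Ioo (-ε) ε)) ∧
    (∀ (γ σ : ℝ → ℂ × ℂ) (ε ε' : ℝ), MoserChain.IsMoserChainThrough M p ξ γ ε →
      MoserChain.IsMoserChainThrough M p ξ σ ε' → MoserChain.SameCurveGerm γ σ) ∧
    (∀ (γ : ℝ → ℂ × ℂ) (ε : ℝ), MoserChain.IsMoserChainThrough M p ξ γ ε →
      ∃ (Φ : OpenPartialHomeomorph (ℂ × ℂ) (ℂ × ℂ)) (F : ℂ × ℝ → ℝ),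
        MoserChain.IsHolomorphicChartAt Φ p ∧ MoserChain.IsStraightenedBy Φ γ ε ∧
        MoserChain.IsGraphedBy M p Φ F ∧ MoserChain.IsMoserNormalForm F) := by
  obtain ⟨L, R, hLξ, hR, hR0, hRs, hMR, hw, hsum, hlevi⟩ := exists_polarized_equation hL hp hξ
  obtain ⟨f, q, hf, hf0, hfd, hMf, hqa, hq⟩ :=
    exists_chain_equation L hR hR0 hRs hMR hw hsum hlevi
  obtain ⟨z, hz, hz0, hz1, hzq⟩ := exists_second_order_solution hqa
  obtain ⟨hg, hg1, ε₀, hch, han⟩ :=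
    exists_isMoserChainThrough L hLξ hf hf0 hfd hMf hq hz hz0 hz1 hzq
  have param : ∀ {γ : ℝ → ℂ × ℂ} {ε : ℝ}, IsMoserChainThrough M p ξ γ ε → ∃ θ : ℝ → ℝ,
      ContDiffAt ℝ 2 θ 0 ∧ θ 0 = 0 ∧ deriv θ 0 ≠ 0 ∧
      ∀ᶠ s in 𝓝 0, γ s = p + L (graphPoint f (z (θ s), θ s)) := fun {γ ε} h => by
    obtain ⟨z', θ, k1, k2, k3, k4, k5, k6, k7, k8⟩ :=
      h.exists_graph_parametrization L hLξ hMf hq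
    have e := second_order_solution_unique hqa k1 hz.contDiffAt k2 hz0 k3 hz1 k4 hzq
    have tθ : Tendsto θ (𝓝 0) (𝓝 0) := by
      have := k5.continuousAt.tendsto
      rwa [k6] at this
    refine ⟨θ, k5, k6, k7, ?_⟩
    filter_upwards [k8, tθ.eventually e] with s h1 h2
    rw [h1, h2]
  refine ⟨⟨_, ε₀, hch, han⟩, fun γ σ ε ε' hγ hσ => ?_, fun γ ε hγ => ?_⟩
  · obtain ⟨θ₁, a1, a2, a3, a4⟩ := param hγ
    obtain ⟨θ₂, b1, b2, b3, b4⟩ := param hσ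
    exact sameCurveGerm_of_comp (Γ := fun u => p + L (graphPoint f (z u, u))) a1 a2 a3 a4 b1 b2 b3 b4
  · obtain ⟨θ, a1, a2, a3, a4⟩ := param hγ
    have hg0 : graphPoint f (z 0, 0) = 0 := by
      have h0 : f (0, 0) = 0 := hf0
      rw [graphPoint_apply, hz0]
      simp [h0]
    obtain ⟨c, hc, hc0, hc1, hce⟩ := exists_holomorphic_curve hg hg0 hg1
    obtain ⟨Φ, F, Q, ε', hε', hΦ, hF, hF0, hFd, hQ, hQs, hκ, hFQ, hΦγ⟩ :=
      exists_chain_chart L hR hRs hMR hw hlevi hch hc hc0 hc1 (hce.mono fun t ht => by rw [ht])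
    obtain ⟨Φ', F', h, hΦ', hF', hN, hh, hh0, hh1, hhs, hΦΦ'⟩ :=
      exists_normal_form_chart hΦ hF hF0 hFd hQ hQs hκ hFQ
    refine ⟨Φ', F', hΦ', ?_, hF', hN⟩
    have tθ : Tendsto θ (𝓝 0) (𝓝 0) := by
      have := a1.continuousAt.tendsto
      rwa [a2] at this
    have tε : Tendsto (fun s => ((ε' * θ s : ℝ) : ℂ)) (𝓝 0) (𝓝 0) :=
      tendsto_ofReal_zero.comp (by simpa using tθ.const_mul ε')
    have h0m : (0 : ℝ) ∈ Ioo (-ε) ε := ⟨by linarith [hγ.1], hγ.1⟩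
    have tγ : Tendsto γ (𝓝 0) (𝓝 p) := by
      have := (hγ.contDiffAt h0m).continuousAt.tendsto
      rwa [hγ.2.2.1] at this
    have hd : HasDerivAt (fun s => (h ((ε' * θ s : ℝ) : ℂ)).re) (ε' * deriv θ 0) 0 := by
      have d1 := (a1.differentiableAt (by norm_num)).hasDerivAt.const_mul ε'
      have d2 : HasDerivAt (fun t : ℝ => (h (t : ℂ)).re) 1 (ε' * θ 0) := by
        rw [a2, mul_zero]
        exact HasDerivAt.real_of_complex (e := h) (e' := 1) (by simpa using hh1)
      have d3 := d2.comp (0 : ℝ) d1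
      rw [one_mul] at d3
      exact d3
    refine isStraightenedBy_of_eventually (k := fun s => (h ((ε' * θ s : ℝ) : ℂ)).re) hγ.1 ?_
      (by simp [a2, hh0]) (by rw [hd.deriv]; exact mul_ne_zero hε' a3) ?_
    · have k1 : ContDiffAt ℝ 1 (fun t : ℝ => (h (t : ℂ)).re) (ε' * θ 0) := by
        rw [a2, mul_zero]
        have e0 : AnalyticAt ℂ h ((0 : ℝ) : ℂ) := by simpa using hh
        have : AnalyticAt ℝ (fun t : ℝ => h (t : ℂ)) 0 :=
          (e0.restrictScalars (𝕜 := ℝ)).comp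
            (analyticAt_ofReal_comp (x := (0 : ℝ)) analyticAt_id)
        exact (analyticAt_re_comp this).contDiffAt
      have k2 : ContDiffAt ℝ 1 θ 0 := a1.of_le (by norm_num)
      have k3 := ContDiffAt.comp (0 : ℝ) (f := fun s => ε' * θ s) k1 (contDiffAt_const.mul k2)
      exact k3
    · filter_upwards [tγ.eventually (Φ'.open_source.mem_nhds hΦ'.mem_source), a4,
        tθ.eventually hΦγ, tε.eventually hhs] with t k1 k2 k3 k4
      rw [← k2] at k3
      refine ⟨k1, ?_⟩
      rw [hΦΦ' _ (by rw [k3]), k3]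
      rw [Complex.conj_ofReal] at k4
      rw [Complex.conj_eq_iff_re.1 k4.symm]
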